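/- Let $d\ge 1$, $h=d/2$, and write $\Gamma[a_0\pm a_1\pm\cdots\pm a_m]=\prod_{\sigma\in\{\pm1\}^m}\Gamma(a_0+\sum_i\sigma_ia_i)$. Boundary points $P_i$ correspond to $y_i\in\mathbb R^d$ with $P_{ij}=-2P_i\cdot P_j=|y_i-y_j|^2$, and bulk points $X$ of Euclidean $\mathrm{AdS}_{d+1}$ to $(z,x)$, $z>0$, with $-2P\cdot X=(z^2+|x-y|^2)/z$ and $dX=dz\,d^dx/z^{d+1}$. **Setting.** Let a connected scalar tree Witten diagram have $n$ boundary points of real dimensions $\Delta_i>0$, $V$ bulk vertices, and bulk-to-bulk propagators $a$ with purely imaginary spectrum variables $c_a$. For a vertex $A$ let $r_A$ be its valency (number of incident bulk-to-bulk propagators) and $\Delta_A$ the sum of the dimensions of the boundary points attached to it. Assume that the bulk integrals converge: $\Delta_A+(r_A-2)h>0$ for every vertex, and $2\Delta_i<\Delta_A+r_Ah$ for every boundary point $i$ attached to $A$. Before the spectrum integrals the diagram is, for distinct $y_i$, $$\mathcal I(y;c)=\int\prod_A dX_A\ \prod_i\frac{\mathcal C_{\Delta_i}}{(-2P_i\cdot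 X_{A(i)})^{\Delta_i}}\ \prod_a\int dQ_a\frac{\mathcal N_{c_a}}{(-2Q_a\cdot X_a)^{h-c_a}(-2Q_a\cdot X_a')^{h+c_a}},$$ where $A(i)$ is the vertex to which $i$ is attached, $X_a,X_a'$ are the end points of $a$, $\mathcal C_\Delta=\frac{\Gamma(\Delta)}{2\pi^h\Gamma(\Delta-h+1)}$ and $\mathcal N_c=\frac{\Gamma[h\pm c]}{2\pi^{2h}\Gamma[\pm c]}$. (The propagator of dimension $\underline\Delta$ is recovered by $\int\frac{dc}{2\pi i}\frac1{(\underline\Delta-h)^2-c^2}$.) Mellin variables are symmetric $\delta_{ij}$ with $\delta_{ii}=-\Delta_i$, $\sum_j\delta_{ij}=0$. Put $s_a=\sum_{i\in S}\Delta_i-2\sum_{i<j\in S}\delta_{ij}$, where $S$ is the set of boundary points on one side of $a$, and let $T$ be the domain $\operatorname{Re}\delta_{ij}>0$ $(i\ne j)$, $\operatorname{Re}s_a<h$. A *Mellin pre-amplitude* of the diagram at $c$ is a function $M$, continuous on $T$ and of at most polynomial growth along every contour $\operatorname{Re}\delta=\delta_0$ in $T$, such that for each such contour and all distinct $y_i$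 the Mellin integral converges absolutely and $$\mathcal I(y;c)=\frac{\pi^h}{2^{2V-1}}\prod_i\frac{\mathcal C_{\Delta_i}}{\Gamma(\Delta_i)}\prod_a\frac1{\Gamma[\pm c_a]}\int[d\delta]\,M(\delta)\prod_{i<j}\frac{\Gamma(\delta_{ij})}{P_{ij}^{\delta_{ij}}},$$ where, with points labelled $0,\dots,n-1$, $[d\delta]$ is the product of $\frac{d\delta_{ij}}{2\pi i}$ over the $\frac{n(n-3)}2$ independent variables $\delta_{ij}$ with $1\le i<j$, $(i,j)\ne(1,2)$. **Theorem.** For each $d$ there are universal functions $C_r[\Delta_A;c_1,\dots,c_r;s_1,\dots,s_r]$, $r\ge0$, with the following properties. 1. (No poles.) $C_r$ is entire on $\mathbb C^{1+2r}$. 2. (Mellin–Barnes formula.) For all $\Delta_A,c_b,s_b\in\mathbb C$, $$C_r=\int\prod_{b=1}^r\frac{dw_b}{2\pi i}\ \frac{\Gamma\big(\frac{\Delta_A+(r-2)h+\sum_bc_b}2+\sum_bw_b\big)}{\Gamma[\frac{\Delta_A+(r-2)h\pm c_1\pm\cdots\pm c_r}2]}\prod_{b=1}^r\frac{\Gamma(-w_b)\Gamma(-c_b-w_b)\Gamma(\frac{h+c_b-s_b}2+w_b)}{\Gamma[\frac{h\pm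 c_b-s_b}2]}$$ over every straight contour $\operatorname{Re}w_b=u_b$ on which all arguments of the $\Gamma$ functions in the numerator have positive real part (so the contour separates left from right poles); the integral converges absolutely. This determines the entire function $C_r$, and so gives the integral's value for other parameters by analytic continuation. 3. (Diagrammatic rules.) For every diagram as above, all integrals in $\mathcal I$ converge absolutely, $T$ contains a real point $\delta_0$, and a Mellin pre-amplitude at $c$ is $$M_{\rm tree}=\prod_{a}\Gamma\big[\tfrac{h\pm c_a-s_a}2\big]\ \prod_{A}\Gamma\big[\tfrac{\Delta_A+(r_A-2)h\pm c_1\pm\cdots\pm c_{r_A}}2\big]\,C_{r_A}[\Delta_A;c_1,\dots,c_{r_A};s_1,\dots,s_{r_A}],$$ where in the factor of $A$ the indices $1,\dots,r_A$ run over the bulk-to-bulk propagators incident to $A$. If $d$ is large enough, $n\le d+2$, and all $\Delta_i>h-1$ and $c_a\ne0$, then it is the only one: every pre-amplitude equals $M_{\rm tree}$ on $T$. -/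

import Mathlib

open MeasureTheory
open scoped Classical

noncomputable section

namespace Witten

/-! ## Anti-de Sitter space and its boundary

`d` is the boundary dimension and `h = d / 2`.  Embedding space is `ℝ^{1,d+1}` in light-cone
coordinates `(A⁺, A⁻, A^μ)` with `A·B = -(A⁺B⁻ + A⁻B⁺)/2 + A^μ B_μ`.  Bulk points `X·X = -1` are
written in the Poincaré chart `(z, x)`, `z > 0`, and boundary points `P·P = 0`, `P ~ λP`, in the
section `P⁺ = 1`. -/

/-- Half of the boundary dimension. -/
def h (d : ℕ) : ℝ := (d : ℝ) / 2

/-- Boundary points (in the section `P⁺ = 1`). -/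
abbrev Bdry (d : ℕ) := EuclideanSpace ℝ (Fin d)

/-- Poincaré coordinates `(z, x)`; the bulk is the part `z > 0`. -/
abbrev Bulk (d : ℕ) := ℝ × EuclideanSpace ℝ (Fin d)

/-- Embedding space, in light-cone coordinates. -/
abbrev Emb (d : ℕ) := ℝ × ℝ × EuclideanSpace ℝ (Fin d)

/-- The Lorentzian product of embedding space. -/
def dot {d : ℕ} (A B : Emb d) : ℝ :=
  -(A.1 * B.2.1 + A.2.1 * B.1) / 2 + inner ℝ A.2.2 B.2.2

/-- The embedding of a boundary point. -/
def bdryEmb {d : ℕ} (y : Bdry d) : Emb d := (1, ‖y‖ ^ 2, y)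

/-- The embedding of a bulk point. -/
def bulkEmb {d : ℕ} (X : Bulk d) : Emb d :=
  (X.1⁻¹, X.1⁻¹ * (X.1 ^ 2 + ‖X.2‖ ^ 2), X.1⁻¹ • X.2)

theorem dot_bdryEmb_self {d : ℕ} (y : Bdry d) : dot (bdryEmb y) (bdryEmb y) = 0 := by
  simp only [dot, bdryEmb, real_inner_self_eq_norm_sq]; ring

theorem dot_bulkEmb_self {d : ℕ} (X : Bulk d) (hX : 0 < X.1) :
    dot (bulkEmb X) (bulkEmb X) = -1 := by
  simp only [dot, bulkEmb, real_inner_self_eq_norm_sq, norm_smul, mul_pow, norm_inv,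
    Real.norm_eq_abs, inv_pow, sq_abs]
  field_simp
  ring

theorem neg_two_dot_bdry_bulk {d : ℕ} (y : Bdry d) (X : Bulk d) (hX : 0 < X.1) :
    -2 * dot (bdryEmb y) (bulkEmb X) = (X.1 ^ 2 + ‖X.2 - y‖ ^ 2) / X.1 := by
  rw [norm_sub_sq_real]
  simp only [dot, bdryEmb, bulkEmb, inner_smul_right, real_inner_comm y X.2]
  field_simp
  ring

theorem neg_two_dot_bdry_bdry {d : ℕ} (y y' : Bdry d) :
    -2 * dot (bdryEmb y) (bdryEmb y') = ‖y - y'‖ ^ 2 := by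
  rw [norm_sub_sq_real]
  simp only [dot, bdryEmb]
  ring

/-- The invariant volume `dz d^dx / z^{d+1}` of the bulk. -/
def adsVolume (d : ℕ) : Measure (Bulk d) :=
  ((volume : Measure (Bulk d)).restrict {X | 0 < X.1}).withDensity
    fun X => ENNReal.ofReal ((X.1 ^ (d + 1))⁻¹)

instance (d : ℕ) : SigmaFinite (adsVolume d) := by
  unfold adsVolume
  exact SigmaFinite.withDensity_ofReal _

/-! ## Propagators -/

/-- `𝒞_Δ = Γ[Δ] / (2 π^h Γ[Δ - h + 1])`. -/
def bdryNorm (d : ℕ) (Δ : ℝ) : ℂ :=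
  1 / (2 * (Real.pi : ℂ) ^ (h d : ℂ)) * (Complex.Gamma Δ / Complex.Gamma (Δ - h d + 1))

/-- The bulk-to-boundary propagator `𝒞_Δ / (-2P·X)^Δ`. -/
def bulkToBdry (d : ℕ) (Δ : ℝ) (X : Bulk d) (y : Bdry d) : ℂ :=
  bdryNorm d Δ / ((-2 * dot (bdryEmb y) (bulkEmb X) : ℝ) : ℂ) ^ (Δ : ℂ)

/-- `𝒩_c = Γ[h ± c] / (2 π^{2h} Γ[± c])`. -/
def splitNorm (d : ℕ) (c : ℂ) : ℂ :=
  Complex.Gamma (h d + c) * Complex.Gamma (h d - c) /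
    (2 * (Real.pi : ℂ) ^ (2 * h d : ℂ) * (Complex.Gamma c * Complex.Gamma (-c)))

/-- Integrand, at the boundary point `Q`, of the split representation of a bulk-to-bulk
propagator: `𝒩_c / ((-2Q·X)^{h-c} (-2Q·Y)^{h+c})`. -/
def splitIntegrand (d : ℕ) (c : ℂ) (X Y : Bulk d) (Q : Bdry d) : ℂ :=
  splitNorm d c /
    (((-2 * dot (bdryEmb Q) (bulkEmb X) : ℝ) : ℂ) ^ (h d - c) *
      ((-2 * dot (bdryEmb Q) (bulkEmb Y) : ℝ) : ℂ) ^ (h d + c))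

/-- The split bulk-to-bulk propagator at spectrum variable `c`.  The propagator of dimension
`Δ'` is its integral over the imaginary `c`-axis against `dc/(2πi) · 1/((Δ'-h)² - c²)`. -/
def splitPropagator (d : ℕ) (c : ℂ) (X Y : Bulk d) : ℂ :=
  ∫ Q : Bdry d, splitIntegrand d c X Y Q

/-! ## Tree diagrams -/

/-- A scalar tree Witten diagram with `n` boundary points: bulk vertices `V`, bulk-to-bulk
propagators `E` (with end points `src`, `tgt`; the orientation only names the ends), and for every
boundary point the bulk vertex it is attached to.  The diagram is connected and its number of
loops `|E| - |V| + 1` vanishes. -/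
structure TreeDiagram (n : ℕ) where
  V : Type
  E : Type
  [fintypeV : Fintype V]
  [fintypeE : Fintype E]
  src : E → V
  tgt : E → V
  attach : Fin n → V
  connected : (SimpleGraph.fromRel fun v w => ∃ e, src e = v ∧ tgt e = w).Connected
  noLoops : Fintype.card V = Fintype.card E + 1

attribute [instance] TreeDiagram.fintypeV TreeDiagram.fintypeE

namespace TreeDiagram

variable {n : ℕ} (D : TreeDiagram n)

/-- The bulk-to-bulk propagators incident to the bulk vertex `v`. -/
abbrev Incident (v : D.V) : Type := {e : D.E // D.src e = v ∨ D.tgt e = v}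

/-- The valency of `v`: the number of bulk-to-bulk propagators incident to it. -/
def valency (v : D.V) : ℕ := Fintype.card (D.Incident v)

/-- `Δ_A`: the total dimension of the boundary points attached to `v`. -/
def vertexDim (Δ : Fin n → ℝ) (v : D.V) : ℝ := ∑ i with D.attach i = v, Δ i

/-- The boundary points on the `src` side of the propagator `e`. -/
def side (e : D.E) : Finset (Fin n) :=
  {i | (SimpleGraph.fromRel fun v w => ∃ e' ≠ e, D.src e' = v ∧ D.tgt e' = w).Reachable
    (D.attach i) (D.src e)}

/-- The Mandelstam variable `s_A = ∑_{i ∈ A} Δ_i - 2 ∑_{i < j ∈ A} δ_{ij}` of a propagator. -/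
def mandelstam (Δ : Fin n → ℝ) (δ : Fin n → Fin n → ℂ) (e : D.E) : ℂ :=
  ∑ i ∈ D.side e, (Δ i : ℂ) - 2 * ∑ i ∈ D.side e, ∑ j ∈ D.side e with i < j, δ i j

/-- The conditions for convergence of the bulk integrals of the diagram at imaginary spectrum
variables.  At each bulk vertex the real parts of the dimensions of the incident legs are the `Δ_i`
of the boundary points and `h` for each bulk-to-bulk propagator; their total has to exceed `2h`,
and each has to be less than the sum of the others (for a bulk-to-bulk leg this repeats the
first condition). -/
structure Convergent (d : ℕ) (Δ : Fin n → ℝ) : Prop where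
  pos : ∀ i, 0 < Δ i
  vertex : ∀ v, 0 < D.vertexDim Δ v + ((D.valency v : ℝ) - 2) * h d
  leg : ∀ i, 2 * Δ i < D.vertexDim Δ (D.attach i) + (D.valency (D.attach i) : ℝ) * h d

/-- Position-space integrand of the diagram before the spectrum integrals, at bulk points `X`. -/
def correlatorIntegrand (d : ℕ) (Δ : Fin n → ℝ) (c : D.E → ℂ) (y : Fin n → Bdry d)
    (X : D.V → Bulk d) : ℂ :=
  (∏ i, bulkToBdry d (Δ i) (X (D.attach i)) (y i)) *
    ∏ e, splitPropagator d (c e) (X (D.src e)) (X (D.tgt e))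

/-- The diagram before the spectrum integrals, in position space. -/
def correlator (d : ℕ) (Δ : Fin n → ℝ) (c : D.E → ℂ) (y : Fin n → Bdry d) : ℂ :=
  ∫ X : D.V → Bulk d, D.correlatorIntegrand d Δ c y X ∂(Measure.pi fun _ => adsVolume d)

/-- The normalisation `π^h / 2^{2V-1} ∏_i 𝒞_{Δ_i}/Γ[Δ_i] ∏_a 1/Γ[± c_a]` of the Mellin
pre-amplitude at tree level. -/
def normalization (d : ℕ) (Δ : Fin n → ℝ) (c : D.E → ℂ) : ℂ :=
  (Real.pi : ℂ) ^ (h d : ℂ) / 2 ^ (2 * Fintype.card D.V - 1) *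
    (∏ i, bdryNorm d (Δ i) / Complex.Gamma (Δ i)) *
    ∏ e, 1 / (Complex.Gamma (c e) * Complex.Gamma (-c e))

/-- The domain of the Mellin variables: symmetric `δ` with `δ_ii = -Δ_i` and `∑_j δ_ij = 0`, whose
real parts lie to the right of the left poles and to the left of the right poles, that is,
`Re δ_ij > 0` for `i ≠ j` and `Re s_a < h` for every propagator. -/
def tube (d : ℕ) (Δ : Fin n → ℝ) : Set (Fin n → Fin n → ℂ) :=
  {δ | (∀ i j, δ i j = δ j i) ∧ (∀ i, δ i i = -(Δ i : ℂ)) ∧ (∀ i, ∑ j, δ i j = 0) ∧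
    (∀ i j, i ≠ j → 0 < (δ i j).re) ∧ ∀ e, (D.mandelstam Δ δ e).re < h d}

end TreeDiagram

/-! ## The Mellin integral

The independent Mellin variables are the `n(n-3)/2` entries `δ_ij`, `1 ≤ i < j`, other than
`δ_12` (points are labelled `0, …, n-1`); the other entries are solved for. -/

/-- Labels of the independent Mellin variables. -/
abbrev MellinIndex (n : ℕ) : Type :=
  {p : Fin n × Fin n // 1 ≤ p.1.val ∧ p.1 < p.2 ∧ ¬ (p.1.val = 1 ∧ p.2.val = 2)}

/-- The part with row and column `0` removed of the matrix with independent entries `t`. -/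
def mellinBlock {n : ℕ} (t : MellinIndex n → ℝ) (i j : Fin n) : ℝ :=
  if hp : 1 ≤ (min i j).val ∧ min i j < max i j ∧
      ¬ ((min i j).val = 1 ∧ (max i j).val = 2) then t ⟨(min i j, max i j), hp⟩
  else if (min i j).val = 1 ∧ (max i j).val = 2 then -∑ q, t q
  else 0

/-- The symmetric matrix with zero diagonal and vanishing row sums whose independent entries
are `t`. -/
def mellinMatrix {n : ℕ} (t : MellinIndex n → ℝ) (i j : Fin n) : ℝ :=
  mellinBlock t i j - (if i.val = 0 then ∑ k, mellinBlock t j k else 0)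
    - (if j.val = 0 then ∑ k, mellinBlock t i k else 0)

/-! `mellinMatrix t` is symmetric, has zero diagonal and vanishing row sums, and its independent
entries are `t`. -/

theorem mellinBlock_comm {n : ℕ} (t : MellinIndex n → ℝ) (i j : Fin n) :
    mellinBlock t i j = mellinBlock t j i := by
  simp only [mellinBlock, min_comm i j, max_comm i j]

theorem sum_mellinBlock {n : ℕ} (hn : 3 ≤ n) (t : MellinIndex n → ℝ) :
    ∑ i, ∑ j, mellinBlock t i j = 0 := by
  have key : ∑ p : Fin n × Fin n with p.1 < p.2, mellinBlock t p.1 p.2 = 0 := by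
    have e : ∀ p ∈ (Finset.univ.filter fun p : Fin n × Fin n => p.1 < p.2), mellinBlock t p.1 p.2 =
        (if hp : 1 ≤ p.1.val ∧ p.1 < p.2 ∧ ¬ (p.1.val = 1 ∧ p.2.val = 2) then t ⟨p, hp⟩ else 0) +
        (if p = (⟨1, by omega⟩, ⟨2, by omega⟩) then -∑ q, t q else 0) := by
      rintro ⟨a, b⟩ hp
      have hab : a < b := by simpa using hp
      simp only [mellinBlock, min_eq_left hab.le, max_eq_right hab.le, Prod.ext_iff, Fin.ext_iff]
      split_ifs <;> simp_all
    rw [Finset.sum_congr rfl e, Finset.sum_add_distrib, Finset.sum_ite_eq']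
    have h1 : ∑ p : Fin n × Fin n with p.1 < p.2,
        (if hp : 1 ≤ p.1.val ∧ p.1 < p.2 ∧ ¬ (p.1.val = 1 ∧ p.2.val = 2) then t ⟨p, hp⟩ else 0)
        = ∑ q, t q := by
      rw [Finset.sum_filter]
      symm
      refine Finset.sum_of_injOn Subtype.val Subtype.val_injective.injOn (by simp) ?_ ?_
      · intro p _ hp
        have : ¬ (1 ≤ p.1.val ∧ p.1 < p.2 ∧ ¬ (p.1.val = 1 ∧ p.2.val = 2)) := fun hh =>
          hp ⟨⟨p, hh⟩, by simp, rfl⟩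
        simp only [dif_neg this, ite_self]
      · rintro ⟨p, hp⟩ _
        simp only [dif_pos hp, if_pos hp.2.1]
    rw [h1]
    simp
  have hdiag : ∀ i, mellinBlock t i i = 0 := fun i => by
    simp only [mellinBlock, min_self, max_self, lt_irrefl]
    simp
    omega
  rw [← Fintype.sum_prod_type' (fun i j => mellinBlock t i j)]
  rw [← Finset.sum_filter_add_sum_filter_not _ (fun p : Fin n × Fin n => p.1 < p.2), key, zero_add]
  rw [← Finset.sum_filter_add_sum_filter_not _ (fun p : Fin n × Fin n => p.2 < p.1),
    Finset.filter_filter, Finset.filter_filter]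
  have h2 : ∑ p : Fin n × Fin n with ¬ p.1 < p.2 ∧ p.2 < p.1, mellinBlock t p.1 p.2 = 0 := by
    rw [← key]
    refine Finset.sum_equiv (Equiv.prodComm _ _) ?_ ?_
    · rintro ⟨a, b⟩; simp; exact fun h => h.le
    · rintro ⟨a, b⟩ _; exact mellinBlock_comm _ _ _
  rw [h2, zero_add]
  refine Finset.sum_eq_zero ?_
  rintro ⟨a, b⟩ hp
  simp at hp
  have : a = b := le_antisymm hp.2 hp.1
  subst this
  exact hdiag a

theorem mellinBlock_zero {n : ℕ} (t : MellinIndex n → ℝ) (i j : Fin n) (hi : i.val = 0) :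
    mellinBlock t i j = 0 := by
  have : (min i j).val = 0 := by
    have : min i j = i := min_eq_left (by rw [Fin.le_def]; omega)
    rw [this, hi]
  simp [mellinBlock, this]

theorem mellinMatrix_comm {n : ℕ} (t : MellinIndex n → ℝ) (i j : Fin n) :
    mellinMatrix t i j = mellinMatrix t j i := by
  simp only [mellinMatrix, mellinBlock_comm t i j]; ring

theorem mellinMatrix_self {n : ℕ} (t : MellinIndex n → ℝ) (i : Fin n) :
    mellinMatrix t i i = 0 := by
  have hd : mellinBlock t i i = 0 := by
    simp only [mellinBlock, min_self, max_self, lt_irrefl]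
    simp
    omega
  by_cases hi : i.val = 0
  · simp [mellinMatrix, hi, mellinBlock_zero t i _ hi]
  · simp [mellinMatrix, hi, hd]

theorem sum_mellinMatrix {n : ℕ} (hn : 3 ≤ n) (t : MellinIndex n → ℝ) (i : Fin n) :
    ∑ j, mellinMatrix t i j = 0 := by
  have hz : ∀ a : ℝ, ∑ j : Fin n, (if j.val = 0 then a else 0) = a := fun a => by
    rw [Finset.sum_eq_single (⟨0, by omega⟩ : Fin n)]
    · simp
    · intro b _ hb
      rw [if_neg]
      exact fun h0 => hb (Fin.ext h0)
    · simp
  simp only [mellinMatrix, Finset.sum_sub_distrib, hz]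
  by_cases hi : i.val = 0
  · simp [hi, sum_mellinBlock hn]
  · simp [hi]

theorem mellinMatrix_index {n : ℕ} (t : MellinIndex n → ℝ) (q : MellinIndex n) :
    mellinMatrix t q.1.1 q.1.2 = t q := by
  obtain ⟨⟨a, b⟩, ha, hab, h12⟩ := q
  have hab' : a < b := hab
  have h0 : a.val ≠ 0 := by simp at ha; omega
  have h0' : b.val ≠ 0 := by rw [Fin.lt_def] at hab'; omega
  simp only [mellinMatrix, h0, h0', if_false, sub_zero, mellinBlock, min_eq_left hab'.le,
    max_eq_right hab'.le]
  exact dif_pos ⟨ha, hab, h12⟩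

/-- The point with parameter `t` of the contour `Re δ = δ₀`. -/
def contourPoint {n : ℕ} (δ₀ : Fin n → Fin n → ℝ) (t : MellinIndex n → ℝ) :
    Fin n → Fin n → ℂ :=
  fun i j => (δ₀ i j : ℂ) + Complex.I * (mellinMatrix t i j : ℂ)

/-- `∏_{i<j} Γ[δ_ij] / P_ij^{δ_ij}` with `P_ij = -2 P_i·P_j`. -/
def dressing {d n : ℕ} (y : Fin n → Bdry d) (δ : Fin n → Fin n → ℂ) : ℂ :=
  ∏ i, ∏ j with i < j, Complex.Gamma (δ i j) /
    ((-2 * dot (bdryEmb (y i)) (bdryEmb (y j)) : ℝ) : ℂ) ^ (δ i j)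

/-- `∫ [dδ] M ∏_{i<j} Γ[δ_ij] / P_ij^{δ_ij}` over the contour `Re δ = δ₀`, where `[dδ]` is the
product of `dδ/(2πi)` over the independent variables. -/
def mellinIntegral {d n : ℕ} (δ₀ : Fin n → Fin n → ℝ) (y : Fin n → Bdry d)
    (M : (Fin n → Fin n → ℂ) → ℂ) : ℂ :=
  ∫ t : MellinIndex n → ℝ, (1 / (2 * (Real.pi : ℂ))) ^ Fintype.card (MellinIndex n) *
    (M (contourPoint δ₀ t) * dressing y (contourPoint δ₀ t))

/-- `M` is the Mellin pre-amplitude of the tree diagram `D` at spectrum variables `c`: it is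
continuous on the domain of the Mellin variables, of moderate growth along the contours, and its
Mellin integral, over any contour in the domain, times the normalisation is the diagram before
the spectrum integrals. -/
structure IsPreAmplitude {n : ℕ} (D : TreeDiagram n) (d : ℕ) (Δ : Fin n → ℝ) (c : D.E → ℂ)
    (M : (Fin n → Fin n → ℂ) → ℂ) : Prop where
  continuousOn : ContinuousOn M (D.tube d Δ)
  growth : ∀ δ₀ : Fin n → Fin n → ℝ, (fun i j => (δ₀ i j : ℂ)) ∈ D.tube d Δ →
    ∃ (K : ℝ) (N : ℕ), ∀ t, ‖M (contourPoint δ₀ t)‖ ≤ K * (1 + ‖t‖) ^ N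
  integrable : ∀ δ₀ : Fin n → Fin n → ℝ, (fun i j => (δ₀ i j : ℂ)) ∈ D.tube d Δ →
    ∀ y : Fin n → Bdry d, Function.Injective y →
      Integrable fun t => M (contourPoint δ₀ t) * dressing y (contourPoint δ₀ t)
  representation : ∀ δ₀ : Fin n → Fin n → ℝ, (fun i j => (δ₀ i j : ℂ)) ∈ D.tube d Δ →
    ∀ y : Fin n → Bdry d, Function.Injective y →
      D.correlator d Δ c y = D.normalization d Δ c * mellinIntegral δ₀ y M

/-! ## The diagrammatic rules -/

/-- `Γ[a₀ ± a₁ ± ⋯ ± a_r]`: the product over all choices of the signs. -/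
def gammaPM {ι : Type} [Fintype ι] (a₀ : ℂ) (a : ι → ℂ) : ℂ :=
  ∏ σ : ι → ℤˣ, Complex.Gamma (a₀ + ∑ i, ((σ i : ℤ) : ℂ) * a i)

/-- The factor `Γ[(h ± c - s)/2]` of a bulk-to-bulk propagator. -/
def propagatorFactor (d : ℕ) (c s : ℂ) : ℂ :=
  Complex.Gamma ((h d + c - s) / 2) * Complex.Gamma ((h d - c - s) / 2)

/-- `Γ[(Δ_A + (r-2)h ± c₁ ± ⋯ ± c_r)/2]`, where `r` is the number of labels. -/
def vertexGamma (d : ℕ) {ι : Type} [Fintype ι] (ΔA : ℂ) (c : ι → ℂ) : ℂ :=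
  gammaPM ((ΔA + ((Fintype.card ι : ℂ) - 2) * h d) / 2) fun a => c a / 2

/-- The integrand of the Mellin–Barnes integral for the correction function of a vertex. -/
def correctionIntegrand (d : ℕ) {ι : Type} [Fintype ι] (ΔA : ℂ) (c s w : ι → ℂ) : ℂ :=
  Complex.Gamma ((ΔA + ((Fintype.card ι : ℂ) - 2) * h d + ∑ b, c b) / 2 + ∑ b, w b) /
      vertexGamma d ΔA c *
    ∏ b, Complex.Gamma (-w b) * Complex.Gamma (-c b - w b) *
      Complex.Gamma ((h d + c b - s b) / 2 + w b) / propagatorFactor d (c b) (s b)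

/-- The straight contours `Re w_b = u_b` that separate the poles of `Γ[-w_b]`, `Γ[-c_b-w_b]`
(on the right) from those of the other two kinds of `Γ` functions in the numerator (on the
left). -/
def IsVertexContour (d : ℕ) {ι : Type} [Fintype ι] (ΔA : ℂ) (c s : ι → ℂ) (u : ι → ℝ) : Prop :=
  (∀ b, u b < 0) ∧ (∀ b, (c b).re + u b < 0) ∧
    (∀ b, 0 < (h d + (c b).re - (s b).re) / 2 + u b) ∧
    0 < (ΔA.re + ((Fintype.card ι : ℝ) - 2) * h d + ∑ b, (c b).re) / 2 + ∑ b, u b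

/-- The point with parameter `v` of the contour `Re w = u`. -/
def vertexContourPoint {ι : Type} (u v : ι → ℝ) : ι → ℂ :=
  fun b => (u b : ℂ) + Complex.I * (v b : ℂ)

/-- The `r`-fold Mellin–Barnes integral `∫ ∏_b dw_b/(2πi)` for the correction function. -/
def correctionIntegral (d : ℕ) {ι : Type} [Fintype ι] (ΔA : ℂ) (c s : ι → ℂ) (u : ι → ℝ) : ℂ :=
  ∫ v : ι → ℝ, (1 / (2 * (Real.pi : ℂ))) ^ Fintype.card ι *
    correctionIntegrand d ΔA c s (vertexContourPoint u v)

/-- The product of the propagator factors and of the vertex factors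
`Γ[(Δ_A + (r-2)h ± c₁ ± ⋯ ± c_r)/2] · C_A` of a tree diagram, for a given `C`. -/
def treeProduct {n : ℕ} (d : ℕ) (C : (ι : Type) → [Fintype ι] → ℂ → (ι → ℂ) → (ι → ℂ) → ℂ)
    (D : TreeDiagram n) (Δ : Fin n → ℝ) (c : D.E → ℂ) (δ : Fin n → Fin n → ℂ) : ℂ :=
  (∏ e, propagatorFactor d (c e) (D.mandelstam Δ δ e)) *
    ∏ v, vertexGamma d (D.vertexDim Δ v : ℂ) (fun a : D.Incident v => c a.1) *
      C (D.Incident v) (D.vertexDim Δ v : ℂ) (fun a => c a.1) (fun a => D.mandelstam Δ δ a.1)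

end Witten

end

/-!
**The correction functions.** In logarithmic coordinates `ζ = e^x`, `a_b = e^{α_b}`, the vertex
integral `vertexIntegral` is a Mellin transform of a product of confluent hypergeometric functions,
one for each propagator at the vertex. Writing the exponentials `e^{-ζ a_b}` as inverse Mellin
transforms turns it into the Mellin–Barnes integral (`vertexIntegral_eq_barnes`), so the correction
function is the vertex integral over a product of `Γ` functions. Integration by parts expresses it
by its values with `Re A` and the `Re B_b` raised by one and with further factors `ζ a_b`, `b ∈ ε`,
in the integrand. The only divisors that appear are `A - ∑_{b ∈ ε} c_b`, and they are cancelled by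
zeros of the reciprocal `Γ` functions. The continuations to larger and larger convex domains
(`continues_succ_vertexFun`) glue to an entire function (`exists_entire_vertexFun`).

**The Mellin side.** For imaginary `c` the product of all the factors is one integral of an
exponential, with exponent affine in the `s_e` and `c_e` (`treeProduct_eq_integral`). As `s_e` is
the sum of the `δ_ij` over the pairs separated by `e`, under the Mellin integral it only rescales
the distances `P_ij`, and the integral over `δ` is that of the Symanzik star formula (`symanzik`).
The result is an integral over `Params × ℝⁿ` of a positive density times a phase linear in `c`
(`mellinIntegral_treeProduct`).

**The position side.** In Schwinger parameters (`correlatorIntegrand_eq`) the integrals over the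
positions in `ℝ^d` of the bulk points and of the points `Q_e` of the split representation are
Gaussian: the energy is that of a tree of springs, the diagram with one more node in the middle of
each propagator. The positions are integrated out leaf by leaf, each time with a change of the
remaining Schwinger parameters that restores the form of the integrand (`Grown.lintegral_eq`). After
a shift of the radial coordinates this is again an integral over `Params × ℝⁿ`, with the density and
the phases of the Mellin side. All this concerns integrals of nonnegative functions: the two
densities have, up to a constant, the same image under the phases (`lintegral_schwinger`). So
convergence on the Mellin side implies convergence on the position side, and the oscillating
integrals agree (`integral_exp_mul_eq_of_lintegral_eq`, `correlator_eq`).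

**Real points of the domain.** With the dimension `h` of the propagator legs lowered slightly to
`η`, the conditions of convergence provide at each vertex a symmetric matrix of positive `δ`s with
the dimensions of the legs as row sums (`exists_legMatrix`). Contracting these along the propagators
(`LegMatrix.glue`) gives a point with all `s_e = η` (`Convergent.exists_mellinPoint`).

**Uniqueness.** For `n ≤ d + 2` the cross ratios of the boundary points take all values in a
neighbourhood of `1` independently (`exists_points_of_crossRatios`). Hence the difference of two
pre-amplitudes along a contour, times the `Γ` functions, has a Fourier transform that vanishes near
the origin. The `Γ` functions decay exponentially and the pre-amplitudes grow at most polynomially,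
so the transform is analytic along lines and vanishes identically (`eq_zero_of_fourier_eq_zero`).
The conditions `Δ_i > h - 1` and `c_e ≠ 0` only serve to make the normalisation nonzero.
-/

noncomputable section

namespace Witten

open Real (exp log exp_add exp_pos pi exp_log log_exp exp_le_exp)
open Complex (Gamma I)
open Function (update)
open ENNReal (ofReal)
open Complex renaming exp → cexp
open Finset (univ sum_congr sum_add_distrib mul_sum mem_univ mem_insert mem_filter sum_sub_distrib
  prod_mul_distrib ne_of_mem_erase sum_mul prod_congr mem_of_mem_erase sum_filter sum_neg_distrib
  sum_comm sum_eq_single prod_ne_zero_iff add_sum_erase sum_le_sum card_insert_of_notMem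
  mem_insert_of_mem card_univ mem_union sum_const_zero prod_inv_distrib sum_filter_add_sum_filter_not
  mem_erase)

/-! ### Laplace transforms and the Gamma function on vertical lines -/

/-- An integral of exponentials is holomorphic in the coefficients of the exponent, on any open set on
which it converges absolutely. -/
theorem differentiableOn_integral_cexp {Ω κ : Type*} [MeasurableSpace Ω] {μ : Measure Ω}
    [Fintype κ] {g : Ω → ℝ} (hg : Measurable g) {ℓ : κ → Ω → ℝ} (hℓ : ∀ j, Measurable (ℓ j)) {U : Set (κ → ℂ)} (hU : IsOpen U)
    (hint : ∀ p ∈ U, Integrable (fun ω => cexp (g ω + ∑ j, p j * ℓ j ω)) μ) :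
    DifferentiableOn ℂ (fun p : κ → ℂ => ∫ ω, cexp (g ω + ∑ j, p j * ℓ j ω) ∂μ) U := by
  intro p₀ hp₀
  obtain ⟨ε', hε', hball⟩ := Metric.isOpen_iff.1 hU p₀ hp₀
  obtain ⟨ε, hε, hεε⟩ : ∃ ε : ℝ, 0 < ε ∧ 2 * ε < ε' := ⟨ε' / 3, by positivity, by linarith⟩
  set F' : (κ → ℂ) → Ω → (κ → ℂ) →L[ℂ] ℂ := fun p ω =>
    cexp (g ω + ∑ j, p j * ℓ j ω) • ∑ j, (ℓ j ω : ℂ) • (ContinuousLinearMap.proj j)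
  set S : Ω → ℝ := fun ω => ∑ j, |ℓ j ω|
  have hcorner : ∀ t : Finset κ, Integrable (fun ω => cexp (g ω + ∑ j, (p₀ j +
      (if j ∈ t then 2 * (ε : ℂ) else -(2 * (ε : ℂ)))) * ℓ j ω)) μ := by
    intro t
    refine hint (fun j => p₀ j + (if j ∈ t then 2 * (ε : ℂ) else -(2 * (ε : ℂ)))) (hball ?_)
    rw [Metric.mem_ball, dist_pi_lt_iff hε']
    intro j
    have : ‖(2 * (ε : ℂ))‖ < ε' := by
      rw [norm_mul, Complex.norm_real, Real.norm_of_nonneg hε.le]; simpa using hεε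
    split_ifs <;> simpa [dist_eq_norm] using this
  have hre : ∀ (p : κ → ℂ) ω, ‖cexp (g ω + ∑ j, p j * ℓ j ω)‖
      = exp (g ω + ∑ j, (p j).re * ℓ j ω) := by
    intro p ω
    rw [Complex.norm_exp, Complex.add_re, Complex.re_sum]
    simp
  set b : Ω → ℝ := fun ω => ε⁻¹ * ∑ t ∈ (univ : Finset κ).powerset,
    ‖cexp (g ω + ∑ j, (p₀ j + (if j ∈ t then 2 * (ε : ℂ) else -(2 * (ε : ℂ)))) * ℓ j ω)‖
  have hb : Integrable b μ :=
    (integrable_finsetSum _ fun t _ => (hcorner t).norm).const_mul _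
  have hbb : ∀ ω, ε⁻¹ * (exp (g ω + ∑ j, (p₀ j).re * ℓ j ω) * exp (2 * ε * S ω)) ≤ b ω := by
    intro ω
    refine mul_le_mul_of_nonneg_left ?_ (by positivity)
    have h1 : exp (2 * ε * S ω) ≤
        ∏ j, (exp (2 * ε * ℓ j ω) + exp (-(2 * ε * ℓ j ω))) := by
      rw [mul_sum, Real.exp_sum]
      refine Finset.prod_le_prod (fun _ _ => (exp_pos _).le) fun j _ => ?_
      rcases abs_cases (ℓ j ω) with ⟨h, -⟩ | ⟨h, -⟩ <;> rw [h]
      · exact le_add_of_nonneg_right (exp_pos _).le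
      · rw [mul_neg]; exact le_add_of_nonneg_left (exp_pos _).le
    refine (mul_le_mul_of_nonneg_left h1 (exp_pos _).le).trans_eq ?_
    rw [Finset.prod_add, mul_sum]
    refine sum_congr rfl fun t _ => ?_
    rw [hre, ← Real.exp_sum, ← Real.exp_sum, ← exp_add, ← exp_add]
    congr 1
    rw [← Finset.sum_sdiff (Finset.subset_univ t), ← Finset.sum_sdiff (Finset.subset_univ t)]
    have e1 : ∀ j ∈ univ \ t, (p₀ j + (if j ∈ t then 2 * (ε : ℂ) else -(2 * (ε : ℂ)))).re
        * ℓ j ω = (p₀ j).re * ℓ j ω + -(2 * ε * ℓ j ω) := by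
      intro j hj
      rw [if_neg (by simpa using hj)]; simp; ring
    have e2 : ∀ j ∈ t, (p₀ j + (if j ∈ t then 2 * (ε : ℂ) else -(2 * (ε : ℂ)))).re
        * ℓ j ω = (p₀ j).re * ℓ j ω + (2 * ε * ℓ j ω) := by
      intro j hj
      rw [if_pos hj]; simp; ring
    rw [sum_congr rfl e1, sum_congr rfl e2, sum_add_distrib,
      sum_add_distrib]
    ring
  have hmeas : ∀ p : κ → ℂ, Measurable fun ω => cexp (g ω + ∑ j, p j * ℓ j ω) := by
    intro p; fun_prop
  have key : HasFDerivAt (fun p : κ → ℂ => ∫ ω, cexp (g ω + ∑ j, p j * ℓ j ω) ∂μ) (∫ ω, F' p₀ ω ∂μ) p₀ := by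
    refine hasFDerivAt_integral_of_dominated_of_fderiv_le (bound := b)
      (Metric.ball_mem_nhds p₀ hε) ?_ (hint p₀ hp₀) ?_ ?_ hb ?_
    · exact .of_forall fun p => (hmeas p).aestronglyMeasurable
    · refine AEStronglyMeasurable.smul (hmeas p₀).aestronglyMeasurable ?_
      refine Finset.aestronglyMeasurable_fun_sum _ fun j _ => ?_
      exact AEStronglyMeasurable.smul_const
        (Complex.measurable_ofReal.comp (hℓ j)).aestronglyMeasurable _
    · refine .of_forall fun ω p hp => ?_
      refine le_trans ?_ (hbb ω)
      rw [norm_smul, hre]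
      have hS : 0 ≤ S ω := Finset.sum_nonneg fun _ _ => abs_nonneg _
      have h1 : ‖∑ j, (ℓ j ω : ℂ) • (ContinuousLinearMap.proj j : (κ → ℂ) →L[ℂ] ℂ)‖ ≤ S ω := by
        refine (norm_sum_le _ _).trans (sum_le_sum fun j _ => ?_)
        rw [norm_smul, Complex.norm_real, Real.norm_eq_abs]
        refine mul_le_of_le_one_right (abs_nonneg _) ?_
        refine ContinuousLinearMap.opNorm_le_bound _ zero_le_one fun x => ?_
        simpa using norm_le_pi_norm x j
      have h2 : S ω ≤ ε⁻¹ * exp (ε * S ω) := by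
        rw [← div_eq_inv_mul, le_div_iff₀ hε]
        linarith [Real.add_one_le_exp (ε * S ω)]
      have h3 : exp (g ω + ∑ j, (p j).re * ℓ j ω) ≤
          exp (g ω + ∑ j, (p₀ j).re * ℓ j ω) * exp (ε * S ω) := by
        rw [← exp_add, add_assoc, mul_sum, ← sum_add_distrib]
        refine exp_le_exp.2 (add_le_add le_rfl <| sum_le_sum fun j _ => ?_)
        have hpj : |(p j).re - (p₀ j).re| ≤ ε := by
          have := (Complex.abs_re_le_norm (p j - p₀ j)).trans (norm_le_pi_norm (p - p₀) j)
          rw [← dist_eq_norm] at this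
          simpa using this.trans (Metric.mem_ball.1 hp).le
        have : ((p j).re - (p₀ j).re) * ℓ j ω ≤ ε * |ℓ j ω| := by
          refine (le_abs_self _).trans ?_
          rw [abs_mul]
          exact mul_le_mul_of_nonneg_right hpj (abs_nonneg _)
        linarith
      calc _ ≤ (exp (g ω + ∑ j, (p₀ j).re * ℓ j ω) * exp (ε * S ω)) *
            (ε⁻¹ * exp (ε * S ω)) :=
            mul_le_mul h3 (h1.trans h2) (norm_nonneg _) (by positivity)
        _ = _ := by
            rw [show 2 * ε * S ω = ε * S ω + ε * S ω by ring, exp_add (ε * S ω)]; ring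
    · refine .of_forall fun ω p _ => ?_
      refine HasFDerivAt.cexp ?_
      refine HasFDerivAt.const_add _ ?_
      refine HasFDerivAt.congr_fderiv (HasFDerivAt.fun_sum fun j _ =>
        ((ContinuousLinearMap.proj (R := ℂ) (φ := fun _ : κ => ℂ) j).hasFDerivAt.mul_const
          (ℓ j ω : ℂ))) ?_
      rfl
  exact key.differentiableAt.differentiableWithinAt

theorem integral_Ioi_eq_integral_exp {E : Type*} [NormedAddCommGroup E] [NormedSpace ℝ E]
    (g : ℝ → E) : ∫ t in Set.Ioi (0 : ℝ), g t = ∫ x : ℝ, exp x • g (exp x) := by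
  rw [← Real.range_exp, ← Set.image_univ, integral_image_eq_integral_abs_deriv_smul
    MeasurableSet.univ (fun x _ => (Real.hasDerivAt_exp x).hasDerivWithinAt)
    Real.exp_injective.injOn]
  simp

theorem integrableOn_Ioi_iff_integrable_exp {E : Type*} [NormedAddCommGroup E] [NormedSpace ℝ E]
    (g : ℝ → E) : IntegrableOn g (Set.Ioi (0 : ℝ)) ↔
      Integrable fun x : ℝ => exp x • g (exp x) := by
  rw [← Real.range_exp, ← Set.image_univ, integrableOn_image_iff_integrableOn_abs_deriv_smul
    MeasurableSet.univ (fun x _ => (Real.hasDerivAt_exp x).hasDerivWithinAt)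
    Real.exp_injective.injOn]
  simp

theorem integrable_rexp_gamma {σ q : ℝ} (hσ : 0 < σ) (hq : 0 < q) :
    Integrable fun x : ℝ => exp (σ * x - q * exp x) := by
  have h := (integrableOn_Ioi_iff_integrable_exp _).1 (Real.GammaIntegral_convergent hσ)
  have h2 := (h.comp_add_right (log q)).const_mul (exp (-σ * log q))
  refine h2.congr (.of_forall fun x => ?_)
  simp only [smul_eq_mul]
  rw [← Real.exp_mul, ← exp_add, ← exp_add, ← exp_add, exp_add x,
    exp_log hq]
  congr 1; ring

theorem integrable_cexp_gamma {s r : ℂ} (hs : 0 < s.re) (hr : 0 < r.re) :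
    Integrable fun x : ℝ => cexp (s * x - r * cexp x) := by
  refine (integrable_rexp_gamma hs hr).mono' (by fun_prop)
    (.of_forall fun x => ?_)
  rw [Complex.norm_exp, ← Complex.ofReal_exp, Complex.sub_re, Complex.re_mul_ofReal,
    Complex.re_mul_ofReal]

theorem integral_cexp_gamma_real {s : ℂ} (hs : 0 < s.re) {q : ℝ} (hq : 0 < q) :
    ∫ x : ℝ, cexp (s * x - q * cexp x) =
      Gamma s * cexp (-s * log q) := by
  have h := Complex.integral_cpow_mul_exp_neg_mul_Ioi hs hq
  rw [integral_Ioi_eq_integral_exp] at h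
  have hq' : cexp (-s * log q) = (1 / (q : ℂ)) ^ s := by
    rw [Complex.cpow_def_of_ne_zero (by simpa using hq.ne'), one_div, Complex.log_inv,
      ← Complex.ofReal_log hq.le]
    · congr 1; ring
    · rw [Complex.arg_ofReal_of_nonneg hq.le]; exact Real.pi_pos.ne
  rw [hq', mul_comm, ← h]
  refine integral_congr_ae (.of_forall fun x => ?_)
  simp only [Complex.real_smul]
  rw [Complex.ofReal_exp, Complex.cpow_def_of_ne_zero (Complex.exp_ne_zero _),
    ← Complex.ofReal_exp, ← Complex.ofReal_log (exp_pos x).le, log_exp,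
    Complex.ofReal_exp, ← Complex.exp_add, ← Complex.exp_add]
  congr 1; ring

/-- The Gamma integral rotated to a ray `e^{iθ} ℝ₊`, by analytic continuation in the rate. -/
theorem integral_cexp_gamma {s r : ℂ} (hs : 0 < s.re) (hr : 0 < r.re) :
    ∫ x : ℝ, cexp (s * x - r * cexp x) =
      Gamma s * cexp (-s * Complex.log r) := by
  have hopen : IsOpen {z : ℂ | 0 < z.re} := isOpen_lt continuous_const Complex.continuous_re
  set ℓ : Fin 2 → ℝ → ℝ := ![fun x => x, fun x => -exp x]
  have hD := differentiableOn_integral_cexp (μ := (volume : Measure ℝ)) (measurable_const (a := (0 : ℝ))) (ℓ := ℓ)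
    (U := {p | 0 < (p 0).re ∧ 0 < (p 1).re})
    (by intro j; fin_cases j <;> simp [ℓ] <;> fun_prop)
    (IsOpen.inter (isOpen_lt continuous_const (Complex.continuous_re.comp (continuous_apply 0)))
      (isOpen_lt continuous_const (Complex.continuous_re.comp (continuous_apply 1))))
    (by
      rintro p ⟨h0, h1⟩
      refine (integrable_cexp_gamma h0 h1).congr (.of_forall fun x => ?_)
      simp [ℓ, Fin.sum_univ_two, sub_eq_add_neg])
  have h1 : DifferentiableOn ℂ (fun r : ℂ => ∫ x : ℝ, cexp (s * x - r * cexp x))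
      {z : ℂ | 0 < z.re} := by
    have := hD.comp (f := fun r : ℂ => ![s, r]) (s := {z : ℂ | 0 < z.re})
      (by
        refine DifferentiableOn.finCons (by fun_prop) ?_
        refine DifferentiableOn.finCons (by fun_prop) (by fun_prop)) (by
        intro r hr; exact ⟨by simpa using hs, by simpa using hr⟩)
    refine this.congr fun r _ => ?_
    refine integral_congr_ae (.of_forall fun x => ?_)
    simp [ℓ, Fin.sum_univ_two, sub_eq_add_neg]
  have h2 : DifferentiableOn ℂ (fun r : ℂ => Gamma s * cexp (-s * Complex.log r))
      {z : ℂ | 0 < z.re} := by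
    intro z hz
    have : DifferentiableAt ℂ Complex.log z :=
      Complex.differentiableAt_log (Complex.mem_slitPlane_iff.2 (Or.inl hz))
    exact (((this.const_mul _).cexp).const_mul _).differentiableWithinAt
  have hfreq : ∃ᶠ z in nhdsWithin (1 : ℂ) {1}ᶜ,
      (∫ x : ℝ, cexp (s * x - z * cexp x)) =
        Gamma s * cexp (-s * Complex.log z) := by
    have ht : Filter.Tendsto (fun n : ℕ => (((1 + 1 / ((n : ℝ) + 1) : ℝ)) : ℂ)) Filter.atTop
        (nhdsWithin (1 : ℂ) {1}ᶜ) := by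
      refine tendsto_nhdsWithin_iff.2 ⟨?_, .of_forall fun n => ?_⟩
      · have h0 : Filter.Tendsto (fun n : ℕ => (1 + 1 / ((n : ℝ) + 1) : ℝ)) Filter.atTop
            (nhds (1 + 0)) := tendsto_const_nhds.add tendsto_one_div_add_atTop_nhds_zero_nat
        simpa [Function.comp_def] using (Complex.continuous_ofReal.tendsto _).comp h0
      · have : (0 : ℝ) < 1 / ((n : ℝ) + 1) := by positivity
        simp only [Set.mem_compl_iff, Set.mem_singleton_iff]
        rw [← Complex.ofReal_one, Complex.ofReal_inj]; linarith
    refine ht.frequently (Filter.Frequently.of_forall fun n => ?_)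
    have hp : (0 : ℝ) < 1 + 1 / ((n : ℝ) + 1) := by positivity
    rw [integral_cexp_gamma_real hs hp, Complex.ofReal_log hp.le]
  exact (h1.analyticOnNhd hopen).eqOn_of_preconnected_of_frequently_eq (h2.analyticOnNhd hopen)
    (convex_halfSpace_re_gt 0).isPreconnected (by simp : (1 : ℂ) ∈ {z : ℂ | 0 < z.re}) hfreq hr

/-- Exponential decay of `Γ` on vertical lines; rotating the ray of integration by `π/4` already
gives the rate `π/4`. -/
theorem norm_Gamma_le {σ : ℝ} (hσ : 0 < σ) : ∃ K : ℝ, 0 < K ∧ ∀ s : ℂ, s.re = σ →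
    ‖Gamma s‖ ≤ K * exp (-(pi / 4) * |s.im|) := by
  set J : ℝ := ∫ x : ℝ, exp (σ * x - Real.cos (pi / 4) * exp x)
  have hc : 0 < Real.cos (pi / 4) :=
    Real.cos_pos_of_mem_Ioo ⟨by linarith [Real.pi_pos], by linarith [Real.pi_pos]⟩
  have hJ : 0 ≤ J := integral_nonneg fun x => (exp_pos _).le
  have main : ∀ ε : ℝ, |ε| = 1 → ∀ s : ℂ, s.re = σ →
      ‖Gamma s‖ ≤ J * exp (-(pi / 4) * (ε * s.im)) := by
    intro ε hε s hs
    set θ : ℝ := ε * (pi / 4)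
    have hθ : Real.cos θ = Real.cos (pi / 4) := by
      rcases (abs_eq zero_le_one).1 hε with h | h <;> simp [θ, h]
    have habs : |θ| = pi / 4 := by
      rw [abs_mul, hε, one_mul, abs_of_pos (by positivity)]
    have hr : 0 < (cexp (θ * I)).re := by
      rw [Complex.exp_ofReal_mul_I_re, hθ]; exact hc
    have h := integral_cexp_gamma (s := s) (by rw [hs]; exact hσ) hr
    rw [Complex.log_exp] at h
    rotate_left
    · simp; linarith [abs_le.1 habs.le, Real.pi_pos]
    · simp; linarith [abs_le.1 habs.le, Real.pi_pos]
    have hn := congrArg norm h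
    rw [norm_mul, Complex.norm_exp] at hn
    have e1 : (-s * (θ * I)).re = s.im * θ := by simp
    rw [e1] at hn
    have hle : ‖∫ x : ℝ, cexp (s * x - cexp (θ * I) * cexp x)‖ ≤ J := by
      refine (norm_integral_le_integral_norm _).trans_eq ?_
      refine integral_congr_ae (.of_forall fun x => ?_)
      simp only [Complex.norm_exp]
      rw [Complex.sub_re, Complex.mul_re, ← Complex.ofReal_exp, Complex.re_mul_ofReal,
        Complex.exp_ofReal_mul_I_re, hθ, hs]
      simp
    rw [hn] at hle
    have : ‖Gamma s‖ = ‖Gamma s‖ * exp (s.im * θ) * exp (-(s.im * θ)) := by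
      rw [mul_assoc, ← exp_add]; simp
    rw [this]
    refine (mul_le_mul_of_nonneg_right hle (exp_pos _).le).trans_eq ?_
    congr 2; simp only [θ]; ring
  refine ⟨J + 1, by linarith, fun s hs => ?_⟩
  have : ‖Gamma s‖ ≤ J * exp (-(pi / 4) * |s.im|) := by
    rcases abs_cases s.im with ⟨h, -⟩ | ⟨h, -⟩ <;> rw [h]
    · simpa using main 1 (by simp) s hs
    · simpa using main (-1) (by simp) s hs
  refine this.trans (mul_le_mul_of_nonneg_right (by linarith) (exp_pos _).le)

theorem integrable_exp_neg_mul_abs {b : ℝ} (hb : 0 < b) :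
    Integrable fun t : ℝ => exp (-b * |t|) := by
  refine (integrable_inv_one_add_sq.comp_mul_left' hb.ne' |>.const_mul 2).mono'
    (by fun_prop) (.of_forall fun t => ?_)
  rw [Real.norm_of_nonneg (exp_pos _).le, neg_mul, Real.exp_neg, ← div_eq_mul_inv,
    inv_le_comm₀ (exp_pos _) (by positivity), inv_div, div_le_iff₀ two_pos]
  have h0 : 0 ≤ b * |t| := by positivity
  have h1 := Real.quadratic_le_exp_of_nonneg h0
  have h2 : (b * |t|) ^ 2 = (b * t) ^ 2 := by rw [mul_pow, sq_abs, mul_pow]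
  rw [h2] at h1
  linarith

theorem integrable_Gamma_vertical {σ : ℝ} (hσ : 0 < σ) :
    Integrable fun t : ℝ => Gamma (σ + I * t) := by
  obtain ⟨K, hK, hle⟩ := norm_Gamma_le hσ
  refine ((integrable_exp_neg_mul_abs (b := pi / 4) (by positivity)).const_mul K).mono' ?_
    (.of_forall fun t => by simpa using hle (σ + I * t) (by simp))
  refine Continuous.aestronglyMeasurable ?_
  refine continuous_iff_continuousAt.2 fun t => ?_
  refine ContinuousAt.comp (f := fun t : ℝ => (σ + I * t : ℂ)) (g := Gamma) ?_
    (by fun_prop)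
  refine (Complex.differentiableAt_Gamma _ fun m h => ?_).continuousAt
  have := congrArg Complex.re h
  simp at this
  have hm : (0 : ℝ) ≤ m := m.cast_nonneg
  linarith

/-- The Mellin–Barnes representation of the exponential, in logarithmic coordinates. -/
theorem integral_Gamma_vertical {σ : ℝ} (hσ : 0 < σ) (y : ℝ) :
    ∫ t : ℝ, Gamma (σ + I * t) * cexp (-(σ + I * t) * y) =
      2 * pi * cexp (-cexp y) := by
  have hG : ∀ s : ℂ, 0 < s.re → mellin (fun x : ℝ => (cexp (-x) : ℂ)) s = Gamma s := by
    intro s hs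
    rw [Complex.Gamma_eq_integral hs, Complex.GammaIntegral_eq_mellin]
    simp
  have h := mellinInv_mellin_eq σ (fun x : ℝ => (cexp (-x) : ℂ)) (exp_pos y) (by
      have := Complex.GammaIntegral_convergent (s := σ) (by simpa using hσ)
      refine this.congr (.of_forall fun x => ?_)
      simp [mul_comm]) (by
      refine (integrable_Gamma_vertical hσ).congr (.of_forall fun t => ?_)
      simp only
      rw [hG _ (by simpa using hσ), mul_comm I]) (by fun_prop)
  rw [mellinInv] at h
  simp only [smul_eq_mul] at h
  rw [← Complex.ofReal_exp y, ← h]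
  push_cast
  rw [Complex.real_smul, ← mul_assoc]
  push_cast
  rw [mul_one_div_cancel (by simp [Real.pi_ne_zero]), one_mul]
  refine integral_congr_ae (.of_forall fun t => ?_)
  simp only
  rw [hG _ (by simpa using hσ), mul_comm, mul_comm I, Complex.cpow_def_of_ne_zero
    (Complex.exp_ne_zero _), ← Complex.ofReal_exp, ← Complex.ofReal_log (exp_pos y).le,
    log_exp]
  congr 2
  ring

/-- The beta integral on `(0, ∞)`, in logarithmic coordinates. -/
theorem integral_beta {B N : ℂ} (hB : 0 < B.re) (hN : B.re < N.re) :
    Integrable (fun α : ℝ => cexp (B * α - N * log (1 + exp α))) ∧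
    Gamma N * ∫ α : ℝ, cexp (B * α - N * log (1 + exp α)) =
      Gamma B * Gamma (N - B) := by
  have hNB : 0 < (N - B).re := by simpa using hN
  have h1 : Integrable (fun p : ℝ × ℝ => cexp ((N - B) * p.1 - 1 * cexp p.1) *
      cexp (B * p.2 - 1 * cexp p.2)) :=
    (integrable_cexp_gamma hNB (by simp)).mul_prod (integrable_cexp_gamma hB (by simp))
  set g : ℝ × ℝ → ℂ := fun p => cexp ((N - B) * p.1 - 1 * cexp p.1) *
      cexp (B * p.2 - 1 * cexp p.2)
  have hmp := measurePreserving_prod_add (G := ℝ) (volume : Measure ℝ) volume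
  have hg : (g ∘ fun p : ℝ × ℝ => (p.1, p.1 + p.2)) = fun p : ℝ × ℝ =>
      cexp (B * p.2) * cexp (N * p.1 - (1 + exp p.2 : ℝ) * cexp p.1) := by
    ext p
    simp only [g, Function.comp, ← Complex.exp_add]
    congr 1
    push_cast
    rw [Complex.exp_add]
    ring
  have h2 : Integrable (g ∘ fun p : ℝ × ℝ => (p.1, p.1 + p.2)) :=
    (hmp.integrable_comp h1.aestronglyMeasurable).2 h1
  have h3 : ∫ p, (g ∘ fun p : ℝ × ℝ => (p.1, p.1 + p.2)) p = ∫ p, g p :=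
    hmp.integral_comp (MeasurableEquiv.shearAddRight ℝ).measurableEmbedding g
  have hΓ : Gamma N ≠ 0 := by
    refine Complex.Gamma_ne_zero fun m h => ?_
    have := congrArg Complex.re h
    have hm : (0 : ℝ) ≤ m := m.cast_nonneg
    simp at this
    linarith
  have hin : ∀ α : ℝ, ∫ x : ℝ, cexp (B * α) *
      cexp (N * x - (1 + exp α : ℝ) * cexp x) =
      Gamma N * cexp (B * α - N * log (1 + exp α)) := by
    intro α
    rw [integral_const_mul, integral_cexp_gamma_real (by linarith) (by positivity),
      mul_left_comm, ← Complex.exp_add]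
    congr 2; ring
  rw [hg] at h2 h3
  constructor
  · have h4 := (h2.integral_prod_right).const_mul (Gamma N)⁻¹
    simp only [hin] at h4
    simpa [inv_mul_cancel_left₀ hΓ] using h4
  · rw [← integral_const_mul]
    simp_rw [← hin]
    rw [← integral_prod_symm _ h2]
    refine h3.trans ?_
    simp only [g]
    rw [Measure.volume_eq_prod, integral_prod_mul (fun x : ℝ => cexp ((N - B) * x - 1 * cexp x))
      (fun x : ℝ => cexp (B * x - 1 * cexp x))]
    have e1 := integral_cexp_gamma_real hNB one_pos
    have e2 := integral_cexp_gamma_real hB one_pos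
    simp only [Real.log_one, Complex.ofReal_zero, mul_zero, Complex.exp_zero, mul_one,
      Complex.ofReal_one] at e1 e2
    rw [e1, e2, mul_comm]

/-! ### The vertex integral -/

section Vertex
variable {ι : Type*} [Fintype ι]

/-- The exponent `A x - e^x + ∑_b (B_b α_b + E_b log (1 + e^{α_b}) - e^{x+α_b})` of the vertex
integral, in logarithmic coordinates `(x, α)`. -/
def vertexExponent (A : ℂ) (B E : ι → ℂ) (p : ℝ × (ι → ℝ)) : ℂ :=
  A * p.1 - exp p.1 + ∑ b, (B b * p.2 b + E b * log (1 + exp (p.2 b)) -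
    exp (p.1 + p.2 b))

/-- The vertex integral: with `ζ = e^x`, `a_b = e^{α_b}`, it is
`∫ dζ/ζ ζ^A e^{-ζ} ∏_b ∫ da/a a^{B_b} (1 + a)^{E_b} e^{-ζ a}`, a Mellin transform of a product of
confluent hypergeometric functions. -/
def vertexIntegral (A : ℂ) (B E : ι → ℂ) : ℂ :=
  ∫ p : ℝ × (ι → ℝ), cexp (vertexExponent A B E p)

theorem exp_neg_exp_le {p : ℝ} (hp : 0 ≤ p) (y : ℝ) : p * y - exp y ≤ p ^ 2 / 2 := by
  rcases le_total y 0 with h | h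
  · have := mul_nonpos_of_nonneg_of_nonpos hp h
    nlinarith [exp_pos y, sq_nonneg p]
  · have := Real.quadratic_le_exp_of_nonneg h
    nlinarith [sq_nonneg (p - y)]

theorem log_one_add_exp_nonneg (α : ℝ) : 0 ≤ log (1 + exp α) :=
  Real.log_nonneg (by linarith [exp_pos α])

theorem exp_neg_exp_add_le {p : ℝ} (hp : 0 ≤ p) (x α : ℝ) :
    exp (-exp (x + α)) ≤ exp (p + p ^ 2 / 2) * (1 + exp (-p * x)) *
      exp (-p * log (1 + exp α)) := by
  have hlog2 : log 2 ≤ 1 := by linarith [Real.log_two_lt_d9]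
  rcases le_total α 0 with h | h
  · have h1 : log (1 + exp α) ≤ 1 :=
      (Real.log_le_log (by positivity) (by linarith [Real.exp_le_one_iff.2 h])).trans hlog2
    have h2 : exp (-exp (x + α)) ≤ exp (p + p ^ 2 / 2) *
        exp (-p * log (1 + exp α)) := by
      rw [← exp_add, exp_le_exp]
      nlinarith [exp_pos (x + α), sq_nonneg p]
    refine h2.trans (mul_le_mul_of_nonneg_right ?_ (exp_pos _).le)
    exact le_mul_of_one_le_right (exp_pos _).le (by linarith [exp_pos (-p * x)])
  · have h1 : log (1 + exp α) ≤ 1 + α := by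
      have : 1 + exp α ≤ 2 * exp α := by linarith [Real.one_le_exp h]
      refine (Real.log_le_log (by positivity) this).trans ?_
      rw [Real.log_mul two_ne_zero (exp_pos _).ne', log_exp]; linarith
    have h2 : exp (-exp (x + α)) ≤ exp (p + p ^ 2 / 2) * exp (-p * x) *
        exp (-p * log (1 + exp α)) := by
      rw [← exp_add, ← exp_add, exp_le_exp]
      have := exp_neg_exp_le hp (x + α)
      nlinarith
    refine h2.trans (mul_le_mul_of_nonneg_right ?_ (exp_pos _).le)
    exact mul_le_mul_of_nonneg_left (by linarith) (exp_pos _).le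

/-- The domain of absolute convergence of the vertex integral. -/
def VertexConv (A : ℂ) (B E : ι → ℂ) : Prop :=
  (∀ b, 0 < (B b).re) ∧ ∑ b, max 0 (B b + E b).re < A.re

theorem integrable_vertex {A : ℂ} {B E : ι → ℂ} (h : VertexConv A B E) :
    Integrable fun p : ℝ × (ι → ℝ) => cexp (vertexExponent A B E p) := by
  obtain ⟨hB, hA⟩ := h
  obtain ⟨ε, hε, hεA⟩ : ∃ ε : ℝ, 0 < ε ∧
      ∑ b, max 0 (B b + E b).re + Fintype.card ι * ε < A.re := by
    have hr : (0 : ℝ) < Fintype.card ι + 1 := by positivity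
    refine ⟨(A.re - ∑ b, max 0 (B b + E b).re) / (Fintype.card ι + 1), by
      apply div_pos <;> linarith, ?_⟩
    have hd : 0 < (A.re - ∑ b, max 0 (B b + E b).re) / (Fintype.card ι + 1) := by
      apply div_pos <;> linarith
    have : (Fintype.card ι + 1) * ((A.re - ∑ b, max 0 (B b + E b).re) / (Fintype.card ι + 1)) =
      A.re - ∑ b, max 0 (B b + E b).re := by field_simp
    nlinarith
  set p : ι → ℝ := fun b => max 0 (B b + E b).re + ε
  have hp0 : ∀ b, 0 ≤ p b := fun b => add_nonneg (le_max_left _ _) hε.le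
  have hsum : ∀ t : Finset ι, ∑ b ∈ t, p b < A.re := by
    intro t
    refine (Finset.sum_le_univ_sum_of_nonneg hp0).trans_lt ?_
    simpa [p, sum_add_distrib] using hεA
  have hx : Integrable fun x : ℝ => exp (A.re * x - exp x) *
      ∏ b, (1 + exp (-p b * x)) := by
    have : (fun x : ℝ => exp (A.re * x - exp x) * ∏ b, (1 + exp (-p b * x))) =
        fun x => ∑ t ∈ (univ : Finset ι).powerset,
          exp ((A.re - ∑ b ∈ t, p b) * x - 1 * exp x) := by
      ext x
      simp_rw [add_comm (1 : ℝ)]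
      rw [Finset.prod_add, mul_sum]
      refine sum_congr rfl fun t _ => ?_
      rw [Finset.prod_const_one, mul_one, ← Real.exp_sum, ← exp_add]
      congr 1
      simp only [neg_mul, sum_neg_distrib, ← sum_mul]
      ring
    rw [this]
    exact integrable_finsetSum _ fun t _ =>
      integrable_rexp_gamma (by linarith [hsum t]) one_pos
  have hα : Integrable fun α : ι → ℝ => ∏ b, exp ((B b).re * α b -
      (p b - (E b).re) * log (1 + exp (α b))) := by
    refine Integrable.fintype_prod_dep (μ := fun _ : ι => (volume : Measure ℝ))
      (f := fun b α => exp ((B b).re * α - (p b - (E b).re) * log (1 + exp α)))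
      fun b => ?_
    have hlt : ((B b).re : ℂ).re < ((p b - (E b).re : ℝ) : ℂ).re := by
      have := le_max_right 0 (B b + E b).re
      simp only [Complex.ofReal_re, p]
      simp only [Complex.add_re] at this
      simp only [Complex.add_re]
      linarith
    have := (integral_beta (B := ((B b).re : ℂ)) (by simpa using hB b) hlt).1.norm
    refine this.congr (.of_forall fun α => ?_)
    simp only [Complex.norm_exp]
    congr 1
    simp
  have hprod := (hx.mul_prod hα).const_mul (∏ b, exp (p b + p b ^ 2 / 2))
  refine hprod.mono' (by unfold vertexExponent; fun_prop) (.of_forall fun q => ?_)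
  rw [Complex.norm_exp]
  have e1 : (vertexExponent A B E q).re = (A.re * q.1 - exp q.1) +
      ∑ b, ((B b).re * q.2 b + (E b).re * log (1 + exp (q.2 b)) +
        -exp (q.1 + q.2 b)) := by
    simp [vertexExponent, Complex.re_sum, -Complex.ofReal_exp, sub_eq_add_neg]
  rw [e1, exp_add, Real.exp_sum, mul_left_comm, mul_assoc]
  refine mul_le_mul_of_nonneg_left ?_ (exp_pos _).le
  rw [← prod_mul_distrib, ← prod_mul_distrib]
  refine Finset.prod_le_prod (fun _ _ => (exp_pos _).le) fun b _ => ?_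
  rw [exp_add]
  refine (mul_le_mul_of_nonneg_left (exp_neg_exp_add_le (hp0 b) q.1 (q.2 b))
    (exp_pos _).le).trans_eq ?_
  have : (B b).re * q.2 b - (p b - (E b).re) * log (1 + exp (q.2 b)) =
      ((B b).re * q.2 b + (E b).re * log (1 + exp (q.2 b))) +
      (-p b * log (1 + exp (q.2 b))) := by ring
  rw [this, exp_add ((B b).re * q.2 b + _)]
  ring

theorem vertexExponent_add_one (A : ℂ) (B E : ι → ℂ) (p : ℝ × (ι → ℝ)) :
    cexp (vertexExponent (A + 1) B E p) =
      cexp (vertexExponent A B E p) * exp p.1 := by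
  rw [Complex.ofReal_exp, ← Complex.exp_add]; congr 1; simp only [vertexExponent]; ring

theorem vertexExponent_add_single (A : ℂ) (B E : ι → ℂ) (b : ι) (z w : ℂ) (p : ℝ × (ι → ℝ)) :
    cexp (vertexExponent A (B + Pi.single b z) (E + Pi.single b w) p) =
      cexp (vertexExponent A B E p) *
        cexp (z * p.2 b + w * log (1 + exp (p.2 b))) := by
  rw [← Complex.exp_add]; congr 1
  have : z * p.2 b + w * log (1 + exp (p.2 b)) =
      ∑ b', ((Pi.single b z : ι → ℂ) b' * p.2 b' +
        (Pi.single b w : ι → ℂ) b' * log (1 + exp (p.2 b'))) := by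
    rw [sum_eq_single b] <;> simp +contextual
  rw [this]
  simp only [vertexExponent, add_assoc, ← sum_add_distrib, Pi.add_apply]
  congr 1
  refine sum_congr rfl fun _ _ => by ring

theorem exp_log_one_add (α : ℝ) : cexp (log (1 + exp α)) = 1 + exp α := by
  rw [← Complex.ofReal_exp, exp_log (by positivity)]; simp

/-- Expanding a factor `1 + a_b`. -/
theorem vertexIntegral_add_single {A : ℂ} {B E : ι → ℂ} (b : ι) (h : VertexConv A B E)
    (h' : VertexConv A (B + Pi.single b 1) E) :
    vertexIntegral A B (E + Pi.single b 1) =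
      vertexIntegral A B E + vertexIntegral A (B + Pi.single b 1) E := by
  simp only [vertexIntegral]
  rw [← integral_add (integrable_vertex h) (integrable_vertex h')]
  refine integral_congr_ae (.of_forall fun p => ?_)
  have e1 := vertexExponent_add_single A B E b 0 1 p
  have e2 := vertexExponent_add_single A B E b 1 0 p
  simp only [Pi.single_zero, add_zero, zero_mul, zero_add, one_mul] at e1 e2
  simp only [e1, e2]
  rw [exp_log_one_add]
  push_cast
  ring

theorem hasLineDerivAt_vertex (A : ℂ) (B E : ι → ℂ) (p v : ℝ × (ι → ℝ)) :
    HasLineDerivAt ℝ (fun p => cexp (vertexExponent A B E p))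
      (cexp (vertexExponent A B E p) * (A * v.1 - exp p.1 * v.1 +
        ∑ b, (B b * v.2 b + E b * (exp (p.2 b) * v.2 b / (1 + exp (p.2 b))) -
          exp (p.1 + p.2 b) * (v.1 + v.2 b)))) p v := by
  unfold HasLineDerivAt
  have h1 : HasDerivAt (fun t : ℝ => (p + t • v).1) v.1 0 := by
    simpa using ((hasDerivAt_id (0 : ℝ)).mul_const v.1).const_add p.1
  have h2 : ∀ b, HasDerivAt (fun t : ℝ => (p + t • v).2 b) (v.2 b) 0 := fun b => by
    simpa using ((hasDerivAt_id (0 : ℝ)).mul_const (v.2 b)).const_add (p.2 b)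
  have hd : HasDerivAt (fun t : ℝ => vertexExponent A B E (p + t • v))
      (A * v.1 - (exp p.1 * v.1 : ℝ) +
        ∑ b, (B b * v.2 b + E b * (exp (p.2 b) * v.2 b / (1 + exp (p.2 b)) : ℝ) -
          (exp (p.1 + p.2 b) * (v.1 + v.2 b) : ℝ))) 0 := by
    unfold vertexExponent
    refine HasDerivAt.add (HasDerivAt.sub (h1.ofReal_comp.const_mul A) ?_)
      (HasDerivAt.fun_sum fun b _ => ((((h2 b).ofReal_comp.const_mul _).add ?_).sub ?_))
    · simpa using (h1.exp).ofReal_comp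
    · refine HasDerivAt.const_mul _ ?_
      have := (((h2 b).exp.const_add 1).log (by positivity)).ofReal_comp
      simpa using this
    · have := ((h1.add (h2 b)).exp).ofReal_comp
      simpa using this
  have := hd.cexp
  simp only [zero_smul, add_zero] at this
  convert! this using 1
  push_cast
  rfl

instance : (volume : Measure (ℝ × (ι → ℝ))).IsAddHaarMeasure := by
  rw [Measure.volume_eq_prod]; infer_instance

theorem integral_lineDeriv_eq_zero {V : Type*} [NormedAddCommGroup V] [NormedSpace ℝ V]
    [MeasurableSpace V] [BorelSpace V] [FiniteDimensional ℝ V] {μ : Measure V}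
    [μ.IsAddHaarMeasure] {f f' : V → ℂ} {v : V} (hf : Integrable f μ) (hf' : Integrable f' μ)
    (hd : ∀ x, HasLineDerivAt ℝ f (f' x) x v) : ∫ x, f' x ∂μ = 0 := by
  have h := integral_bilinear_hasLineDerivAt_right_eq_neg_left_of_integrable (μ := μ) (v := v)
    (B := ContinuousLinearMap.mul ℝ ℂ) (f := f) (f' := f') (g := fun _ => 1) (g' := fun _ => 0)
    (by simpa using hf') (by simp) (by simpa using hf) (fun x _ => hd x)
    (fun x _ => by
      unfold HasLineDerivAt
      exact hasDerivAt_const _ _)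
  simpa using h.symm

/-- Integration by parts in the variable `ζ`. -/
theorem vertexIntegral_ibp_zero {A : ℂ} {B E : ι → ℂ} (h : VertexConv A B E)
    (h1 : VertexConv (A + 1) B E) (hb : ∀ b, VertexConv (A + 1) (B + Pi.single b 1) E) :
    A * vertexIntegral A B E = vertexIntegral (A + 1) B E +
      ∑ b, vertexIntegral (A + 1) (B + Pi.single b 1) E := by
  have hs : Integrable fun p : ℝ × (ι → ℝ) =>
      ∑ b, cexp (vertexExponent (A + 1) (B + Pi.single b 1) E p) :=
    integrable_finsetSum _ fun b _ => integrable_vertex (hb b)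
  have hs1 : Integrable fun p : ℝ × (ι → ℝ) => cexp (vertexExponent (A + 1) B E p) +
      ∑ b, cexp (vertexExponent (A + 1) (B + Pi.single b 1) E p) :=
    (integrable_vertex h1).add hs
  have hint : Integrable fun p : ℝ × (ι → ℝ) => A * cexp (vertexExponent A B E p) -
      (cexp (vertexExponent (A + 1) B E p) +
        ∑ b, cexp (vertexExponent (A + 1) (B + Pi.single b 1) E p)) :=
    ((integrable_vertex h).const_mul A).sub hs1
  have key := integral_lineDeriv_eq_zero (v := ((1 : ℝ), (0 : ι → ℝ))) (integrable_vertex h) hint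
    (fun p => by
      convert! hasLineDerivAt_vertex A B E p (1, 0) using 1
      simp only [vertexExponent_add_one]
      have : ∀ b, cexp (vertexExponent A (B + Pi.single b 1) E p) =
          cexp (vertexExponent A B E p) * exp (p.2 b) := fun b => by
        have := vertexExponent_add_single A B E b 1 0 p
        simpa using this
      simp only [this, exp_add, Pi.zero_apply, Complex.ofReal_mul, mul_sub, mul_add, mul_sum,
        sum_sub_distrib, sum_add_distrib]
      simp only [Complex.ofReal_zero, mul_zero, zero_div, sum_const_zero, add_zero,
        Complex.ofReal_one, mul_one, zero_sub]
      rw [mul_comm A, ← sub_sub, sub_eq_add_neg _ (∑ b, _)]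
      congr 3
      ext b; ring)
  rw [integral_sub ((integrable_vertex h).const_mul A) hs1, integral_const_mul,
    integral_add (integrable_vertex h1) hs,
    integral_finsetSum _ fun b _ => integrable_vertex (hb b)] at key
  exact sub_eq_zero.1 key

/-- Integration by parts in the variable `a_b`. -/
theorem vertexIntegral_ibp {A : ℂ} {B E : ι → ℂ} (b : ι) (h : VertexConv A B E)
    (h1 : VertexConv A (B + Pi.single b 1) (E + Pi.single b (-1)))
    (h2 : VertexConv (A + 1) (B + Pi.single b 1) E) :
    B b * vertexIntegral A B E +
      E b * vertexIntegral A (B + Pi.single b 1) (E + Pi.single b (-1)) =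
      vertexIntegral (A + 1) (B + Pi.single b 1) E := by
  have hs : Integrable fun p : ℝ × (ι → ℝ) => B b * cexp (vertexExponent A B E p) +
      E b * cexp (vertexExponent A (B + Pi.single b 1) (E + Pi.single b (-1)) p) :=
    ((integrable_vertex h).const_mul _).add ((integrable_vertex h1).const_mul _)
  have hint : Integrable fun p : ℝ × (ι → ℝ) => (B b * cexp (vertexExponent A B E p) +
      E b * cexp (vertexExponent A (B + Pi.single b 1) (E + Pi.single b (-1)) p)) -
      cexp (vertexExponent (A + 1) (B + Pi.single b 1) E p) :=
    hs.sub (integrable_vertex h2)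
  have key := integral_lineDeriv_eq_zero (v := ((0 : ℝ), (Pi.single b 1 : ι → ℝ)))
    (integrable_vertex h) hint
    (fun p => by
      convert! hasLineDerivAt_vertex A B E p (0, Pi.single b 1) using 1
      have e0 := vertexExponent_add_single A B E b 1 0 p
      have e1 := vertexExponent_add_single A B E b 1 (-1) p
      simp only [Pi.single_zero, add_zero, zero_mul, one_mul] at e0
      simp only [vertexExponent_add_one]
      rw [e0, e1, sum_eq_single b (by intro b' _ hb'; simp [hb']) (by simp)]
      rw [Complex.exp_add, neg_one_mul, Complex.exp_neg, exp_log_one_add, exp_add]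
      simp only [Pi.single_eq_same, one_mul, Complex.ofReal_zero, mul_zero, sub_zero, zero_add,
        Complex.ofReal_one, mul_one, Complex.ofReal_mul, Complex.ofReal_exp]
      ring)
  rw [integral_sub hs (integrable_vertex h2), integral_add ((integrable_vertex h).const_mul _)
    ((integrable_vertex h1).const_mul _), integral_const_mul, integral_const_mul] at key
  exact sub_eq_zero.1 key

end Vertex

/-! ### Entire continuation of the vertex integral -/

section Continuation
variable {ι : Type*} [Fintype ι]

theorem VertexConv.mono {A A' : ℂ} {B c B' E' : ι → ℂ} (h : VertexConv A B (c - B))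
    (hB' : ∀ b, 0 < (B' b).re) (m : ι → ℝ) (hm : ∀ b, 0 ≤ m b)
    (hE : ∀ b, (B' b + E' b).re ≤ (c b).re + m b) (hA : A.re + ∑ b, m b ≤ A'.re) :
    VertexConv A' B' E' := by
  refine ⟨hB', ?_⟩
  have h2 := h.2
  simp only [Pi.sub_apply, add_sub_cancel] at h2
  calc ∑ b, max 0 (B' b + E' b).re ≤ ∑ b, (max 0 (c b).re + m b) := by
        refine sum_le_sum fun b _ => max_le (add_nonneg (le_max_left _ _) (hm b)) ?_
        exact (hE b).trans (add_le_add (le_max_right _ _) le_rfl)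
    _ < A'.re := by rw [sum_add_distrib]; linarith

/-- The indicator function of a set of propagators. -/
def indic (ε : Finset ι) : ι → ℂ := fun b => if b ∈ ε then 1 else 0

/-- The vertex integral with the factors `ζ a_b`, `b ∈ ε`, inserted; it corresponds to replacing
the confluent hypergeometric function `U_b` by `-ζ U_b'` for `b ∈ ε`. -/
def vertexInsert (ε : Finset ι) (A : ℂ) (B c : ι → ℂ) : ℂ :=
  vertexIntegral (A + ε.card) (B + indic ε) (c - B)

theorem sum_indic_re (ε : Finset ι) : ∑ b, (indic ε b).re = ε.card := by
  have : ∀ b, (indic ε b).re = if b ∈ ε then 1 else 0 := fun b => by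
    unfold indic; split_ifs <;> simp
  simp [this]

theorem indic_re_nonneg (ε : Finset ι) (b : ι) : 0 ≤ (indic ε b).re := by
  unfold indic; split_ifs <;> simp

theorem single_re_nonneg (b b' : ι) : 0 ≤ ((Pi.single b 1 : ι → ℂ) b').re := by
  rcases eq_or_ne b' b with rfl | h
  · simp
  · simp [h]

theorem sum_single_re (b : ι) : ∑ b', ((Pi.single b 1 : ι → ℂ) b').re = 1 := by
  rw [sum_eq_single b] <;> simp +contextual

theorem indic_insert {ε : Finset ι} {b : ι} (hb : b ∉ ε) :
    indic (insert b ε) = indic ε + Pi.single b 1 := by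
  ext b'
  rcases eq_or_ne b' b with rfl | h
  · simp [indic, hb]
  · simp [indic, h]

theorem indic_erase {ε : Finset ι} {b : ι} (hb : b ∈ ε) :
    indic ε = indic (ε.erase b) + Pi.single b 1 := by
  conv_lhs => rw [← Finset.insert_erase hb]
  exact indic_insert (Finset.notMem_erase b ε)

variable {A : ℂ} {B c : ι → ℂ} (h : VertexConv A B (c - B))
include h

/-- Integration by parts in `a_b`, for a propagator `b` without inserted factor. -/
theorem vertexInsert_lower_of_notMem {ε : Finset ι} {b : ι} (hb : b ∉ ε) :
    B b * vertexInsert ε A B c = (B b - c b) * vertexInsert ε A (B + Pi.single b 1) c +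
      vertexInsert ε (A + 1) (B + Pi.single b 1) c +
      vertexInsert (insert b ε) A (B + Pi.single b 1) c := by
  have hind := indic_re_nonneg ε
  have hsum := sum_indic_re ε
  have hsb := single_re_nonneg b
  have hsums := sum_single_re b
  have e1 : B + indic ε + Pi.single b 1 = B + Pi.single b 1 + indic ε := by abel
  have e2 : c - B + Pi.single b (-1) = c - (B + Pi.single b 1) := by
    rw [Pi.single_neg]; abel
  have e3 : c - B = c - (B + Pi.single b 1) + Pi.single b 1 := by abel
  have e4 : (B + indic ε) b = B b := by simp [indic, hb]
  have i1 := vertexIntegral_ibp (A := A + ε.card) (B := B + indic ε) (E := c - B) b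
    (h.mono (fun b' => by have := h.1 b'; have := hind b'; simp <;> linarith) (fun b' => (indic ε b').re)
      hind (fun b' => by simp <;> linarith) (by rw [hsum]; simp))
    (h.mono (fun b' => by have := h.1 b'; have := hind b'; have := hsb b'; simp <;> linarith)
      (fun b' => (indic ε b').re)
      hind (fun b' => by rw [Pi.single_neg]; simp <;> linarith) (by rw [hsum]; simp))
    (h.mono (fun b' => by have := h.1 b'; have := hind b'; have := hsb b'; simp <;> linarith)
      (fun b' => (indic ε b').re + ((Pi.single b 1 : ι → ℂ) b').re)
      (fun b' => add_nonneg (hind b') (hsb b')) (fun b' => by simp <;> linarith)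
      (by rw [sum_add_distrib, hsum, hsums]; simp <;> linarith))
  have i2 := vertexIntegral_add_single (A := A + ε.card + 1) (B := B + Pi.single b 1 + indic ε)
    (E := c - (B + Pi.single b 1)) b
    (h.mono (fun b' => by have := h.1 b'; have := hind b'; have := hsb b'; simp <;> linarith)
      (fun b' => (indic ε b').re) hind (fun b' => by simp <;> linarith) (by rw [hsum]; simp <;> linarith))
    (h.mono (fun b' => by have := h.1 b'; have := hind b'; have := hsb b'; simp <;> linarith)
      (fun b' => (indic ε b').re + ((Pi.single b 1 : ι → ℂ) b').re)
      (fun b' => add_nonneg (hind b') (hsb b')) (fun b' => by simp <;> linarith)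
      (by rw [sum_add_distrib, hsum, hsums]; simp <;> linarith))
  rw [e1, e2, e4] at i1
  rw [← e3] at i2
  rw [i2] at i1
  simp only [vertexInsert, card_insert_of_notMem hb, indic_insert hb]
  rw [show (A + 1 + (ε.card : ℂ)) = A + ε.card + 1 by ring,
    show (A + ((ε.card + 1 : ℕ) : ℂ)) = A + ε.card + 1 by push_cast; ring,
    show B + Pi.single b 1 + (indic ε + Pi.single b 1) =
      B + Pi.single b 1 + indic ε + Pi.single b 1 by abel, add_assoc, ← i1]
  simp only [Pi.sub_apply]
  ring

/-- Expansion of a factor `1 + a_b`, for a propagator `b` with inserted factor. -/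
theorem vertexInsert_lower_of_mem {ε : Finset ι} {b : ι} (hb : b ∈ ε) :
    vertexInsert ε A B c = vertexInsert (ε.erase b) (A + 1) (B + Pi.single b 1) c +
      vertexInsert ε A (B + Pi.single b 1) c := by
  have hind := indic_re_nonneg ε
  have hsum := sum_indic_re ε
  have hsb := single_re_nonneg b
  have hsums := sum_single_re b
  have e3 : c - B = c - (B + Pi.single b 1) + Pi.single b 1 := by abel
  have i2 := vertexIntegral_add_single (A := A + ε.card) (B := B + indic ε)
    (E := c - (B + Pi.single b 1)) b
    (h.mono (fun b' => by have := h.1 b'; have := hind b'; simp <;> linarith)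
      (fun b' => (indic ε b').re) hind (fun b' => by have := hsb b'; simp <;> linarith)
      (by rw [hsum]; simp))
    (h.mono (fun b' => by have := h.1 b'; have := hind b'; have := hsb b'; simp <;> linarith)
      (fun b' => (indic ε b').re) hind (fun b' => by simp <;> linarith)
      (by rw [hsum]; simp))
  rw [← e3] at i2
  have hc : ((ε.erase b).card : ℂ) + 1 = ε.card := by
    rw [← Finset.card_erase_add_one hb]; push_cast; rfl
  simp only [vertexInsert]
  rw [i2, show A + 1 + ((ε.erase b).card : ℂ) = A + ε.card by rw [← hc]; ring]
  congr 2
  · rw [indic_erase hb]; abel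
  · abel

/-- Integration by parts in `ζ`, with the terms of the propagators in `ε` reduced to fewer insertions. It
raises `A`, at the price of the divisor `A - ∑_{b∈ε} c_b` and of terms with one more insertion. -/
theorem vertexInsert_lower_zero (ε : Finset ι) :
    (A - ∑ b ∈ ε, c b) * vertexInsert ε A B c = (1 - ε.card) * vertexInsert ε (A + 1) B c +
      ∑ b ∈ εᶜ, vertexInsert (insert b ε) A B c +
      ∑ b ∈ ε, B b * vertexInsert (ε.erase b) (A + 1) B c := by
  have hind := indic_re_nonneg ε
  have hsum := sum_indic_re ε
  have i1 := vertexIntegral_ibp_zero (A := A + ε.card) (B := B + indic ε) (E := c - B)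
    (h.mono (fun b' => by have := h.1 b'; have := hind b'; simp <;> linarith) (fun b' => (indic ε b').re)
      hind (fun b' => by simp <;> linarith) (by rw [hsum]; simp))
    (h.mono (fun b' => by have := h.1 b'; have := hind b'; simp <;> linarith) (fun b' => (indic ε b').re)
      hind (fun b' => by simp <;> linarith) (by rw [hsum]; simp <;> linarith))
    (fun b => h.mono (fun b' => by
        have := h.1 b'; have := hind b'; have := single_re_nonneg b b'; simp <;> linarith)
      (fun b' => (indic ε b').re + ((Pi.single b 1 : ι → ℂ) b').re)
      (fun b' => add_nonneg (hind b') (single_re_nonneg b b')) (fun b' => by simp <;> linarith)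
      (by rw [sum_add_distrib, hsum, sum_single_re b]; simp <;> linarith))
  have hout : ∀ b ∈ εᶜ, vertexIntegral (A + ε.card + 1) (B + indic ε + Pi.single b 1) (c - B) =
      vertexInsert (insert b ε) A B c := by
    intro b hb
    have hb' : b ∉ ε := by simpa using hb
    simp only [vertexInsert, card_insert_of_notMem hb', indic_insert hb']
    congr 1
    · push_cast; ring
    · abel
  have hin : ∀ b ∈ ε, vertexIntegral (A + ε.card + 1) (B + indic ε + Pi.single b 1) (c - B) =
      B b * vertexInsert (ε.erase b) (A + 1) B c + ((c b + 1) * vertexInsert ε A B c -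
        vertexInsert ε (A + 1) B c) := by
    intro b hb
    have hsb := single_re_nonneg b
    have hsums := sum_single_re b
    have hie := indic_erase hb
    have hie' : ∀ b', (indic ε b').re = (indic (ε.erase b) b').re + ((Pi.single b 1 : ι → ℂ) b').re :=
      fun b' => by rw [hie]; simp
    have hind' := indic_re_nonneg (ε.erase b)
    have hc : ((ε.erase b).card : ℂ) + 1 = ε.card := by
      rw [← Finset.card_erase_add_one hb]; push_cast; rfl
    have hB0 : ∀ b', 0 < ((B + indic (ε.erase b)) b').re := fun b' => by
      have := h.1 b'; have := hind' b'; simp <;> linarith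
    have hB1 : ∀ b', 0 < ((B + indic ε) b').re := fun b' => by
      have := h.1 b'; have := hind b'; simp <;> linarith
    have hB2 : ∀ b', 0 < ((B + indic ε + (Pi.single b 1 : ι → ℂ)) b').re := fun b' => by
      have := hB1 b'; have := hsb b'; rw [Pi.add_apply, Complex.add_re]; linarith
    have j1 := vertexIntegral_ibp (A := A + ε.card) (B := B + indic (ε.erase b))
      (E := c - B + Pi.single b 1) b
      (h.mono hB0 (fun b' => (indic ε b').re) hind (fun b' => by rw [hie']; simp <;> linarith)
        (by rw [hsum]; simp))
      (h.mono (by rw [add_assoc, ← hie]; exact hB1) (fun b' => (indic ε b').re) hind (fun b' => by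
        rw [hie', Pi.single_neg]; simp <;> linarith) (by rw [hsum]; simp))
      (h.mono (by rw [add_assoc, ← hie]; exact hB1)
        (fun b' => (indic ε b').re + ((Pi.single b 1 : ι → ℂ) b').re)
        (fun b' => add_nonneg (hind b') (hsb b')) (fun b' => by rw [hie']; simp <;> linarith)
        (by rw [sum_add_distrib, hsum, hsums]; simp <;> linarith))
    have j2 := vertexIntegral_add_single (A := A + ε.card) (B := B + indic (ε.erase b))
      (E := c - B) b
      (h.mono hB0 (fun b' => (indic ε b').re) hind
        (fun b' => by have := hsb b'; rw [hie']; simp <;> linarith) (by rw [hsum]; simp))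
      (h.mono (by rw [add_assoc, ← hie]; exact hB1) (fun b' => (indic ε b').re) hind
        (fun b' => by rw [hie']; simp <;> linarith) (by rw [hsum]; simp))
    have j3 := vertexIntegral_add_single (A := A + ε.card + 1) (B := B + indic ε)
      (E := c - B) b
      (h.mono hB1 (fun b' => (indic ε b').re) hind (fun b' => by simp <;> linarith)
        (by rw [hsum]; simp <;> linarith))
      (h.mono hB2 (fun b' => (indic ε b').re + ((Pi.single b 1 : ι → ℂ) b').re)
        (fun b' => add_nonneg (hind b') (hsb b')) (fun b' => by simp <;> linarith)
        (by rw [sum_add_distrib, hsum, hsums]; simp <;> linarith))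
    have e1 : B + indic (ε.erase b) + Pi.single b 1 = B + indic ε := by rw [hie]; abel
    have e2 : c - B + Pi.single b 1 + Pi.single b (-1) = c - B := by rw [Pi.single_neg]; abel
    have e3 : (B + indic (ε.erase b)) b = B b := by simp [indic]
    have e4 : (c - B + (Pi.single b 1 : ι → ℂ)) b = c b - B b + 1 := by simp
    rw [e1] at j1 j2
    rw [e2, e3, e4, j2, j3] at j1
    simp only [vertexInsert]
    rw [show A + 1 + ((ε.erase b).card : ℂ) = A + ε.card by rw [← hc]; ring,
      show A + 1 + (ε.card : ℂ) = A + ε.card + 1 by ring]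
    linear_combination -j1
  rw [← Finset.sum_add_sum_compl ε, sum_congr rfl hin, sum_congr rfl hout,
    sum_add_distrib, sum_sub_distrib, Finset.sum_const, ← sum_mul,
    sum_add_distrib, Finset.sum_const] at i1
  have e5 : vertexIntegral (A + ε.card + 1) (B + indic ε) (c - B) = vertexInsert ε (A + 1) B c := by
    simp only [vertexInsert]; congr 1; ring
  rw [e5] at i1
  have e6 : vertexIntegral (A + ε.card) (B + indic ε) (c - B) = vertexInsert ε A B c := rfl
  rw [e6] at i1
  simp only [nsmul_eq_mul, mul_one] at i1
  linear_combination i1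

end Continuation

/-! ### Gluing of continuations -/

section Identity
variable {X : Type*} [NormedAddCommGroup X] [NormedSpace ℂ X]

/-- Identity theorem on convex domains in several variables, by restriction to complex lines. -/
theorem eqOn_of_convex {W U : Set X} (hW : IsOpen W) (hWc : Convex ℝ W) (hU : IsOpen U)
    (hne : (U ∩ W).Nonempty) {f g : X → ℂ} (hf : DifferentiableOn ℂ f W)
    (hg : DifferentiableOn ℂ g W) (hfg : Set.EqOn f g (U ∩ W)) : Set.EqOn f g W := by
  obtain ⟨u, hu, huW⟩ := hne
  intro x hx
  set L : ℂ → X := fun z => u + z • (x - u)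
  have hLc : Continuous L := by fun_prop
  have hLd : Differentiable ℂ L := by fun_prop
  have hSo : IsOpen (L ⁻¹' W) := hW.preimage hLc
  have hSc : Convex ℝ (L ⁻¹' W) := by
    intro z hz w hw a b ha hb hab
    have : L (a • z + b • w) = a • L z + b • L w := by
      have hb' : b = 1 - a := by linarith
      subst hb'
      simp only [L, ← Complex.coe_smul]
      simp only [smul_eq_mul]
      push_cast
      module
    rw [Set.mem_preimage, this]
    exact hWc hz hw ha hb hab
  have h0 : L 0 = u := by simp [L]
  have h1 : L 1 = x := by simp [L]
  have hev : (f ∘ L) =ᶠ[nhds 0] (g ∘ L) := by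
    have : L ⁻¹' (U ∩ W) ∈ nhds (0 : ℂ) :=
      ((hU.inter hW).preimage hLc).mem_nhds (by rw [Set.mem_preimage, h0]; exact ⟨hu, huW⟩)
    filter_upwards [this] with z hz using hfg hz
  have := ((hf.comp hLd.differentiableOn (Set.mapsTo_preimage _ _)).analyticOnNhd hSo).eqOn_of_preconnected_of_eventuallyEq
    ((hg.comp hLd.differentiableOn (Set.mapsTo_preimage _ _)).analyticOnNhd hSo) hSc.isPreconnected
    (by rw [Set.mem_preimage, h0]; exact huW) hev (by rw [Set.mem_preimage, h1]; exact hx : (1 : ℂ) ∈ L ⁻¹' W)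
  simpa [h1] using this

/-- Continuations to an increasing sequence of convex domains glue. -/
theorem exists_entire_of_continuations {U : ℕ → Set X} (hUo : ∀ k, IsOpen (U k))
    (hUc : ∀ k, Convex ℝ (U k)) (hmono : Monotone U) (hne : (U 0).Nonempty)
    (hcover : ∀ x, ∃ k, x ∈ U k) {f : X → ℂ}
    (hf : ∀ k, ∃ F : X → ℂ, DifferentiableOn ℂ F (U k) ∧ Set.EqOn f F (U 0)) :
    ∃ F : X → ℂ, Differentiable ℂ F ∧ Set.EqOn f F (U 0) := by
  choose F hF hfF using hf
  have hagree : ∀ k l, k ≤ l → Set.EqOn (F k) (F l) (U k) := fun k l hkl =>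
    eqOn_of_convex (hUo k) (hUc k) (hUo 0) (by
      rw [Set.inter_eq_left.2 (hmono (Nat.zero_le k))]; exact hne) (hF k) ((hF l).mono (hmono hkl))
      fun x hx => (hfF k hx.1).symm.trans (hfF l hx.1)
  choose N hN using hcover
  have hval : ∀ k x, x ∈ U k → F (N x) x = F k x := by
    intro k x hx
    rcases le_total (N x) k with h | h
    · exact hagree _ _ h (hN x)
    · exact (hagree _ _ h hx).symm
  refine ⟨fun x => F (N x) x, fun x => ?_, fun x hx => by
    show f x = F (N x) x
    rw [hval 0 x hx]; exact hfF 0 hx⟩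
  have hd : DifferentiableAt ℂ (F (N x)) x := (hF (N x)).differentiableAt ((hUo _).mem_nhds (hN x))
  refine hd.congr_of_eventuallyEq ?_
  filter_upwards [(hUo (N x)).mem_nhds (hN x)] with y hy using hval _ _ hy

theorem differentiable_prod {κ : Type*} {s : Finset κ} {f : κ → X → ℂ}
    (hf : ∀ i ∈ s, Differentiable ℂ (f i)) : Differentiable ℂ fun x => ∏ i ∈ s, f i x := by
  induction s using Finset.induction_on with
  | empty => simp
  | insert a s ha ih =>
    simp only [Finset.prod_insert ha]
    exact (hf a (Finset.mem_insert_self _ _)).mul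
      (ih fun i hi => hf i (mem_insert_of_mem hi))

end Identity

section Entire
variable {ι : Type*} [Fintype ι]

/-- The domain of convergence of the vertex integral, shifted to the left by `k`. -/
def vertexDomain (ι : Type*) [Fintype ι] (k : ℕ) : Set (ℂ × (ι → ℂ) × (ι → ℂ)) :=
  {x | (∀ b, -(k : ℝ) < (x.2.1 b).re) ∧ ∑ b, max 0 (x.2.2 b).re < x.1.re + k}

theorem isOpen_vertexDomain (k : ℕ) : IsOpen (vertexDomain ι k) := by
  have : vertexDomain ι k = (⋂ b, {x : ℂ × (ι → ℂ) × (ι → ℂ) | -(k : ℝ) < (x.2.1 b).re}) ∩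
      {x : ℂ × (ι → ℂ) × (ι → ℂ) | ∑ b, max 0 (x.2.2 b).re < x.1.re + k} := by
    ext x; simp [vertexDomain]
  rw [this]
  refine IsOpen.inter (isOpen_iInter_of_finite fun b => isOpen_lt continuous_const ?_)
    (isOpen_lt ?_ ?_)
  · exact Complex.continuous_re.comp ((continuous_apply b).comp (continuous_fst.comp continuous_snd))
  · refine continuous_finsetSum _ fun b _ => continuous_const.max ?_
    exact Complex.continuous_re.comp ((continuous_apply b).comp (continuous_snd.comp continuous_snd))
  · exact (Complex.continuous_re.comp continuous_fst).add continuous_const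

theorem convex_vertexDomain (k : ℕ) : Convex ℝ (vertexDomain ι k) := by
  rintro x ⟨hx1, hx2⟩ y ⟨hy1, hy2⟩ a b ha hb hab
  refine ⟨fun i => ?_, ?_⟩
  · have h1 := hx1 i
    have h2 := hy1 i
    have : ((a • x + b • y).2.1 i).re = a * (x.2.1 i).re + b * (y.2.1 i).re := by simp
    rw [this]
    have : -(k : ℝ) = a * -(k : ℝ) + b * -(k : ℝ) := by rw [← add_mul, hab, one_mul]
    rw [this]
    rcases ha.eq_or_lt with rfl | ha'
    · have : b = 1 := by linarith
      subst this; simpa using h2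
    · exact add_lt_add_of_lt_of_le (by gcongr) (by gcongr)
  · have h3 : ∑ i, max 0 ((a • x + b • y).2.2 i).re ≤
        a * ∑ i, max 0 (x.2.2 i).re + b * ∑ i, max 0 (y.2.2 i).re := by
      rw [mul_sum, mul_sum, ← sum_add_distrib]
      refine sum_le_sum fun i _ => max_le ?_ ?_
      · exact add_nonneg (mul_nonneg ha (le_max_left _ _)) (mul_nonneg hb (le_max_left _ _))
      · have : ((a • x + b • y).2.2 i).re = a * (x.2.2 i).re + b * (y.2.2 i).re := by simp
        rw [this]
        gcongr <;> exact le_max_right _ _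
    have h4 : (a • x + b • y).1.re + k = a * (x.1.re + k) + b * (y.1.re + k) := by
      have : (k : ℝ) = a * k + b * k := by rw [← add_mul, hab, one_mul]
      simp
      linarith
    rw [h4]
    refine h3.trans_lt ?_
    rcases ha.eq_or_lt with rfl | ha'
    · have : b = 1 := by linarith
      subst this; simpa using hy2
    · exact add_lt_add_of_lt_of_le (by gcongr) (by gcongr)

theorem vertexDomain_zero {A : ℂ} {B c : ι → ℂ} :
    (A, B, c) ∈ vertexDomain ι 0 ↔ VertexConv A B (c - B) := by
  simp [vertexDomain, VertexConv]

/-- Functions on the domain of convergence of the vertex integral that continue to the `k`-th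
shifted domain. -/
def Continues (k : ℕ) (f : ℂ × (ι → ℂ) × (ι → ℂ) → ℂ) : Prop :=
  ∃ F, DifferentiableOn ℂ F (vertexDomain ι k) ∧ Set.EqOn f F (vertexDomain ι 0)

theorem Continues.add {k : ℕ} {f g : ℂ × (ι → ℂ) × (ι → ℂ) → ℂ} (hf : Continues k f)
    (hg : Continues k g) : Continues k fun x => f x + g x := by
  obtain ⟨F, hF, hfF⟩ := hf
  obtain ⟨G, hG, hgG⟩ := hg
  exact ⟨fun x => F x + G x, hF.add hG, fun x hx => congrArg₂ _ (hfF hx) (hgG hx)⟩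

theorem Continues.mul {k : ℕ} {f g : ℂ × (ι → ℂ) × (ι → ℂ) → ℂ} (hf : Continues k f)
    (hg : Continues k g) : Continues k fun x => f x * g x := by
  obtain ⟨F, hF, hfF⟩ := hf
  obtain ⟨G, hG, hgG⟩ := hg
  exact ⟨fun x => F x * G x, hF.mul hG, fun x hx => congrArg₂ _ (hfF hx) (hgG hx)⟩

theorem Continues.of_differentiable {k : ℕ} {f : ℂ × (ι → ℂ) × (ι → ℂ) → ℂ}
    (hf : Differentiable ℂ f) : Continues k f := ⟨f, hf.differentiableOn, fun _ _ => rfl⟩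

theorem Continues.congr {k : ℕ} {f g : ℂ × (ι → ℂ) × (ι → ℂ) → ℂ} (hf : Continues k f)
    (hfg : Set.EqOn g f (vertexDomain ι 0)) : Continues k g := by
  obtain ⟨F, hF, hfF⟩ := hf
  exact ⟨F, hF, hfg.trans hfF⟩

theorem Continues.sum {k : ℕ} {κ : Type*} (s : Finset κ) {f : κ → ℂ × (ι → ℂ) × (ι → ℂ) → ℂ}
    (hf : ∀ i ∈ s, Continues k (f i)) : Continues k fun x => ∑ i ∈ s, f i x := by
  induction s using Finset.induction_on with
  | empty => simpa using Continues.of_differentiable (differentiable_const (0 : ℂ))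
  | insert a s ha ih =>
    simp only [Finset.sum_insert ha]
    exact (hf a (Finset.mem_insert_self _ _)).add
      (ih fun i hi => hf i (mem_insert_of_mem hi))

/-- `∏_S 1 / Γ(A - ∑_{b∈S} c_b)` over all sets `S` of propagators. -/
def vertexNorm (A : ℂ) (c : ι → ℂ) : ℂ := ∏ S : Finset ι, (Gamma (A - ∑ b ∈ S, c b))⁻¹

/-- `∏_S (A - ∑_{b∈S} c_b)` over all sets `S` of propagators containing `ε`. -/
def vertexFactor (ε : Finset ι) (A : ℂ) (c : ι → ℂ) : ℂ :=
  ∏ S : Finset ι with ε ⊆ S, (A - ∑ b ∈ S, c b)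

/-- `∏_b 1 / Γ(B_b)`. -/
def legNorm (B : ι → ℂ) : ℂ := ∏ b, (Gamma (B b))⁻¹

theorem vertexNorm_eq (A : ℂ) (c : ι → ℂ) :
    vertexNorm A c = vertexFactor ∅ A c * vertexNorm (A + 1) c := by
  simp only [vertexNorm, vertexFactor, Finset.empty_subset, Finset.filter_true,
    ← prod_mul_distrib]
  refine prod_congr rfl fun S _ => ?_
  rw [Complex.one_div_Gamma_eq_self_mul_one_div_Gamma_add_one]
  congr 3; ring

theorem legNorm_eq (B : ι → ℂ) (b : ι) : legNorm B = B b * legNorm (B + Pi.single b 1) := by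
  simp only [legNorm]
  rw [← Finset.mul_prod_erase _ _ (mem_univ b), ← Finset.mul_prod_erase _ _ (mem_univ b),
    Complex.one_div_Gamma_eq_self_mul_one_div_Gamma_add_one, mul_assoc]
  congr 2
  · simp
  · refine prod_congr rfl fun b' hb' => ?_
    simp [ne_of_mem_erase hb']

theorem differentiable_vertexNorm :
    Differentiable ℂ fun x : ℂ × (ι → ℂ) × (ι → ℂ) => vertexNorm x.1 x.2.2 := by
  unfold vertexNorm
  refine differentiable_prod fun S _ => ?_
  exact Complex.differentiable_one_div_Gamma.comp (f := fun x : ℂ × (ι → ℂ) × (ι → ℂ) =>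
    x.1 - ∑ b ∈ S, x.2.2 b) (by fun_prop)

theorem differentiable_vertexFactor (ε : Finset ι) :
    Differentiable ℂ fun x : ℂ × (ι → ℂ) × (ι → ℂ) => vertexFactor ε x.1 x.2.2 := by
  unfold vertexFactor
  exact differentiable_prod fun S _ => by fun_prop

theorem differentiable_legNorm :
    Differentiable ℂ fun x : ℂ × (ι → ℂ) × (ι → ℂ) => legNorm x.2.1 := by
  unfold legNorm
  refine differentiable_prod fun b _ => ?_
  exact Complex.differentiable_one_div_Gamma.comp (f := fun x : ℂ × (ι → ℂ) × (ι → ℂ) =>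
    x.2.1 b) (by fun_prop)

theorem vertexFactor_eq (ε : Finset ι) (A : ℂ) (c : ι → ℂ) :
    vertexFactor ε A c = (A - ∑ b ∈ ε, c b) *
      ∏ S : Finset ι with ε ⊂ S, (A - ∑ b ∈ S, c b) := by
  have : (univ.filter fun S : Finset ι => ε ⊆ S) =
      insert ε (univ.filter fun S : Finset ι => ε ⊂ S) := by
    ext S
    simp only [mem_filter, mem_univ, true_and, mem_insert]
    rw [subset_iff_ssubset_or_eq]; tauto
  rw [vertexFactor, this, Finset.prod_insert (by simp)]

/-- The zeros of the normalisation that are not used up at `ε` contain those that are needed for one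
more insertion. -/
theorem exists_vertexFactor_dvd {ε ε' : Finset ι} {b : ι} (hε : ε' = insert b ε) (hb : b ∉ ε) :
    ∃ R : ℂ × (ι → ℂ) × (ι → ℂ) → ℂ, Differentiable ℂ R ∧ ∀ x,
      ∏ S : Finset ι with ε ⊂ S, (x.1 - ∑ b ∈ S, x.2.2 b) = vertexFactor ε' x.1 x.2.2 * R x := by
  refine ⟨fun x => ∏ S : Finset ι with ε ⊂ S ∧ ¬ ε' ⊆ S, (x.1 - ∑ b ∈ S, x.2.2 b),
    differentiable_prod fun S _ => by fun_prop, fun x => ?_⟩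
  have : (univ.filter fun S : Finset ι => ε' ⊆ S) =
      (univ.filter fun S : Finset ι => ε ⊂ S).filter fun S => ε' ⊆ S := by
    ext S
    simp only [mem_filter, mem_univ, true_and]
    refine ⟨fun h => ⟨?_, h⟩, fun h => h.2⟩
    exact lt_of_lt_of_le (by rw [hε]; exact Finset.ssubset_insert hb) h
  rw [vertexFactor, this, ← Finset.prod_filter_mul_prod_filter_not _ (fun S => ε' ⊆ S),
    Finset.filter_filter (fun S => ε ⊂ S) (fun S => ¬ ε' ⊆ S)]

theorem exists_vertexFactor_empty_dvd (ε : Finset ι) :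
    ∃ R : ℂ × (ι → ℂ) × (ι → ℂ) → ℂ, Differentiable ℂ R ∧ ∀ x,
      vertexFactor ∅ x.1 x.2.2 = vertexFactor ε x.1 x.2.2 * R x := by
  refine ⟨fun x => ∏ S : Finset ι with ¬ ε ⊆ S, (x.1 - ∑ b ∈ S, x.2.2 b),
    differentiable_prod fun S _ => by fun_prop, fun x => ?_⟩
  simp only [vertexFactor, Finset.empty_subset, Finset.filter_true]
  rw [Finset.prod_filter_mul_prod_filter_not]

/-- The normalised vertex integral with insertions. -/
def vertexFun (ε : Finset ι) (x : ℂ × (ι → ℂ) × (ι → ℂ)) : ℂ :=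
  vertexNorm x.1 x.2.2 * legNorm x.2.1 * vertexInsert ε x.1 x.2.1 x.2.2

theorem continues_zero_vertexFun (ε : Finset ι) : Continues 0 (vertexFun ε) := by
  refine ⟨vertexFun ε, ?_, fun _ _ => rfl⟩
  refine DifferentiableOn.mul (differentiable_vertexNorm.mul differentiable_legNorm).differentiableOn ?_
  -- the coefficients of `x`, `α_b`, `log (1 + e^{α_b})` in the exponent
  set ℓ : Option (ι ⊕ ι) → ℝ × (ι → ℝ) → ℝ := fun j q => match j with
    | none => q.1
    | some (Sum.inl b) => q.2 b
    | some (Sum.inr b) => log (1 + exp (q.2 b))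
  set g : ℝ × (ι → ℝ) → ℝ := fun q => -exp q.1 - ∑ b, exp (q.1 + q.2 b)
  have hexp : ∀ (p : Option (ι ⊕ ι) → ℂ) q, (g q : ℂ) + ∑ j, p j * ℓ j q =
      vertexExponent (p none) (fun b => p (some (Sum.inl b))) (fun b => p (some (Sum.inr b))) q := by
    intro p q
    rw [Fintype.sum_option, Fintype.sum_sum_type]
    simp only [ℓ, g, vertexExponent, sum_sub_distrib, sum_add_distrib]
    push_cast
    ring
  have hD := differentiableOn_integral_cexp (μ := (volume : Measure (ℝ × (ι → ℝ)))) (g := g)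
    (by fun_prop) (ℓ := ℓ) (by rintro (_ | _ | _) <;> simp only [ℓ] <;> fun_prop)
    (U := {p | VertexConv (p none) (fun b => p (some (Sum.inl b))) (fun b => p (some (Sum.inr b)))})
    (by
      simp only [VertexConv, Set.ofPred_and]
      refine IsOpen.inter ?_ (isOpen_lt ?_ ?_)
      · simp only [Set.ofPred_forall]
        exact isOpen_iInter_of_finite fun b => isOpen_lt continuous_const
          (Complex.continuous_re.comp (continuous_apply _))
      · refine continuous_finsetSum _ fun b _ => continuous_const.max
          (Complex.continuous_re.comp ((continuous_apply _).add (continuous_apply _)))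
      · exact Complex.continuous_re.comp (continuous_apply _))
    (by
      intro p hp
      simp only [hexp]
      exact integrable_vertex hp)
  set φ : ℂ × (ι → ℂ) × (ι → ℂ) → Option (ι ⊕ ι) → ℂ := fun x j => match j with
      | none => x.1 + (ε.card : ℂ)
      | some (Sum.inl b) => x.2.1 b + indic ε b
      | some (Sum.inr b) => x.2.2 b - x.2.1 b with hφdef
  have hφ : Differentiable ℂ φ := by
    refine differentiable_pi.2 ?_
    rintro (_ | _ | _) <;> simp only [hφdef] <;> fun_prop
  refine (hD.comp hφ.differentiableOn ?_).congr fun x _ => ?_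
  · rintro ⟨A, B, c⟩ hx
    have h := vertexDomain_zero.1 hx
    refine h.mono (fun b => ?_) (fun b => (indic ε b).re) (indic_re_nonneg ε) (fun b => ?_) ?_
    · have := h.1 b; have := indic_re_nonneg ε b; simp [φ]; linarith
    · simp [φ]; linarith
    · rw [sum_indic_re]; simp [φ]
  · simp only [vertexInsert, vertexIntegral, Function.comp, hexp]
    rfl

theorem vertexFun_lower_of_notMem {ε : Finset ι} {b : ι} (hb : b ∉ ε) {A : ℂ} {B c : ι → ℂ}
    (h : VertexConv A B (c - B)) :
    vertexFun ε (A, B, c) = (B b - c b) * vertexFun ε (A, B + Pi.single b 1, c) +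
      vertexFactor ∅ A c * vertexFun ε (A + 1, B + Pi.single b 1, c) +
      vertexFun (insert b ε) (A, B + Pi.single b 1, c) := by
  simp only [vertexFun]
  rw [legNorm_eq B b, vertexNorm_eq A c]
  linear_combination (vertexFactor ∅ A c * vertexNorm (A + 1) c * legNorm (B + Pi.single b 1)) *
    vertexInsert_lower_of_notMem h hb

theorem vertexFun_lower_of_mem {ε : Finset ι} {b : ι} (hb : b ∈ ε) {A : ℂ} {B c : ι → ℂ}
    (h : VertexConv A B (c - B)) :
    vertexFun ε (A, B, c) = B b * (vertexFactor ∅ A c *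
      vertexFun (ε.erase b) (A + 1, B + Pi.single b 1, c) +
      vertexFun ε (A, B + Pi.single b 1, c)) := by
  simp only [vertexFun]
  rw [legNorm_eq B b, vertexNorm_eq A c]
  linear_combination (vertexFactor ∅ A c * vertexNorm (A + 1) c * legNorm (B + Pi.single b 1)) * B b *
    vertexInsert_lower_of_mem h hb

theorem vertexFun_lower_zero (ε : Finset ι) {A : ℂ} {B c : ι → ℂ} (h : VertexConv A B (c - B)) :
    (A - ∑ b ∈ ε, c b) * (vertexNorm (A + 1) c * legNorm B * vertexInsert ε A B c) =
      (1 - ε.card) * vertexFun ε (A + 1, B, c) +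
      ∑ b ∈ εᶜ, vertexNorm (A + 1) c * legNorm B * vertexInsert (insert b ε) A B c +
      ∑ b ∈ ε, B b * vertexFun (ε.erase b) (A + 1, B, c) := by
  have := congrArg (fun z => vertexNorm (A + 1) c * legNorm B * z) (vertexInsert_lower_zero h ε)
  simp only [mul_add, mul_sum] at this
  simp only [vertexFun]
  rw [mul_left_comm, this]
  congr 1
  · congr 1
    ring
  · exact sum_congr rfl fun b _ => by ring

/-- Raising every `B_b` by one and `A` by at least one leads from the shifted domain `k + 1` back to the
domain `k`. At the same `A`, insertions in all propagators are treated first. -/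
theorem continues_succ_vertexFun {k : ℕ} (hk : ∀ ε : Finset ι, Continues k (vertexFun ε))
    (ε : Finset ι) : Continues (k + 1) (vertexFun ε) := by
  -- functions at `A + 1 + j`, with `B_b` raised by one for the propagators `b` in `s`
  have hA : ∀ (s : Finset ι) (j : ℕ) (ε : Finset ι), Continues (k + 1) fun x =>
      vertexFun ε (x.1 + 1 + j, x.2.1 + indic s, x.2.2) := by
    intro s
    suffices H : ∀ t : Finset ι, ∀ (j : ℕ) (ε : Finset ι), Continues (k + 1) fun x =>
        vertexFun ε (x.1 + 1 + j, x.2.1 + indic tᶜ, x.2.2) by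
      have := H sᶜ; simpa using this
    intro t
    induction t using Finset.induction_on with
    | empty =>
      intro j ε
      obtain ⟨F, hF, hfF⟩ := hk ε
      have hi : ∀ b : ι, indic (∅ᶜ : Finset ι) b = 1 := fun b => by simp [indic]
      have hm : ∀ l, Set.MapsTo (fun x : ℂ × (ι → ℂ) × (ι → ℂ) =>
          (x.1 + 1 + (j : ℂ), x.2.1 + indic (∅ᶜ : Finset ι), x.2.2)) (vertexDomain ι (l + 1))
          (vertexDomain ι l) := by
        rintro l x ⟨h1, h2⟩
        have hj : (0 : ℝ) ≤ j := j.cast_nonneg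
        push_cast at h1 h2
        refine ⟨fun b => ?_, ?_⟩
        · have := h1 b
          simp only [Pi.add_apply, hi]; simp; linarith
        · simp; linarith
      refine ⟨fun x => F (x.1 + 1 + j, x.2.1 + indic ∅ᶜ, x.2.2), ?_, fun x hx => hfF (hm 0 ?_)⟩
      · exact hF.comp (g := F) (f := fun x : ℂ × (ι → ℂ) × (ι → ℂ) =>
          (x.1 + 1 + (j : ℂ), x.2.1 + indic (∅ᶜ : Finset ι), x.2.2)) (by fun_prop) (hm k)
      · obtain ⟨h1, h2⟩ := hx
        simp only [CharP.cast_eq_zero, neg_zero, add_zero] at h1 h2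
        exact ⟨fun b => by have := h1 b; push_cast; linarith, by push_cast; linarith⟩
    | insert b t hb ih =>
      intro j ε
      have hbt : b ∈ tᶜ := by simpa using hb
      have hcomp : (insert b t)ᶜ = tᶜ.erase b := by rw [Finset.compl_insert]
      have hb' : indic (insert b t)ᶜ b = 0 := by simp [indic]
      have hshift : ∀ B : ι → ℂ, B + indic (insert b t)ᶜ + Pi.single b 1 = B + indic tᶜ := by
        intro B; rw [hcomp, indic_erase hbt]; abel
      have hconv : ∀ x ∈ vertexDomain ι 0, VertexConv (x.1 + 1 + j) (x.2.1 + indic (insert b t)ᶜ)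
          (x.2.2 - (x.2.1 + indic (insert b t)ᶜ)) := by
        rintro ⟨A, B, c⟩ hx
        have h := vertexDomain_zero.1 hx
        have hj : (0 : ℝ) ≤ j := j.cast_nonneg
        refine h.mono (fun b' => ?_) 0 (fun _ => le_rfl) (fun b' => by simp) (by simp; linarith)
        have := h.1 b'; have := indic_re_nonneg (insert b t)ᶜ b'; simp only [Pi.add_apply, Complex.add_re]; linarith
      have hD : Continues (k + 1) fun x : ℂ × (ι → ℂ) × (ι → ℂ) =>
          vertexFactor ∅ (x.1 + 1 + j) x.2.2 := Continues.of_differentiable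
        ((differentiable_vertexFactor ∅).comp (f := fun x : ℂ × (ι → ℂ) × (ι → ℂ) =>
          (x.1 + 1 + (j : ℂ), x.2)) (by fun_prop))
      have hj1 : ∀ A : ℂ, A + 1 + j + 1 = A + 1 + ((j + 1 : ℕ) : ℂ) := fun A => by push_cast; ring
      have hlin : Continues (k + 1) fun x : ℂ × (ι → ℂ) × (ι → ℂ) => x.2.1 b :=
        Continues.of_differentiable (by fun_prop)
      have hlin' : Continues (k + 1) fun x : ℂ × (ι → ℂ) × (ι → ℂ) => x.2.1 b - x.2.2 b :=
        Continues.of_differentiable (by fun_prop)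
      by_cases hε : b ∈ ε
      · refine (hlin.mul ((hD.mul (ih (j + 1) (ε.erase b))).add (ih j ε))).congr fun x hx => ?_
        simp only
        rw [vertexFun_lower_of_mem hε (hconv x hx), hshift, hj1, Pi.add_apply, hb', add_zero]
      · refine (((hlin'.mul (ih j ε)).add (hD.mul (ih (j + 1) ε))).add
          (ih j (insert b ε))).congr fun x hx => ?_
        simp only
        rw [vertexFun_lower_of_notMem hε (hconv x hx), hshift, hj1, Pi.add_apply, hb', add_zero]
  have hA0 : ∀ ε : Finset ι, Continues (k + 1) fun x => vertexFun ε (x.1 + 1, x.2.1, x.2.2) := by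
    intro ε
    have := hA ∅ 0 ε
    have h0 : (indic ∅ : ι → ℂ) = 0 := by ext; simp [indic]
    simpa [h0] using this
  -- descending induction on the set of insertions
  have hV : ∀ ε : Finset ι, Continues (k + 1) fun x => vertexFactor ε x.1 x.2.2 *
      (vertexNorm (x.1 + 1) x.2.2 * legNorm x.2.1 * vertexInsert ε x.1 x.2.1 x.2.2) := by
    suffices H : ∀ t ε : Finset ι, ε = tᶜ → Continues (k + 1) fun x => vertexFactor ε x.1 x.2.2 *
        (vertexNorm (x.1 + 1) x.2.2 * legNorm x.2.1 * vertexInsert ε x.1 x.2.1 x.2.2) from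
      fun ε => H εᶜ ε (by simp)
    intro t
    induction t using Finset.strongInductionOn with
    | _ t ih =>
    intro ε hεt
    set P : ℂ × (ι → ℂ) × (ι → ℂ) → ℂ := fun x =>
      ∏ S : Finset ι with ε ⊂ S, (x.1 - ∑ b ∈ S, x.2.2 b)
    have hP : Continues (k + 1) P := Continues.of_differentiable
      (differentiable_prod fun S _ => by fun_prop)
    have hconst : Continues (ι := ι) (k + 1) fun _ => ((1 : ℂ) - ε.card) :=
      Continues.of_differentiable (differentiable_const _)
    have hout : ∀ b ∈ εᶜ, Continues (k + 1) fun x => P x *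
        (vertexNorm (x.1 + 1) x.2.2 * legNorm x.2.1 * vertexInsert (insert b ε) x.1 x.2.1 x.2.2) := by
      intro b hb
      have hb' : b ∉ ε := by simpa using hb
      obtain ⟨R, hR, hRx⟩ := exists_vertexFactor_dvd (ε' := insert b ε) rfl hb'
      have := ih (t.erase b) (Finset.erase_ssubset (by simpa [hεt] using hb)) (insert b ε) (by
        rw [Finset.compl_erase, hεt])
      refine (this.mul (Continues.of_differentiable hR)).congr fun x _ => ?_
      simp only [P, hRx]; ring
    refine ((hP.mul ((hconst.mul (hA0 ε)))).add ((Continues.sum _ hout).add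
      (Continues.sum ε fun b _ => hP.mul ((Continues.of_differentiable (f := fun x => x.2.1 b)
        (by fun_prop)).mul (hA0 (ε.erase b)))))).congr fun x hx => ?_
    have := vertexFun_lower_zero ε (vertexDomain_zero.1 hx)
    simp only
    rw [vertexFactor_eq, mul_right_comm, this, mul_comm]
    change P x * _ = _
    rw [mul_add, mul_add, mul_sum, mul_sum, add_assoc]
  obtain ⟨R, hR, hRx⟩ := exists_vertexFactor_empty_dvd ε
  refine ((hV ε).mul (Continues.of_differentiable hR)).congr fun x _ => ?_
  simp only [vertexFun]
  rw [vertexNorm_eq, hRx]; ring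

/-- The normalised vertex integral continues to an entire function. -/
theorem exists_entire_vertexFun (ι : Type*) [Fintype ι] :
    ∃ F : ℂ × (ι → ℂ) × (ι → ℂ) → ℂ, Differentiable ℂ F ∧ ∀ A B c, VertexConv A B (c - B) →
      F (A, B, c) = vertexNorm A c * legNorm B * vertexIntegral A B (c - B) := by
  have hall : ∀ k, ∀ ε : Finset ι, Continues k (vertexFun ε) := by
    intro k
    induction k with
    | zero => exact continues_zero_vertexFun
    | succ k ih => exact continues_succ_vertexFun ih
  obtain ⟨F, hF, hfF⟩ := exists_entire_of_continuations (U := vertexDomain ι) isOpen_vertexDomain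
    convex_vertexDomain (by
      rintro k l hkl x ⟨h1, h2⟩
      have : (k : ℝ) ≤ l := by exact_mod_cast hkl
      exact ⟨fun b => by linarith [h1 b], by linarith⟩)
    ⟨(1, fun _ => 1, 0), by simp [vertexDomain]⟩ (by
      intro x
      obtain ⟨k, hk⟩ := exists_nat_gt (max ((∑ b, max 0 (x.2.2 b).re) - x.1.re)
        (∑ b, |(x.2.1 b).re|))
      rw [max_lt_iff] at hk
      refine ⟨k, fun b => ?_, by linarith⟩
      have h1 := Finset.single_le_sum (f := fun b => |(x.2.1 b).re|) (fun _ _ => abs_nonneg _)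
        (mem_univ b)
      have h3 := neg_abs_le (x.2.1 b).re
      linarith)
    (fun k => hall k ∅)
  refine ⟨F, hF, fun A B c h => ?_⟩
  rw [← hfF (vertexDomain_zero.2 h)]
  have h0 : (indic ∅ : ι → ℂ) = 0 := by ext b; simp [indic]
  simp [vertexFun, vertexInsert, h0]

end Entire

/-! ### The Mellin–Barnes formula and the correction functions -/

section MellinBarnes
variable {ι : Type} [Fintype ι]

/-- The product of `Γ` functions in the Mellin–Barnes integral of the vertex integral. -/
def barnesIntegrand (A : ℂ) (B c w : ι → ℂ) : ℂ :=
  Gamma (A + ∑ b, w b) *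
    ∏ b, Gamma (-w b) * Gamma (-c b - w b) * Gamma (B b + w b)

/-- The Mellin–Barnes formula: insert `e^{-e^y} = ∫ Γ(-w) e^{w y} dw` for each leg and do the
remaining integrals, which are `Γ` and beta integrals. -/
theorem vertexIntegral_eq_barnes {A : ℂ} {B c : ι → ℂ} {u : ι → ℝ} (hu : ∀ b, u b < 0)
    (hc : ∀ b, (c b).re + u b < 0) (hB : ∀ b, 0 < (B b).re + u b) (hA : 0 < A.re + ∑ b, u b) :
    Integrable (fun v => barnesIntegrand A B c (vertexContourPoint u v)) ∧
      (2 * (pi : ℂ)) ^ Fintype.card ι * ((∏ b, Gamma (B b - c b)) *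
        vertexIntegral A B (c - B)) = ∫ v, barnesIntegrand A B c (vertexContourPoint u v) := by
  set w := fun v : ι → ℝ => vertexContourPoint u v
  have hwre : ∀ v b, (w v b).re = u b := fun v b => by simp [w, vertexContourPoint]
  set G : (ι → ℝ) × (ℝ × (ι → ℝ)) → ℂ := fun q =>
    (∏ b, Gamma (-w q.1 b)) * (cexp ((A + ∑ b, w q.1 b) * q.2.1 - 1 * cexp q.2.1) *
      ∏ b, cexp ((B b + w q.1 b) * q.2.2 b - (B b - c b) * log (1 + exp (q.2.2 b))))
    with hG
  have hint0 : Integrable fun q : (ι → ℝ) × (ℝ × (ι → ℝ)) =>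
      (∏ b, Gamma (-w q.1 b)) * (cexp ((A + ∑ b, u b : ℂ) * q.2.1 - 1 * cexp q.2.1) *
      ∏ b, cexp ((B b + u b) * q.2.2 b - (B b - c b) * log (1 + exp (q.2.2 b)))) := by
    refine Integrable.mul_prod (f := fun v : ι → ℝ => ∏ b, Gamma (-w v b))
      (g := fun p : ℝ × (ι → ℝ) => cexp ((A + ∑ b, u b : ℂ) * p.1 - 1 * cexp p.1) *
      ∏ b, cexp ((B b + u b) * p.2 b - (B b - c b) * log (1 + exp (p.2 b)))) ?_ ?_
    · refine Integrable.fintype_prod_dep (f := fun b (t : ℝ) => Gamma (-(u b + I * t)))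
        fun b => ?_
      have := (integrable_Gamma_vertical (σ := -u b) (by linarith [hu b])).comp_neg
      refine this.congr (.of_forall fun t => ?_)
      simp only; congr 1; push_cast; ring
    · refine Integrable.mul_prod (f := fun x : ℝ => cexp ((A + ∑ b, u b : ℂ) * x - 1 * cexp x))
        (g := fun α : ι → ℝ => ∏ b, cexp ((B b + u b) * α b -
          (B b - c b) * log (1 + exp (α b)))) ?_ ?_
      · exact integrable_cexp_gamma (by simpa using hA) (by simp)
      · exact Integrable.fintype_prod_dep (f := fun b (a : ℝ) => cexp ((B b + u b) * a -
          (B b - c b) * log (1 + exp a))) fun b =>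
          (integral_beta (by simpa using hB b) (by simp; linarith [hc b])).1
  have hwc : Continuous w := by
    refine continuous_pi fun b => ?_
    simp only [w, vertexContourPoint]
    fun_prop
  have hΓc : Continuous fun v => ∏ b, Gamma (-w v b) := by
    refine continuous_finsetProd _ fun b _ => ?_
    refine continuous_iff_continuousAt.2 fun v => ?_
    refine ContinuousAt.comp (f := fun v => -w v b) (g := Gamma) ?_ ?_
    · refine (Complex.differentiableAt_Gamma _ fun m hm => ?_).continuousAt
      have := congrArg Complex.re hm
      simp [hwre] at this
      have h2 : (0 : ℝ) ≤ m := m.cast_nonneg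
      linarith [hu b]
    · exact ((continuous_apply b).comp hwc).neg.continuousAt
  have hGc : Continuous G := by
    have hl : ∀ α : ℝ, 1 + exp α ≠ 0 := fun α => by positivity
    have hw' : ∀ b, Continuous fun q : (ι → ℝ) × (ℝ × (ι → ℝ)) => w q.1 b := fun b =>
      (continuous_apply b).comp (hwc.comp continuous_fst)
    refine (hΓc.comp continuous_fst).mul (Continuous.mul ?_ (continuous_finsetProd _ fun b _ => ?_))
    · have := continuous_finsetSum univ fun b _ => hw' b
      fun_prop
    · have := hw' b
      have h3 : Continuous fun q : (ι → ℝ) × (ℝ × (ι → ℝ)) => log (1 + exp (q.2.2 b)) :=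
        Continuous.log (by fun_prop) fun q => hl _
      fun_prop
  have hGint : Integrable G := by
    refine hint0.mono hGc.aestronglyMeasurable (.of_forall fun q => le_of_eq ?_)
    simp only [hG, norm_mul, norm_prod, Complex.norm_exp]
    congr 2
    · congr 1
      simp [hwre, ← Complex.ofReal_exp]
    · refine prod_congr rfl fun b _ => ?_
      congr 1
      simp [hwre, ← Complex.ofReal_exp]
  -- integration over the bulk variables first
  have hinner : ∀ v, ∫ p, G (v, p) = (∏ b, (Gamma (B b - c b))⁻¹) * barnesIntegrand A B c (w v) := by
    intro v
    simp only [hG]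
    rw [integral_const_mul]
    erw [integral_prod_mul (fun x : ℝ => cexp ((A + ∑ b, w v b) * x - 1 * cexp x))
      (fun α : ι → ℝ => ∏ b, cexp ((B b + w v b) * α b -
        (B b - c b) * log (1 + exp (α b))))]
    rw [integral_fintype_prod_volume_eq_prod (fun b (a : ℝ) => cexp ((B b + w v b) * a -
        (B b - c b) * log (1 + exp a)))]
    have h1 := integral_cexp_gamma_real (s := A + ∑ b, w v b) (by simpa [hwre] using hA) one_pos
    simp only [Complex.ofReal_one, Real.log_one, Complex.ofReal_zero, mul_zero, Complex.exp_zero,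
      mul_one] at h1
    have h2 : ∀ b, ∫ a : ℝ, cexp ((B b + w v b) * a - (B b - c b) * log (1 + exp a)) =
        (Gamma (B b - c b))⁻¹ * (Gamma (-c b - w v b) * Gamma (B b + w v b)) := by
      intro b
      have h3 := (integral_beta (B := B b + w v b) (N := B b - c b) (by simpa [hwre] using hB b)
        (by simp [hwre]; linarith [hc b])).2
      have h4 : Gamma (B b - c b) ≠ 0 := Complex.Gamma_ne_zero_of_re_pos (by
        simp; linarith [hc b, hB b])
      rw [show B b - c b - (B b + w v b) = -c b - w v b by ring] at h3
      rw [eq_inv_mul_iff_mul_eq₀ h4, h3]; ring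
    simp only [h1, h2, barnesIntegrand, prod_mul_distrib]
    ring
  -- integration over the contour first
  have houter : ∀ p, ∫ v, G (v, p) = (2 * (pi : ℂ)) ^ Fintype.card ι *
      cexp (vertexExponent A B (c - B) p) := by
    rintro ⟨x, α⟩
    have h1 : ∀ v, G (v, (x, α)) = cexp (A * x - exp x +
        ∑ b, (B b * α b - (B b - c b) * log (1 + exp (α b)))) *
        ∏ b, (Gamma (-(u b + I * v b)) * cexp ((u b + I * v b) * (x + α b))) := by
      intro v
      simp only [hG, w, vertexContourPoint, prod_mul_distrib, ← Complex.exp_sum]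
      rw [← Complex.exp_add, mul_left_comm, ← Complex.exp_add]
      congr 2
      push_cast
      rw [add_mul, sum_mul]
      simp only [mul_add, add_mul, sum_add_distrib, sum_sub_distrib]
      ring
    simp only [h1]
    rw [integral_const_mul, integral_fintype_prod_volume_eq_prod (fun b (t : ℝ) =>
      Gamma (-(u b + I * t)) * cexp ((u b + I * t) * (x + α b)))]
    have h2 : ∀ b, ∫ t : ℝ, Gamma (-(u b + I * t)) *
        cexp ((u b + I * t) * (x + α b)) =
        2 * pi * cexp (-exp (x + α b)) := by
      intro b
      have h3 := integral_Gamma_vertical (σ := -u b) (by linarith [hu b]) (x + α b)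
      rw [← integral_neg_eq_self] at h3
      push_cast at h3 ⊢
      rw [← h3]
      refine integral_congr_ae (.of_forall fun t => ?_)
      simp only
      congr 2 <;> ring
    simp only [h2, prod_mul_distrib, Finset.prod_const, card_univ, ← Complex.exp_sum]
    rw [mul_left_comm, ← Complex.exp_add, mul_pow]
    congr 2
    simp only [vertexExponent, sum_sub_distrib, sum_add_distrib, Pi.sub_apply,
      sum_neg_distrib, sub_mul]
    ring
  have hne : (∏ b, (Gamma (B b - c b))) ≠ 0 := prod_ne_zero_iff.2 fun b _ =>
    Complex.Gamma_ne_zero_of_re_pos (by simp; linarith [hc b, hB b])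
  have hGint' : Integrable G (volume.prod volume) := hGint
  refine ⟨?_, ?_⟩
  · have := hGint'.integral_prod_left
    simp only [hinner] at this
    refine (this.const_mul (∏ b, (Gamma (B b - c b)))).congr
      (.of_forall fun v => ?_)
    simp only [prod_inv_distrib]
    rw [mul_inv_cancel_left₀ hne]
  · have := (integral_prod G hGint').symm.trans (integral_prod_symm G hGint')
    simp only [hinner, houter] at this
    rw [integral_const_mul, integral_const_mul, prod_inv_distrib,
      inv_mul_eq_iff_eq_mul₀ hne] at this
    rw [this, vertexIntegral]
    ring

/-- Reflecting the variables `c_b`, `b ∈ T`: on the Mellin–Barnes side this is a translation of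
the contour. -/
theorem vertexIntegral_reflect {A : ℂ} {B c : ι → ℂ} (hA : 0 < A.re) (hB : ∀ b, 0 < (B b).re)
    (hc : ∀ b, (c b).re = 0) (T : Finset ι) :
    (∏ b, Gamma (B b - c b)) * vertexIntegral A B (c - B) =
      (∏ b, Gamma (if b ∈ T then B b else B b - c b)) *
        vertexIntegral (A - ∑ b ∈ T, c b) (fun b => if b ∈ T then B b - c b else B b)
          ((fun b => if b ∈ T then -c b else c b) - fun b => if b ∈ T then B b - c b else B b) := by
  obtain ⟨ε, hε, hεB, hεA⟩ : ∃ ε : ℝ, 0 < ε ∧ (∀ b, ε < (B b).re) ∧ Fintype.card ι * ε < A.re := by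
    have h1 : ∀ᶠ ε : ℝ in nhdsWithin 0 (Set.Ioi 0), ∀ b, ε < (B b).re :=
      Filter.eventually_all.2 fun b => nhdsWithin_le_nhds (eventually_lt_nhds (hB b))
    have h2 : ∀ᶠ ε : ℝ in nhdsWithin 0 (Set.Ioi 0), Fintype.card ι * ε < A.re := by
      refine nhdsWithin_le_nhds ?_
      refine ContinuousAt.eventually_lt (f := fun ε : ℝ => Fintype.card ι * ε) (by fun_prop)
        continuousAt_const (by simpa using hA)
    obtain ⟨ε, h⟩ := ((h1.and h2).and self_mem_nhdsWithin).exists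
    exact ⟨ε, h.2, h.1.1, h.1.2⟩
  set u : ι → ℝ := fun _ => -ε
  have e1 := (vertexIntegral_eq_barnes (A := A) (B := B) (c := c) (u := u) (fun b => by simp [u, hε])
    (fun b => by simp [u, hε, hc]) (fun b => by simp [u, hεB]) (by simp [u]; linarith)).2
  have e2 := (vertexIntegral_eq_barnes (A := A - ∑ b ∈ T, c b)
    (B := fun b => if b ∈ T then B b - c b else B b) (c := fun b => if b ∈ T then -c b else c b)
    (u := u) (fun b => by simp [u, hε])
    (fun b => by split_ifs <;> simp [u, hε, hc]) (fun b => by split_ifs <;> simp [u, hεB, hc])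
    (by simp [u, hc]; linarith)).2
  have hsub : ∀ b, (if b ∈ T then B b - c b else B b) - (if b ∈ T then -c b else c b) =
      if b ∈ T then B b else B b - c b := fun b => by split_ifs <;> ring
  simp only [hsub] at e2
  have h2π : (2 * (pi : ℂ)) ^ Fintype.card ι ≠ 0 :=
    pow_ne_zero _ (by simp [Real.pi_ne_zero])
  refine mul_left_cancel₀ h2π (e1.trans (Eq.trans ?_ e2.symm))
  rw [← integral_add_right_eq_self (μ := (volume : Measure (ι → ℝ))) (fun v =>
      barnesIntegrand (A - ∑ b ∈ T, c b) (fun b => if b ∈ T then B b - c b else B b)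
        (fun b => if b ∈ T then -c b else c b) (vertexContourPoint u v))
    (fun b => if b ∈ T then (c b).im else 0)]
  refine integral_congr_ae (.of_forall fun v => ?_)
  have hw : ∀ b, vertexContourPoint u (v + fun b => if b ∈ T then (c b).im else 0) b =
      vertexContourPoint u v b + if b ∈ T then c b else 0 := by
    intro b
    have : c b = I * (c b).im := by
      apply Complex.ext <;> simp [hc]
    simp only [vertexContourPoint, Pi.add_apply]
    split_ifs
    · conv_rhs => rw [this]
      push_cast; ring
    · push_cast; ring
  simp only [barnesIntegrand, hw, sum_add_distrib]
  congr 1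
  · congr 1
    rw [Finset.sum_ite_mem, Finset.univ_inter]; ring
  · refine prod_congr rfl fun b _ => ?_
    split_ifs
    · rw [show -(vertexContourPoint u v b + c b) = -c b - vertexContourPoint u v b by ring,
        show - -c b - (vertexContourPoint u v b + c b) = -vertexContourPoint u v b by ring,
        show B b - c b + (vertexContourPoint u v b + c b) = B b + vertexContourPoint u v b by ring]
      ring
    · simp

end MellinBarnes

section Correction
variable {ι : Type} [Fintype ι]

/-- The sign choices of `Γ[a₀ ± a₁ ± ⋯]` as sets of minus signs. -/
theorem gammaPM_inv_eq_vertexNorm (A : ℂ) (c : ι → ℂ) :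
    (gammaPM (A - (∑ b, c b) / 2) fun b => c b / 2)⁻¹ = vertexNorm A c := by
  rw [gammaPM, vertexNorm, ← prod_inv_distrib]
  refine Finset.prod_bij (fun σ _ => univ.filter fun b => σ b = -1) (fun _ _ => mem_univ _)
    ?_ ?_ ?_
  · intro σ _ τ _ h
    ext b
    have h1 := Finset.ext_iff.1 h b
    simp only [mem_filter, mem_univ, true_and] at h1
    rcases Int.units_eq_one_or (σ b) with h2 | h2 <;> rcases Int.units_eq_one_or (τ b) with h3 | h3 <;>
      simp_all
  · intro S _
    refine ⟨fun b => if b ∈ S then -1 else 1, mem_univ _, ?_⟩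
    ext b
    simp
  · intro σ _
    congr 2
    rw [sum_filter, Finset.sum_div, sub_add, ← sum_sub_distrib]
    congr 1
    refine sum_congr rfl fun b _ => ?_
    rcases Int.units_eq_one_or (σ b) with h2 | h2 <;> simp [h2]

theorem vertexGamma_inv (d : ℕ) (ΔA : ℂ) (c : ι → ℂ) :
    (vertexGamma d ΔA c)⁻¹ =
      vertexNorm ((ΔA + ((Fintype.card ι : ℂ) - 2) * h d + ∑ b, c b) / 2) c := by
  rw [← gammaPM_inv_eq_vertexNorm, vertexGamma]
  congr 3
  ring

/-- The entire continuation of the normalised vertex integral. -/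
def entireVertex (ι : Type) [Fintype ι] : ℂ × (ι → ℂ) × (ι → ℂ) → ℂ :=
  (exists_entire_vertexFun ι).choose

/-- The correction function of a vertex, as the entire continuation of the normalised vertex
integral. -/
def correction (d : ℕ) (ι : Type) [Fintype ι] (ΔA : ℂ) (c s : ι → ℂ) : ℂ :=
  entireVertex ι ((ΔA + ((Fintype.card ι : ℂ) - 2) * h d + ∑ b, c b) / 2,
    fun b => (h d + c b - s b) / 2, c)

theorem differentiable_correction (d : ℕ) (ι : Type) [Fintype ι] :
    Differentiable ℂ fun p : ℂ × (ι → ℂ) × (ι → ℂ) => correction d ι p.1 p.2.1 p.2.2 := by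
  refine (exists_entire_vertexFun ι).choose_spec.1.comp
    (f := fun p : ℂ × (ι → ℂ) × (ι → ℂ) => ((p.1 + ((Fintype.card ι : ℂ) - 2) * h d + ∑ b, p.2.1 b) / 2,
    fun b => (h d + p.2.1 b - p.2.2 b) / 2, p.2.1)) ?_
  refine Differentiable.prodMk (by fun_prop) (Differentiable.prodMk ?_ (by fun_prop))
  exact differentiable_pi.2 fun b => by fun_prop

theorem correction_eq (d : ℕ) {ΔA : ℂ} {c s : ι → ℂ} {A : ℂ} {B : ι → ℂ}
    (hA : A = (ΔA + ((Fintype.card ι : ℂ) - 2) * h d + ∑ b, c b) / 2)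
    (hB : ∀ b, B b = (h d + c b - s b) / 2) (hconv : VertexConv A B (c - B)) :
    correction d ι ΔA c s = (vertexGamma d ΔA c)⁻¹ * legNorm B * vertexIntegral A B (c - B) := by
  rw [vertexGamma_inv, ← hA, ← (exists_entire_vertexFun ι).choose_spec.2 A B c hconv, correction, hA,
    funext hB, entireVertex]

/-- The factors `Γ(B_b - c_b)` in the Mellin–Barnes formula of the vertex integral cancel half of the
factors `Γ[(h ± c_b - s_b) / 2]`. -/
theorem correction_eq_correctionIntegral (d : ℕ) (ΔA : ℂ) (c s : ι → ℂ) (u : ι → ℝ)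
    (hu : IsVertexContour d ΔA c s u) :
    Integrable (fun v => correctionIntegrand d ΔA c s (vertexContourPoint u v)) ∧
      correction d ι ΔA c s = correctionIntegral d ΔA c s u := by
  obtain ⟨h1, h2, h3, h4⟩ := hu
  set A : ℂ := (ΔA + ((Fintype.card ι : ℂ) - 2) * h d + ∑ b, c b) / 2 with hA
  set B : ι → ℂ := fun b => (h d + c b - s b) / 2 with hB
  have hAre : A.re = (ΔA.re + ((Fintype.card ι : ℝ) - 2) * h d + ∑ b, (c b).re) / 2 := by
    simp [hA]
  have hBre : ∀ b, (B b).re = (h d + (c b).re - (s b).re) / 2 := fun b => by simp [hB]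
  have h3' : ∀ b, 0 < (B b).re + u b := fun b => by rw [hBre]; exact h3 b
  obtain ⟨hi, hval⟩ := vertexIntegral_eq_barnes (A := A) (B := B) (c := c) h1 h2 h3'
    (by rw [hAre]; exact h4)
  have hconv : VertexConv A B (c - B) := by
    refine ⟨fun b => by linarith [h3' b, h1 b], ?_⟩
    have : ∑ b, max 0 (B b + (c - B) b).re ≤ ∑ b, -u b :=
      sum_le_sum fun b _ => max_le (by linarith [h1 b]) (by simp; linarith [h2 b])
    rw [sum_neg_distrib] at this
    linarith [hAre]
  have hfac : ∀ w, correctionIntegrand d ΔA c s w = ((vertexGamma d ΔA c)⁻¹ * legNorm B *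
      ∏ b, (Gamma (B b - c b))⁻¹) * barnesIntegrand A B c w := by
    intro w
    have e : ∀ b, (h d - c b - s b) / 2 = B b - c b := fun b => by simp only [hB]; ring
    simp only [correctionIntegrand, barnesIntegrand, propagatorFactor, legNorm, e,
      Finset.prod_div_distrib, prod_mul_distrib, prod_inv_distrib, ← hA]
    simp only [hB, div_eq_mul_inv, mul_inv]
    ring
  refine ⟨by simp only [hfac]; exact hi.const_mul _, ?_⟩
  rw [correction_eq d (B := B) hA (fun b => rfl) hconv, correctionIntegral]
  simp only [hfac]
  rw [integral_const_mul, integral_const_mul, ← hval, prod_inv_distrib, div_pow, one_pow]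
  have hne : (∏ b, (Gamma (B b - c b))) ≠ 0 := prod_ne_zero_iff.2 fun b _ =>
    Complex.Gamma_ne_zero_of_re_pos (by simp; linarith [h2 b, h3' b])
  have h2π : (2 * (pi : ℂ)) ^ Fintype.card ι ≠ 0 :=
    pow_ne_zero _ (by simp [Real.pi_ne_zero])
  field_simp

end Correction

/-! ### Combinatorics of tree diagrams -/

/-- Trees with nodes `S` and links `L` that grow from a root by adding leaves: the new node `v` is
joined by the new link `k` to the old node `p`.  `χ k` is a two-colouring of the nodes; the links
that have been added cut the tree into the two colours. -/
inductive Grown {N K : Type*} [DecidableEq N] [DecidableEq K] (e₁ e₂ : K → N) (χ : K → N → Prop) :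
    Finset N → Finset K → Prop
  | root (r : N) : Grown e₁ e₂ χ {r} ∅
  | leaf {S : Finset N} {L : Finset K} (v p : N) (k : K) (hg : Grown e₁ e₂ χ S L) (hv : v ∉ S)
      (hp : p ∈ S) (hk : k ∉ L) (hends : (e₁ k = v ∧ e₂ k = p) ∨ (e₁ k = p ∧ e₂ k = v))
      (hsep : ¬ (χ k v ↔ χ k p)) (hS : ∀ u ∈ S, χ k u ↔ χ k p)
      (hL : ∀ k' ∈ L, χ k' v ↔ χ k' p) : Grown e₁ e₂ χ (insert v S) (insert k L)

theorem Grown.ends_mem {N K : Type*} [DecidableEq N] [DecidableEq K] {e₁ e₂ : K → N}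
    {χ : K → N → Prop} {S : Finset N} {L : Finset K} (h : Grown e₁ e₂ χ S L) :
    ∀ k ∈ L, e₁ k ∈ S ∧ e₂ k ∈ S := by
  induction h with
  | root r => simp
  | leaf v p k hg hv hp hk hends hsep hS hL ih =>
    intro k' hk'
    rcases mem_insert.1 hk' with rfl | hk'
    · rcases hends with ⟨h1, h2⟩ | ⟨h1, h2⟩ <;> simp [h1, h2, hp]
    · exact ⟨mem_insert_of_mem (ih k' hk').1, mem_insert_of_mem (ih k' hk').2⟩

namespace TreeDiagram
variable {n : ℕ} (D : TreeDiagram n)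

/-- The bulk vertices on the `src` side of a propagator. -/
def OnSrc (e : D.E) (v : D.V) : Prop :=
  (SimpleGraph.fromRel fun v w => ∃ e' ≠ e, D.src e' = v ∧ D.tgt e' = w).Reachable v (D.src e)

theorem mem_side (e : D.E) (i : Fin n) : i ∈ D.side e ↔ D.OnSrc e (D.attach i) := by
  simp [side, OnSrc]

theorem onSrc_src (e : D.E) : D.OnSrc e (D.src e) := SimpleGraph.Reachable.refl _

theorem onSrc_src_iff_tgt {e e' : D.E} (h : e' ≠ e) :
    D.OnSrc e (D.src e') ↔ D.OnSrc e (D.tgt e') := by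
  by_cases hl : D.src e' = D.tgt e'
  · rw [hl]
  have hadj : (SimpleGraph.fromRel fun v w => ∃ e' ≠ e, D.src e' = v ∧ D.tgt e' = w).Adj
      (D.src e') (D.tgt e') := by
    rw [SimpleGraph.fromRel_adj]
    exact ⟨hl, Or.inl ⟨e', h, rfl, rfl⟩⟩
  exact ⟨fun hr => hadj.symm.reachable.trans hr, fun hr => hadj.reachable.trans hr⟩

/-- Subtrees with vertices `U` and propagators `F`, grown from a vertex. -/
inductive Subtree : Finset D.V → Finset D.E → Prop
  | root (v : D.V) : Subtree {v} ∅
  | edge {U : Finset D.V} {F : Finset D.E} (e : D.E) (u w : D.V) (hs : Subtree U F) (he : e ∉ F)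
      (hu : u ∈ U) (hw : w ∉ U) (hends : (D.src e = u ∧ D.tgt e = w) ∨ (D.src e = w ∧ D.tgt e = u)) :
      Subtree (insert w U) (insert e F)

variable {D}

theorem Subtree.card {U : Finset D.V} {F : Finset D.E} (h : D.Subtree U F) :
    U.card = F.card + 1 := by
  induction h with
  | root v => simp
  | edge e u w hs he hu hw hends ih =>
    rw [card_insert_of_notMem hw, card_insert_of_notMem he, ih]

theorem Subtree.ends_mem {U : Finset D.V} {F : Finset D.E} (h : D.Subtree U F) :
    ∀ e ∈ F, D.src e ∈ U ∧ D.tgt e ∈ U := by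
  induction h with
  | root v => simp
  | edge e u w hs he hu hw hends ih =>
    intro e' he'
    rcases mem_insert.1 he' with rfl | he'
    · rcases hends with ⟨h1, h2⟩ | ⟨h1, h2⟩ <;> simp [h1, h2, hu]
    · exact ⟨mem_insert_of_mem (ih e' he').1, mem_insert_of_mem (ih e' he').2⟩

theorem Subtree.onSrc_iff {U : Finset D.V} {F : Finset D.E} (h : D.Subtree U F) {e : D.E}
    (he : e ∉ F) : ∀ u ∈ U, ∀ u' ∈ U, D.OnSrc e u ↔ D.OnSrc e u' := by
  induction h with
  | root v => simp
  | @edge U F e' u w hs he' hu hw hends ih =>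
    rw [mem_insert, not_or] at he
    have hne : e' ≠ e := fun h => he.1 h.symm
    have huw : D.OnSrc e u ↔ D.OnSrc e w := by
      have := D.onSrc_src_iff_tgt hne
      rcases hends with ⟨h1, h2⟩ | ⟨h1, h2⟩
      · rwa [h1, h2] at this
      · rw [h1, h2] at this; exact this.symm
    have key : ∀ a ∈ insert w U, D.OnSrc e a ↔ D.OnSrc e u := by
      intro a ha
      rcases mem_insert.1 ha with rfl | ha
      · exact huw.symm
      · exact ih he.2 a ha u hu
    exact fun a ha b hb => (key a ha).trans (key b hb).symm

/-- If the propagators with property `P` connect the diagram, they contain a spanning tree. -/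
theorem exists_spanning_subtree (P : D.E → Prop)
    (hP : (SimpleGraph.fromRel fun v w => ∃ e, P e ∧ D.src e = v ∧ D.tgt e = w).Connected) :
    ∃ F, D.Subtree univ F ∧ ∀ e ∈ F, P e := by
  have hne : Nonempty D.V := hP.nonempty
  have key : ∀ m : ℕ, m + 1 ≤ Fintype.card D.V → ∃ U F, D.Subtree U F ∧ U.card = m + 1 ∧
      ∀ e ∈ F, P e := by
    intro m
    induction m with
    | zero =>
      intro _
      obtain ⟨v⟩ := hne
      exact ⟨{v}, ∅, .root v, by simp, by simp⟩
    | succ m ih =>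
      intro hm
      obtain ⟨U, F, hUF, hc, hF⟩ := ih (by omega)
      obtain ⟨u, hu⟩ : U.Nonempty := by rw [← Finset.card_pos]; omega
      obtain ⟨w, hw⟩ : ∃ w, w ∉ U := by
        by_contra hcon
        push Not at hcon
        have : U = univ := Finset.eq_univ_iff_forall.2 hcon
        rw [this, card_univ] at hc
        omega
      obtain ⟨p⟩ := hP.preconnected u w
      obtain ⟨dt, -, h1, h2⟩ := p.exists_boundary_dart (U : Set D.V) (by simpa using hu)
        (by simpa using hw)
      have hadj := dt.adj
      rw [SimpleGraph.fromRel_adj] at hadj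
      simp only [Finset.mem_coe] at h1 h2
      obtain ⟨-, ⟨e, hPe, hs, ht⟩ | ⟨e, hPe, hs, ht⟩⟩ := hadj
      · refine ⟨_, _, .edge e dt.fst dt.snd hUF (fun he => h2 ?_) h1 h2 (Or.inl ⟨hs, ht⟩),
          by rw [card_insert_of_notMem h2, hc], ?_⟩
        · rw [← ht]; exact (hUF.ends_mem e he).2
        · intro e' he'
          rcases mem_insert.1 he' with rfl | he'
          exacts [hPe, hF _ he']
      · refine ⟨_, _, .edge e dt.fst dt.snd hUF (fun he => h2 ?_) h1 h2 (Or.inr ⟨hs, ht⟩),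
          by rw [card_insert_of_notMem h2, hc], ?_⟩
        · rw [← hs]; exact (hUF.ends_mem e he).1
        · intro e' he'
          rcases mem_insert.1 he' with rfl | he'
          exacts [hPe, hF _ he']
  have hpos : 0 < Fintype.card D.V := Fintype.card_pos
  obtain ⟨U, F, hUF, hc, hF⟩ := key (Fintype.card D.V - 1) (by omega)
  have : U = univ := Finset.eq_univ_of_card _ (by omega)
  exact ⟨F, this ▸ hUF, hF⟩

variable (D)

theorem subtree_univ : D.Subtree univ univ := by
  obtain ⟨F, hF, -⟩ := exists_spanning_subtree (D := D) (fun _ => True) (by simpa using D.connected)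
  have h1 := hF.card
  have h2 := D.noLoops
  rw [card_univ] at h1
  have : F = univ := Finset.eq_univ_of_card _ (by omega)
  exact this ▸ hF

/-- Every propagator is a bridge. -/
theorem not_onSrc_tgt (e : D.E) : ¬ D.OnSrc e (D.tgt e) := by
  intro h
  set G := SimpleGraph.fromRel fun v w => ∃ e' ≠ e, D.src e' = v ∧ D.tgt e' = w with hG
  have hconn : G.Connected := by
    have hD := D.connected
    have := hD.nonempty
    refine ⟨fun v w => ?_⟩
    obtain ⟨p⟩ := hD.preconnected v w
    induction p with
    | nil => exact SimpleGraph.Reachable.refl _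
    | cons hadj p ih =>
      refine SimpleGraph.Reachable.trans ?_ ih
      rw [SimpleGraph.fromRel_adj] at hadj
      obtain ⟨hne, ⟨e', h1, h2⟩ | ⟨e', h1, h2⟩⟩ := hadj
      · by_cases he : e' = e
        · subst he; rw [← h1, ← h2]; exact SimpleGraph.Reachable.symm h
        · refine SimpleGraph.Adj.reachable ?_
          rw [hG, SimpleGraph.fromRel_adj]
          exact ⟨hne, Or.inl ⟨e', he, h1, h2⟩⟩
      · by_cases he : e' = e
        · subst he; rw [← h1, ← h2]; exact h
        · refine SimpleGraph.Adj.reachable ?_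
          rw [hG, SimpleGraph.fromRel_adj]
          exact ⟨hne, Or.inr ⟨e', he, h1, h2⟩⟩
  obtain ⟨F, hF, hFe⟩ := exists_spanning_subtree (D := D) (fun e' => e' ≠ e) hconn
  have h1 := hF.card
  have h2 := D.noLoops
  rw [card_univ] at h1
  have : F = univ := Finset.eq_univ_of_card _ (by omega)
  exact hFe e (this ▸ mem_univ e) rfl

theorem src_ne_tgt (e : D.E) : D.src e ≠ D.tgt e := fun h =>
  D.not_onSrc_tgt e (h ▸ D.onSrc_src e)

/-- The half propagators: pairs of a bulk vertex and an incident propagator. -/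
abbrev Link : Type := Σ v, D.Incident v

/-- The half of a propagator at its source. -/
def srcLink (e : D.E) : D.Link := ⟨D.src e, e, Or.inl rfl⟩

/-- The half of a propagator at its target. -/
def tgtLink (e : D.E) : D.Link := ⟨D.tgt e, e, Or.inr rfl⟩

/-- The two halves of each propagator. -/
def linkEquiv : D.E ⊕ D.E ≃ D.Link := Equiv.ofBijective (Sum.elim D.srcLink D.tgtLink) (by
  constructor
  · rintro (e | e) (e' | e') h
    · have : e = e' := congrArg (fun k : D.Link => k.2.1) h
      rw [this]
    · have h1 : e = e' := congrArg (fun k : D.Link => k.2.1) h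
      subst h1
      exact absurd (congrArg Sigma.fst h) (D.src_ne_tgt e)
    · have h1 : e = e' := congrArg (fun k : D.Link => k.2.1) h
      subst h1
      exact absurd (congrArg Sigma.fst h) (D.src_ne_tgt e).symm
    · have : e = e' := congrArg (fun k : D.Link => k.2.1) h
      rw [this]
  · rintro ⟨v, e, rfl | rfl⟩
    · exact ⟨Sum.inl e, rfl⟩
    · exact ⟨Sum.inr e, rfl⟩)

@[to_additive]
theorem prod_link {M : Type*} [CommMonoid M] (f : D.Link → M) :
    ∏ k, f k = ∏ e, f (D.srcLink e) * f (D.tgtLink e) := by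
  rw [← D.linkEquiv.prod_comp, Fintype.prod_sum_type, prod_mul_distrib]
  rfl

/-- The colouring of vertices and propagators (as nodes of the tree of links) by a link. -/
def Colour (k : D.Link) : D.V ⊕ D.E → Prop
  | Sum.inl v => D.OnSrc k.2.1 v
  | Sum.inr e => if e = k.2.1 then ¬ D.OnSrc k.2.1 k.1 else D.OnSrc k.2.1 (D.src e)

theorem grown_of_subtree {U : Finset D.V} {F : Finset D.E} (h : D.Subtree U F) :
    Grown (fun k : D.Link => (Sum.inl k.1 : D.V ⊕ D.E)) (fun k => Sum.inr k.2.1) D.Colour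
      (U.disjSum F) (univ.filter fun k : D.Link => k.2.1 ∈ F) := by
  induction h with
  | root v =>
    have := Grown.root (e₁ := fun k : D.Link => (Sum.inl k.1 : D.V ⊕ D.E))
      (e₂ := fun k => Sum.inr k.2.1) (χ := D.Colour) (Sum.inl v)
    convert this using 1 <;> (ext k; simp)
  | @edge U F e u w hs he hu hw hends ih =>
    obtain ⟨ku, hku1, hku2⟩ : ∃ k : D.Link, k.1 = u ∧ k.2.1 = e := by
      rcases hends with ⟨h1, h2⟩ | ⟨h1, h2⟩
      exacts [⟨D.srcLink e, h1, rfl⟩, ⟨D.tgtLink e, h2, rfl⟩]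
    obtain ⟨kw, hkw1, hkw2⟩ : ∃ k : D.Link, k.1 = w ∧ k.2.1 = e := by
      rcases hends with ⟨h1, h2⟩ | ⟨h1, h2⟩
      exacts [⟨D.tgtLink e, h2, rfl⟩, ⟨D.srcLink e, h1, rfl⟩]
    have huw : u ≠ w := fun h => hw (h ▸ hu)
    have hsides : ¬ (D.OnSrc e u ↔ D.OnSrc e w) := by
      have h1 := D.onSrc_src e
      have h2 := D.not_onSrc_tgt e
      rcases hends with ⟨rfl, rfl⟩ | ⟨rfl, rfl⟩ <;> tauto
    have hU : ∀ a ∈ U, D.OnSrc e a ↔ D.OnSrc e u := fun a ha => hs.onSrc_iff he a ha u hu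
    have hF : ∀ e' ∈ F, e' ≠ e := fun e' he' h => he (h ▸ he')
    have hcol : ∀ k : D.Link, k.2.1 ∈ F → (D.Colour k (Sum.inr e) ↔ D.OnSrc k.2.1 u) ∧
        (D.Colour k (Sum.inr e) ↔ D.OnSrc k.2.1 w) := by
      intro k hk
      have hne := (hF _ hk).symm
      have h3 := D.onSrc_src_iff_tgt hne
      simp only [Colour, if_neg hne]
      rcases hends with ⟨rfl, rfl⟩ | ⟨rfl, rfl⟩ <;> tauto
    have step1 := Grown.leaf (Sum.inr e) (Sum.inl u) ku ih (by simpa using he) (by simpa using hu)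
      (by simp [hku2, he]) (Or.inr ⟨by simp [hku1], by simp [hku2]⟩)
      (by simp [Colour, hku1, hku2]) (by
        intro x hx
        rcases Finset.mem_disjSum.1 hx with ⟨a, ha, rfl⟩ | ⟨e', he', rfl⟩
        · simpa [Colour, hku2] using hU a ha
        · simp only [Colour, hku2, if_neg (hF e' he')]
          exact hU _ (hs.ends_mem e' he').1) (by
        intro k hk
        exact (hcol k (by simpa using hk)).1)
    have hkk : kw ≠ ku := fun h => huw (by rw [← hku1, ← hkw1, h])
    have step2 := Grown.leaf (Sum.inl w) (Sum.inr e) kw step1 (by simpa using hw) (by simp)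
      (by simp [hkw2, he, hkk]) (Or.inl ⟨by simp [hkw1], by simp [hkw2]⟩)
      (by simp [Colour, hkw1, hkw2]) (by
        intro x hx
        have hRHS : D.Colour kw (Sum.inr e) ↔ D.OnSrc e u := by
          simp only [Colour, hkw1, hkw2, if_true]; tauto
        rw [hRHS]
        rcases mem_insert.1 hx with rfl | hx
        · exact hRHS
        rcases Finset.mem_disjSum.1 hx with ⟨a, ha, rfl⟩ | ⟨e', he', rfl⟩
        · simpa [Colour, hkw2] using hU a ha
        · simp only [Colour, hkw2, if_neg (hF e' he')]
          exact hU _ (hs.ends_mem e' he').1) (by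
        intro k hk
        rcases mem_insert.1 hk with rfl | hk
        · simp only [Colour, hku1, hku2, if_true]; tauto
        · exact ((hcol k (by simpa using hk)).2).symm)
    have hset1 : (insert w U).disjSum (insert e F) =
        insert (Sum.inl w) (insert (Sum.inr e) (U.disjSum F)) := by
      ext x; rcases x with a | a <;> simp
    have hset2 : (univ.filter fun k : D.Link => k.2.1 ∈ insert e F) =
        insert kw (insert ku (univ.filter fun k : D.Link => k.2.1 ∈ F)) := by
      ext k
      have hk : k.2.1 = e ↔ k = kw ∨ k = ku := by
        constructor
        · rintro hke
          have : k.1 = u ∨ k.1 = w := by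
            rcases k.2.2 with h | h <;> rw [hke] at h <;>
              rcases hends with ⟨h1, h2⟩ | ⟨h1, h2⟩ <;> simp_all
          have hext : ∀ k' : D.Link, k.1 = k'.1 → k.2.1 = k'.2.1 → k = k' := by
            rintro ⟨v', e', h'⟩ h1 h2
            obtain ⟨v, e'', h''⟩ := k
            simp only at h1 h2
            subst h1; subst h2; rfl
          rcases this with h | h
          · exact Or.inr (hext _ (h.trans hku1.symm) (hke.trans hku2.symm))
          · exact Or.inl (hext _ (h.trans hkw1.symm) (hke.trans hkw2.symm))
        · rintro (rfl | rfl) <;> assumption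
      simp only [mem_filter, mem_univ, true_and, mem_insert, hk, or_assoc]
    rw [hset1, hset2]
    exact step2

theorem grown_univ : Grown (fun k : D.Link => (Sum.inl k.1 : D.V ⊕ D.E)) (fun k => Sum.inr k.2.1)
    D.Colour univ univ := by
  convert D.grown_of_subtree D.subtree_univ using 1
  · ext x; rcases x with a | a <;> simp
  · ext k; simp

theorem colour_attach_iff (k : D.Link) (i : Fin n) :
    D.Colour k (Sum.inl (D.attach i)) ↔ i ∈ D.side k.2.1 := (D.mem_side _ _).symm

/-- `s_e` is the sum of the `δ_ij` over the pairs separated by `e`. -/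
theorem mandelstam_eq {Δ : Fin n → ℝ} {δ : Fin n → Fin n → ℂ} (hsymm : ∀ i j, δ i j = δ j i)
    (hdiag : ∀ i, δ i i = -(Δ i : ℂ)) (hsum : ∀ i, ∑ j, δ i j = 0) (e : D.E) :
    D.mandelstam Δ δ e =
      ∑ i, ∑ j with i < j, if (i ∈ D.side e ↔ j ∈ D.side e) then 0 else δ i j := by
  set S := D.side e
  have h1 : ∑ i ∈ S, ∑ j ∈ S, δ i j = -∑ i ∈ S, (Δ i : ℂ) + 2 * ∑ i ∈ S, ∑ j ∈ S with i < j, δ i j := by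
    have h2 : ∀ i ∈ S, ∑ j ∈ S, δ i j = -(Δ i : ℂ) + ∑ j ∈ S with i < j, δ i j +
        ∑ j ∈ S with j < i, δ i j := by
      intro i hi
      rw [← add_sum_erase _ _ hi, hdiag, add_assoc,
        ← sum_filter_add_sum_filter_not (S.erase i) (fun j => i < j)]
      congr 2
      · refine sum_congr ?_ fun _ _ => rfl
        ext j; simp only [mem_filter, mem_erase]
        exact ⟨fun h => ⟨h.1.2, h.2⟩, fun h => ⟨⟨h.2.ne', h.1⟩, h.2⟩⟩
      · refine sum_congr ?_ fun _ _ => rfl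
        ext j; simp only [mem_filter, mem_erase, not_lt]
        exact ⟨fun h => ⟨h.1.2, lt_of_le_of_ne h.2 h.1.1⟩, fun h => ⟨⟨h.2.ne, h.1⟩, h.2.le⟩⟩
    have h3 : ∑ i ∈ S, ∑ j ∈ S with j < i, δ i j = ∑ i ∈ S, ∑ j ∈ S with i < j, δ i j := by
      simp only [sum_filter]
      rw [sum_comm]
      refine sum_congr rfl fun i _ => sum_congr rfl fun j _ => ?_
      rw [hsymm]
    rw [sum_congr rfl h2, sum_add_distrib, sum_add_distrib, h3,
      sum_neg_distrib]
    ring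
  have h4 : D.mandelstam Δ δ e = ∑ i ∈ S, ∑ j ∈ Sᶜ, δ i j := by
    have h5 : ∑ i ∈ S, ∑ j ∈ Sᶜ, δ i j = -∑ i ∈ S, ∑ j ∈ S, δ i j := by
      rw [← sum_neg_distrib]
      refine sum_congr rfl fun i _ => ?_
      rw [eq_neg_iff_add_eq_zero, add_comm, Finset.sum_add_sum_compl, hsum]
    rw [h5, h1, mandelstam]; ring
  have h6 : ∑ i, ∑ j with i < j, (if (i ∈ S ↔ j ∈ S) then 0 else δ i j) =
      ∑ i, ∑ j, (if i < j ∧ i ∈ S ∧ j ∉ S then δ i j else 0) +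
      ∑ i, ∑ j, (if i < j ∧ i ∉ S ∧ j ∈ S then δ i j else 0) := by
    simp only [sum_filter, ← sum_add_distrib]
    refine sum_congr rfl fun i _ => sum_congr rfl fun j _ => ?_
    by_cases a : i < j <;> by_cases b : i ∈ S <;> by_cases c : j ∈ S <;> simp [a, b, c]
  have h7 : ∑ i, ∑ j, (if i < j ∧ i ∉ S ∧ j ∈ S then δ i j else 0) =
      ∑ i, ∑ j, (if j < i ∧ i ∈ S ∧ j ∉ S then δ i j else 0) := by
    rw [sum_comm]
    refine sum_congr rfl fun i _ => sum_congr rfl fun j _ => ?_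
    rw [hsymm]
    congr 1
    exact propext ⟨fun h => ⟨h.1, h.2.2, h.2.1⟩, fun h => ⟨h.1, h.2.2, h.2.1⟩⟩
  have h8 : ∑ i ∈ S, ∑ j ∈ Sᶜ, δ i j = ∑ i, ∑ j, (if i ∈ S ∧ j ∉ S then δ i j else 0) := by
    rw [← sum_filter_add_sum_filter_not univ (· ∈ S), Finset.filter_mem_eq_inter,
      Finset.univ_inter]
    rw [Finset.sum_eq_zero (s := univ.filter (· ∉ S)), add_zero]
    · refine sum_congr rfl fun i hi => ?_
      simp only [hi, true_and]
      rw [← sum_filter]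
      refine sum_congr ?_ fun _ _ => rfl
      ext j; simp
    · intro i hi
      have : i ∉ S := by simpa using hi
      simp [this]
  rw [h4, h6, h7, h8, ← sum_add_distrib]
  refine sum_congr rfl fun i _ => ?_
  rw [← sum_add_distrib]
  refine sum_congr rfl fun j _ => ?_
  rcases lt_trichotomy i j with h | h | h
  · simp [h, h.not_gt]
  · subst h; simp
  · simp [h, h.not_gt]

end TreeDiagram

/-! ### Gaussian integrals of stars -/

section Scaling
variable {ι : Type*} [Fintype ι]

/-- Averages over the orbits of a group of translations determine the integral. -/
theorem lintegral_eq_of_orbits [Nonempty ι] {F G : (ι → ℝ) → ENNReal} (hF : Measurable F)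
    (hG : Measurable G) (c : ENNReal)
    (h : ∀ v, ∫⁻ s : ℝ, F (v + fun _ => s) = c * ∫⁻ s : ℝ, G (v + fun _ => s)) :
    ∫⁻ v, F v = c * ∫⁻ v, G v := by
  obtain ⟨i₀⟩ := ‹Nonempty ι›
  set ψ : ℝ → ENNReal := (Set.Icc 0 1).indicator 1
  have hψ : Measurable ψ := measurable_one.indicator measurableSet_Icc
  have hψ1 : ∫⁻ s, ψ s = 1 := by
    rw [lintegral_indicator_one measurableSet_Icc]; simp
  have key : ∀ F : (ι → ℝ) → ENNReal, Measurable F →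
      ∫⁻ v, F v = ∫⁻ v : ι → ℝ, ψ (v i₀) * ∫⁻ s : ℝ, F (v + fun _ => s) := by
    intro F hF
    calc ∫⁻ v, F v = ∫⁻ v : ι → ℝ, ∫⁻ s : ℝ, F v * ψ (v i₀ - s) := by
          refine lintegral_congr fun v => ?_
          rw [lintegral_const_mul _ (by fun_prop), lintegral_sub_left_eq_self, hψ1, mul_one]
      _ = ∫⁻ s : ℝ, ∫⁻ v : ι → ℝ, F v * ψ (v i₀ - s) :=
          lintegral_lintegral_swap (by fun_prop)
      _ = ∫⁻ s : ℝ, ∫⁻ v : ι → ℝ, F (v + fun _ => s) * ψ (v i₀) := by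
          refine lintegral_congr fun s => ?_
          rw [← lintegral_add_right_eq_self _ (fun _ => s)]
          refine lintegral_congr fun v => ?_
          simp
      _ = ∫⁻ v : ι → ℝ, ∫⁻ s : ℝ, F (v + fun _ => s) * ψ (v i₀) :=
          lintegral_lintegral_swap (by fun_prop)
      _ = _ := by
          refine lintegral_congr fun v => ?_
          rw [lintegral_mul_const _ (by fun_prop), mul_comm]
  rw [key F hF, key G hG, ← lintegral_const_mul]
  · refine lintegral_congr fun v => ?_
    rw [h]; ring
  · refine Measurable.mul (by fun_prop) ?_
    exact Measurable.lintegral_prod_right' (f := fun q : (ι → ℝ) × ℝ => G (q.1 + fun _ => q.2))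
      (by fun_prop)

theorem lintegral_comp_two_mul_add (F : ℝ → ENNReal) (hF : Measurable F) (c : ℝ) :
    ∫⁻ s, F s = 2 * ∫⁻ s : ℝ, F (2 * s + c) := by
  have h1 := Real.map_volume_mul_left (a := 2) two_ne_zero
  have h2 : ∫⁻ s : ℝ, F (2 * s + c) = ofReal |(2 : ℝ)⁻¹| * ∫⁻ s, F s := by
    rw [← lintegral_add_right_eq_self F c, ← smul_eq_mul, ← lintegral_smul_measure, ← h1,
      lintegral_map (by fun_prop) (by fun_prop)]
  rw [h2, ← mul_assoc, show (2 : ENNReal) = ofReal 2 by simp, ← ENNReal.ofReal_mul (by norm_num)]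
  norm_num

/-- The substitution `t_i = v_i + log ∑_j e^{v_j}`, whose Jacobian is `2`. -/
theorem lintegral_comp_add_log_sum_exp [Nonempty ι] {F : (ι → ℝ) → ENNReal} (hF : Measurable F) :
    ∫⁻ t, F t = 2 * ∫⁻ v : ι → ℝ, F (fun i => v i + log (∑ j, exp (v j))) := by
  refine lintegral_eq_of_orbits hF (by fun_prop) 2 fun v => ?_
  rw [lintegral_comp_two_mul_add _ (by fun_prop) (log (∑ j, exp (v j)))]
  congr 1
  refine lintegral_congr fun s => ?_
  congr 1
  ext i
  have hpos : 0 < ∑ j, exp (v j) := Finset.sum_pos (fun _ _ => exp_pos _) Finset.univ_nonempty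
  simp only [Pi.add_apply, exp_add, ← sum_mul]
  rw [Real.log_mul hpos.ne' (Real.exp_ne_zero _), log_exp]
  ring

end Scaling

section Gaussian
variable {d : ℕ} {κ : Type*} [Fintype κ]

/-- The Gaussian integral of a star with end points `y` and conductances `w`. -/
theorem lintegral_star (w : κ → ℝ) (hW : 0 < ∑ i, w i) (y : κ → Bdry d) :
    ∫⁻ x : Bdry d, ofReal (exp (-∑ i, w i * ‖x - y i‖ ^ 2)) =
      ofReal (exp (h d * log pi - h d * log (∑ i, w i) -
        1 / 2 * ∑ i, ∑ j, w i * w j / (∑ i, w i) * ‖y i - y j‖ ^ 2)) := by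
  set W := ∑ i, w i
  set c : Bdry d := W⁻¹ • ∑ i, w i • y i
  have hc : W • c = ∑ i, w i • y i := by simp [c, smul_smul, hW.ne']
  have hsq : ∀ x, ∑ i, w i * ‖x - y i‖ ^ 2 = W * ‖x - c‖ ^ 2 +
      1 / 2 * ∑ i, ∑ j, w i * w j / W * ‖y i - y j‖ ^ 2 := by
    intro x
    have h1 : ∑ i, w i * inner ℝ x (y i) = W * inner ℝ x c := by
      rw [← real_inner_smul_right, hc, inner_sum]; simp [real_inner_smul_right]
    have h2 : ∑ i, ∑ j, w i * w j * inner ℝ (y i) (y j) = W ^ 2 * ‖c‖ ^ 2 := by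
      rw [← mul_pow, ← Real.norm_of_nonneg hW.le, ← norm_smul, hc, ← real_inner_self_eq_norm_sq,
        sum_inner]
      refine sum_congr rfl fun i _ => ?_
      rw [inner_sum]
      refine sum_congr rfl fun j _ => ?_
      rw [real_inner_smul_left, real_inner_smul_right]; ring
    have h3 : ∑ i, ∑ j, w i * w j / W * ‖y i - y j‖ ^ 2 =
        2 * ∑ i, w i * ‖y i‖ ^ 2 - 2 * (W * ‖c‖ ^ 2) := by
      have e : ∀ i j, w i * w j / W * ‖y i - y j‖ ^ 2 = (w i * ‖y i‖ ^ 2) * w j / W +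
          w i * (w j * ‖y j‖ ^ 2) / W - 2 / W * (w i * w j * inner ℝ (y i) (y j)) := by
        intro i j; rw [norm_sub_sq_real]; ring
      simp only [e, sum_add_distrib, sum_sub_distrib, ← mul_sum, h2,
        ← Finset.sum_div, ← sum_mul]
      change _ * W / W + W * _ / W - _ = _
      field_simp; ring
    have h4 : ∀ i, w i * ‖x - y i‖ ^ 2 = w i * ‖x‖ ^ 2 - 2 * (w i * inner ℝ x (y i)) +
        w i * ‖y i‖ ^ 2 := fun i => by rw [norm_sub_sq_real]; ring
    simp only [h4, sum_add_distrib, sum_sub_distrib, ← mul_sum, h1, h3,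
      ← sum_mul]
    rw [norm_sub_sq_real]
    change W * _ - _ + _ = _
    ring
  have hg := GaussianFourier.integral_rexp_neg_mul_sq_norm (V := Bdry d) hW
  have hpos : 0 < (pi / W) ^ (Module.finrank ℝ (Bdry d) / 2 : ℝ) :=
    Real.rpow_pos_of_pos (by positivity) _
  have hint : Integrable fun v : Bdry d => exp (-W * ‖v‖ ^ 2) := by
    by_contra hcon
    rw [integral_undef hcon] at hg
    exact hpos.ne hg
  simp only [hsq]
  have hsplit : ∀ x : Bdry d, ofReal (exp (-(W * ‖x - c‖ ^ 2 +
      1 / 2 * ∑ i, ∑ j, w i * w j / W * ‖y i - y j‖ ^ 2))) =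
      ofReal (exp (-W * ‖x - c‖ ^ 2)) *
        ofReal (exp (-(1 / 2 * ∑ i, ∑ j, w i * w j / W * ‖y i - y j‖ ^ 2))) := by
    intro x
    rw [← ENNReal.ofReal_mul (exp_pos _).le, ← exp_add]
    congr 2; ring
  simp only [hsplit]
  rw [lintegral_mul_const _ (by fun_prop),
    lintegral_sub_right_eq_self (fun x : Bdry d => ofReal (exp (-W * ‖x‖ ^ 2))) c,
    ← ofReal_integral_eq_lintegral_ofReal hint (.of_forall fun _ => (exp_pos _).le),
    hg, ← ENNReal.ofReal_mul hpos.le]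
  congr 1
  rw [Real.rpow_def_of_pos (by positivity), ← exp_add, Real.log_div Real.pi_ne_zero hW.ne']
  congr 1
  simp [h]
  ring

end Gaussian

/-! ### Trees of springs -/

section TreeIdentity

/-- `log (1 + e^a)`. -/
def softplus (a : ℝ) : ℝ := log (1 + exp a)

/-- `log √(e^a / (1 + e^a))`, the logarithm of the transmission factor of a link. -/
def logRho (a : ℝ) : ℝ := (a - softplus a) / 2

@[fun_prop]
theorem measurable_softplus : Measurable softplus := by unfold softplus; fun_prop

@[fun_prop]
theorem measurable_logRho : Measurable logRho := by unfold logRho; fun_prop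

theorem exp_softplus (a : ℝ) : exp (softplus a) = 1 + exp a :=
  exp_log (by positivity)

variable {N K ι : Type*} [Fintype ι]

/-- The logarithm of the product of the transmission factors of the links in `L` that separate
two nodes. -/
def sepLog (χ : K → N → Prop) (L : Finset K) (a : K → ℝ) (A B : N) : ℝ :=
  ∑ k ∈ L, if (χ k A ↔ χ k B) then 0 else logRho (a k)

/-- `∑_i e^{v_i} R(B, A_i)`, where `R` is the transmission factor between two nodes. -/
def mass (χ : K → N → Prop) (L : Finset K) (att : ι → N) (v : ι → ℝ) (a : K → ℝ) (B : N) : ℝ :=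
  ∑ i, exp (v i + sepLog χ L a B (att i))

/-- `½ ∑_ij e^{v_i+v_j} R(A_i, A_j) P_ij`. -/
def pairEnergy {d : ℕ} (χ : K → N → Prop) (L : Finset K) (att : ι → N) (y : ι → Bdry d)
    (v : ι → ℝ) (a : K → ℝ) : ℝ :=
  1 / 2 * ∑ i, ∑ j, exp (v i + v j + sepLog χ L a (att i) (att j)) * ‖y i - y j‖ ^ 2

/-- The logarithm of the density of the variables `(v, a)`. -/
def treeWeight {d : ℕ} (χ : K → N → Prop) (S : Finset N) (L : Finset K) (att : ι → N)
    (y : ι → Bdry d) (v : ι → ℝ) (a : K → ℝ) : ℝ :=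
  -(d * ∑ B ∈ S, log (mass χ L att v a B)) - h d * ∑ k ∈ L, softplus (a k) -
    pairEnergy χ L att y v a

/-- The parameters of the boundary legs as functions of the variables `(v, a)`. -/
def treeT (χ : K → N → Prop) (L : Finset K) (att : ι → N) (v : ι → ℝ) (a : K → ℝ) (i : ι) : ℝ :=
  v i + log (mass χ L att v a (att i))

/-- The parameters of the links as functions of the variables `(v, a)`. -/
def treeTau (e₁ e₂ : K → N) (χ : K → N → Prop) (L : Finset K) (att : ι → N) (v : ι → ℝ)
    (a : K → ℝ) (k : K) : ℝ :=
  if k ∈ L then (a k + softplus (a k)) / 2 + log (mass χ L att v a (e₁ k)) +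
    log (mass χ L att v a (e₂ k)) else a k

/-- The energy of a tree of springs. -/
def springEnergy {d : ℕ} (e₁ e₂ : K → N) (L : Finset K) (att : ι → N) (y : ι → Bdry d)
    (t : ι → ℝ) (τ : K → ℝ) (x : N → Bdry d) : ℝ :=
  ∑ i, exp (t i) * ‖x (att i) - y i‖ ^ 2 + ∑ k ∈ L, exp (τ k) * ‖x (e₁ k) - x (e₂ k)‖ ^ 2

@[fun_prop]
theorem measurable_sepLog (χ : K → N → Prop) (L : Finset K) (A B : N) :
    Measurable fun a => sepLog χ L a A B := by
  unfold sepLog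
  refine Finset.measurable_fun_sum _ fun k _ => ?_
  split_ifs <;> fun_prop

theorem measurable_mass (χ : K → N → Prop) (L : Finset K) (att : ι → N) (B : N) :
    Measurable fun q : (ι → ℝ) × (K → ℝ) => mass χ L att q.1 q.2 B := by
  unfold mass
  refine Finset.measurable_fun_sum _ fun i _ => ?_
  exact Real.measurable_exp.comp (((measurable_pi_apply i).comp measurable_fst).add
    ((measurable_sepLog χ L B (att i)).comp measurable_snd))

theorem measurable_pairEnergy {d : ℕ} (χ : K → N → Prop) (L : Finset K) (att : ι → N)
    (y : ι → Bdry d) :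
    Measurable fun q : (ι → ℝ) × (K → ℝ) => pairEnergy χ L att y q.1 q.2 := by
  unfold pairEnergy
  refine measurable_const.mul (Finset.measurable_fun_sum _ fun i _ => Finset.measurable_fun_sum _
    fun j _ => Measurable.mul_const ?_ _)
  exact Real.measurable_exp.comp ((((measurable_pi_apply i).comp measurable_fst).add
    ((measurable_pi_apply j).comp measurable_fst)).add
    ((measurable_sepLog χ L (att i) (att j)).comp measurable_snd))

theorem measurable_treeWeight {d : ℕ} (χ : K → N → Prop) (S : Finset N) (L : Finset K)
    (att : ι → N) (y : ι → Bdry d) :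
    Measurable fun q : (ι → ℝ) × (K → ℝ) => treeWeight χ S L att y q.1 q.2 := by
  unfold treeWeight
  refine Measurable.sub (Measurable.sub ?_ ?_) (measurable_pairEnergy χ L att y)
  · exact ((Finset.measurable_fun_sum _ fun B _ =>
      Real.measurable_log.comp (measurable_mass χ L att B)).const_mul _).neg
  · refine Measurable.const_mul (Finset.measurable_fun_sum _ fun k _ => ?_) _
    exact measurable_softplus.comp ((measurable_pi_apply k).comp measurable_snd)

theorem measurable_treeT (χ : K → N → Prop) (L : Finset K) (att : ι → N) :
    Measurable fun q : (ι → ℝ) × (K → ℝ) => treeT χ L att q.1 q.2 := by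
  refine measurable_pi_lambda _ fun i => ?_
  exact ((measurable_pi_apply i).comp measurable_fst).add
    (Real.measurable_log.comp (measurable_mass χ L att _))

theorem measurable_treeTau (e₁ e₂ : K → N) (χ : K → N → Prop) (L : Finset K) (att : ι → N) :
    Measurable fun q : (ι → ℝ) × (K → ℝ) => treeTau e₁ e₂ χ L att q.1 q.2 := by
  refine measurable_pi_lambda _ fun k => ?_
  have hk : Measurable fun q : (ι → ℝ) × (K → ℝ) => q.2 k :=
    (measurable_pi_apply k).comp measurable_snd
  unfold treeTau
  split_ifs
  · exact (((hk.add (measurable_softplus.comp hk)).div_const _).add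
      (Real.measurable_log.comp (measurable_mass χ L att _))).add
      (Real.measurable_log.comp (measurable_mass χ L att _))
  · exact hk

theorem measurable_springEnergy {d : ℕ} (e₁ e₂ : K → N) (L : Finset K) (att : ι → N)
    (y : ι → Bdry d) : Measurable fun q : ((ι → ℝ) × (K → ℝ)) × (N → Bdry d) =>
      springEnergy e₁ e₂ L att y q.1.1 q.1.2 q.2 := by
  have hx : ∀ A : N, Measurable fun q : ((ι → ℝ) × (K → ℝ)) × (N → Bdry d) => q.2 A := fun A =>
    (measurable_pi_apply A).comp measurable_snd
  unfold springEnergy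
  refine Measurable.add (Finset.measurable_fun_sum _ fun i _ => ?_)
    (Finset.measurable_fun_sum _ fun k _ => ?_)
  · exact (Real.measurable_exp.comp ((measurable_pi_apply i).comp
      (measurable_fst.comp measurable_fst))).mul (((hx _).sub_const _).norm.pow_const 2)
  · exact (Real.measurable_exp.comp ((measurable_pi_apply k).comp
      (measurable_snd.comp measurable_fst))).mul (((hx _).sub (hx _)).norm.pow_const 2)

section Step
variable [DecidableEq N] [DecidableEq K] {e₁ e₂ : K → N} {χ : K → N → Prop} {S : Finset N}
  {L : Finset K} {v p : N} {k : K}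

/-- Moving the legs at a leaf `v` to its neighbour `p`. -/
def moveAtt (v p : N) (att : ι → N) (i : ι) : N := if att i = v then p else att i

/-- Integrating out the position of a leaf of a tree of springs. -/
theorem lintegral_springEnergy_leaf {d : ℕ} {att : ι → N} (y : ι → Bdry d)
    (hv : v ∉ S) (hp : p ∈ S) (hk : k ∉ L) (hends : (e₁ k = v ∧ e₂ k = p) ∨ (e₁ k = p ∧ e₂ k = v))
    (hL : ∀ k' ∈ L, e₁ k' ∈ S ∧ e₂ k' ∈ S) (t : ι → ℝ) (τ : K → ℝ) (x : N → Bdry d) :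
    ∫⁻ z : Bdry d, ofReal (exp (-springEnergy e₁ e₂ (insert k L) att y t τ
        (update x v z))) =
      ofReal (exp (h d * log pi -
        h d * log ((∑ i, if att i = v then exp (t i) else 0) + exp (τ k)) -
        1 / 2 * ∑ i, ∑ j, if att i = v ∧ att j = v then exp (t i + t j -
          log ((∑ i, if att i = v then exp (t i) else 0) + exp (τ k))) *
            ‖y i - y j‖ ^ 2 else 0)) *
      ofReal (exp (-springEnergy e₁ e₂ L (moveAtt v p att) y (fun i =>
        if att i = v then t i + τ k -
          log ((∑ i, if att i = v then exp (t i) else 0) + exp (τ k)) else t i) τ x)) := by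
  have hpv : p ≠ v := fun h => hv (h ▸ hp)
  set w : ι → ℝ := fun i => if att i = v then exp (t i) else 0 with hw
  have hw0 : ∀ i, 0 ≤ w i := fun i => by simp only [hw]; split_ifs <;> positivity
  set g := exp (τ k)
  have hg : 0 < g := exp_pos _
  have hW : 0 < ∑ i, w i + g := add_pos_of_nonneg_of_pos (Finset.sum_nonneg fun i _ => hw0 i) hg
  set W := ∑ i, w i + g with hWdef
  -- the star of `v`
  set w' : Option ι → ℝ := fun o => o.elim g w
  set y' : Option ι → Bdry d := fun o => o.elim (x p) y
  have hW' : ∑ o, w' o = W := by rw [Fintype.sum_option]; simp only [w', Option.elim, hWdef]; ring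
  have hstar := lintegral_star w' (by rw [hW']; exact hW) y'
  -- the part of the energy that does not involve `v`
  set R : ℝ := (∑ i, if att i = v then 0 else exp (t i) * ‖x (att i) - y i‖ ^ 2) +
    ∑ k' ∈ L, exp (τ k') * ‖x (e₁ k') - x (e₂ k')‖ ^ 2 with hR
  have hE : ∀ z, springEnergy e₁ e₂ (insert k L) att y t τ (update x v z) =
      ∑ o, w' o * ‖z - y' o‖ ^ 2 + R := by
    intro z
    rw [Fintype.sum_option, springEnergy, Finset.sum_insert hk]
    have h1 : ∑ i, exp (t i) * ‖update x v z (att i) - y i‖ ^ 2 =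
        ∑ i, w i * ‖z - y i‖ ^ 2 +
          ∑ i, if att i = v then 0 else exp (t i) * ‖x (att i) - y i‖ ^ 2 := by
      rw [← sum_add_distrib]
      refine sum_congr rfl fun i _ => ?_
      by_cases hi : att i = v
      · simp [hw, hi]
      · simp [hw, hi]
    have h2 : ‖update x v z (e₁ k) - update x v z (e₂ k)‖ = ‖z - x p‖ := by
      rcases hends with ⟨h1, h2⟩ | ⟨h1, h2⟩
      · simp [h1, h2, hpv]
      · rw [norm_sub_rev]; simp [h1, h2, hpv]
    have h3 : ∑ k' ∈ L, exp (τ k') * ‖update x v z (e₁ k') -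
        update x v z (e₂ k')‖ ^ 2 = ∑ k' ∈ L, exp (τ k') * ‖x (e₁ k') - x (e₂ k')‖ ^ 2 := by
      refine sum_congr rfl fun k' hk' => ?_
      have h4 : e₁ k' ≠ v := fun h => hv (h ▸ (hL k' hk').1)
      have h5 : e₂ k' ≠ v := fun h => hv (h ▸ (hL k' hk').2)
      rw [Function.update_of_ne h4, Function.update_of_ne h5]
    rw [h1, h2, h3, hR]
    simp only [w', y', Option.elim]
    ring
  have hsplit : ∀ z, ofReal (exp (-springEnergy e₁ e₂ (insert k L) att y t τ
        (update x v z))) = ofReal (exp (-∑ o, w' o * ‖z - y' o‖ ^ 2)) *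
        ofReal (exp (-R)) := by
    intro z
    rw [hE, ← ENNReal.ofReal_mul (exp_pos _).le, ← exp_add, neg_add]
  simp only [hsplit]
  rw [lintegral_mul_const _ (by fun_prop), hstar, ← ENNReal.ofReal_mul (exp_pos _).le,
    ← ENNReal.ofReal_mul (exp_pos _).le, ← exp_add, ← exp_add, hW']
  congr 2
  have hexpW : ∀ s : ℝ, exp (s - log W) = exp s / W := fun s => by
    rw [Real.exp_sub, exp_log hW]
  have hq : ∑ o, ∑ o', w' o * w' o' / W * ‖y' o - y' o'‖ ^ 2 =
      (∑ i, ∑ j, if att i = v ∧ att j = v then exp (t i + t j - log W) *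
            ‖y i - y j‖ ^ 2 else 0) + 2 * ∑ i, w i * g / W * ‖x p - y i‖ ^ 2 := by
    simp only [Fintype.sum_option, w', y', Option.elim, sub_self, norm_zero]
    have h1 : ∀ i j, w i * w j / W * ‖y i - y j‖ ^ 2 =
        if att i = v ∧ att j = v then exp (t i + t j - log W) * ‖y i - y j‖ ^ 2 else 0 := by
      intro i j
      simp only [hw]
      by_cases hi : att i = v <;> by_cases hj : att j = v <;> simp [hi, hj, hexpW, exp_add]
    simp only [h1, sum_add_distrib]
    have h2 : ∑ i, w i * g / W * ‖y i - x p‖ ^ 2 = ∑ i, w i * g / W * ‖x p - y i‖ ^ 2 :=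
      sum_congr rfl fun i _ => by rw [norm_sub_rev]
    have h3 : ∑ i, g * w i / W * ‖x p - y i‖ ^ 2 = ∑ i, w i * g / W * ‖x p - y i‖ ^ 2 :=
      sum_congr rfl fun i _ => by rw [mul_comm g]
    rw [h2, h3]
    ring
  have hs : springEnergy e₁ e₂ L (moveAtt v p att) y (fun i =>
        if att i = v then t i + τ k - log W else t i) τ x =
      R + ∑ i, w i * g / W * ‖x p - y i‖ ^ 2 := by
    rw [springEnergy, hR, add_right_comm, ← sum_add_distrib]
    congr 1
    refine sum_congr rfl fun i _ => ?_
    by_cases hi : att i = v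
    · simp only [moveAtt, hi, if_true, hexpW, hw, exp_add, zero_add]
      rfl
    · simp [moveAtt, hi, hw]
  rw [hq, hs]
  ring

end Step
end TreeIdentity

/-! ### Removing a leaf: the change of variables -/

section Marginal
variable {K : Type*} [DecidableEq K] {X : K → Type*} [∀ k, MeasurableSpace (X k)]
  {μ : ∀ k, Measure (X k)} [∀ k, SigmaFinite (μ k)]

theorem lintegral_lmarginal_swap {α : Type*} [MeasurableSpace α] {ν : Measure α} [SFinite ν]
    {f : α → (∀ k, X k) → ENNReal} (hf : Measurable fun q : α × (∀ k, X k) => f q.1 q.2)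
    (L : Finset K) (x : ∀ k, X k) :
    ∫⁻ s, (∫⋯∫⁻_L, f s ∂μ) x ∂ν = (∫⋯∫⁻_L, (fun y => ∫⁻ s, f s y ∂ν) ∂μ) x := by
  simp only [lmarginal]
  refine lintegral_lintegral_swap (Measurable.aemeasurable ?_)
  exact hf.comp (measurable_fst.prodMk (measurable_updateFinset.comp measurable_snd))

theorem lmarginal_const_mul (c : ENNReal) {f : (∀ k, X k) → ENNReal} (hf : Measurable f)
    (L : Finset K) (x : ∀ k, X k) :
    (∫⋯∫⁻_L, (fun y => c * f y) ∂μ) x = c * (∫⋯∫⁻_L, f ∂μ) x := by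
  simp only [lmarginal]
  exact lintegral_const_mul _ (hf.comp measurable_updateFinset)

theorem measurable_lmarginal_param {α : Type*} [MeasurableSpace α]
    {f : α → (∀ k, X k) → ENNReal} (hf : Measurable fun q : α × (∀ k, X k) => f q.1 q.2)
    (L : Finset K) (x : ∀ k, X k) : Measurable fun s => (∫⋯∫⁻_L, f s ∂μ) x := by
  simp only [lmarginal]
  exact Measurable.lintegral_prod_right' (f := fun q : α × (∀ k : L, X k) =>
    f q.1 (Function.updateFinset x L q.2))
    (hf.comp (measurable_fst.prodMk (measurable_updateFinset.comp measurable_snd)))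

/-- Peeling off one variable, with the remaining marginal at the old base point. -/
theorem lmarginal_insert_eq {f : (∀ k, X k) → ENNReal} (hf : Measurable f) {L : Finset K} {k : K}
    (hk : k ∉ L) (x : ∀ k, X k) :
    (∫⋯∫⁻_insert k L, f ∂μ) x = ∫⁻ s, (∫⋯∫⁻_L, (fun y => f (update y k s)) ∂μ) x ∂μ k := by
  rw [lmarginal_insert _ hf hk]
  exact lintegral_congr fun s => lmarginal_update_of_notMem hf hk x s

end Marginal

section Step
variable {N K ι : Type*} [Fintype ι] [DecidableEq N] [DecidableEq K] {e₁ e₂ : K → N}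
  {χ : K → N → Prop} {S : Finset N} {L : Finset K} {v p : N} {k : K} {att : ι → N}

theorem sepLog_insert (hk : k ∉ L) (a : K → ℝ) (α : ℝ) (A B : N) :
    sepLog χ (insert k L) (update a k α) A B =
      (if (χ k A ↔ χ k B) then 0 else logRho α) + sepLog χ L a A B := by
  rw [sepLog, Finset.sum_insert hk, Function.update_self, sepLog]
  congr 1
  refine sum_congr rfl fun k' hk' => ?_
  have : k' ≠ k := fun h => hk (h ▸ hk')
  rw [Function.update_of_ne this]

theorem sepLog_congr {A A' B B' : N} (hA : ∀ k ∈ L, χ k A ↔ χ k A') (hB : ∀ k ∈ L, χ k B ↔ χ k B')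
    (a : K → ℝ) : sepLog χ L a A B = sepLog χ L a A' B' :=
  sum_congr rfl fun k hk => by simp only [hA k hk, hB k hk]

theorem sepLog_self (L : Finset K) (a : K → ℝ) (A : N) : sepLog χ L a A A = 0 :=
  Finset.sum_eq_zero fun k _ => by simp

/-- The translation of the leg variables at the leaf `v`. -/
def leafShift (v : N) (att : ι → N) (c : ℝ) (i : ι) : ℝ := if att i = v then c else 0

/-- `∑ e^{t_i}` over the legs at `v`. -/
def legSum (v : N) (att : ι → N) (t : ι → ℝ) : ℝ := ∑ i, if att i = v then exp (t i) else 0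

theorem legSum_pos {t : ι → ℝ} (hi : ∃ i, att i = v) : 0 < legSum v att t := by
  obtain ⟨i, hi⟩ := hi
  refine Finset.sum_pos' (fun j _ => by split_ifs <;> positivity) ⟨i, mem_univ _, ?_⟩
  simp [hi, exp_pos]

@[fun_prop]
theorem measurable_legSum (v : N) (att : ι → N) : Measurable (legSum v att) := by
  unfold legSum
  refine Finset.measurable_fun_sum _ fun i _ => ?_
  split_ifs <;> fun_prop

theorem legSum_add (t : ι → ℝ) (c : ℝ) :
    legSum v att (t + leafShift v att c) = legSum v att t * exp c := by
  simp only [legSum, sum_mul, Pi.add_apply, leafShift]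
  refine sum_congr rfl fun i _ => ?_
  split_ifs <;> simp [exp_add]

/-- The data of a leaf `v` joined by the link `k` to the tree `S`, `L`. -/
structure IsLeaf (e₁ e₂ : K → N) (χ : K → N → Prop) (S : Finset N) (L : Finset K) (v p : N) (k : K) :
    Prop where
  notMem : v ∉ S
  mem : p ∈ S
  link_notMem : k ∉ L
  ends : (e₁ k = v ∧ e₂ k = p) ∨ (e₁ k = p ∧ e₂ k = v)
  sep : ¬ (χ k v ↔ χ k p)
  same : ∀ u ∈ S, χ k u ↔ χ k p
  cong : ∀ k' ∈ L, χ k' v ↔ χ k' p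
  ends_mem : ∀ k' ∈ L, e₁ k' ∈ S ∧ e₂ k' ∈ S

namespace IsLeaf
variable (H : IsLeaf e₁ e₂ χ S L v p k) (hatt : ∀ i, att i ∈ insert v S)
include H

theorem ne : p ≠ v := fun h => H.notMem (h ▸ H.mem)

include hatt

theorem moveAtt_mem (i : ι) : moveAtt v p att i ∈ S := by
  unfold moveAtt
  split_ifs with h
  · exact H.mem
  · exact (mem_insert.1 (hatt i)).resolve_left h

theorem sepLog_old {B : N} (hB : B ∈ S) (a : K → ℝ) (α : ℝ) (i : ι) :
    sepLog χ (insert k L) (update a k α) B (att i) =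
      leafShift v att (logRho α) i + sepLog χ L a B (moveAtt v p att i) := by
  rw [sepLog_insert H.link_notMem]
  by_cases h : att i = v
  · have h1 := H.same B hB
    have h2 := H.sep
    rw [if_neg (by rw [h, h1]; tauto)]
    simp only [leafShift, moveAtt, h, if_true]
    rw [sepLog_congr (fun _ _ => Iff.rfl) H.cong]
  · have hi : att i ∈ S := (mem_insert.1 (hatt i)).resolve_left h
    rw [if_pos (by rw [H.same B hB, H.same _ hi])]
    simp [leafShift, moveAtt, h]

theorem sepLog_new (a : K → ℝ) (α : ℝ) (i : ι) :
    sepLog χ (insert k L) (update a k α) v (att i) =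
      if att i = v then 0 else logRho α + sepLog χ L a p (moveAtt v p att i) := by
  rw [sepLog_insert H.link_notMem]
  by_cases h : att i = v
  · simp [h, sepLog_self]
  · have hi : att i ∈ S := (mem_insert.1 (hatt i)).resolve_left h
    have h2 := H.sep
    rw [if_neg (by rw [H.same _ hi]; exact h2), if_neg h]
    rw [sepLog_congr H.cong (fun _ _ => Iff.rfl)]
    simp [moveAtt, h]

theorem sepLog_pair (a : K → ℝ) (α : ℝ) (i j : ι) :
    sepLog χ (insert k L) (update a k α) (att i) (att j) =
      if att i = v ∧ att j = v then 0 else leafShift v att (logRho α) i +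
        leafShift v att (logRho α) j + sepLog χ L a (moveAtt v p att i) (moveAtt v p att j) := by
  by_cases h : att i = v
  · rw [h, H.sepLog_new hatt]
    by_cases h' : att j = v <;> simp [h, h', leafShift, moveAtt]
  · have hi : att i ∈ S := (mem_insert.1 (hatt i)).resolve_left h
    rw [H.sepLog_old hatt hi]
    simp [h, leafShift, moveAtt]

theorem mass_old {B : N} (hB : B ∈ S) (w : ι → ℝ) (a : K → ℝ) (α : ℝ) :
    mass χ (insert k L) att w (update a k α) B =
      mass χ L (moveAtt v p att) (w + leafShift v att (logRho α)) a B := by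
  refine sum_congr rfl fun i _ => ?_
  rw [H.sepLog_old hatt hB, Pi.add_apply, add_assoc]

theorem mass_pos (hi : ∃ i, att i = v) (L : Finset K) (att' : ι → N) (w : ι → ℝ) (a : K → ℝ) (B : N) :
    0 < mass χ L att' w a B := by
  obtain ⟨i, _⟩ := hi
  exact Finset.sum_pos (fun _ _ => exp_pos _) ⟨i, mem_univ _⟩

theorem log_mass_new (hi : ∃ i, att i = v) (w : ι → ℝ) (a : K → ℝ) (α : ℝ) :
    log (mass χ (insert k L) att w (update a k α) v) =
      log (legSum v att (w + leafShift v att (logRho α)) +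
        exp α * mass χ L (moveAtt v p att) (w + leafShift v att (logRho α)) a p) -
      logRho α - softplus α := by
  set ρ := exp (logRho α)
  have hρ : 0 < ρ := exp_pos _
  have hρ2 : ρ ^ 2 * (1 + exp α) = exp α := by
    rw [← exp_softplus, ← Real.exp_nat_mul, ← exp_add]
    congr 1; unfold logRho; push_cast; ring
  set r := ∑ i, if att i = v then 0 else exp (w i + sepLog χ L a p (moveAtt v p att i))
  have hV := legSum_pos (t := w + leafShift v att (logRho α)) hi
  set V := legSum v att (w + leafShift v att (logRho α)) with hVdef
  have hM : mass χ L (moveAtt v p att) (w + leafShift v att (logRho α)) a p = V + r := by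
    rw [hVdef, legSum, ← sum_add_distrib]
    refine sum_congr rfl fun i _ => ?_
    by_cases h : att i = v <;> simp [h, leafShift, moveAtt, sepLog_self]
  have hm : mass χ (insert k L) att w (update a k α) v = V / ρ + ρ * r := by
    rw [hVdef, legSum, Finset.sum_div, mul_sum, ← sum_add_distrib]
    refine sum_congr rfl fun i _ => ?_
    rw [H.sepLog_new hatt]
    by_cases h : att i = v
    · simp only [h, leafShift, if_true, add_zero, Pi.add_apply, mul_zero, exp_add]
      rw [mul_div_assoc, div_self hρ.ne', mul_one]
    · simp only [h, if_false, zero_div, zero_add]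
      rw [← exp_add]; congr 1; ring
  have hr : 0 ≤ r := Finset.sum_nonneg fun i _ => by split_ifs <;> positivity
  have hpos : 0 < V + exp α * (V + r) := by positivity
  rw [hm, hM]
  have : V / ρ + ρ * r = (V + exp α * (V + r)) / (ρ * (1 + exp α)) := by
    field_simp
    linear_combination (r) * hρ2
  rw [this, Real.log_div hpos.ne' (by positivity), Real.log_mul hρ.ne' (by positivity), log_exp]
  unfold softplus
  ring

theorem pairEnergy_eq {d : ℕ} (y : ι → Bdry d) (w : ι → ℝ) (a : K → ℝ) (α : ℝ) :
    pairEnergy χ (insert k L) att y w (update a k α) =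
      pairEnergy χ L (moveAtt v p att) y (w + leafShift v att (logRho α)) a +
      1 / 2 * ∑ i, ∑ j, if att i = v ∧ att j = v then
        exp (w i + w j + 2 * logRho α - α) * ‖y i - y j‖ ^ 2 else 0 := by
  rw [pairEnergy, pairEnergy, ← mul_add, ← sum_add_distrib]
  congr 1
  refine sum_congr rfl fun i _ => ?_
  rw [← sum_add_distrib]
  refine sum_congr rfl fun j _ => ?_
  rw [H.sepLog_pair hatt]
  by_cases h : att i = v ∧ att j = v
  · have e : exp (2 * logRho α) + exp (2 * logRho α - α) = 1 := by
      have h1 : 2 * logRho α = α - softplus α := by unfold logRho; ring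
      rw [h1, show α - softplus α - α = - softplus α by ring, Real.exp_sub, Real.exp_neg,
        exp_softplus]
      field_simp
      ring
    simp only [Pi.add_apply, leafShift, moveAtt, h.1, h.2, and_self, if_true, sepLog_self, add_zero]
    rw [← add_mul]
    congr 1
    rw [show w i + logRho α + (w j + logRho α) = (w i + w j) + 2 * logRho α by ring,
      add_sub_assoc, exp_add _ (2 * logRho α), exp_add _ (2 * logRho α - α), ← mul_add, e,
      mul_one]
  · rw [if_neg h, if_neg h, add_zero]
    congr 2
    simp only [Pi.add_apply]; ring

end IsLeaf
end Step

/-! ### Removing a leaf: the Gaussian integral -/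

section Step
variable {N K ι : Type*} [Fintype ι] [DecidableEq N] [DecidableEq K] {e₁ e₂ : K → N}
  {χ : K → N → Prop} {S : Finset N} {L : Finset K} {v p : N} {k : K} {att : ι → N}

/-- The Gaussian integral over the positions of the nodes in `S`. -/
def springIntegral {d : ℕ} (e₁ e₂ : K → N) (S : Finset N) (L : Finset K) (att : ι → N)
    (y : ι → Bdry d) (x₀ : N → Bdry d) (q : (ι → ℝ) × (K → ℝ)) : ENNReal :=
  (∫⋯∫⁻_S, (fun x => ofReal (exp (-springEnergy e₁ e₂ L att y q.1 q.2 x)))) x₀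

theorem measurable_springIntegral {d : ℕ} (y : ι → Bdry d) (x₀ : N → Bdry d) :
    Measurable (springIntegral e₁ e₂ S L att y x₀) :=
  measurable_lmarginal_param (f := fun (q : (ι → ℝ) × (K → ℝ)) x =>
    ofReal (exp (-springEnergy e₁ e₂ L att y q.1 q.2 x)))
    (Measurable.ennreal_ofReal (Real.measurable_exp.comp (measurable_springEnergy e₁ e₂ L att y).neg))
    S x₀

theorem springIntegral_update {d : ℕ} (hk : k ∉ L) (y : ι → Bdry d) (x₀ : N → Bdry d) (t : ι → ℝ)
    (τ : K → ℝ) (s : ℝ) : springIntegral e₁ e₂ S L att y x₀ (t, update τ k s) =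
      springIntegral e₁ e₂ S L att y x₀ (t, τ) := by
  unfold springIntegral
  congr 1
  have : ∀ x, springEnergy e₁ e₂ L att y t (update τ k s) x =
      springEnergy e₁ e₂ L att y t τ x := by
    intro x
    unfold springEnergy
    congr 1
    refine sum_congr rfl fun k' hk' => ?_
    have : k' ≠ k := fun h => hk (h ▸ hk')
    rw [Function.update_of_ne this]
  simp only [this]

/-- The factor from integrating out the position of the leaf `v`, in the variables
`σ = τ_k - log ∑ e^{t_i}` and the effective parameters of the legs at the neighbour of `v`. -/
def leafFactor {d : ℕ} (v : N) (att : ι → N) (y : ι → Bdry d) (σ : ℝ) (t : ι → ℝ) : ℝ :=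
  -(h d * (log (legSum v att t) + 2 * softplus σ - σ)) -
    1 / 2 * ∑ i, ∑ j, if att i = v ∧ att j = v then
      exp (t i + t j - σ - log (legSum v att t)) * ‖y i - y j‖ ^ 2 else 0

theorem measurable_leafFactor {d : ℕ} (v : N) (att : ι → N) (y : ι → Bdry d) :
    Measurable fun q : ℝ × (ι → ℝ) => leafFactor v att y q.1 q.2 := by
  unfold leafFactor
  have h1 : Measurable fun q : ℝ × (ι → ℝ) => log (legSum v att q.2) :=
    Real.measurable_log.comp ((measurable_legSum v att).comp measurable_snd)
  have h2 : Measurable fun q : ℝ × (ι → ℝ) => softplus q.1 := measurable_softplus.comp measurable_fst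
  refine Measurable.sub (by fun_prop) (Measurable.const_mul (Finset.measurable_fun_sum _ fun i _ =>
    Finset.measurable_fun_sum _ fun j _ => ?_) _)
  split_ifs
  · exact Measurable.mul_const (Real.measurable_exp.comp (by fun_prop)) _
  · exact measurable_const

/-- `π^h`. -/
def gaussConst (d : ℕ) : ENNReal := ofReal (exp (h d * log pi))

namespace IsLeaf
variable (H : IsLeaf e₁ e₂ χ S L v p k) (hatt : ∀ i, att i ∈ insert v S)
include H

theorem springIntegral_leaf {d : ℕ} (y : ι → Bdry d) (x₀ : N → Bdry d) (t : ι → ℝ) (τ : K → ℝ)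
    {ℓ : ℝ} (hℓ : log ((∑ i, if att i = v then exp (t i) else 0) + exp (τ k)) = ℓ) :
    springIntegral e₁ e₂ (insert v S) (insert k L) att y x₀ (t, τ) =
      ofReal (exp (h d * log pi - h d * ℓ -
        1 / 2 * ∑ i, ∑ j, if att i = v ∧ att j = v then exp (t i + t j - ℓ) *
            ‖y i - y j‖ ^ 2 else 0)) *
        springIntegral e₁ e₂ S L (moveAtt v p att) y x₀
          (fun i => if att i = v then t i + τ k - ℓ else t i, τ) := by
  have hmeas : ∀ (L : Finset K) (att : ι → N) (t : ι → ℝ), Measurable fun x => ofReal (exp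
      (-springEnergy e₁ e₂ L att y t τ x)) := fun L att t =>
    Measurable.ennreal_ofReal (Real.measurable_exp.comp
      ((measurable_springEnergy e₁ e₂ L att y).comp (measurable_prodMk_left (x := (t, τ)))).neg)
  unfold springIntegral
  rw [lmarginal_insert' _ (hmeas _ _ _) H.notMem, ← lmarginal_const_mul _ (hmeas _ _ _)]
  simp only [lintegral_springEnergy_leaf y H.notMem H.mem H.link_notMem H.ends H.ends_mem, hℓ]

theorem springIntegral_eq {d : ℕ} (hi : ∃ i, att i = v) (y : ι → Bdry d) (x₀ : N → Bdry d)
    (σ : ℝ) (t : ι → ℝ) (τ : K → ℝ) :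
    springIntegral e₁ e₂ (insert v S) (insert k L) att y x₀
      (t + leafShift v att (softplus σ - σ), update τ k (log (legSum v att t) + softplus σ)) =
      gaussConst d * ofReal (exp (leafFactor v att y σ t)) *
        springIntegral e₁ e₂ S L (moveAtt v p att) y x₀ (t, τ) := by
  obtain ⟨t', ht'⟩ : ∃ t', t' = t + leafShift v att (softplus σ - σ) := ⟨_, rfl⟩
  obtain ⟨τ', hτ'⟩ : ∃ τ', τ' = update τ k (log (legSum v att t) + softplus σ) :=
    ⟨_, rfl⟩
  have hW := legSum_pos (t := t) hi
  have hτk : τ' k = log (legSum v att t) + softplus σ := by simp [hτ']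
  have hsum : (∑ i, if att i = v then exp (t' i) else 0) + exp (τ' k) =
      legSum v att t * exp (2 * softplus σ - σ) := by
    change legSum v att t' + _ = _
    rw [ht', legSum_add, hτk, exp_add, exp_log hW, ← mul_add]
    congr 1
    rw [show 2 * softplus σ - σ = (softplus σ - σ) + softplus σ by ring, exp_add _ (softplus σ),
      Real.exp_sub, exp_softplus]
    have := exp_pos σ
    field_simp
  have hlog : log ((∑ i, if att i = v then exp (t' i) else 0) + exp (τ' k)) =
      log (legSum v att t) + (2 * softplus σ - σ) := by
    rw [hsum, Real.log_mul hW.ne' (Real.exp_ne_zero _), log_exp]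
  have hhat : (fun i => if att i = v then t' i + τ' k -
      (log (legSum v att t) + (2 * softplus σ - σ)) else t' i) = t := by
    ext i
    by_cases h : att i = v
    · simp only [h, if_true, ht', Pi.add_apply, leafShift, hτk]; ring
    · simp [h, ht', leafShift]
  have hquad : ∀ i j, (if att i = v ∧ att j = v then exp (t' i + t' j -
      (log (legSum v att t) + (2 * softplus σ - σ))) * ‖y i - y j‖ ^ 2 else 0) =
      if att i = v ∧ att j = v then
        exp (t i + t j - σ - log (legSum v att t)) * ‖y i - y j‖ ^ 2 else 0 := by
    intro i j
    by_cases hij : att i = v ∧ att j = v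
    · rw [if_pos hij, if_pos hij]
      congr 2
      simp only [ht', Pi.add_apply, leafShift, hij.1, hij.2, if_true]; ring
    · rw [if_neg hij, if_neg hij]
  have hfac : h d * log pi - h d * (log (legSum v att t) + (2 * softplus σ - σ)) -
      1 / 2 * (∑ i, ∑ j, if att i = v ∧ att j = v then
        exp (t i + t j - σ - log (legSum v att t)) * ‖y i - y j‖ ^ 2 else 0) =
      h d * log pi + leafFactor v att y σ t := by
    rw [leafFactor]; ring
  rw [← ht', ← hτ', H.springIntegral_leaf y x₀ t' τ' hlog, hhat]
  simp only [hquad]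
  rw [hfac, exp_add, ENNReal.ofReal_mul (exp_pos _).le, gaussConst, hτ',
    springIntegral_update H.link_notMem]

include hatt

/-- The change of variables of the tree identity at a leaf: when the legs at the leaf `v` are moved to its
neighbour `p` and rescaled by the transmission factor of the link, the density and the parameters of
the legs and links of the smaller tree become those of the larger one. -/
theorem weight_eq {d : ℕ} (hi : ∃ i, att i = v) (y : ι → Bdry d) (w : ι → ℝ) (a : K → ℝ) (α : ℝ) :
    let u := w + leafShift v att (logRho α)
    let σ := α + log (mass χ L (moveAtt v p att) u a p) - log (legSum v att u)
    let t := treeT χ L (moveAtt v p att) u a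
    treeWeight χ S L (moveAtt v p att) y u a + leafFactor v att y σ t =
        treeWeight χ (insert v S) (insert k L) att y w (update a k α) ∧
      t + leafShift v att (softplus σ - σ) = treeT χ (insert k L) att w (update a k α) ∧
      update (treeTau e₁ e₂ χ L (moveAtt v p att) u a) k
        (log (legSum v att t) + softplus σ) =
        treeTau e₁ e₂ χ (insert k L) att w (update a k α) := by
  intro u σ t
  have hV := legSum_pos (t := u) hi
  have hM := H.mass_pos hatt hi L (moveAtt v p att) u a p
  set M := mass χ L (moveAtt v p att) u a p with hMdef
  set V := legSum v att u with hVdef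
  have hX : 0 < V + exp α * M := by positivity
  set X := log (V + exp α * M) with hXdef
  have hnew := H.log_mass_new hatt hi w a α
  rw [← hMdef, ← hVdef, ← hXdef] at hnew
  -- `log (1 + e^σ)` and the effective sum over the legs at `v`
  have hsσ : softplus σ = X - log V := by
    rw [softplus, hXdef, ← Real.log_div hX.ne' hV.ne']
    congr 1
    rw [show σ = α + log M - log V from rfl, Real.exp_sub, exp_add, exp_log hM,
      exp_log hV]
    field_simp
  have hσ : σ = α + log M - log V := rfl
  have htv : ∀ i, att i = v → t i = w i + logRho α + log M := by
    intro i h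
    simp only [t, treeT, u, moveAtt, h, if_true, Pi.add_apply, leafShift]
    rfl
  have hW : log (legSum v att t) = log V + log M := by
    rw [← Real.log_mul hV.ne' hM.ne', hVdef]
    congr 1
    rw [legSum, legSum, sum_mul]
    refine sum_congr rfl fun i _ => ?_
    by_cases h : att i = v
    · rw [if_pos h, if_pos h, htv i h, exp_add, exp_log hM]
      simp [u, leafShift, h]
    · simp [h]
  have hρ : logRho α = (α - softplus α) / 2 := rfl
  refine ⟨?_, ?_, ?_⟩
  · have e1 : ∑ B ∈ insert v S, log (mass χ (insert k L) att w (update a k α) B) =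
        (X - logRho α - softplus α) + ∑ B ∈ S, log (mass χ L (moveAtt v p att) u a B) := by
      rw [Finset.sum_insert H.notMem, hnew]
      congr 1
      exact sum_congr rfl fun B hB => by rw [H.mass_old hatt hB]
    have e2 : ∑ k' ∈ insert k L, softplus (update a k α k') =
        softplus α + ∑ k' ∈ L, softplus (a k') := by
      rw [Finset.sum_insert H.link_notMem, Function.update_self]
      congr 1
      refine sum_congr rfl fun k' hk' => ?_
      have : k' ≠ k := fun h => H.link_notMem (h ▸ hk')
      rw [Function.update_of_ne this]
    have e3 : ∀ i j, (if att i = v ∧ att j = v then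
        exp (t i + t j - σ - log (legSum v att t)) * ‖y i - y j‖ ^ 2 else 0) =
        if att i = v ∧ att j = v then
        exp (w i + w j + 2 * logRho α - α) * ‖y i - y j‖ ^ 2 else 0 := by
      intro i j
      by_cases hij : att i = v ∧ att j = v
      · rw [if_pos hij, if_pos hij, htv i hij.1, htv j hij.2, hW, hσ]
        congr 2; ring
      · rw [if_neg hij, if_neg hij]
    rw [treeWeight, treeWeight, leafFactor, e1, e2, H.pairEnergy_eq hatt]
    simp only [e3]
    rw [hW, hsσ, hσ, show w + leafShift v att (logRho α) = u from rfl,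
      show (d : ℝ) = 2 * h d by unfold h; ring]
    linear_combination (-2 * h d) * hρ
  · ext i
    by_cases hiv : att i = v
    · rw [Pi.add_apply, htv i hiv, treeT, hiv, hnew]
      simp only [leafShift, hiv, if_true]
      rw [hsσ, hσ, hρ]; ring
    · have hmem : att i ∈ S := (mem_insert.1 (hatt i)).resolve_left hiv
      rw [treeT, H.mass_old hatt hmem]
      simp [t, treeT, leafShift, hiv, moveAtt, u]
  · have hmid : log (legSum v att t) + softplus σ = (α + softplus α) / 2 + log M +
        (X - logRho α - softplus α) := by rw [hW, hsσ, hρ]; ring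
    have hmp : mass χ (insert k L) att w (update a k α) p = M := H.mass_old hatt H.mem w a α
    ext k'
    rcases eq_or_ne k' k with rfl | hne
    · rw [Function.update_self, treeTau, if_pos (Finset.mem_insert_self _ _), Function.update_self, hmid]
      rcases H.ends with ⟨h1, h2⟩ | ⟨h1, h2⟩
      · rw [h1, h2, hmp, hnew]; ring
      · rw [h1, h2, hmp, hnew]
    · rw [Function.update_of_ne hne, treeTau, treeTau, Function.update_of_ne hne]
      by_cases hk' : k' ∈ L
      · rw [if_pos hk', if_pos (mem_insert_of_mem hk'), H.mass_old hatt (H.ends_mem k' hk').1,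
          H.mass_old hatt (H.ends_mem k' hk').2]
      · rw [if_neg hk', if_neg (by simp [hne, hk'])]

end IsLeaf
end Step

/-! ### Integrating out a tree of springs -/

section Identity
variable {N K ι : Type*} [Fintype ι] [DecidableEq N] [DecidableEq K] {e₁ e₂ : K → N}
  {χ : K → N → Prop} {S : Finset N} {L : Finset K} {v p : N} {k : K} {att : ι → N}

theorem tree_identity_root [Nonempty ι] {d : ℕ} (y : ι → Bdry d) (x₀ : N → Bdry d) {r : N}
    (hatt : ∀ i, att i = r) {Φ : (ι → ℝ) × (K → ℝ) → ENNReal} (hΦ : Measurable Φ) (τ₀ : K → ℝ) :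
    ∫⁻ t, Φ (t, τ₀) * springIntegral e₁ e₂ {r} ∅ att y x₀ (t, τ₀) =
      2 * gaussConst d * ∫⁻ w, ofReal (exp (treeWeight χ {r} ∅ att y w τ₀)) *
        Φ (treeT χ ∅ att w τ₀, τ₀) := by
  have hpos : ∀ w : ι → ℝ, 0 < ∑ i, exp (w i) := fun w =>
    Finset.sum_pos (fun _ _ => exp_pos _) Finset.univ_nonempty
  have hmass : ∀ w B, mass χ ∅ att w τ₀ B = ∑ i, exp (w i) := fun w B => by
    simp [mass, sepLog]
  have hΦ' : Measurable fun t => Φ (t, τ₀) := hΦ.comp measurable_prodMk_right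
  have hm : Measurable fun t => springIntegral e₁ e₂ {r} ∅ att y x₀ (t, τ₀) :=
    (measurable_springIntegral y x₀).comp measurable_prodMk_right
  rw [lintegral_comp_add_log_sum_exp (F := fun t => Φ (t, τ₀) *
    springIntegral e₁ e₂ {r} ∅ att y x₀ (t, τ₀)) (hΦ'.mul hm), mul_assoc,
    ← lintegral_const_mul (gaussConst d)]
  · congr 1
    refine lintegral_congr fun w => ?_
    have ht : (fun i => w i + log (∑ j, exp (w j))) = treeT χ ∅ att w τ₀ := by
      ext i; rw [treeT, hmass]
    have hexp : ∀ i, exp (treeT χ ∅ att w τ₀ i) = exp (w i) * ∑ j, exp (w j) := by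
      intro i; rw [← ht, exp_add, exp_log (hpos w)]
    rw [ht, mul_comm (ofReal _), mul_left_comm]
    congr 1
    have hE : ∀ z, springEnergy e₁ e₂ ∅ att y (treeT χ ∅ att w τ₀) τ₀ (update x₀ r z) =
        ∑ i, exp (treeT χ ∅ att w τ₀ i) * ‖z - y i‖ ^ 2 := by
      intro z; simp [springEnergy, hatt]
    unfold springIntegral
    rw [lmarginal_singleton]
    simp only [hE]
    rw [lintegral_star _ (hpos _), gaussConst, ← ENNReal.ofReal_mul (exp_pos _).le, ← exp_add]
    congr 2
    have hW : ∑ i, exp (treeT χ ∅ att w τ₀ i) = (∑ j, exp (w j)) ^ 2 := by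
      simp only [hexp, ← sum_mul]; ring
    rw [hW, treeWeight, Finset.sum_singleton, hmass, Real.log_pow, pairEnergy]
    have hq : ∀ i j, exp (treeT χ ∅ att w τ₀ i) * exp (treeT χ ∅ att w τ₀ j) /
        (∑ j, exp (w j)) ^ 2 = exp (w i + w j + sepLog χ ∅ τ₀ (att i) (att j)) := by
      intro i j
      have := (hpos w).ne'
      simp only [hexp, sepLog, Finset.sum_empty, add_zero, exp_add]
      field_simp
    simp only [hq, Finset.sum_empty]
    rw [show (d : ℝ) = 2 * h d by unfold h; ring]
    push_cast
    ring
  · have h0 : Measurable fun w : ι → ℝ => (w, τ₀) := by fun_prop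
    have h1 := (measurable_treeWeight χ {r} ∅ att y).comp h0
    have h2 := ((measurable_treeT χ ∅ att).comp h0).prodMk
      (measurable_const : Measurable fun _ : ι → ℝ => τ₀)
    exact h1.exp.ennreal_ofReal.mul (hΦ.comp h2)

/-- The integrand of the tree with the leaf `v` removed that results from an integrand `Φ`. -/
def leafSubst {d : ℕ} (v : N) (k : K) (att : ι → N) (y : ι → Bdry d)
    (Φ : (ι → ℝ) × (K → ℝ) → ENNReal) (σ : ℝ) (q : (ι → ℝ) × (K → ℝ)) : ENNReal :=
  Φ (q.1 + leafShift v att (softplus σ - σ),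
      update q.2 k (log (legSum v att q.1) + softplus σ)) *
    (gaussConst d * ofReal (exp (leafFactor v att y σ q.1)))

omit [Fintype ι] in
theorem measurable_leafShift (v : N) (att : ι → N) : Measurable fun c => leafShift v att c := by
  refine measurable_pi_lambda _ fun i => ?_
  simp only [leafShift]
  split_ifs <;> fun_prop

theorem measurable_leafSubst {d : ℕ} (y : ι → Bdry d) {Φ : (ι → ℝ) × (K → ℝ) → ENNReal}
    (hΦ : Measurable Φ) :
    Measurable fun q : ℝ × ((ι → ℝ) × (K → ℝ)) => leafSubst v k att y Φ q.1 q.2 := by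
  have h0 : Measurable fun q : ℝ × ((ι → ℝ) × (K → ℝ)) =>
      q.2.1 + leafShift v att (softplus q.1 - q.1) := by
    have := (measurable_leafShift v att).comp (measurable_softplus.sub measurable_id)
    exact (measurable_fst.comp measurable_snd).add (this.comp measurable_fst)
  have h1 : Measurable fun q : ℝ × ((ι → ℝ) × (K → ℝ)) => log (legSum v att q.2.1) :=
    Real.measurable_log.comp ((measurable_legSum v att).comp (measurable_fst.comp measurable_snd))
  have h1' : Measurable fun q : ℝ × ((ι → ℝ) × (K → ℝ)) =>
      log (legSum v att q.2.1) + softplus q.1 :=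
    h1.add (measurable_softplus.comp measurable_fst)
  have h1'' : Measurable fun q : ℝ × ((ι → ℝ) × (K → ℝ)) => q.2.2 :=
    measurable_snd.comp measurable_snd
  have hupd : Measurable fun q : (K → ℝ) × ℝ => update q.1 k q.2 := measurable_update'
  have h2 : Measurable fun q : ℝ × ((ι → ℝ) × (K → ℝ)) =>
      update q.2.2 k (log (legSum v att q.2.1) + softplus q.1) :=
    hupd.comp (h1''.prodMk h1')
  have h3 : Measurable fun q : ℝ × ((ι → ℝ) × (K → ℝ)) => leafFactor v att y q.1 q.2.1 := by
    have h : Measurable fun q : ℝ × ((ι → ℝ) × (K → ℝ)) => (q.1, q.2.1) := by fun_prop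
    have := (measurable_leafFactor v att y).comp h
    exact this
  have h4 : Measurable fun q : ℝ × ((ι → ℝ) × (K → ℝ)) =>
      (q.2.1 + leafShift v att (softplus q.1 - q.1),
        update q.2.2 k (log (legSum v att q.2.1) + softplus q.1)) := h0.prodMk h2
  have h5 : Measurable fun q : ℝ × ((ι → ℝ) × (K → ℝ)) =>
      ofReal (exp (leafFactor v att y q.1 q.2.1)) := h3.exp.ennreal_ofReal
  exact (hΦ.comp h4).mul (h5.const_mul _)

set_option maxHeartbeats 1000000 in
/-- The induction step of the tree identity: removing the leaf `v`. -/
theorem tree_identity_leaf (H : IsLeaf e₁ e₂ χ S L v p k) (hatt : ∀ i, att i ∈ insert v S)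
    (hi : ∃ i, att i = v) {d : ℕ} (y : ι → Bdry d) (x₀ : N → Bdry d) (τ₀ : K → ℝ) {C : ENNReal}
    (ih : ∀ Φ : (ι → ℝ) × (K → ℝ) → ENNReal, Measurable Φ →
      ∫⁻ t, (∫⋯∫⁻_L, (fun τ => Φ (t, τ) *
        springIntegral e₁ e₂ S L (moveAtt v p att) y x₀ (t, τ))) τ₀ =
      C * ∫⁻ w, (∫⋯∫⁻_L, (fun a => ofReal (exp (treeWeight χ S L (moveAtt v p att) y w a)) *
        Φ (treeT χ L (moveAtt v p att) w a, treeTau e₁ e₂ χ L (moveAtt v p att) w a))) τ₀)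
    {Φ : (ι → ℝ) × (K → ℝ) → ENNReal} (hΦ : Measurable Φ) :
    ∫⁻ t, (∫⋯∫⁻_insert k L, (fun τ => Φ (t, τ) *
        springIntegral e₁ e₂ (insert v S) (insert k L) att y x₀ (t, τ))) τ₀ =
      C * gaussConst d * ∫⁻ w, (∫⋯∫⁻_insert k L, (fun a =>
        ofReal (exp (treeWeight χ (insert v S) (insert k L) att y w a)) *
        Φ (treeT χ (insert k L) att w a, treeTau e₁ e₂ χ (insert k L) att w a))) τ₀ := by
  set μK : K → Measure ℝ := fun _ => volume
  obtain ⟨F, hF⟩ : ∃ F : (ι → ℝ) × (K → ℝ) → ENNReal, F = fun q => Φ q *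
    springIntegral e₁ e₂ (insert v S) (insert k L) att y x₀ q := ⟨_, rfl⟩
  have hFm : Measurable F := hF ▸ hΦ.mul (measurable_springIntegral y x₀)
  have hFt : ∀ t, Measurable fun τ => F (t, τ) := fun t => hFm.comp measurable_prodMk_left
  have hupd : Measurable fun q : (K → ℝ) × ℝ => update q.1 k q.2 := measurable_update'
  -- the substituted integrand
  have hΦ'm := measurable_leafSubst (v := v) (k := k) (att := att) y hΦ
  obtain ⟨Φ', hΦ'⟩ : ∃ Φ', Φ' = leafSubst v k att y Φ := ⟨_, rfl⟩
  rw [← hΦ'] at hΦ'm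
  have hΦ'eq : ∀ σ t τ, F (t + leafShift v att (softplus σ - σ),
      update τ k (log (legSum v att t) + softplus σ)) =
      Φ' σ (t, τ) * springIntegral e₁ e₂ S L (moveAtt v p att) y x₀ (t, τ) := by
    intro σ t τ
    rw [hF, hΦ', leafSubst]
    simp only
    rw [H.springIntegral_eq hi]
    ring
  -- the integrand in the new variables
  obtain ⟨Q, hQ⟩ : ∃ Q : (ι → ℝ) → (K → ℝ) → ℝ → ENNReal, Q = fun u a σ =>
    ofReal (exp (treeWeight χ S L (moveAtt v p att) y u a)) *
      Φ' σ (treeT χ L (moveAtt v p att) u a, treeTau e₁ e₂ χ L (moveAtt v p att) u a) := ⟨_, rfl⟩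
  have hQm : Measurable fun q : ((ι → ℝ) × (K → ℝ)) × ℝ => Q q.1.1 q.1.2 q.2 := by
    rw [hQ]
    refine Measurable.mul ?_ (hΦ'm.comp (measurable_snd.prodMk (Measurable.prodMk ?_ ?_)))
    · exact Measurable.ennreal_ofReal (Real.measurable_exp.comp
        ((measurable_treeWeight χ S L (moveAtt v p att) y).comp measurable_fst))
    · exact (measurable_treeT χ L (moveAtt v p att)).comp measurable_fst
    · exact (measurable_treeTau e₁ e₂ χ L (moveAtt v p att)).comp measurable_fst
  obtain ⟨s, hs⟩ : ∃ s : (ι → ℝ) → (K → ℝ) → ℝ, s = fun u a =>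
    log (mass χ L (moveAtt v p att) u a p) - log (legSum v att u) := ⟨_, rfl⟩
  have hsm : Measurable fun q : (ι → ℝ) × (K → ℝ) => s q.1 q.2 := by
    rw [hs]
    exact (Real.measurable_log.comp (measurable_mass χ L _ p)).sub
      (Real.measurable_log.comp ((measurable_legSum v att).comp measurable_fst))
  have hQsm : Measurable fun q : ((ι → ℝ) × (K → ℝ)) × ℝ => Q q.1.1 q.1.2 (q.2 + s q.1.1 q.1.2) :=
    hQm.comp (measurable_fst.prodMk (measurable_snd.add (hsm.comp measurable_fst)))
  obtain ⟨G, hG⟩ : ∃ G : (ι → ℝ) → (K → ℝ) → ENNReal, G = fun w a =>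
    ofReal (exp (treeWeight χ (insert v S) (insert k L) att y w a)) *
        Φ (treeT χ (insert k L) att w a, treeTau e₁ e₂ χ (insert k L) att w a) := ⟨_, rfl⟩
  have hGm : Measurable fun q : (ι → ℝ) × (K → ℝ) => G q.1 q.2 := by
    rw [hG]
    refine Measurable.mul ?_ (hΦ.comp (Measurable.prodMk ?_ ?_))
    · exact Measurable.ennreal_ofReal (Real.measurable_exp.comp (measurable_treeWeight χ _ _ att y))
    · exact measurable_treeT χ _ att
    · exact measurable_treeTau e₁ e₂ χ _ att
  have hQG : ∀ w a α, Q (w + leafShift v att (logRho α)) a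
      (α + s (w + leafShift v att (logRho α)) a) = gaussConst d * G w (update a k α) := by
    intro w a α
    obtain ⟨h1, h2, h3⟩ := H.weight_eq hatt hi y w a α
    rw [hQ, hΦ', hG, hs]
    simp only [leafSubst, ← add_sub_assoc]
    rw [h2, h3, ← h1, exp_add, ENNReal.ofReal_mul (exp_pos _).le]
    ring
  have hgoal : ∫⁻ t, (∫⋯∫⁻_insert k L, (fun τ => F (t, τ)) ∂μK) τ₀ =
      C * gaussConst d * ∫⁻ w, (∫⋯∫⁻_insert k L, (fun a => G w a) ∂μK) τ₀ := by
   calc ∫⁻ t, (∫⋯∫⁻_insert k L, (fun τ => F (t, τ)) ∂μK) τ₀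
       = ∫⁻ t, ∫⁻ σ, (∫⋯∫⁻_L, (fun τ => F (t, update τ k σ)) ∂μK) τ₀ :=
         lintegral_congr fun t => lmarginal_insert_eq (hFt t) H.link_notMem τ₀
     _ = ∫⁻ t, ∫⁻ σ, (∫⋯∫⁻_L, (fun τ => F (t, update τ k
           (σ + log (legSum v att t)))) ∂μK) τ₀ :=
         lintegral_congr fun t => (lintegral_add_right_eq_self (fun σ =>
           (∫⋯∫⁻_L, (fun τ => F (t, update τ k σ)) ∂μK) τ₀) _).symm
     _ = ∫⁻ σ, ∫⁻ t, (∫⋯∫⁻_L, (fun τ => F (t, update τ k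
           (σ + log (legSum v att t)))) ∂μK) τ₀ := by
         refine lintegral_lintegral_swap (Measurable.aemeasurable ?_)
         refine measurable_lmarginal_param (f := fun (q : (ι → ℝ) × ℝ) τ => F (q.1, update τ k
           (q.2 + log (legSum v att q.1)))) ?_ L τ₀
         refine hFm.comp (Measurable.prodMk (measurable_fst.comp measurable_fst)
           (hupd.comp (measurable_snd.prodMk ?_)))
         exact (measurable_snd.comp measurable_fst).add (Real.measurable_log.comp
           ((measurable_legSum v att).comp (measurable_fst.comp measurable_fst)))
     _ = ∫⁻ σ, ∫⁻ t, (∫⋯∫⁻_L, (fun τ => Φ' σ (t, τ) *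
           springIntegral e₁ e₂ S L (moveAtt v p att) y x₀ (t, τ)) ∂μK) τ₀ := by
         refine lintegral_congr fun σ => ?_
         rw [← lintegral_add_right_eq_self _ (leafShift v att (softplus σ - σ))]
         refine lintegral_congr fun t => ?_
         congr 1
         ext τ
         rw [← hΦ'eq, legSum_add, Real.log_mul (legSum_pos hi).ne' (Real.exp_ne_zero _), log_exp]
         congr 3
         ring
     _ = ∫⁻ σ, C * ∫⁻ u, (∫⋯∫⁻_L, (fun a => Q u a σ) ∂μK) τ₀ := by
         refine lintegral_congr fun σ => ?_
         rw [ih (Φ' σ) (hΦ'm.comp measurable_prodMk_left), hQ]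
     _ = C * ∫⁻ u, ∫⁻ σ, (∫⋯∫⁻_L, (fun a => Q u a σ) ∂μK) τ₀ := by
         have hm : Measurable fun q : ℝ × (ι → ℝ) => (∫⋯∫⁻_L, (fun a => Q q.2 a q.1) ∂μK) τ₀ :=
           measurable_lmarginal_param (f := fun (q : ℝ × (ι → ℝ)) a => Q q.2 a q.1)
             (hQm.comp (((measurable_snd.comp measurable_fst).prodMk measurable_snd).prodMk
               (measurable_fst.comp measurable_fst))) L τ₀
         rw [lintegral_const_mul _ (Measurable.lintegral_prod_right' hm), lintegral_lintegral_swap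
           hm.aemeasurable]
     _ = C * ∫⁻ u, (∫⋯∫⁻_L, (fun a => ∫⁻ α, Q u a (α + s u a)) ∂μK) τ₀ := by
         congr 1
         refine lintegral_congr fun u => ?_
         rw [lintegral_lmarginal_swap]
         · congr 1
           ext a
           rw [lintegral_add_right_eq_self (fun α => Q u a α)]
         · exact hQm.comp ((measurable_const.prodMk measurable_snd).prodMk measurable_fst)
     _ = C * ∫⁻ u, ∫⁻ α, (∫⋯∫⁻_L, (fun a => Q u a (α + s u a)) ∂μK) τ₀ := by
         congr 1
         refine lintegral_congr fun u => ?_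
         rw [lintegral_lmarginal_swap]
         exact hQsm.comp ((measurable_const.prodMk measurable_snd).prodMk measurable_fst)
     _ = C * ∫⁻ α, ∫⁻ u, (∫⋯∫⁻_L, (fun a => Q u a (α + s u a)) ∂μK) τ₀ := by
         rw [lintegral_lintegral_swap (Measurable.aemeasurable ?_)]
         exact measurable_lmarginal_param (f := fun (q : (ι → ℝ) × ℝ) a => Q q.1 a (q.2 + s q.1 a))
           (hQsm.comp (((measurable_fst.comp measurable_fst).prodMk measurable_snd).prodMk
               (measurable_snd.comp measurable_fst))) L τ₀
     _ = C * ∫⁻ α, ∫⁻ w, (∫⋯∫⁻_L, (fun a => gaussConst d * G w (update a k α)) ∂μK) τ₀ := by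
         congr 1
         refine lintegral_congr fun α => ?_
         rw [← lintegral_add_right_eq_self _ (leafShift v att (logRho α))]
         simp only [hQG]
     _ = C * ∫⁻ w, ∫⁻ α, (∫⋯∫⁻_L, (fun a => gaussConst d * G w (update a k α)) ∂μK) τ₀ := by
         rw [lintegral_lintegral_swap (Measurable.aemeasurable ?_)]
         exact measurable_lmarginal_param (f := fun (q : ℝ × (ι → ℝ)) a =>
           gaussConst d * G q.2 (update a k q.1)) (Measurable.const_mul (hGm.comp
             ((measurable_snd.comp measurable_fst).prodMk (hupd.comp (measurable_snd.prodMk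
               (measurable_fst.comp measurable_fst))))) _) L τ₀
     _ = C * ∫⁻ w, gaussConst d * (∫⋯∫⁻_insert k L, (fun a => G w a) ∂μK) τ₀ := by
         congr 1
         refine lintegral_congr fun w => ?_
         have hw : Measurable fun a => G w a := hGm.comp measurable_prodMk_left
         rw [← lmarginal_const_mul _ hw, lmarginal_insert_eq (hw.const_mul _) H.link_notMem]
     _ = _ := by
         rw [lintegral_const_mul, mul_assoc]
         exact measurable_lmarginal_param (f := G) hGm _ τ₀
  rw [hF, hG] at hgoal
  exact hgoal

/-- The change of variables that diagonalises a tree of springs: after the positions of the nodes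
have been integrated out, the end points `y` interact pairwise, with coupling `R_ij P_ij`. -/
theorem Grown.lintegral_eq [Nonempty ι] (hg : Grown e₁ e₂ χ S L) {d : ℕ} (y : ι → Bdry d)
    (x₀ : N → Bdry d) (τ₀ : K → ℝ) : ∀ att : ι → N, (∀ i, att i ∈ S) →
    (∀ k ∈ L, ∃ i j, ¬ (χ k (att i) ↔ χ k (att j))) →
    ∀ Φ : (ι → ℝ) × (K → ℝ) → ENNReal, Measurable Φ →
    ∫⁻ t, (∫⋯∫⁻_L, (fun τ => Φ (t, τ) * springIntegral e₁ e₂ S L att y x₀ (t, τ))) τ₀ =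
      2 * gaussConst d ^ S.card * ∫⁻ w, (∫⋯∫⁻_L, (fun a =>
        ofReal (exp (treeWeight χ S L att y w a)) *
        Φ (treeT χ L att w a, treeTau e₁ e₂ χ L att w a))) τ₀ := by
  induction hg with
  | root r =>
    intro att hatt _ Φ hΦ
    simp only [lmarginal_empty, Finset.card_singleton, pow_one]
    rw [tree_identity_root (χ := χ) y x₀ (fun i => by simpa using hatt i) hΦ]
    rfl
  | @leaf S L v p k hg hv hp hk hends hsep hS hL ih =>
    intro att hatt hlink Φ hΦ
    have H : IsLeaf e₁ e₂ χ S L v p k := ⟨hv, hp, hk, hends, hsep, hS, hL, hg.ends_mem⟩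
    have hi : ∃ i, att i = v := by
      obtain ⟨i, j, hij⟩ := hlink k (Finset.mem_insert_self _ _)
      by_contra hcon
      push Not at hcon
      have h1 : ∀ i, χ k (att i) ↔ χ k p := fun i =>
        hS _ ((mem_insert.1 (hatt i)).resolve_left (hcon i))
      exact hij ((h1 i).trans (h1 j).symm)
    rw [tree_identity_leaf H hatt hi y x₀ τ₀ (C := 2 * gaussConst d ^ S.card) (ih (moveAtt v p att)
      (H.moveAtt_mem hatt) ?_) hΦ, card_insert_of_notMem hv, pow_succ, mul_assoc 2]
    intro k' hk'
    obtain ⟨i, j, hij⟩ := hlink k' (mem_insert_of_mem hk')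
    have h1 : ∀ i, χ k' (att i) ↔ χ k' (moveAtt v p att i) := by
      intro i
      unfold moveAtt
      split_ifs with h
      · rw [h]; exact hL k' hk'
      · rfl
    exact ⟨i, j, by rw [← h1, ← h1]; exact hij⟩

end Identity

/-! ### The product of the factors as an integral of exponentials -/

section ProductOfVertices

theorem integrable_leg {B : ℂ} (hB : 0 < B.re) (E : ℂ) (x : ℝ) :
    Integrable fun α : ℝ => cexp (B * α + E * log (1 + exp α) - exp (x + α)) := by
  set e := max 0 E.re
  have he : 0 ≤ e := le_max_left _ _
  have h1 := (integrable_rexp_gamma hB (exp_pos x)).add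
    (integrable_rexp_gamma (σ := B.re + e) (by linarith) (exp_pos x))
  have hc : Continuous fun α : ℝ => log (1 + exp α) :=
    Continuous.log (by fun_prop) fun α => by positivity
  refine (h1.const_mul (exp e)).mono' (by fun_prop) (.of_forall fun α => ?_)
  rw [Complex.norm_exp]
  have h2 : (B * α + E * log (1 + exp α) - exp (x + α)).re =
      B.re * α + E.re * log (1 + exp α) - exp x * exp α := by
    rw [← exp_add]; simp [← Complex.ofReal_exp]
  have h3 : exp (E.re * log (1 + exp α)) ≤ exp e * (1 + exp (e * α)) := by
    have hl := log_one_add_exp_nonneg α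
    have h4 : E.re * log (1 + exp α) ≤ e * log (1 + exp α) :=
      mul_le_mul_of_nonneg_right (le_max_right _ _) hl
    have hlog2 : log 2 ≤ 1 := by linarith [Real.log_two_lt_d9]
    rcases le_total α 0 with h | h
    · have : log (1 + exp α) ≤ 1 := le_trans (Real.log_le_log (by positivity)
        (by have := Real.exp_le_one_iff.2 h; linarith)) hlog2
      calc _ ≤ exp (e * 1) := exp_le_exp.2 (h4.trans (by gcongr))
        _ ≤ exp e * (1 + exp (e * α)) := by
          rw [mul_one]; nlinarith [exp_pos e, exp_pos (e * α)]
    · have : log (1 + exp α) ≤ 1 + α := by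
        have h5 : log (2 * exp α) = log 2 + α := by
          rw [Real.log_mul two_ne_zero (Real.exp_ne_zero _), log_exp]
        have := Real.log_le_log (by positivity) (show 1 + exp α ≤ 2 * exp α by
          have := Real.one_le_exp h; linarith)
        linarith
      calc _ ≤ exp (e * (1 + α)) := exp_le_exp.2 (h4.trans (by gcongr))
        _ = exp e * exp (e * α) := by rw [← exp_add]; congr 1; ring
        _ ≤ exp e * (1 + exp (e * α)) := by gcongr; linarith
  rw [h2, show B.re * α + E.re * log (1 + exp α) - exp x * exp α =
    (B.re * α - exp x * exp α) + E.re * log (1 + exp α) by ring, exp_add]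
  calc _ ≤ exp (B.re * α - exp x * exp α) * (exp e * (1 + exp (e * α))) := by
        gcongr
    _ = _ := by
        simp only [Pi.add_apply]
        rw [show (B.re + e) * α - exp x * exp α =
          (B.re * α - exp x * exp α) + e * α by ring, exp_add]
        ring

variable {V : Type} [Fintype V] {J : V → Type} [∀ v, Fintype (J v)]

/-- The exponent of a product of vertex integrals. -/
def productExponent (A : V → ℂ) (B E : ∀ v, J v → ℂ) (p : (V → ℝ) × ((Σ v, J v) → ℝ)) : ℂ :=
  ∑ v, (A v * p.1 v - exp (p.1 v)) + ∑ k : Σ v, J v, (B k.1 k.2 * p.2 k +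
    E k.1 k.2 * log (1 + exp (p.2 k)) - exp (p.1 k.1 + p.2 k))

/-- Fubini for a product of vertex integrals. -/
theorem prod_vertexIntegral {A : V → ℂ} {B E : ∀ v, J v → ℂ}
    (hconv : ∀ v, VertexConv (A v) (B v) (E v)) :
    Integrable (fun p => cexp (productExponent A B E p)) ∧
      ∏ v, vertexIntegral (A v) (B v) (E v) = ∫ p, cexp (productExponent A B E p) := by
  set g : V → ℝ → ℂ := fun v x => cexp (A v * x - exp x)
  set φ : (k : Σ v, J v) → ℝ → ℝ → ℂ := fun k x α => cexp (B k.1 k.2 * α +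
    E k.1 k.2 * log (1 + exp α) - exp (x + α))
  have hφ : ∀ k x, Integrable (φ k x) := fun k x => integrable_leg ((hconv k.1).1 k.2) _ x
  have hsplit : ∀ p : (V → ℝ) × ((Σ v, J v) → ℝ), cexp (productExponent A B E p) =
      (∏ v, g v (p.1 v)) * ∏ k, φ k (p.1 k.1) (p.2 k) := by
    intro p
    simp only [productExponent, g, φ, Complex.exp_add, Complex.exp_sum]
  have hone : ∀ v x (α : J v → ℝ), cexp (vertexExponent (A v) (B v) (E v) (x, α)) =
      g v x * ∏ b, φ ⟨v, b⟩ x (α b) := by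
    intro v x α
    simp only [vertexExponent, g, φ, Complex.exp_add, Complex.exp_sum]
  have hmeas : AEStronglyMeasurable (fun p => cexp (productExponent A B E p))
      ((volume : Measure (V → ℝ)).prod (volume : Measure ((Σ v, J v) → ℝ))) := by
    refine Continuous.aestronglyMeasurable ?_
    have : ∀ k : Σ v, J v, Continuous fun p : (V → ℝ) × ((Σ v, J v) → ℝ) =>
        log (1 + exp (p.2 k)) := fun k =>
      Continuous.log (by fun_prop) fun p => by positivity
    unfold productExponent
    fun_prop
  -- the vertex integrals with the leg integrals done first
  have hv : ∀ v, Integrable (fun x => g v x * ∏ b, ∫ α, φ ⟨v, b⟩ x α) ∧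
      Integrable (fun x => ‖g v x‖ * ∏ b, ∫ α, ‖φ ⟨v, b⟩ x α‖) ∧
      vertexIntegral (A v) (B v) (E v) = ∫ x, g v x * ∏ b, ∫ α, φ ⟨v, b⟩ x α := by
    intro v
    have hi : Integrable (fun p : ℝ × (J v → ℝ) => cexp (vertexExponent (A v) (B v) (E v) p))
      (volume.prod volume) := integrable_vertex (hconv v)
    have e1 : ∀ x, ∫ α : J v → ℝ, cexp (vertexExponent (A v) (B v) (E v) (x, α)) =
        g v x * ∏ b, ∫ α, φ ⟨v, b⟩ x α := by
      intro x
      simp only [hone]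
      rw [integral_const_mul, integral_fintype_prod_volume_eq_prod (fun b α => φ ⟨v, b⟩ x α)]
    have e2 : ∀ x, ∫ α : J v → ℝ, ‖cexp (vertexExponent (A v) (B v) (E v) (x, α))‖ =
        ‖g v x‖ * ∏ b, ∫ α, ‖φ ⟨v, b⟩ x α‖ := by
      intro x
      simp only [hone, norm_mul, norm_prod]
      rw [integral_const_mul, integral_fintype_prod_volume_eq_prod (fun b α => ‖φ ⟨v, b⟩ x α‖)]
    refine ⟨?_, ?_, ?_⟩
    · simpa only [e1] using hi.integral_prod_left
    · simpa only [e2] using hi.norm.integral_prod_left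
    · rw [vertexIntegral]
      exact (integral_prod _ hi).trans (by simp only [e1])
  have e1 : ∀ ζ : V → ℝ, ∫ a, cexp (productExponent A B E (ζ, a)) =
      ∏ v, (g v (ζ v) * ∏ b, ∫ α, φ ⟨v, b⟩ (ζ v) α) := by
    intro ζ
    simp only [hsplit]
    rw [integral_const_mul, integral_fintype_prod_volume_eq_prod (fun k α => φ k (ζ k.1) α),
      prod_mul_distrib, Fintype.prod_sigma]
  have hint : Integrable (fun p => cexp (productExponent A B E p))
      ((volume : Measure (V → ℝ)).prod (volume : Measure ((Σ v, J v) → ℝ))) := by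
    rw [integrable_prod_iff hmeas]
    constructor
    · refine .of_forall fun ζ => ?_
      simp only [hsplit]
      exact (Integrable.fintype_prod_dep (f := fun k α => φ k (ζ k.1) α) fun k => hφ k _).const_mul _
    · have e2 : ∀ ζ : V → ℝ, ∫ a, ‖cexp (productExponent A B E (ζ, a))‖ =
          ∏ v, (‖g v (ζ v)‖ * ∏ b, ∫ α, ‖φ ⟨v, b⟩ (ζ v) α‖) := by
        intro ζ
        simp only [hsplit, norm_mul, norm_prod]
        rw [integral_const_mul, integral_fintype_prod_volume_eq_prod (fun k α => ‖φ k (ζ k.1) α‖),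
          prod_mul_distrib, Fintype.prod_sigma]
      simp only [e2]
      exact Integrable.fintype_prod_dep (f := fun v x => ‖g v x‖ * ∏ b, ∫ α, ‖φ ⟨v, b⟩ x α‖)
        fun v => (hv v).2.1
  refine ⟨hint, ?_⟩
  refine Eq.trans ?_ (integral_prod _ hint).symm
  simp only [e1]
  rw [integral_fintype_prod_volume_eq_prod (fun v x => g v x * ∏ b, ∫ α, φ ⟨v, b⟩ x α)]
  exact prod_congr rfl fun v _ => (hv v).2.2

end ProductOfVertices

namespace TreeDiagram
variable {n : ℕ} (D : TreeDiagram n)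

/-- The variables `(ζ, a)` of the integral representation of the pre-amplitude. -/
abbrev Params : Type := (D.V → ℝ) × (D.Link → ℝ)

/-- The logarithm of the transmission factor of a propagator. -/
def crossLog (a : D.Link → ℝ) (e : D.E) : ℝ := logRho (a (D.srcLink e)) + logRho (a (D.tgtLink e))

/-- The variable conjugate to the spectrum variable of a propagator. -/
def logLambda (p : D.Params) (e : D.E) : ℝ :=
  (p.2 (D.tgtLink e) + softplus (p.2 (D.tgtLink e)) + p.1 (D.tgt e) -
    (p.2 (D.srcLink e) + softplus (p.2 (D.srcLink e)) + p.1 (D.src e))) / 2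

/-- `(Δ_A + (r - 2) h) / 2`. -/
def vertexPower (d : ℕ) (Δ : Fin n → ℝ) (v : D.V) : ℝ :=
  (D.vertexDim Δ v + ((D.valency v : ℝ) - 2) * h d) / 2

/-- The logarithm of the density of the variables `(ζ, a)` at vanishing Mandelstam variables. -/
def vertexWeight (d : ℕ) (Δ : Fin n → ℝ) (p : D.Params) : ℝ :=
  ∑ v, (D.vertexPower d Δ v * p.1 v - exp (p.1 v)) +
    ∑ k, (h d * logRho (p.2 k) - exp (p.1 k.1 + p.2 k))

/-- The exponent of the integral representation of the pre-amplitude. -/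
def amplitudeExponent (d : ℕ) (Δ : Fin n → ℝ) (c s : D.E → ℂ) (p : D.Params) : ℂ :=
  D.vertexWeight d Δ p - ∑ e, s e * D.crossLog p.2 e + ∑ e, c e * D.logLambda p e

/-- Representation of the pre-amplitude by an integral of exponentials. -/
theorem treeProduct_eq_integral (d : ℕ) {Δ : Fin n → ℝ} (hΔ : D.Convergent d Δ) {c : D.E → ℂ}
    (hc : ∀ e, (c e).re = 0) {δ : Fin n → Fin n → ℂ} (hδ : ∀ e, (D.mandelstam Δ δ e).re < h d) :
    Integrable (fun p => cexp (D.amplitudeExponent d Δ c (D.mandelstam Δ δ) p)) ∧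
      treeProduct d (correction d) D Δ c δ =
        ∫ p, cexp (D.amplitudeExponent d Δ c (D.mandelstam Δ δ) p) := by
  set s := D.mandelstam Δ δ with hs
  set A : D.V → ℂ := fun v => ((D.vertexDim Δ v : ℂ) + ((Fintype.card (D.Incident v) : ℂ) - 2) * h d +
    ∑ b : D.Incident v, c b.1) / 2 with hA
  set B : ∀ v, D.Incident v → ℂ := fun v b => (h d + c b.1 - s b.1) / 2 with hB
  set T : ∀ v, Finset (D.Incident v) := fun v => univ.filter fun b => D.src b.1 = v with hT
  set c' : ∀ v, D.Incident v → ℂ := fun v b => if b ∈ T v then -c b.1 else c b.1 with hc'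
  set B' : ∀ v, D.Incident v → ℂ := fun v b => if b ∈ T v then B v b - c b.1 else B v b with hB'
  set A' : D.V → ℂ := fun v => A v - ∑ b ∈ T v, c b.1 with hA'
  have hpow : ∀ v, 0 < D.vertexPower d Δ v := fun v => by
    have := hΔ.vertex v; unfold vertexPower; linarith
  have hAre : ∀ v, (A v).re = D.vertexPower d Δ v := by
    intro v; simp [hA, hc, vertexPower, valency]
  have hBre : ∀ v b, 0 < (B v b).re := by
    intro v b; have := hδ b.1; simp [hB, hc]; linarith
  have hB're : ∀ v b, 0 < (B' v b).re := by
    intro v b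
    have := hBre v b
    simp only [hB']
    split_ifs <;> simp [hc, this]
  have hA're : ∀ v, (A' v).re = D.vertexPower d Δ v := by
    intro v; simp [hA', hAre, hc]
  have hconv : ∀ v, VertexConv (A v) (B v) ((fun b : D.Incident v => c b.1) - B v) := by
    intro v
    refine ⟨hBre v, ?_⟩
    rw [hAre]
    simpa [hc] using hpow v
  have hconv' : ∀ v, VertexConv (A' v) (B' v) (c' v - B' v) := by
    intro v
    refine ⟨hB're v, ?_⟩
    rw [hA're]
    have : ∀ b, (B' v b + (c' v - B' v) b).re = 0 := by
      intro b
      simp only [Pi.sub_apply, add_sub_cancel, hc']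
      split_ifs <;> simp [hc]
    simp only [this, max_self, sum_const_zero]
    exact hpow v
  have hvertex : ∀ v, vertexGamma d (D.vertexDim Δ v : ℂ) (fun a : D.Incident v => c a.1) *
      correction d (D.Incident v) (D.vertexDim Δ v : ℂ) (fun a => c a.1) (fun a => s a.1) =
      (∏ b, (Gamma (B' v b))⁻¹) * vertexIntegral (A' v) (B' v) (c' v - B' v) := by
    intro v
    have hne : vertexGamma d (D.vertexDim Δ v : ℂ) (fun a : D.Incident v => c a.1) ≠ 0 := by
      refine prod_ne_zero_iff.2 fun σ _ => Complex.Gamma_ne_zero_of_re_pos ?_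
      have := hpow v
      have h0 : (∑ i : D.Incident v, ((σ i : ℤ) : ℂ) * (c i.1 / 2)).re = 0 := by
        simp [hc]
      rw [Complex.add_re, h0]
      unfold vertexPower valency at this
      simpa using this
    rw [correction_eq d (A := A v) (B := B v) rfl (fun b => rfl) (hconv v), ← mul_assoc, ← mul_assoc,
      mul_inv_cancel₀ hne, one_mul]
    have href : (∏ b, Gamma (B v b - c b.1)) *
        vertexIntegral (A v) (B v) ((fun b => c b.1) - B v) =
        (∏ b, Gamma (if b ∈ T v then B v b else B v b - c b.1)) *
          vertexIntegral (A' v) (B' v) (c' v - B' v) := by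
      convert vertexIntegral_reflect (A := A v) (B := B v) (c := fun b => c b.1)
        ((hpow v).trans_eq (hAre v).symm) (hBre v) (fun b => hc b.1) (T v)
    have h1 : ∏ b, Gamma (B v b - c b.1) ≠ 0 := prod_ne_zero_iff.2 fun b _ =>
      Complex.Gamma_ne_zero_of_re_pos (by have := hBre v b; simpa [hc] using this)
    have h2 : legNorm (B v) * ∏ b, Gamma (if b ∈ T v then B v b else B v b - c b.1) =
        (∏ b, (Gamma (B' v b))⁻¹) * ∏ b, Gamma (B v b - c b.1) := by
      rw [legNorm, ← prod_mul_distrib, ← prod_mul_distrib]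
      refine prod_congr rfl fun b _ => ?_
      have h3 : Gamma (B v b) ≠ 0 := Complex.Gamma_ne_zero_of_re_pos (hBre v b)
      have h4 : Gamma (B v b - c b.1) ≠ 0 :=
        Complex.Gamma_ne_zero_of_re_pos (by have := hBre v b; simpa [hc] using this)
      simp only [hB']
      split_ifs
      · rw [inv_mul_cancel₀ h3, inv_mul_cancel₀ h4]
      · rfl
    refine mul_left_cancel₀ h1 ?_
    have e0 : (∏ b, (Gamma (B v b))⁻¹) = legNorm (B v) := rfl
    linear_combination legNorm (B v) * href + vertexIntegral (A' v) (B' v) (c' v - B' v) * h2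
  have hprop : ∏ e, propagatorFactor d (c e) (s e) ≠ 0 := by
    refine prod_ne_zero_iff.2 fun e _ => mul_ne_zero ?_ ?_ <;>
    · refine Complex.Gamma_ne_zero_of_re_pos ?_
      have := hδ e
      simp [hc]; linarith
  have hlegs : ∏ v, ∏ b, (Gamma (B' v b))⁻¹ = (∏ e, propagatorFactor d (c e) (s e))⁻¹ := by
    rw [← Fintype.prod_sigma (fun k : D.Link => (Gamma (B' k.1 k.2))⁻¹), D.prod_link,
      ← prod_inv_distrib]
    refine prod_congr rfl fun e _ => ?_
    have e1 : B' (D.srcLink e).1 (D.srcLink e).2 = (h d - c e - s e) / 2 := by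
      simp [hB', hT, hB, srcLink]; ring
    have e2 : B' (D.tgtLink e).1 (D.tgtLink e).2 = (h d + c e - s e) / 2 := by
      simp [hB', hT, hB, tgtLink, D.src_ne_tgt e]
    rw [e1, e2, propagatorFactor, mul_inv, mul_comm]
  obtain ⟨hi, hprod⟩ := prod_vertexIntegral (A := A') (B := B') (E := fun v => c' v - B' v) hconv'
  have hexp : ∀ p : D.Params, productExponent A' B' (fun v => c' v - B' v) p =
      D.amplitudeExponent d Δ c s p := by
    intro p
    have h1 : ∑ v, (A' v * p.1 v - exp (p.1 v)) =
        ∑ v, ((D.vertexPower d Δ v : ℂ) * p.1 v - exp (p.1 v)) +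
          ∑ k : D.Link, c' k.1 k.2 / 2 * p.1 k.1 := by
      rw [Fintype.sum_sigma, ← sum_add_distrib]
      refine sum_congr rfl fun v _ => ?_
      have : A' v = D.vertexPower d Δ v + ∑ b, c' v b / 2 := by
        simp only [hA', hA, hc', vertexPower, valency]
        rw [← Finset.sum_div, Finset.sum_ite, sum_neg_distrib, Finset.filter_mem_eq_inter,
          Finset.univ_inter, ← sum_filter_add_sum_filter_not univ (· ∈ T v)
          (fun b : D.Incident v => c b.1), Finset.filter_mem_eq_inter, Finset.univ_inter]
        push_cast
        ring
      rw [this, add_mul, sum_mul]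
      ring
    have h2 : ∀ k : D.Link, c' k.1 k.2 / 2 * p.1 k.1 + (B' k.1 k.2 * p.2 k +
        (c' k.1 k.2 - B' k.1 k.2) * log (1 + exp (p.2 k)) - exp (p.1 k.1 + p.2 k)) =
        (((h d * logRho (p.2 k) - exp (p.1 k.1 + p.2 k) : ℝ) : ℂ) - s k.2.1 * logRho (p.2 k)) +
        c' k.1 k.2 * ((p.2 k + softplus (p.2 k) + p.1 k.1 : ℝ) : ℂ) / 2 := by
      intro k
      have : B' k.1 k.2 = (h d + c' k.1 k.2 - s k.2.1) / 2 := by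
        simp only [hB', hc', hB]
        split_ifs <;> ring
      rw [this]
      simp only [logRho, softplus]
      push_cast
      ring
    simp only [productExponent, Pi.sub_apply]
    rw [h1, add_assoc, ← sum_add_distrib, sum_congr rfl fun k _ => h2 k,
      sum_add_distrib,
      sum_sub_distrib (f := fun k : D.Link => ((h d * logRho (p.2 k) -
        exp (p.1 k.1 + p.2 k) : ℝ) : ℂ)) (g := fun k => s k.2.1 * (logRho (p.2 k) : ℂ)),
      D.sum_link (fun k => s k.2.1 * (logRho (p.2 k) : ℂ)),
      D.sum_link (fun k => c' k.1 k.2 * ((p.2 k + softplus (p.2 k) + p.1 k.1 : ℝ) : ℂ) / 2),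
      amplitudeExponent, vertexWeight]
    have h3 : ∀ e, c' (D.srcLink e).1 (D.srcLink e).2 = -c e := fun e => by
      simp [hc', hT, srcLink]
    have h4 : ∀ e, c' (D.tgtLink e).1 (D.tgtLink e).2 = c e := fun e => by
      simp [hc', hT, tgtLink, D.src_ne_tgt e]
    have h5 : ∀ e, -c e * ((p.2 (D.srcLink e) + softplus (p.2 (D.srcLink e)) +
        p.1 (D.srcLink e).1 : ℝ) : ℂ) / 2 + c e * ((p.2 (D.tgtLink e) + softplus (p.2 (D.tgtLink e)) +
        p.1 (D.tgtLink e).1 : ℝ) : ℂ) / 2 = c e * D.logLambda p e := by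
      intro e
      simp only [logLambda, srcLink, tgtLink]
      push_cast
      ring
    have h6 : ∀ e, s (D.srcLink e).2.1 * (logRho (p.2 (D.srcLink e)) : ℂ) +
        s (D.tgtLink e).2.1 * (logRho (p.2 (D.tgtLink e)) : ℂ) = s e * D.crossLog p.2 e := by
      intro e
      simp only [crossLog, srcLink, tgtLink]
      push_cast
      ring
    simp only [h3, h4, h5, h6]
    push_cast
    ring
  simp only [hexp] at hi hprod
  refine ⟨hi, ?_⟩
  rw [← hprod, treeProduct, prod_congr rfl fun v _ => hvertex v, prod_mul_distrib, hlegs,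
    mul_inv_cancel_left₀ hprop]

end TreeDiagram

/-! ### The Symanzik star formula -/

section Pairs
variable {n : ℕ}

/-- The pairs of labels whose Mellin variables are solved for: `(1, 2)` and `(0, j)`, `j ≥ 1`,
labelled by `0` and by `j`. -/
def dependentPair (hn : 3 ≤ n) (r : Fin n) : Fin n × Fin n :=
  if r.val = 0 then (⟨1, by omega⟩, ⟨2, by omega⟩) else (⟨0, by omega⟩, r)

theorem dependentPair_lt (hn : 3 ≤ n) (r : Fin n) : (dependentPair hn r).1 < (dependentPair hn r).2 := by
  unfold dependentPair
  split_ifs with h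
  · simp
  · simp only [Fin.lt_def]; omega

theorem prod_pairs {M : Type*} [CommMonoid M] (hn : 3 ≤ n) (f : Fin n → Fin n → M) :
    ∏ i, ∏ j with i < j, f i j =
      (∏ r, f (dependentPair hn r).1 (dependentPair hn r).2) * ∏ q : MellinIndex n, f q.1.1 q.1.2 := by
  set P : Fin n × Fin n → Prop := fun p => 1 ≤ p.1.val ∧ p.1 < p.2 ∧ ¬ (p.1.val = 1 ∧ p.2.val = 2)
  have h0 : ∏ i, ∏ j with i < j, f i j = ∏ p : Fin n × Fin n with p.1 < p.2, f p.1 p.2 := by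
    simp only [Finset.prod_filter]
    rw [Fintype.prod_prod_type]
  rw [h0, ← Finset.prod_filter_mul_prod_filter_not _ P, mul_comm]
  congr 1
  · rw [Finset.filter_filter]
    symm
    refine Finset.prod_nbij (dependentPair hn) ?_ ?_ ?_ fun _ _ => rfl
    · intro r _
      simp only [mem_filter, mem_univ, true_and]
      refine ⟨dependentPair_lt hn r, ?_⟩
      simp only [P, dependentPair]
      split_ifs <;> simp
    · intro r _ r' _ h
      simp only [dependentPair] at h
      split_ifs at h <;> simp_all [Fin.ext_iff]
    · rintro ⟨a, b⟩ hab
      simp only [P, Finset.coe_filter, mem_univ, true_and, Set.mem_ofPred_eq, not_and_or] at hab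
      obtain ⟨h1, h2 | h2 | h2⟩ := hab
      · refine ⟨b, by simp, ?_⟩
        have : b.val ≠ 0 := by rw [Fin.lt_def] at h1; omega
        simp [dependentPair, this, Fin.ext_iff]; omega
      · exact absurd h1 h2
      · refine ⟨⟨0, by omega⟩, by simp, ?_⟩
        rw [not_or, not_not, not_not] at h2
        simp [dependentPair, Prod.ext_iff, Fin.ext_iff, h2.1, h2.2]
  · rw [Finset.filter_filter]
    symm
    refine Finset.prod_nbij Subtype.val ?_ Subtype.val_injective.injOn ?_ fun _ _ => rfl
    · intro q _
      exact mem_filter.2 ⟨mem_univ _, q.2.2.1, q.2⟩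
    · intro p hp
      simp only [Finset.coe_filter, mem_univ, true_and, Set.mem_ofPred_eq] at hp
      exact ⟨⟨p, hp.2⟩, by simp, rfl⟩

theorem sum_pairs {M : Type*} [AddCommMonoid M] (hn : 3 ≤ n) (f : Fin n → Fin n → M) :
    ∑ i, ∑ j with i < j, f i j =
      (∑ r, f (dependentPair hn r).1 (dependentPair hn r).2) + ∑ q : MellinIndex n, f q.1.1 q.1.2 :=
  prod_pairs (M := Multiplicative M) hn f

/-- For a symmetric matrix with vanishing row sums, the sum over pairs of `δ_ij (v_i + v_j)` involves
only the diagonal. -/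
theorem sum_pairs_add {δ : Fin n → Fin n → ℂ} (hsymm : ∀ i j, δ i j = δ j i)
    (hsum : ∀ i, ∑ j, δ i j = 0) (v : Fin n → ℂ) :
    ∑ i, ∑ j with i < j, δ i j * (v i + v j) = -∑ i, δ i i * v i := by
  have h1 : ∑ i, ∑ j with i < j, δ i j * (v i + v j) =
      ∑ i, ∑ j with i < j, δ i j * v i + ∑ i, ∑ j with j < i, δ i j * v i := by
    have : ∑ i, ∑ j with j < i, δ i j * v i = ∑ i, ∑ j with i < j, δ i j * v j := by
      simp only [sum_filter]
      rw [sum_comm]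
      simp only [hsymm]
    rw [this, ← sum_add_distrib]
    refine sum_congr rfl fun i _ => ?_
    rw [← sum_add_distrib]
    exact sum_congr rfl fun j _ => mul_add _ _ _
  rw [h1, ← sum_add_distrib, ← sum_neg_distrib]
  refine sum_congr rfl fun i _ => ?_
  have h2 := hsum i
  rw [← sum_filter_add_sum_filter_not _ (fun j => i < j),
    ← sum_filter_add_sum_filter_not (univ.filter fun j => ¬ i < j) (fun j => j < i),
    Finset.filter_filter, Finset.filter_filter] at h2
  have h3 : (univ.filter fun j => ¬ i < j ∧ j < i) = univ.filter fun j => j < i := by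
    ext j; simp; exact fun h => h.le
  have h4 : (univ.filter fun j => ¬ i < j ∧ ¬ j < i) = {i} := by
    ext j; simp; exact ⟨fun h => le_antisymm h.1 h.2, fun h => by simp [h]⟩
  rw [h3, h4, Finset.sum_singleton] at h2
  rw [← sum_mul, ← sum_mul]
  linear_combination v i * h2

/-- The sums of the variables over the dependent pairs. -/
def pairSums (hn : 3 ≤ n) (v : Fin n → ℝ) (r : Fin n) : ℝ :=
  v (dependentPair hn r).1 + v (dependentPair hn r).2

/-- The map to the sums over the dependent pairs has determinant `±2`. -/
theorem map_pairSums (hn : 3 ≤ n) :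
    Measurable (pairSums hn) ∧
    Measure.map (pairSums hn) (volume : Measure (Fin n → ℝ)) = ofReal (1 / 2) • volume := by
  have hmeas : Measurable (pairSums hn) := by unfold pairSums; fun_prop
  refine ⟨hmeas, ?_⟩
  set z : Fin n := ⟨0, by omega⟩ with hz
  set o : Fin n := ⟨1, by omega⟩ with ho
  set w : Fin n := ⟨2, by omega⟩ with hw
  -- a shear followed by an upper triangular map
  set S : Matrix (Fin n) (Fin n) ℝ := fun i j => if i = j then 1 else if j = z then 1 else 0 with hS
  set T : Matrix (Fin n) (Fin n) ℝ := fun i j =>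
    if i = z then (if j = z then -2 else if j = o then 1 else if j = w then 1 else 0)
    else if i = j then 1 else 0 with hT
  have hzle : ∀ j : Fin n, z ≤ j := fun j => by rw [Fin.le_def]; exact Nat.zero_le _
  have hSdet : S.det = 1 := by
    rw [Matrix.det_of_isLowerTriangular]
    · simp [hS]
    · intro i j hij
      have hij' : i < j := hij
      have h1 : j ≠ z := fun h => absurd (hzle i) (not_le.2 (h ▸ hij'))
      simp [hS, hij'.ne, h1]
  have hTdet : T.det = -2 := by
    rw [Matrix.det_of_isUpperTriangular]
    · rw [Finset.prod_eq_single z]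
      · simp [hT]
      · intro b _ hb; simp [hT, hb]
      · simp
    · intro i j hij
      have hij' : j < i := hij
      have h1 : i ≠ z := fun h => absurd (hzle j) (not_le.2 (h ▸ hij'))
      simp [hT, hij'.ne', h1]
  have hfac : pairSums hn = Matrix.toLin' (T * S) := by
    ext v r
    rw [Matrix.toLin'_mul, LinearMap.comp_apply, Matrix.toLin'_apply, Matrix.toLin'_apply]
    have hSv : ∀ i, Matrix.mulVec S v i = if i = z then v z else v i + v z := by
      intro i
      simp only [Matrix.mulVec, dotProduct, hS]
      split_ifs with h
      · subst h
        rw [sum_eq_single z]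
        · simp
        · intro b _ hb; simp [hb, hb.symm]
        · simp
      · rw [Finset.sum_eq_add i z h]
        · simp
        · intro b _ hb; simp [hb.1.symm, hb.2]
        · simp
        · simp
    simp only [Matrix.mulVec, dotProduct] at hSv ⊢
    simp only [hSv]
    by_cases hr : r = z
    · subst hr
      have hoz : o ≠ z := by simp [ho, hz]
      have hwz : w ≠ z := by simp [hw, hz]
      have how : o ≠ w := by simp [ho, hw]
      have h1 : ∀ j, T z j * (if j = z then v z else v j + v z) =
          (if j = z then -2 * v z else 0) + (if j = o then v o + v z else 0) +
            (if j = w then v w + v z else 0) := by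
        intro j
        simp only [hT]
        by_cases a1 : j = z
        · simp [a1, hoz.symm, hwz.symm]
        by_cases a2 : j = o
        · simp [a2, hoz, how]
        by_cases a3 : j = w
        · simp [a3, hwz, how.symm]
        simp [a1, a2, a3]
      simp only [h1, sum_add_distrib, Finset.sum_ite_eq', mem_univ, if_true]
      have : dependentPair hn z = (o, w) := by simp [dependentPair, hz, ho, hw]
      simp only [pairSums, this]
      ring
    · have h2 : r.val ≠ 0 := fun h => hr (Fin.ext h)
      rw [sum_eq_single r]
      · simp [hT, hr, pairSums, dependentPair, h2, ← hz]; ring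
      · intro b _ hb; simp [hT, hr, hb.symm]
      · simp
  have hdet : (T * S).det = -2 := by rw [Matrix.det_mul, hSdet, hTdet, mul_one]
  have := Real.map_matrix_volume_pi_eq_smul_volume_pi (M := T * S) (by rw [hdet]; norm_num)
  rw [hfac, this, hdet]
  norm_num

theorem integral_comp_pairSums {E : Type*} [NormedAddCommGroup E] [NormedSpace ℝ E] (hn : 3 ≤ n)
    {f : (Fin n → ℝ) → E} (hf : Integrable f) :
    Integrable (fun v => f (pairSums hn v)) ∧
      ∫ v, f (pairSums hn v) = (1 / 2 : ℝ) • ∫ x, f x := by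
  obtain ⟨hm, hmap⟩ := map_pairSums hn
  have hf' : Integrable f (Measure.map (pairSums hn) volume) := by
    rw [hmap]; exact hf.smul_measure ENNReal.ofReal_ne_top
  refine ⟨hf'.comp_measurable hm, ?_⟩
  rw [← integral_map hm.aemeasurable hf'.aestronglyMeasurable, hmap, integral_smul_measure,
    ENNReal.toReal_ofReal (by norm_num)]

theorem continuous_mellinMatrix (i j : Fin n) : Continuous fun t : MellinIndex n → ℝ => mellinMatrix t i j := by
  have : ∀ i j : Fin n, Continuous fun t : MellinIndex n → ℝ => mellinBlock t i j := by
    intro i j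
    unfold mellinBlock
    split_ifs <;> fun_prop
  unfold mellinMatrix
  have h1 := this i j
  have h2 := fun k => this j k
  have h3 := fun k => this i k
  split_ifs <;> fun_prop

theorem continuous_contourPoint (δ₀ : Fin n → Fin n → ℝ) (i j : Fin n) :
    Continuous fun t : MellinIndex n → ℝ => contourPoint δ₀ t i j := by
  have := continuous_mellinMatrix i j
  unfold contourPoint
  fun_prop

/-- Real symmetric matrices with vanishing row sums and positive off-diagonal entries. -/
structure IsMellinPoint (δ₀ : Fin n → Fin n → ℝ) : Prop where
  symm : ∀ i j, δ₀ i j = δ₀ j i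
  sum : ∀ i, ∑ j, δ₀ i j = 0
  pos : ∀ i j, i ≠ j → 0 < δ₀ i j

/-- The potential of the Symanzik star integral, with couplings `exp (L i j)`. -/
def pairPotential (L : Fin n → Fin n → ℝ) (v : Fin n → ℝ) : ℝ :=
  ∑ i, ∑ j with i < j, exp (v i + v j + L i j)

/-- The Symanzik star formula, with `v i` the logarithms of the Schwinger parameters. The `n` dependent
`Γ` functions are written as integrals over the sums of the `v i`; the integrals over the independent
`δ_ij` are then inverse Mellin transforms. -/
theorem symanzik (hn : 3 ≤ n) {δ₀ : Fin n → Fin n → ℝ} (hδ : IsMellinPoint δ₀)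
    (L : Fin n → Fin n → ℝ) :
    Integrable (fun t => ∏ i, ∏ j with i < j, Gamma (contourPoint δ₀ t i j) *
        cexp (-contourPoint δ₀ t i j * L i j)) ∧
    Integrable (fun v => exp (∑ i, -δ₀ i i * v i - pairPotential L v)) ∧
    ∫ t, ∏ i, ∏ j with i < j, Gamma (contourPoint δ₀ t i j) *
        cexp (-contourPoint δ₀ t i j * L i j) =
      2 * (2 * pi) ^ Fintype.card (MellinIndex n) *
        ((∫ v, exp (∑ i, -δ₀ i i * v i - pairPotential L v) : ℝ) : ℂ) := by
  set a : Fin n → Fin n := fun r => (dependentPair hn r).1 with ha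
  set b : Fin n → Fin n := fun r => (dependentPair hn r).2 with hb
  have hab : ∀ r, a r ≠ b r := fun r => (dependentPair_lt hn r).ne
  have hqne : ∀ q : MellinIndex n, q.1.1 ≠ q.1.2 := fun q => q.2.2.1.ne
  have hre : ∀ t i j, (contourPoint δ₀ t i j).re = δ₀ i j := fun t i j => by simp [contourPoint]
  have hq : ∀ t (q : MellinIndex n), contourPoint δ₀ t q.1.1 q.1.2 = δ₀ q.1.1 q.1.2 + I * t q :=
    fun t q => by rw [contourPoint, mellinMatrix_index]
  set g : (MellinIndex n → ℝ) → ℂ := fun t => ∏ q : MellinIndex n,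
    Gamma (δ₀ q.1.1 q.1.2 + I * t q) *
      cexp (-(δ₀ q.1.1 q.1.2 + I * t q) * L q.1.1 q.1.2) with hg
  have hgi : Integrable g := by
    refine Integrable.fintype_prod (f := fun (q : MellinIndex n) (t : ℝ) =>
      Gamma (δ₀ q.1.1 q.1.2 + I * t) *
        cexp (-(δ₀ q.1.1 q.1.2 + I * t) * L q.1.1 q.1.2)) fun q => ?_
    refine (integrable_Gamma_vertical (hδ.pos _ _ (hqne q))).mul_bdd
      (c := exp (-δ₀ q.1.1 q.1.2 * L q.1.1 q.1.2)) (by fun_prop)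
      (.of_forall fun t => ?_)
    rw [Complex.norm_exp]
    simp
  set k : (MellinIndex n → ℝ) → (Fin n → ℝ) → ℂ := fun t x =>
    ∏ r, cexp (contourPoint δ₀ t (a r) (b r) * x r -
      (exp (L (a r) (b r)) : ℝ) * cexp (x r)) with hk
  have hki : ∀ t, Integrable (k t) := fun t =>
    Integrable.fintype_prod (f := fun r (x : ℝ) => cexp (contourPoint δ₀ t (a r) (b r) * x -
      (exp (L (a r) (b r)) : ℝ) * cexp x)) fun r =>
      integrable_cexp_gamma (by rw [hre]; exact hδ.pos _ _ (hab r)) (by rw [Complex.ofReal_re]; exact exp_pos _)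
  have hkint : ∀ t, ∫ x, k t x = ∏ r, Gamma (contourPoint δ₀ t (a r) (b r)) *
      cexp (-contourPoint δ₀ t (a r) (b r) * L (a r) (b r)) := by
    intro t
    simp only [hk]
    rw [integral_fintype_prod_volume_eq_prod (fun r (x : ℝ) =>
      cexp (contourPoint δ₀ t (a r) (b r) * x -
      (exp (L (a r) (b r)) : ℝ) * cexp x))]
    refine prod_congr rfl fun r _ => ?_
    rw [integral_cexp_gamma_real (by rw [hre]; exact hδ.pos _ _ (hab r)) (exp_pos _), log_exp]
  have hknorm : ∀ t x, ‖k t x‖ = ‖k 0 x‖ := by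
    intro t x
    simp only [hk, norm_prod, Complex.norm_exp, Complex.sub_re, Complex.re_mul_ofReal, hre]
  have hkc : Continuous fun p : (MellinIndex n → ℝ) × (Fin n → ℝ) => k p.1 p.2 := by
    have := fun r => continuous_contourPoint δ₀ (a r) (b r)
    simp only [hk]
    fun_prop
  -- both orders of integration of `F` are evaluated
  set F : (MellinIndex n → ℝ) × (Fin n → ℝ) → ℂ := fun p => g p.1 * k p.1 (pairSums hn p.2) with hF
  have hFi : Integrable F (volume.prod volume) := by
    have h1 : Integrable (fun p : (MellinIndex n → ℝ) × (Fin n → ℝ) => g p.1 * k 0 (pairSums hn p.2))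
      (volume.prod volume) := hgi.mul_prod (integral_comp_pairSums hn (hki 0)).1
    refine h1.mono ?_ (.of_forall fun p => ?_)
    · refine (hgi.aestronglyMeasurable.comp_fst).mul ?_
      have : Continuous fun p : (MellinIndex n → ℝ) × (Fin n → ℝ) => k p.1 (pairSums hn p.2) := by
        have h2 : Continuous (pairSums hn) := by unfold pairSums; fun_prop
        exact hkc.comp (continuous_fst.prodMk (h2.comp continuous_snd))
      exact this.aestronglyMeasurable
    · simp only [hF, norm_mul, hknorm p.1, le_refl]
  have e1 : ∀ t, ∫ v, F (t, v) = (1 / 2 : ℝ) * ∏ i, ∏ j with i < j, Gamma (contourPoint δ₀ t i j) *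
        cexp (-contourPoint δ₀ t i j * L i j) := by
    intro t
    simp only [hF]
    rw [integral_const_mul, (integral_comp_pairSums hn (hki t)).2, hkint, prod_pairs hn]
    simp only [hg, hq, Complex.real_smul]
    ring
  have e2 : ∀ v, ∫ t, F (t, v) = (2 * pi) ^ Fintype.card (MellinIndex n) *
      ((exp (∑ i, -δ₀ i i * v i - pairPotential L v) : ℝ) : ℂ) := by
    intro v
    have h1 : ∀ t, F (t, v) = cexp (∑ i, -δ₀ i i * v i -
        ∑ r, exp (v (a r) + v (b r) + L (a r) (b r))) *
        ∏ q : MellinIndex n, Gamma (δ₀ q.1.1 q.1.2 + I * t q) *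
          cexp (-(δ₀ q.1.1 q.1.2 + I * t q) *
            ((v q.1.1 + v q.1.2 + L q.1.1 q.1.2 : ℝ) : ℂ)) := by
      intro t
      have h2 := sum_pairs_add (δ := contourPoint δ₀ t)
        (fun i j => by simp only [contourPoint, hδ.symm i j, mellinMatrix_comm t i j])
        (fun i => by
          simp only [contourPoint]
          rw [sum_add_distrib, ← mul_sum, ← Complex.ofReal_sum, ← Complex.ofReal_sum,
            hδ.sum, sum_mellinMatrix hn]
          simp) (fun i => (v i : ℂ))
      rw [sum_pairs hn] at h2
      have h3 : ∀ i, contourPoint δ₀ t i i = δ₀ i i := fun i => by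
        simp [contourPoint, mellinMatrix_self]
      simp only [h3, hq] at h2
      simp only [hF, hg, hk, prod_mul_distrib, ← Complex.exp_sum]
      rw [mul_assoc, mul_left_comm (cexp _), ← Complex.exp_add,
        ← Complex.exp_add]
      congr 2
      have h4 : ∑ r, (contourPoint δ₀ t (a r) (b r) * pairSums hn v r -
          (exp (L (a r) (b r)) : ℝ) * cexp (pairSums hn v r)) =
          ∑ r, contourPoint δ₀ t (a r) (b r) * (v (a r) + v (b r)) -
            ((∑ r, exp (v (a r) + v (b r) + L (a r) (b r)) : ℝ) : ℂ) := by
        rw [Complex.ofReal_sum, ← sum_sub_distrib]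
        refine sum_congr rfl fun r _ => ?_
        have h7 : pairSums hn v r = v (a r) + v (b r) := rfl
        rw [h7, exp_add _ (L (a r) (b r)), Complex.ofReal_mul, Complex.ofReal_exp (_ + _),
          Complex.ofReal_add]
        ring
      have h5 : ∑ q : MellinIndex n, -(δ₀ q.1.1 q.1.2 + I * t q) *
          ((v q.1.1 + v q.1.2 + L q.1.1 q.1.2 : ℝ) : ℂ) =
          ∑ q : MellinIndex n, -(δ₀ q.1.1 q.1.2 + I * t q) * L q.1.1 q.1.2 -
          ∑ q : MellinIndex n, (δ₀ q.1.1 q.1.2 + I * t q) * (v q.1.1 + v q.1.2) := by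
        rw [← sum_sub_distrib]
        refine sum_congr rfl fun q _ => ?_
        push_cast
        ring
      have h6 : ((∑ i, -δ₀ i i * v i : ℝ) : ℂ) = -∑ i, (δ₀ i i : ℂ) * v i := by
        push_cast
        rw [← sum_neg_distrib]
        exact sum_congr rfl fun i _ => by ring
      rw [h4, h5, h6]
      linear_combination h2
    simp only [h1]
    rw [integral_const_mul, integral_fintype_prod_volume_eq_prod (fun (q : MellinIndex n) (t : ℝ) =>
      Gamma (δ₀ q.1.1 q.1.2 + I * t) *
          cexp (-(δ₀ q.1.1 q.1.2 + I * t) *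
            ((v q.1.1 + v q.1.2 + L q.1.1 q.1.2 : ℝ) : ℂ)))]
    simp only [integral_Gamma_vertical (hδ.pos _ _ (hqne _))]
    rw [prod_mul_distrib, Finset.prod_const, card_univ, mul_left_comm, ← Complex.exp_sum,
      ← Complex.exp_add, Complex.ofReal_exp, pairPotential, sum_pairs hn]
    congr 2
    push_cast
    rw [sum_neg_distrib]
    ring
  have hpi : ((2 * pi : ℂ)) ^ Fintype.card (MellinIndex n) ≠ 0 :=
    pow_ne_zero _ (by exact_mod_cast (by positivity : (2 * pi) ≠ 0))
  refine ⟨?_, ?_, ?_⟩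
  · have := hFi.integral_prod_left
    simp only [e1] at this
    refine (this.const_mul 2).congr (.of_forall fun t => ?_)
    push_cast; ring
  · have := hFi.integral_prod_right
    simp only [e2] at this
    refine (this.const_mul (((2 * pi : ℂ)) ^ Fintype.card (MellinIndex n))⁻¹).re.congr
      (.of_forall fun v => ?_)
    simp only [inv_mul_cancel_left₀ hpi]
    exact Complex.ofReal_re _
  · have h1 := integral_integral_swap (f := fun t v => F (t, v)) hFi
    simp only [e1, e2] at h1
    rw [integral_const_mul, integral_const_mul, integral_complex_ofReal] at h1
    push_cast at h1 ⊢
    linear_combination 2 * h1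

end Pairs

/-! ### Real points of the Mellin domain -/

section Legs
variable {X : Type*} [Fintype X]

/-- A symmetric matrix supported on `s`, with vanishing diagonal, positive entries off the diagonal,
and row sums `ℓ`, no row of which consists of a single entry. -/
structure LegMatrix (s : Finset X) (ℓ : X → ℝ) (M : X → X → ℝ) : Prop where
  nonempty : s.Nonempty
  symm : ∀ x y, M x y = M y x
  zero : ∀ x ∉ s, ∀ y, M x y = 0
  diag : ∀ x, M x x = 0
  pos : ∀ x ∈ s, ∀ y ∈ s, x ≠ y → 0 < M x y
  sum : ∀ x ∈ s, ∑ y, M x y = ℓ x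
  lt : ∀ x ∈ s, ∀ y, M x y < ℓ x

/-- The row sums determine a rank-one solution: `M x y = q ψ x ψ y` with `q ψ² - ψ + ℓ = 0` and
`q ∑ ψ = 1`.  All `ψ` are the smaller roots of the quadratic equation, or all but the one of the
largest `ℓ`. -/
theorem exists_quadratic_roots {s : Finset X} (hs : s.Nonempty) {ℓ : X → ℝ} (hℓ : ∀ x ∈ s, 0 < ℓ x)
    (hlt : ∀ x ∈ s, 2 * ℓ x < ∑ y ∈ s, ℓ y) :
    ∃ (q : ℝ) (ψ : X → ℝ), 0 < q ∧ (∀ x ∈ s, 0 < ψ x ∧ q * ψ x ^ 2 - ψ x + ℓ x = 0) ∧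
      q * ∑ x ∈ s, ψ x = 1 := by
  obtain ⟨m, hm, hmax⟩ := s.exists_max_image ℓ hs
  have hm0 := hℓ m hm
  set f : X → ℝ → ℝ := fun x q => 2 * ℓ x / (1 + Real.sqrt (1 - 4 * ℓ x * q)) with hf
  have hden : ∀ x q, 0 < 1 + Real.sqrt (1 - 4 * ℓ x * q) := fun x q => by positivity
  have hfc : ∀ x, Continuous (f x) := fun x =>
    continuous_const.div (by fun_prop) fun q => (hden x q).ne'
  have hf0 : ∀ x, f x 0 = ℓ x := fun x => by simp [hf]; ring
  have hfpos : ∀ x ∈ s, ∀ q, 0 < f x q := fun x hx q =>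
    div_pos (by linarith [hℓ x hx]) (hden x q)
  set Q := 1 / (4 * ℓ m) with hQ
  have hQ0 : 0 < Q := by positivity
  have hroot : ∀ x ∈ s, ∀ q, q ≤ Q → 0 < q → q * f x q ^ 2 - f x q + ℓ x = 0 := by
    intro x hx q hq hq0
    have h1 : 0 ≤ 1 - 4 * ℓ x * q := by
      have : ℓ x * q ≤ ℓ m * Q := mul_le_mul (hmax x hx) hq hq0.le hm0.le
      have h2 : ℓ m * Q = 1 / 4 := by rw [hQ]; field_simp
      linarith
    have h3 := Real.sq_sqrt h1
    have h4 := hden x q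
    simp only [hf]
    set r := Real.sqrt (1 - 4 * ℓ x * q)
    field_simp
    linear_combination (ℓ x) * h3
  have hfm : f m Q = 2 * ℓ m := by
    have : 1 - 4 * ℓ m * Q = 0 := by rw [hQ]; field_simp; ring
    simp [hf, this]
  -- `f m` is a double root at `Q`; if `q ∑ ψ` has not reached `1` there, the larger root is taken for `m`
  by_cases hcase : 1 ≤ Q * ∑ x ∈ s, f x Q
  · have hg : Continuous fun q => q * ∑ x ∈ s, f x q := by fun_prop
    obtain ⟨q, hq, hq1⟩ := intermediate_value_Icc hQ0.le hg.continuousOn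
      (show (1 : ℝ) ∈ Set.Icc _ _ from ⟨by simp, hcase⟩)
    have hq0 : 0 < q := by
      rcases hq.1.lt_or_eq with h | h
      · exact h
      · subst h; simp at hq1
    exact ⟨q, fun x => f x q, hq0, fun x hx => ⟨hfpos x hx q, hroot x hx q hq.2 hq0⟩, hq1⟩
  · have hg : Continuous fun q => 2 * f m q - ∑ x ∈ s, f x q := by fun_prop
    have hneg : 2 * f m 0 - ∑ x ∈ s, f x 0 < 0 := by simp only [hf0]; linarith [hlt m hm]
    have hpos : 0 < 2 * f m Q - ∑ x ∈ s, f x Q := by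
      push Not at hcase
      have h1 : Q * (2 * f m Q) = 1 := by rw [hfm, hQ]; field_simp; norm_num
      have : 0 < Q * (2 * f m Q - ∑ x ∈ s, f x Q) := by rw [mul_sub]; linarith
      exact pos_of_mul_pos_right this hQ0.le
    obtain ⟨q, hq, hq1⟩ := intermediate_value_Icc hQ0.le hg.continuousOn
      (show (0 : ℝ) ∈ Set.Icc _ _ from ⟨hneg.le, hpos.le⟩)
    simp only at hq1
    have hq0 : 0 < q := by
      rcases hq.1.lt_or_eq with h | h
      · exact h
      · subst h; exact absurd hq1 hneg.ne
    have hfq : f m q ≤ 2 * ℓ m := by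
      rw [hf]
      exact div_le_self (by linarith) (by linarith [Real.sqrt_nonneg (1 - 4 * ℓ m * q)])
    have hm1 : 0 < 1 / q - f m q := by
      have h1 : 1 / Q ≤ 1 / q := one_div_le_one_div_of_le hq0 hq.2
      have h2 : 1 / Q = 4 * ℓ m := by rw [hQ, one_div_one_div]
      linarith
    refine ⟨q, fun x => if x = m then 1 / q - f m q else f x q, hq0, fun x hx => ?_, ?_⟩
    · by_cases hxm : x = m
      · subst hxm
        simp only [if_true]
        refine ⟨hm1, ?_⟩
        have h1 := hroot x hm q hq.2 hq0
        have h2 : q * (1 / q) = 1 := mul_one_div_cancel hq0.ne'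
        linear_combination h1 + (1 / q - 2 * f x q) * h2
      · simp only [if_neg hxm]
        exact ⟨hfpos x hx q, hroot x hx q hq.2 hq0⟩
    · rw [← add_sum_erase s _ hm]
      rw [← add_sum_erase s _ hm] at hq1
      simp only [if_true]
      rw [sum_congr rfl fun x hx => if_neg (ne_of_mem_erase hx)]
      have h2 : q * (1 / q) = 1 := mul_one_div_cancel hq0.ne'
      linear_combination h2 - q * hq1

theorem exists_legMatrix {s : Finset X} (hs : s.Nonempty) {ℓ : X → ℝ} (hℓ : ∀ x ∈ s, 0 < ℓ x)
    (hlt : ∀ x ∈ s, 2 * ℓ x < ∑ y ∈ s, ℓ y) : ∃ M, LegMatrix s ℓ M := by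
  obtain ⟨q, ψ, hq, hψ, hsum⟩ := exists_quadratic_roots hs hℓ hlt
  set M : X → X → ℝ := fun x y => if x ∈ s ∧ y ∈ s ∧ x ≠ y then q * ψ x * ψ y else 0 with hM
  have hpos : ∀ x ∈ s, ∀ y ∈ s, x ≠ y → 0 < M x y := by
    intro x hx y hy hxy
    have := (hψ x hx).1
    have := (hψ y hy).1
    simp only [hM, hx, hy, hxy, ne_eq, not_false_eq_true, and_self, if_true]
    positivity
  have hrow : ∀ x ∈ s, ∑ y, M x y = ℓ x := by
    intro x hx
    have h1 : ∀ y, M x y = if y ∈ s then (if y = x then 0 else q * ψ x * ψ y) else 0 := by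
      intro y
      simp only [hM, hx, true_and]
      by_cases h1 : y ∈ s <;> by_cases h2 : y = x <;> simp [h1, h2, Ne.symm, eq_comm]
    simp only [h1]
    rw [Finset.sum_ite_mem, Finset.univ_inter, ← add_sum_erase s _ hx, if_pos rfl, zero_add,
      sum_congr rfl fun y hy => if_neg (ne_of_mem_erase hy), ← mul_sum]
    rw [← add_sum_erase s _ hx] at hsum
    linear_combination ψ x * hsum - (hψ x hx).2
  have hsymm : ∀ x y, M x y = M y x := fun x y => by
    simp only [hM]
    by_cases h1 : x ∈ s <;> by_cases h2 : y ∈ s <;> by_cases h3 : x = y <;>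
      simp [h1, h2, h3, Ne.symm, eq_comm] <;> ring
  have hnn : ∀ x y, 0 ≤ M x y := by
    intro x y
    by_cases h : x ∈ s ∧ y ∈ s ∧ x ≠ y
    · exact (hpos x h.1 y h.2.1 h.2.2).le
    · simp only [hM, if_neg h, le_refl]
  refine ⟨M, hs, hsymm, fun x hx y => by simp [hM, hx], fun x => by simp [hM], hpos, hrow,
    fun x hx y => ?_⟩
  by_contra hcon
  push Not at hcon
  have hy : y ∈ s ∧ x ≠ y := by
    by_contra h
    have : M x y = 0 := by simp only [hM]; rw [if_neg]; tauto
    linarith [hℓ x hx]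
  -- otherwise there is no further leg, and the two are equal
  have hall : s = {x, y} := by
    refine Finset.Subset.antisymm (fun z hz => ?_) (by simp [Finset.insert_subset_iff, hx, hy.1])
    by_contra hne
    simp only [mem_insert, Finset.mem_singleton, not_or] at hne
    have h1 := hpos x hx z hz (Ne.symm hne.1)
    have h2 : M x y + M x z ≤ ∑ w, M x w := by
      rw [← Finset.sum_pair (f := fun w => M x w) (Ne.symm hne.2)]
      exact Finset.sum_le_sum_of_subset_of_nonneg (Finset.subset_univ _) fun w _ _ => hnn x w
    rw [hrow x hx] at h2
    linarith
  have h1 := hlt x hx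
  have h2 := hlt y hy.1
  rw [hall, Finset.sum_pair hy.2] at h1 h2
  linarith

/-- Contraction of a leg `k` of one matrix with a leg `k'` of another. -/
def glueMatrix (M N : X → X → ℝ) (η : ℝ) (k k' : X) (x y : X) : ℝ :=
  (if x = k ∨ y = k then 0 else M x y) + (if x = k' ∨ y = k' then 0 else N x y) +
    (M x k * N k' y + M y k * N k' x) / η

variable {s t : Finset X} {ℓ : X → ℝ} {M N : X → X → ℝ} {k k' : X}

theorem sum_glueMatrix {η : ℝ} (hM : LegMatrix s ℓ M) (hN : LegMatrix t ℓ N) (hk : k ∈ s) (hk' : k' ∈ t)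
    (σ : X → X → ℝ) (hσ : ∀ x y, σ x y = σ y x) :
    ∑ x, ∑ y, σ x y * glueMatrix M N η k k' x y =
      (∑ x, ∑ y, σ x y * M x y - 2 * ∑ x, σ x k * M x k) +
      (∑ x, ∑ y, σ x y * N x y - 2 * ∑ x, σ x k' * N x k') +
      2 / η * ∑ x, ∑ y, σ x y * (M x k * N k' y) := by
  have cut : ∀ (P : X → X → ℝ) (p : X), (∀ x y, P x y = P y x) → P p p = 0 →
      ∑ x, ∑ y, σ x y * (if x = p ∨ y = p then 0 else P x y) =
        ∑ x, ∑ y, σ x y * P x y - 2 * ∑ x, σ x p * P x p := by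
    intro P p hP hp
    have h1 : ∀ x y, σ x y * (if x = p ∨ y = p then 0 else P x y) =
        σ x y * P x y - (if y = p then σ x y * P x y else 0) - (if x = p then σ x y * P x y else 0) := by
      intro x y
      by_cases h1 : x = p <;> by_cases h2 : y = p <;> simp [h1, h2, hp]
    simp only [h1, sum_sub_distrib, Finset.sum_ite_eq', mem_univ, if_true]
    have h2 : ∑ x, ∑ y, (if x = p then σ x y * P x y else 0) = ∑ x, σ x p * P x p := by
      rw [sum_comm]
      simp only [Finset.sum_ite_eq', mem_univ, if_true]
      exact sum_congr rfl fun y _ => by rw [hσ, hP]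
    rw [h2]; ring
  have hswap : ∑ x, ∑ y, σ x y * (M y k * N k' x) = ∑ x, ∑ y, σ x y * (M x k * N k' y) := by
    rw [sum_comm]
    exact sum_congr rfl fun y _ => sum_congr rfl fun x _ => by rw [hσ]
  rw [← cut M k hM.symm (hM.diag k), ← cut N k' hN.symm (hN.diag k')]
  simp only [glueMatrix, mul_add, add_div, sum_add_distrib]
  have h3 : ∀ (f : X → X → ℝ), ∑ x, ∑ y, σ x y * (f x y / η) = 1 / η * ∑ x, ∑ y, σ x y * f x y := by
    intro f
    rw [mul_sum]
    refine sum_congr rfl fun x _ => ?_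
    rw [mul_sum]
    exact sum_congr rfl fun y _ => by ring
  rw [h3 (fun x y => M x k * N k' y), h3 (fun x y => M y k * N k' x), hswap]
  ring

/-- The row of `k'` sums to `ℓ k`, so a leg of `M` keeps its row sum when its entry at `k` is distributed
over the legs of `N`, and conversely. -/
theorem LegMatrix.glue (hM : LegMatrix s ℓ M) (hN : LegMatrix t ℓ N) (hst : Disjoint s t)
    (hk : k ∈ s) (hk' : k' ∈ t) (hkk' : ℓ k = ℓ k') (hη : 0 < ℓ k) :
    LegMatrix (s.erase k ∪ t.erase k') ℓ (glueMatrix M N (ℓ k) k k') := by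
  set η := ℓ k with hηdef
  have hts : ∀ {x}, x ∈ t → x ∉ s := fun h h' => (Finset.disjoint_left.1 hst h' h)
  have hMz : ∀ x y, y ∉ s → M x y = 0 := fun x y h => by rw [hM.symm, hM.zero y h]
  have hNz : ∀ x y, y ∉ t → N x y = 0 := fun x y h => by rw [hN.symm, hN.zero y h]
  have hMk : M k' k = 0 := hM.zero _ (hts hk') _
  have hNk : N k' k = 0 := hNz _ _ (fun h => hts h hk)
  have hrow : ∀ x, ∑ y, glueMatrix M N η k k' x y = (if x = k then 0 else ∑ y, M x y - M x k) +
      (if x = k' then 0 else ∑ y, N x y - N x k') + M x k + N k' x := by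
    intro x
    simp only [glueMatrix, sum_add_distrib, ← Finset.sum_div, ← mul_sum, ← sum_mul]
    have h1 : ∀ (P : X → X → ℝ) p, ∑ y, (if x = p ∨ y = p then 0 else P x y) =
        if x = p then 0 else ∑ y, P x y - P x p := by
      intro P p
      by_cases h : x = p
      · simp [h]
      · simp only [h, false_or, if_false]
        rw [← add_sum_erase _ _ (mem_univ p), if_pos rfl, zero_add,
          sum_congr rfl fun y hy => if_neg (ne_of_mem_erase hy),
          ← add_sum_erase _ (fun y => P x y) (mem_univ p)]
        ring
    have h2 : ∑ y, M y k = η :=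
      (sum_congr rfl fun y _ => hM.symm _ _).trans (hM.sum k hk)
    rw [h1, h1, hN.sum k' hk', h2, ← hkk']
    field_simp
    ring
  have hs : ∀ x, x ∈ s.erase k → ∀ y, glueMatrix M N η k k' x y =
      (if y = k then 0 else M x y) + M x k * N k' y / η := by
    intro x hx y
    have hx2 := mem_of_mem_erase hx
    have hxt : x ∉ t := fun h => hts h hx2
    rw [glueMatrix, hN.zero x hxt, hNz k' x hxt]
    simp [ne_of_mem_erase hx]
  have ht : ∀ x, x ∈ t.erase k' → ∀ y, glueMatrix M N η k k' x y =
      (if y = k' then 0 else N x y) + M y k * N k' x / η := by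
    intro x hx y
    have hx2 := mem_of_mem_erase hx
    rw [glueMatrix, hM.zero x (hts hx2), hM.zero x (hts hx2)]
    simp [ne_of_mem_erase hx]
  refine ⟨?_, ?_, ?_, ?_, ?_, ?_, ?_⟩
  · have h1 := hM.sum k hk
    obtain ⟨x, -, hx⟩ := Finset.exists_ne_zero_of_sum_ne_zero (h1.trans_ne hη.ne')
    refine ⟨x, Finset.mem_union_left _ (mem_erase.2 ⟨?_, ?_⟩)⟩
    · rintro rfl; exact hx (hM.diag _)
    · by_contra h; exact hx (hMz _ _ h)
  · intro x y
    simp only [glueMatrix, hM.symm x y, hN.symm x y, or_comm (a := x = k), or_comm (a := x = k')]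
    ring
  · intro x hx y
    simp only [mem_union, mem_erase, not_or, not_and', ne_eq, not_not] at hx
    by_cases hxs : x ∈ s
    · have := hx.1 hxs; subst this
      simp [glueMatrix, hM.diag, hNk, hN.zero x (fun h => hts h hxs)]
    · by_cases hxt : x ∈ t
      · have := hx.2 hxt; subst this
        simp [glueMatrix, hN.diag, hMk, hM.zero x hxs]
      · simp [glueMatrix, hM.zero x hxs, hN.zero x hxt, hNz _ x hxt]
  · intro x
    simp only [glueMatrix, hM.diag, hN.diag]
    by_cases hxs : x ∈ s
    · simp [hNz _ x (fun h => hts h hxs)]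
    · simp [hM.zero x hxs]
  · intro x hx y hy hxy
    rcases mem_union.1 hx with hx | hx <;> rcases mem_union.1 hy with hy | hy
    · rw [hs x hx, hNz _ y (fun h => hts h (mem_of_mem_erase hy))]
      simpa [ne_of_mem_erase hy] using
        hM.pos x (mem_of_mem_erase hx) y (mem_of_mem_erase hy) hxy
    · rw [hs x hx, hMz x y (hts (mem_of_mem_erase hy)), ite_self, zero_add]
      exact div_pos (mul_pos (hM.pos _ (mem_of_mem_erase hx) _ hk (ne_of_mem_erase hx))
        (hN.pos _ hk' _ (mem_of_mem_erase hy) (ne_of_mem_erase hy).symm)) hη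
    · rw [ht x hx, hNz x y (fun h => hts h (mem_of_mem_erase hy)), ite_self, zero_add]
      exact div_pos (mul_pos (hM.pos _ (mem_of_mem_erase hy) _ hk (ne_of_mem_erase hy))
        (hN.pos _ hk' _ (mem_of_mem_erase hx) (ne_of_mem_erase hx).symm)) hη
    · rw [ht x hx, hM.zero y (hts (mem_of_mem_erase hy))]
      simpa [ne_of_mem_erase hy] using
        hN.pos x (mem_of_mem_erase hx) y (mem_of_mem_erase hy) hxy
  · intro x hx
    rw [hrow]
    rcases mem_union.1 hx with hx | hx
    · have hx2 := mem_of_mem_erase hx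
      have hxt : x ∉ t := fun h => hts h hx2
      rw [if_neg (ne_of_mem_erase hx), hM.sum x hx2, hNz _ x hxt]
      simp [hN.zero x hxt]
    · have hx2 := mem_of_mem_erase hx
      rw [if_neg (ne_of_mem_erase hx), hN.sum x hx2, hM.zero x (hts hx2), hN.symm k' x]
      simp [hM.zero x (hts hx2)]
  · intro x hx y
    rcases mem_union.1 hx with hx | hx
    · have hx2 := mem_of_mem_erase hx
      rw [hs x hx]
      by_cases hy : y ∈ t
      · rw [hMz x y (hts hy), ite_self, zero_add, div_lt_iff₀ hη]
        have h1 := hM.lt x hx2 k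
        have h2 := hN.lt k' hk' y
        have h3 := hM.pos x hx2 k hk (ne_of_mem_erase hx)
        rw [← hkk'] at h2
        nlinarith
      · rw [hNz _ y hy, mul_zero, zero_div, add_zero]
        split_ifs
        · exact (hM.pos x hx2 k hk (ne_of_mem_erase hx)).trans (hM.lt x hx2 k)
        · exact hM.lt x hx2 y
    · have hx2 := mem_of_mem_erase hx
      rw [ht x hx]
      by_cases hy : y ∈ t
      · rw [hM.zero y (hts hy), zero_mul, zero_div, add_zero]
        split_ifs
        · exact (hN.pos x hx2 k' hk' (ne_of_mem_erase hx)).trans (hN.lt x hx2 k')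
        · exact hN.lt x hx2 y
      · rw [hNz x y hy, ite_self, zero_add, div_lt_iff₀ hη]
        have h1 := hN.lt x hx2 k'
        have h3 := hN.pos x hx2 k' hk' (ne_of_mem_erase hx)
        rw [hN.symm] at h1 h3
        by_cases hys : y ∈ s
        · have h2 := hM.lt k hk y
          rw [hM.symm] at h2
          nlinarith
        · rw [hM.zero y hys, zero_mul]; nlinarith

end Legs

namespace TreeDiagram
variable {n : ℕ} (D : TreeDiagram n)

/-- The vertex at which a boundary point or a half-edge is attached. -/
def legVertex : Fin n ⊕ D.Link → D.V := Sum.elim D.attach Sigma.fst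

/-- The legs of the subdiagram with vertices `U` and propagators `F`. -/
def legSet (U : Finset D.V) (F : Finset D.E) : Finset (Fin n ⊕ D.Link) :=
  {x | D.legVertex x ∈ U ∧ ∀ k, x = Sum.inr k → k.2.1 ∉ F}

theorem mem_legSet {U : Finset D.V} {F : Finset D.E} {x : Fin n ⊕ D.Link} :
    x ∈ D.legSet U F ↔ D.legVertex x ∈ U ∧ ∀ k, x = Sum.inr k → k.2.1 ∉ F :=
  ⟨fun h => (mem_filter.1 h).2, fun h => mem_filter.2 ⟨mem_univ _, h⟩⟩

theorem inl_mem_legSet {U : Finset D.V} {F : Finset D.E} {i : Fin n} :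
    Sum.inl i ∈ D.legSet U F ↔ D.attach i ∈ U := by
  rw [mem_legSet]; simp [legVertex]

theorem inr_mem_legSet {U : Finset D.V} {F : Finset D.E} {k : D.Link} :
    Sum.inr k ∈ D.legSet U F ↔ k.1 ∈ U ∧ k.2.1 ∉ F := by
  rw [mem_legSet]; simp only [legVertex, Sum.elim_inr, Sum.inr.injEq, forall_eq']

/-- The dimensions of the legs, those of the bulk-to-bulk propagators being `η`. -/
def legDim (Δ : Fin n → ℝ) (η : ℝ) : Fin n ⊕ D.Link → ℝ := Sum.elim Δ fun _ => η

/-- `1` if the propagator `e` separates the two legs, and `0` otherwise. -/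
def separation (e : D.E) (x y : Fin n ⊕ D.Link) : ℝ :=
  if (D.OnSrc e (D.legVertex x) ↔ D.OnSrc e (D.legVertex y)) then 0 else 1

variable {D}

/-- Gluing along a subtree. The total weight of the pairs separated by a contracted propagator, each
pair being counted twice, is `2 η`. -/
theorem Subtree.exists_legMatrix {U : Finset D.V} {F : Finset D.E} (hU : D.Subtree U F)
    {Δ : Fin n → ℝ} {η : ℝ} (hη : 0 < η)
    (hv : ∀ v, ∃ M, LegMatrix (D.legSet {v} ∅) (D.legDim Δ η) M) :
    ∃ M, LegMatrix (D.legSet U F) (D.legDim Δ η) M ∧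
      ∀ e ∈ F, ∑ x, ∑ y, D.separation e x y * M x y = 2 * η := by
  induction hU with
  | root v =>
    obtain ⟨M, hM⟩ := hv v
    exact ⟨M, hM, by simp⟩
  | @edge U F e u w hs he hu hw hends ih =>
    obtain ⟨M, hM, hcut⟩ := ih
    obtain ⟨N, hN⟩ := hv w
    set k : D.Link := ⟨u, e, by rcases hends with h | h <;> simp [h.1, h.2]⟩ with hk
    set k' : D.Link := ⟨w, e, by rcases hends with h | h <;> simp [h.1, h.2]⟩ with hk'
    have hkS : Sum.inr k ∈ D.legSet U F := D.inr_mem_legSet.2 ⟨hu, he⟩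
    have hkT : Sum.inr k' ∈ D.legSet {w} ∅ :=
      D.inr_mem_legSet.2 ⟨Finset.mem_singleton_self w, Finset.notMem_empty _⟩
    have hmemS : ∀ {x}, x ∈ D.legSet U F → D.legVertex x ∈ U := fun hx => (mem_filter.1 hx).2.1
    have hmemT : ∀ {x}, x ∈ D.legSet {w} ∅ → D.legVertex x = w := fun hx =>
      Finset.mem_singleton.1 (mem_filter.1 hx).2.1
    have hdisj : Disjoint (D.legSet U F) (D.legSet {w} ∅) :=
      Finset.disjoint_left.2 fun x hx hx' => hw (hmemT hx' ▸ hmemS hx)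
    have hset : D.legSet (insert w U) (insert e F) =
        (D.legSet U F).erase (Sum.inr k) ∪ (D.legSet {w} ∅).erase (Sum.inr k') := by
      ext x
      rcases x with i | l
      · simp only [inl_mem_legSet, mem_insert, mem_union, mem_erase, ne_eq,
          reduceCtorEq, not_false_eq_true, true_and, Finset.mem_singleton, or_comm]
      · obtain ⟨v, e', hv'⟩ := l
        have h1 : v = w → e' ∉ F := by
          rintro rfl hF
          have := hs.ends_mem e' hF
          rcases hv' with h | h
          · exact hw (h ▸ this.1)
          · exact hw (h ▸ this.2)
        have h2 : v ∈ U → ((⟨v, e', hv'⟩ : D.Link) = k ↔ e' = e) := by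
          intro hvU
          constructor
          · intro h
            rw [hk, Sigma.mk.inj_iff] at h
            obtain ⟨rfl, h⟩ := h
            exact congrArg Subtype.val (eq_of_heq h)
          · rintro rfl
            have : v = u := by
              rcases hends with h | h <;> rcases hv' with h' | h'
              · rw [← h', h.1]
              · rw [← h', h.2] at hvU; exact absurd hvU hw
              · rw [← h', h.1] at hvU; exact absurd hvU hw
              · rw [← h', h.2]
            subst this
            rfl
        have h3 : v = w → ((⟨v, e', hv'⟩ : D.Link) = k' ↔ e' = e) := by
          rintro rfl
          constructor
          · intro h
            rw [hk', Sigma.mk.inj_iff] at h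
            exact congrArg Subtype.val (eq_of_heq h.2)
          · rintro rfl; rfl
        simp only [inr_mem_legSet, Sum.inr.injEq, mem_insert, mem_union, mem_erase, ne_eq,
          Finset.mem_singleton, Finset.notMem_empty, not_false_eq_true, and_true, not_or]
        constructor
        · rintro ⟨h | h, h4, h5⟩
          · exact Or.inr ⟨(h3 h).not.2 h4, h⟩
          · exact Or.inl ⟨(h2 h).not.2 h4, h, h5⟩
        · rintro (⟨h, h4, h5⟩ | ⟨h, h4⟩)
          · exact ⟨Or.inr h4, (h2 h4).not.1 h, h5⟩
          · exact ⟨Or.inl h4, (h3 h4).not.1 h, h1 h4⟩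
    have hsep : ∀ e x y, D.separation e x y = D.separation e y x := fun e x y => by
      simp only [separation, iff_comm]
    have hMz : ∀ x y, D.legVertex x ∉ U → M x y = 0 := fun x y h =>
      hM.zero x (fun hx => h (hmemS hx)) y
    have hNz : ∀ x y, D.legVertex x ≠ w → N x y = 0 := fun x y h =>
      hN.zero x (fun hx => h (hmemT hx)) y
    have hMsum : ∑ x, M x (Sum.inr k) = η :=
      (sum_congr rfl fun y _ => hM.symm _ _).trans (hM.sum _ hkS)
    have hNsum : ∑ y, N (Sum.inr k') y = η := hN.sum _ hkT
    have hself : ∀ e x y, (D.OnSrc e (D.legVertex x) ↔ D.OnSrc e (D.legVertex y)) →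
        D.separation e x y = 0 := fun e x y h => if_pos h
    have hNcut : ∀ e' x y, D.separation e' x y * N x y = 0 := by
      intro e' x y
      by_cases hx : D.legVertex x = w
      · by_cases hy : D.legVertex y = w
        · rw [hself _ _ _ (by rw [hx, hy]), zero_mul]
        · rw [hN.symm, hNz y x hy, mul_zero]
      · rw [hNz x y hx, mul_zero]
    refine ⟨glueMatrix M N η (Sum.inr k) (Sum.inr k'), ?_, ?_⟩
    · rw [hset]
      convert hM.glue hN hdisj hkS hkT rfl hη
      rfl
    intro e' he'
    rw [sum_glueMatrix hM hN hkS hkT _ (hsep e')]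
    simp only [hNcut, sum_const_zero, mul_zero, sub_zero, add_zero]
    rcases mem_insert.1 he' with rfl | he'
    · -- the new propagator separates exactly the legs of the two parts
      have hin : ∀ x ∈ U, ∀ y ∈ U, D.OnSrc e' x ↔ D.OnSrc e' y := hs.onSrc_iff he
      have hMcut : ∀ x y, D.separation e' x y * M x y = 0 := by
        intro x y
        by_cases hx : D.legVertex x ∈ U
        · by_cases hy : D.legVertex y ∈ U
          · rw [hself _ _ _ (hin _ hx _ hy), zero_mul]
          · rw [hM.symm, hMz y x hy, mul_zero]
        · rw [hMz x y hx, mul_zero]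
      have hcross : ∀ x y, D.separation e' x y * (M x (Sum.inr k) * N (Sum.inr k') y) =
          M x (Sum.inr k) * N (Sum.inr k') y := by
        intro x y
        by_cases hx : D.legVertex x ∈ U
        · by_cases hy : D.legVertex y = w
          · have h1 : D.OnSrc e' (D.legVertex x) ↔ D.OnSrc e' u := hin _ hx _ hu
            have h2 : ¬ (D.OnSrc e' u ↔ D.OnSrc e' w) := by
              have h3 := D.onSrc_src e'
              have h4 := D.not_onSrc_tgt e'
              rcases hends with h | h
              · rw [h.1] at h3; rw [h.2] at h4; tauto
              · rw [h.1] at h3; rw [h.2] at h4; tauto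
            rw [separation, if_neg (by rw [hy, h1]; exact h2), one_mul]
          · rw [hN.symm, hNz y _ hy, mul_zero, mul_zero]
        · rw [hMz x _ hx, zero_mul, mul_zero]
      simp only [hMcut, hcross, sum_const_zero, mul_zero, sub_zero, zero_add]
      simp only [← mul_sum, ← sum_mul, hMsum, hNsum]
      field_simp
    · have hne : e ≠ e' := fun h => he (h ▸ he')
      have huw : D.OnSrc e' u ↔ D.OnSrc e' w := by
        have := onSrc_src_iff_tgt (D := D) hne
        rcases hends with h | h
        · rwa [h.1, h.2] at this
        · rw [h.1, h.2] at this; exact this.symm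
      have hcross : ∀ x y, D.separation e' x y * (M x (Sum.inr k) * N (Sum.inr k') y) =
          D.separation e' x (Sum.inr k) * M x (Sum.inr k) * N (Sum.inr k') y := by
        intro x y
        by_cases hy : D.legVertex y = w
        · have : D.separation e' x y = D.separation e' x (Sum.inr k) := by
            have h1 : D.legVertex (Sum.inr k) = u := rfl
            simp only [separation, hy, h1, huw]
          rw [this]; ring
        · rw [hN.symm, hNz y _ hy]; ring
      simp only [hcross]
      simp only [← mul_sum, ← sum_mul, hNsum]
      rw [hcut e' he']
      field_simp
      ring

theorem sum_legDim (Δ : Fin n → ℝ) (η : ℝ) (v : D.V) :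
    ∑ x ∈ D.legSet {v} ∅, D.legDim Δ η x = D.vertexDim Δ v + D.valency v * η := by
  have h1 : ∀ x, x ∈ D.legSet {v} ∅ ↔ D.legVertex x = v := by
    intro x
    rw [mem_legSet]
    simp
  have h2 : D.legSet {v} ∅ = univ.filter fun x => D.legVertex x = v := by
    ext x
    rw [h1, mem_filter]
    simp
  rw [h2, sum_filter, Fintype.sum_sum_type, vertexDim, sum_filter]
  congr 1
  rw [Fintype.sum_sigma, sum_eq_single v]
  · simp [legVertex, legDim, valency]
  · intro b _ hb
    simp [legVertex, hb]
  · simp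

/-- The Mellin domain contains real points, at which moreover all `s_e` are positive. -/
theorem Convergent.exists_mellinPoint {d : ℕ} (hd : 0 < d) {Δ : Fin n → ℝ} (hΔ : D.Convergent d Δ) :
    3 ≤ n ∧ ∃ (δ₀ : Fin n → Fin n → ℝ) (η : ℝ), IsMellinPoint δ₀ ∧ (∀ i, δ₀ i i = -Δ i) ∧ 0 < η ∧
      η < h d ∧ ∀ e, D.mandelstam Δ (fun i j => (δ₀ i j : ℂ)) e = η := by
  have hh : 0 < h d := by unfold h; positivity
  -- the conditions of convergence are open in the dimension of the propagator legs
  obtain ⟨η, hη1, hη2, hηv, hηi⟩ : ∃ η, 0 < η ∧ η < h d ∧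
      (∀ v, 0 < D.vertexDim Δ v + ((D.valency v : ℝ) - 2) * η) ∧
      ∀ i, 2 * Δ i < D.vertexDim Δ (D.attach i) + (D.valency (D.attach i) : ℝ) * η := by
    have h1 : ∀ᶠ η in nhds (h d), ∀ v, 0 < D.vertexDim Δ v + ((D.valency v : ℝ) - 2) * η :=
      Filter.eventually_all.2 fun v => (show Continuous fun η : ℝ =>
        D.vertexDim Δ v + ((D.valency v : ℝ) - 2) * η by fun_prop).continuousAt.eventually
        (lt_mem_nhds (hΔ.vertex v))
    have h2 : ∀ᶠ η in nhds (h d), ∀ i, 2 * Δ i < D.vertexDim Δ (D.attach i) +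
        (D.valency (D.attach i) : ℝ) * η :=
      Filter.eventually_all.2 fun i => (show Continuous fun η : ℝ =>
        D.vertexDim Δ (D.attach i) + (D.valency (D.attach i) : ℝ) * η by fun_prop).continuousAt.eventually
        (lt_mem_nhds (hΔ.leg i))
    have h3 := ((h1.and (h2.and (lt_mem_nhds hh))).filter_mono nhdsWithin_le_nhds).and
      (self_mem_nhdsWithin (a := h d) (s := Set.Iio (h d)))
    obtain ⟨η, ⟨a1, a2, a3⟩, a4⟩ := h3.exists
    exact ⟨η, a3, a4, a1, a2⟩
  obtain ⟨M, hM, hcut⟩ := (subtree_univ (D := D)).exists_legMatrix (Δ := Δ) hη1 (fun v => by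
    have hsum := sum_legDim (D := D) Δ η v
    have hv := hηv v
    refine exists_legMatrix ?_ ?_ ?_
    · by_contra hne
      rw [Finset.not_nonempty_iff_eq_empty.1 hne, Finset.sum_empty] at hsum
      nlinarith
    · rintro (i | k) _
      · exact hΔ.pos i
      · exact hη1
    · rw [hsum]
      rintro (i | k) hx
      · have : D.attach i = v := Finset.mem_singleton.1 (D.inl_mem_legSet.1 hx)
        exact this ▸ hηi i
      · have : D.legDim Δ η (Sum.inr k) = η := rfl
        rw [this]; linarith)
  have hinl : ∀ i, Sum.inl i ∈ D.legSet univ univ := fun i =>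
    D.inl_mem_legSet.2 (mem_univ _)
  have hinr : ∀ k x, M (Sum.inr k) x = 0 := fun k => hM.zero _ fun hk =>
    (D.inr_mem_legSet.1 hk).2 (mem_univ _)
  have hinr' : ∀ x k, M x (Sum.inr k) = 0 := fun x k => by rw [hM.symm, hinr]
  have hrow : ∀ i, ∑ j, M (Sum.inl i) (Sum.inl j) = Δ i := by
    intro i
    have := hM.sum _ (hinl i)
    rw [Fintype.sum_sum_type] at this
    simpa [hinr', legDim] using this
  have hn : 3 ≤ n := by
    obtain ⟨x, hx⟩ := hM.nonempty
    obtain ⟨i⟩ : Nonempty (Fin n) := by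
      rcases x with i | k
      · exact ⟨i⟩
      · exact absurd (mem_univ _) (D.inr_mem_legSet.1 hx).2
    obtain ⟨j, -, hj⟩ := Finset.exists_ne_zero_of_sum_ne_zero ((hrow i).trans_ne (hΔ.pos i).ne')
    have hij : j ≠ i := by rintro rfl; exact hj (hM.diag _)
    by_contra hlt
    have hall : (univ : Finset (Fin n)) = {i, j} := by
      symm
      refine Finset.eq_univ_of_card _ (le_antisymm (Finset.card_le_univ _) ?_)
      rw [Finset.card_pair hij.symm, Fintype.card_fin]
      omega
    have h1 := hrow i
    rw [hall, Finset.sum_pair hij.symm, hM.diag, zero_add] at h1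
    have h2 := hM.lt _ (hinl i) (Sum.inl j)
    rw [h1] at h2
    exact lt_irrefl _ h2
  refine ⟨hn, fun i j => M (Sum.inl i) (Sum.inl j) - if i = j then Δ i else 0, η, ⟨?_, ?_, ?_⟩, ?_, hη1,
    hη2, ?_⟩
  · intro i j
    rw [hM.symm]
    by_cases h : i = j
    · rw [h]
    · rw [if_neg h, if_neg (Ne.symm h)]
  · intro i
    rw [sum_sub_distrib, hrow]
    simp
  · intro i j hij
    rw [if_neg hij, sub_zero]
    exact hM.pos _ (hinl i) _ (hinl j) (by simpa using hij)
  · intro i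
    simp [hM.diag]
  · intro e
    have hre : ∀ i j : Fin n, i < j → (if (i ∈ D.side e ↔ j ∈ D.side e) then (0 : ℂ) else
        ((M (Sum.inl i) (Sum.inl j) - if i = j then Δ i else 0 : ℝ) : ℂ)) =
        ((D.separation e (Sum.inl i) (Sum.inl j) * M (Sum.inl i) (Sum.inl j) : ℝ) : ℂ) := by
      intro i j hij
      have hi := D.mem_side e i
      have hj := D.mem_side e j
      rw [if_neg hij.ne, sub_zero]
      by_cases hc : D.OnSrc e (D.attach i) ↔ D.OnSrc e (D.attach j)
      · rw [if_pos (by rw [hi, hj]; exact hc), show D.separation e (Sum.inl i) (Sum.inl j) = 0 from if_pos hc, zero_mul,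
          Complex.ofReal_zero]
      · rw [if_neg (by rw [hi, hj]; exact hc), show D.separation e (Sum.inl i) (Sum.inl j) = 1 from if_neg hc, one_mul]
    rw [mandelstam_eq]
    · rw [sum_congr rfl fun i _ => sum_congr rfl fun j hj => hre i j (mem_filter.1 hj).2]
      have h1 := hcut e (mem_univ _)
      rw [Fintype.sum_sum_type] at h1
      simp only [Fintype.sum_sum_type, hinr, hinr', mul_zero, sum_const_zero, add_zero] at h1
      set f : Fin n → Fin n → ℝ := fun i j => D.separation e (Sum.inl i) (Sum.inl j) * M (Sum.inl i) (Sum.inl j) with hf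
      have hfs : ∀ i j, f i j = f j i := fun i j => by
        simp only [hf, hM.symm (Sum.inl i)]
        congr 1
        simp only [separation, iff_comm]
      have h2 : ∑ i, ∑ j, f i j = 2 * ∑ i, ∑ j with i < j, f i j := by
        have h3 : ∀ i, ∑ j, f i j = ∑ j with i < j, f i j + ∑ j with j < i, f i j := by
          intro i
          rw [← sum_filter_add_sum_filter_not _ (fun j => i < j)]
          congr 1
          rw [sum_filter, sum_filter]
          refine sum_congr rfl fun j _ => ?_
          rcases lt_trichotomy i j with h | h | h
          · simp [h, h.le.not_gt]
          · subst h; simp [hf, hM.diag]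
          · simp [h, h.le.not_gt]
        have h4 : ∑ i, ∑ j with j < i, f i j = ∑ i, ∑ j with i < j, f i j := by
          simp only [sum_filter]
          rw [sum_comm]
          simp only [hfs]
        rw [sum_congr rfl fun i _ => h3 i, sum_add_distrib, h4]
        ring
      rw [h2] at h1
      have h5 : ∑ i, ∑ j with i < j, f i j = η := by linarith
      rw [← h5]
      simp only [hf, Complex.ofReal_sum]
    · intro i j
      simp only
      rw [hM.symm]
      by_cases h : i = j
      · rw [h]
      · rw [if_neg h, if_neg (Ne.symm h)]
    · intro i; simp [hM.diag]
    · intro i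
      rw [← Complex.ofReal_sum, sum_sub_distrib, hrow]
      simp

end TreeDiagram

/-! ### The Mellin integral of the product of the factors -/

theorem dressing_eq {d n : ℕ} {y : Fin n → Bdry d} (hy : Function.Injective y)
    (δ : Fin n → Fin n → ℂ) : dressing y δ = ∏ i, ∏ j with i < j, Gamma (δ i j) *
      cexp (-δ i j * log (‖y i - y j‖ ^ 2)) := by
  refine prod_congr rfl fun i _ => prod_congr rfl fun j hj => ?_
  have hij : i ≠ j := (mem_filter.1 hj).2.ne
  have hpos : 0 < ‖y i - y j‖ ^ 2 := by
    have := norm_pos_iff.2 (sub_ne_zero.2 (hy.ne hij))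
    positivity
  rw [neg_two_dot_bdry_bdry, Complex.cpow_def_of_ne_zero (by exact_mod_cast hpos.ne'),
    ← Complex.ofReal_log hpos.le, div_eq_mul_inv, ← Complex.exp_neg]
  congr 2
  ring

namespace TreeDiagram
variable {n : ℕ} (D : TreeDiagram n)

/-- The logarithm of the transmission factor between two boundary points. -/
def pathLog (a : D.Link → ℝ) (i j : Fin n) : ℝ :=
  ∑ e, if (i ∈ D.side e ↔ j ∈ D.side e) then 0 else D.crossLog a e

/-- The potential of the boundary points in the combined integral representation. -/
def boundaryPotential {d : ℕ} (y : Fin n → Bdry d) (a : D.Link → ℝ) (w : Fin n → ℝ) : ℝ :=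
  pairPotential (fun i j => log (‖y i - y j‖ ^ 2) + D.pathLog a i j) w

/-- The logarithm of the density of the variables of the combined integral representation. -/
def totalWeight {d : ℕ} (Δ : Fin n → ℝ) (y : Fin n → Bdry d) (q : D.Params × (Fin n → ℝ)) : ℝ :=
  D.vertexWeight d Δ q.1 + (∑ i, Δ i * q.2 i - D.boundaryPotential y q.1.2 q.2)

/-- The exponent `∑_e s_e log ρ_e` distributes over the pairs of boundary points. -/
theorem sum_mandelstam_mul {Δ : Fin n → ℝ} {δ : Fin n → Fin n → ℂ} (hsymm : ∀ i j, δ i j = δ j i)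
    (hdiag : ∀ i, δ i i = -(Δ i : ℂ)) (hsum : ∀ i, ∑ j, δ i j = 0) (a : D.Link → ℝ) :
    ∑ e, D.mandelstam Δ δ e * D.crossLog a e = ∑ i, ∑ j with i < j, δ i j * D.pathLog a i j := by
  simp only [D.mandelstam_eq hsymm hdiag hsum, sum_mul, pathLog, Complex.ofReal_sum,
    mul_sum]
  rw [sum_comm]
  refine sum_congr rfl fun i _ => ?_
  rw [sum_comm]
  refine sum_congr rfl fun j _ => sum_congr rfl fun e _ => ?_
  split_ifs <;> simp

theorem continuous_softplus : Continuous softplus := by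
  unfold softplus
  exact Continuous.log (by fun_prop) fun p => by positivity

theorem continuous_logRho : Continuous logRho := by
  have := continuous_softplus
  unfold logRho
  fun_prop

theorem continuous_crossLog (e : D.E) : Continuous fun a => D.crossLog a e := by
  have := continuous_logRho
  unfold crossLog
  fun_prop

theorem continuous_pathLog (i j : Fin n) : Continuous fun a => D.pathLog a i j := by
  unfold pathLog
  refine continuous_finsetSum _ fun e _ => ?_
  have := D.continuous_crossLog e
  split_ifs <;> fun_prop

theorem continuous_logLambda (e : D.E) : Continuous fun p => D.logLambda p e := by
  have := continuous_softplus
  unfold logLambda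
  fun_prop

theorem continuous_vertexWeight (d : ℕ) (Δ : Fin n → ℝ) : Continuous (D.vertexWeight d Δ) := by
  have := continuous_logRho
  unfold vertexWeight
  fun_prop

theorem continuous_totalWeight {d : ℕ} (Δ : Fin n → ℝ) (y : Fin n → Bdry d) :
    Continuous (D.totalWeight Δ y) := by
  have h1 := D.continuous_vertexWeight d Δ
  have h2 := D.continuous_pathLog
  have h3 : ∀ i j, Continuous fun q : D.Params × (Fin n → ℝ) => D.pathLog q.1.2 i j := fun i j =>
    (h2 i j).comp (by fun_prop)
  unfold totalWeight boundaryPotential pairPotential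
  fun_prop

variable {D}

theorem mem_tube_contourPoint {d : ℕ} {Δ : Fin n → ℝ} (hn : 3 ≤ n) {δ₀ : Fin n → Fin n → ℝ}
    (hδ : (fun i j => (δ₀ i j : ℂ)) ∈ D.tube d Δ) :
    IsMellinPoint δ₀ ∧ (∀ i, δ₀ i i = -Δ i) ∧ ∀ t, contourPoint δ₀ t ∈ D.tube d Δ ∧
      ∀ e, (D.mandelstam Δ (contourPoint δ₀ t) e).re = (D.mandelstam Δ (fun i j => (δ₀ i j : ℂ)) e).re := by
  obtain ⟨h1, h2, h3, h4, h5⟩ := hδ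
  simp only at h1 h2 h3 h4
  have hre : ∀ t i j, (contourPoint δ₀ t i j).re = δ₀ i j := fun t i j => by simp [contourPoint]
  have hp : IsMellinPoint δ₀ := ⟨fun i j => by exact_mod_cast h1 i j,
    fun i => by exact_mod_cast h3 i, fun i j hij => by simpa using h4 i j hij⟩
  have hd : ∀ i, δ₀ i i = -Δ i := fun i => by exact_mod_cast h2 i
  have hs : ∀ t e, (D.mandelstam Δ (contourPoint δ₀ t) e).re =
      (D.mandelstam Δ (fun i j => (δ₀ i j : ℂ)) e).re := by
    intro t e
    simp only [mandelstam, Complex.sub_re, Complex.re_sum, Complex.mul_re, hre]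
    simp
  refine ⟨hp, hd, fun t => ⟨⟨fun i j => ?_, fun i => ?_, fun i => ?_, fun i j hij => ?_, fun e => ?_⟩,
    hs t⟩⟩
  · simp only [contourPoint, hp.symm i j, mellinMatrix_comm t i j]
  · simp [contourPoint, mellinMatrix_self, hd]
  · simp only [contourPoint]
    rw [sum_add_distrib, ← mul_sum, ← Complex.ofReal_sum, ← Complex.ofReal_sum,
      hp.sum, sum_mellinMatrix hn]
    simp
  · rw [hre]; exact hp.pos i j hij
  · rw [hs]; exact h5 e

/-- The Mellin integral of the product of the factors, as an integral over the variables of the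
combined representation. -/
theorem mellinIntegral_treeProduct {d : ℕ} {Δ : Fin n → ℝ} (hΔ : D.Convergent d Δ) (hn : 3 ≤ n)
    {c : D.E → ℂ} (hc : ∀ e, (c e).re = 0) {δ₀ : Fin n → Fin n → ℝ}
    (hδ : (fun i j => (δ₀ i j : ℂ)) ∈ D.tube d Δ) {y : Fin n → Bdry d} (hy : Function.Injective y) :
    Integrable (fun t => treeProduct d (correction d) D Δ c (contourPoint δ₀ t) *
      dressing y (contourPoint δ₀ t)) ∧
    Integrable (fun q => exp (D.totalWeight Δ y q)) ∧
    mellinIntegral δ₀ y (treeProduct d (correction d) D Δ c) =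
      2 * ∫ q, cexp (D.totalWeight Δ y q + ∑ e, c e * D.logLambda q.1 e) := by
  obtain ⟨hp, hd, hcont⟩ := mem_tube_contourPoint hn hδ
  set s : (MellinIndex n → ℝ) → D.E → ℂ := fun t => D.mandelstam Δ (contourPoint δ₀ t) with hs
  have hsre : ∀ t e, (s t e).re = (s 0 e).re := fun t e => by rw [hs, (hcont t).2 e, ← (hcont 0).2 e]
  have htree : ∀ t, Integrable (fun p => cexp (D.amplitudeExponent d Δ c (s t) p)) ∧
      treeProduct d (correction d) D Δ c (contourPoint δ₀ t) =
        ∫ p, cexp (D.amplitudeExponent d Δ c (s t) p) := fun t =>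
    D.treeProduct_eq_integral d hΔ hc (hcont t).1.2.2.2.2
  obtain ⟨g, hg⟩ : ∃ g : (MellinIndex n → ℝ) → ℂ, g = fun t => dressing y (contourPoint δ₀ t) := ⟨_, rfl⟩
  have hgi : Integrable g := by
    have := (symanzik hn hp fun i j => log (‖y i - y j‖ ^ 2)).1
    rw [hg]
    simpa only [dressing_eq hy] using this
  have hsc : ∀ e, Continuous fun t => s t e := by
    intro e
    have := fun i j => continuous_contourPoint (n := n) δ₀ i j
    simp only [hs, mandelstam]
    fun_prop
  have hnorm : ∀ t p, ‖cexp (D.amplitudeExponent d Δ c (s t) p)‖ =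
      ‖cexp (D.amplitudeExponent d Δ c (s 0) p)‖ := by
    intro t p
    simp only [Complex.norm_exp, amplitudeExponent, Complex.add_re, Complex.sub_re, Complex.re_sum,
      Complex.re_mul_ofReal, hsre t]
  have hampc : Continuous fun x : (MellinIndex n → ℝ) × D.Params =>
      cexp (D.amplitudeExponent d Δ c (s x.1) x.2) := by
    have h1 := D.continuous_vertexWeight d Δ
    have h2 := D.continuous_logLambda
    have h3 : ∀ e, Continuous fun x : (MellinIndex n → ℝ) × D.Params => D.crossLog x.2.2 e := fun e =>
      (D.continuous_crossLog e).comp (by fun_prop)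
    unfold amplitudeExponent
    fun_prop
  obtain ⟨f, hf⟩ : ∃ f : (MellinIndex n → ℝ) × D.Params → ℂ,
    f = fun x => g x.1 * cexp (D.amplitudeExponent d Δ c (s x.1) x.2) := ⟨_, rfl⟩
  have hfi : Integrable f (volume.prod volume) := by
    have h1 : Integrable (fun x : (MellinIndex n → ℝ) × D.Params =>
        g x.1 * cexp (D.amplitudeExponent d Δ c (s 0) x.2)) (volume.prod volume) :=
      hgi.mul_prod (htree 0).1
    refine h1.mono ?_ (.of_forall fun x => ?_)
    · rw [hf]
      exact hgi.aestronglyMeasurable.comp_fst.mul hampc.aestronglyMeasurable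
    · simp only [hf, norm_mul, hnorm x.1, le_refl]
  have e1 : ∀ t, ∫ p, f (t, p) = treeProduct d (correction d) D Δ c (contourPoint δ₀ t) *
      dressing y (contourPoint δ₀ t) := by
    intro t
    simp only [hf, hg]
    rw [integral_const_mul, (htree t).2, mul_comm]
  have hsym := fun p : D.Params => symanzik hn hp
    fun i j => log (‖y i - y j‖ ^ 2) + D.pathLog p.2 i j
  have e2 : ∀ p, ∫ t, f (t, p) = 2 * (2 * pi) ^ Fintype.card (MellinIndex n) *
      (cexp (D.vertexWeight d Δ p + ∑ e, c e * D.logLambda p e) *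
      ((∫ w, exp (∑ i, Δ i * w i - D.boundaryPotential y p.2 w) : ℝ) : ℂ)) := by
    intro p
    have h1 : ∀ t, f (t, p) = cexp (D.vertexWeight d Δ p + ∑ e, c e * D.logLambda p e) *
        ∏ i, ∏ j with i < j, Gamma (contourPoint δ₀ t i j) *
        cexp (-contourPoint δ₀ t i j *
          ((log (‖y i - y j‖ ^ 2) + D.pathLog p.2 i j : ℝ) : ℂ)) := by
      intro t
      have ht := (hcont t).1
      have h2 := D.sum_mandelstam_mul ht.1 ht.2.1 ht.2.2.1 p.2
      have h3 : ∏ i, ∏ j with i < j, Gamma (contourPoint δ₀ t i j) *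
          cexp (-contourPoint δ₀ t i j *
            ((log (‖y i - y j‖ ^ 2) + D.pathLog p.2 i j : ℝ) : ℂ)) =
          g t * cexp (-∑ i, ∑ j with i < j, contourPoint δ₀ t i j * D.pathLog p.2 i j) := by
        rw [hg]
        simp only [dressing_eq hy, ← sum_neg_distrib, Complex.exp_sum]
        rw [← prod_mul_distrib]
        refine prod_congr rfl fun i _ => ?_
        rw [← prod_mul_distrib]
        refine prod_congr rfl fun j _ => ?_
        rw [mul_assoc, ← Complex.exp_add]
        congr 2
        push_cast
        ring
      rw [h3, hf, ← h2, mul_left_comm, ← Complex.exp_add]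
      simp only [amplitudeExponent, hs]
      congr 2
      ring
    simp only [h1]
    rw [integral_const_mul, (hsym p).2.2]
    simp only [hd, neg_neg, boundaryPotential]
    ring
  have hpi : (2 * (2 * pi : ℂ) ^ Fintype.card (MellinIndex n)) ≠ 0 :=
    mul_ne_zero two_ne_zero (pow_ne_zero _ (by exact_mod_cast (by positivity : (2 * pi) ≠ 0)))
  have hpnorm : ∀ p, ‖cexp (D.vertexWeight d Δ p + ∑ e, c e * D.logLambda p e)‖ =
      exp (D.vertexWeight d Δ p) := by
    intro p
    simp [Complex.norm_exp, hc]
  have hint : Integrable (fun q : D.Params × (Fin n → ℝ) => exp (D.totalWeight Δ y q))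
      (volume.prod volume) := by
    rw [integrable_prod_iff (D.continuous_totalWeight Δ y).rexp.aestronglyMeasurable]
    constructor
    · refine .of_forall fun p => ?_
      have := (hsym p).2.1.const_mul (exp (D.vertexWeight d Δ p))
      simp only [← exp_add, hd, neg_neg] at this
      exact this
    · have h1 := (hfi.integral_prod_right.const_mul (2 * (2 * pi : ℂ) ^ Fintype.card (MellinIndex n))⁻¹).norm
      refine h1.congr (.of_forall fun p => ?_)
      simp only [e2, inv_mul_cancel_left₀ hpi]
      rw [norm_mul, hpnorm, Complex.norm_real, Real.norm_of_nonneg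
        (integral_nonneg fun w => (exp_pos _).le), ← integral_const_mul]
      simp only [Real.norm_of_nonneg (exp_pos _).le, ← exp_add]
      rfl
  refine ⟨?_, hint, ?_⟩
  · have := hfi.integral_prod_left
    simpa only [e1] using this
  · have h1 := integral_integral_swap (f := fun t p => f (t, p)) hfi
    simp only [e1, e2] at h1
    rw [mellinIntegral, integral_const_mul, h1, integral_const_mul]
    have h2 : Integrable (fun q : D.Params × (Fin n → ℝ) =>
        cexp (D.totalWeight Δ y q + ∑ e, c e * D.logLambda q.1 e)) (volume.prod volume) := by
      refine hint.mono (Continuous.aestronglyMeasurable ?_) (.of_forall fun q => ?_)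
      · have h1 := D.continuous_totalWeight Δ y
        have h2 := D.continuous_logLambda
        fun_prop
      · rw [Complex.norm_exp, Real.norm_of_nonneg (exp_pos _).le]
        simp [hc]
    have h3 : ∫ q, cexp (D.totalWeight Δ y q + ∑ e, c e * D.logLambda q.1 e) =
        ∫ p, cexp (D.vertexWeight d Δ p + ∑ e, c e * D.logLambda p e) *
          ((∫ w, exp (∑ i, Δ i * w i - D.boundaryPotential y p.2 w) : ℝ) : ℂ) := by
      refine (integral_prod _ h2).trans (integral_congr_ae (.of_forall fun p => ?_))
      simp only
      rw [← integral_complex_ofReal, ← integral_const_mul]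
      refine integral_congr_ae (.of_forall fun w => ?_)
      simp only [totalWeight]
      rw [Complex.ofReal_exp, ← Complex.exp_add]
      congr 1
      push_cast
      ring
    rw [h3]
    have hpi' : (2 * pi : ℂ) ^ Fintype.card (MellinIndex n) ≠ 0 := right_ne_zero_of_mul hpi
    rw [one_div, inv_pow]
    field_simp

end TreeDiagram

/-! ### Comparison of the densities and of the phases -/

/-- A link separates its own ends and no other link does. -/
theorem Grown.colour_ends_iff {N K : Type*} [DecidableEq N] [DecidableEq K] {e₁ e₂ : K → N}
    {χ : K → N → Prop} {S : Finset N} {L : Finset K} (h : Grown e₁ e₂ χ S L) :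
    ∀ j ∈ L, ∀ k ∈ L, (χ j (e₁ k) ↔ χ j (e₂ k)) ↔ j ≠ k := by
  induction h with
  | root r => simp
  | leaf v p k hg hv hp hk hends hsep hS hL ih =>
    intro j hj k' hk''
    rcases mem_insert.1 hk'' with rfl | hk'
    · rcases mem_insert.1 hj with rfl | hj
      · rcases hends with h | h <;> rw [h.1, h.2] <;> tauto
      · have hne : j ≠ k' := fun h => hk (h ▸ hj)
        have := hL j hj
        rcases hends with h | h <;> rw [h.1, h.2] <;> tauto
    · have hends' := hg.ends_mem k' hk'
      rcases mem_insert.1 hj with rfl | hj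
      · have hne : j ≠ k' := by rintro rfl; exact hk hk'
        simp [hS _ hends'.1, hS _ hends'.2, hne]
      · exact ih j hj k' hk'

/-- Of the links at a node exactly one separates it from any given other node. -/
theorem Grown.card_separating {N K : Type*} [DecidableEq N] [DecidableEq K] {e₁ e₂ : K → N}
    {χ : K → N → Prop} {S : Finset N} {L : Finset K} (h : Grown e₁ e₂ χ S L) :
    ∀ A ∈ S, ∀ B ∈ S, (L.filter fun k => (e₁ k = A ∨ e₂ k = A) ∧ ¬ (χ k A ↔ χ k B)).card =
      if A = B then 0 else 1 := by
  induction h with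
  | root r => simp
  | @leaf S L v p k hg hv hp hk hends hsep hS hL ih =>
    intro A hA B hB
    have hmem := hg.ends_mem
    rw [Finset.filter_insert]
    have hknot : k ∉ L.filter fun k => (e₁ k = A ∨ e₂ k = A) ∧ ¬ (χ k A ↔ χ k B) := fun h =>
      hk (mem_filter.1 h).1
    have hcard : (if (e₁ k = A ∨ e₂ k = A) ∧ ¬ (χ k A ↔ χ k B) then
        insert k (L.filter fun k => (e₁ k = A ∨ e₂ k = A) ∧ ¬ (χ k A ↔ χ k B)) else
        L.filter fun k => (e₁ k = A ∨ e₂ k = A) ∧ ¬ (χ k A ↔ χ k B)).card =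
        (if (e₁ k = A ∨ e₂ k = A) ∧ ¬ (χ k A ↔ χ k B) then 1 else 0) +
        (L.filter fun k => (e₁ k = A ∨ e₂ k = A) ∧ ¬ (χ k A ↔ χ k B)).card := by
      split_ifs
      · rw [card_insert_of_notMem hknot, add_comm]
      · rw [zero_add]
    have hkA : (e₁ k = A ∨ e₂ k = A) ↔ A = v ∨ A = p := by
      rcases hends with h | h <;> rw [h.1, h.2] <;> constructor <;> rintro (h | h) <;> simp [h]
    rw [hcard, if_congr (and_congr_left' hkA) rfl rfl]
    rcases mem_insert.1 hA with rfl | hAS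
    · have hempty : (L.filter fun k => (e₁ k = A ∨ e₂ k = A) ∧ ¬ (χ k A ↔ χ k B)) = ∅ := by
        refine Finset.filter_eq_empty_iff.2 fun j hj h => ?_
        rcases h.1 with h | h
        · exact hv (h ▸ (hmem j hj).1)
        · exact hv (h ▸ (hmem j hj).2)
      rw [hempty, Finset.card_empty, add_zero]
      rcases mem_insert.1 hB with rfl | hB
      · simp
      · have hAB : A ≠ B := fun h => hv (h ▸ hB)
        have := hS B hB
        rw [if_neg hAB, if_pos ⟨Or.inl rfl, by tauto⟩]
    · have hAv : A ≠ v := fun h => hv (h ▸ hAS)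
      rcases mem_insert.1 hB with rfl | hB
      · have hfil : (L.filter fun k => (e₁ k = A ∨ e₂ k = A) ∧ ¬ (χ k A ↔ χ k B)) =
            L.filter fun k => (e₁ k = A ∨ e₂ k = A) ∧ ¬ (χ k A ↔ χ k p) := by
          refine Finset.filter_congr fun j hj => ?_
          rw [hL j hj]
        rw [hfil, ih A hAS p hp, if_neg hAv]
        by_cases hAp : A = p
        · subst hAp
          rw [if_pos ⟨Or.inr rfl, by tauto⟩, if_pos rfl]
        · rw [if_neg (fun h => h.1.elim hAv hAp), if_neg hAp]
      · have h1 := hS A hAS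
        have h2 := hS B hB
        have h3 : ¬ ((A = v ∨ A = p) ∧ ¬ (χ k A ↔ χ k B)) := fun h => h.2 (h1.trans h2.symm)
        rw [ih A hAS B hB, if_neg h3, zero_add]

namespace TreeDiagram
variable {n : ℕ} (D : TreeDiagram n)

/-- The node at which a boundary point is attached. -/
def node (i : Fin n) : D.V ⊕ D.E := Sum.inl (D.attach i)

/-- The masses of the nodes. -/
def nodeMass (w : Fin n → ℝ) (a : D.Link → ℝ) (B : D.V ⊕ D.E) : ℝ :=
  mass D.Colour univ D.node w a B

theorem nodeMass_pos [Nonempty (Fin n)] (w : Fin n → ℝ) (a : D.Link → ℝ) (B : D.V ⊕ D.E) :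
    0 < D.nodeMass w a B := by
  unfold nodeMass mass
  exact Finset.sum_pos (fun _ _ => exp_pos _) Finset.univ_nonempty

theorem sepLog_node (a : D.Link → ℝ) (i j : Fin n) :
    sepLog D.Colour univ a (D.node i) (D.node j) = D.pathLog a i j := by
  rw [sepLog, D.sum_link, pathLog]
  refine sum_congr rfl fun e => ?_
  have h1 := D.colour_attach_iff (D.srcLink e) i
  have h2 := D.colour_attach_iff (D.srcLink e) j
  have h3 := D.colour_attach_iff (D.tgtLink e) i
  have h4 := D.colour_attach_iff (D.tgtLink e) j
  have e1 : (D.srcLink e).2.1 = e := rfl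
  have e2 : (D.tgtLink e).2.1 = e := rfl
  rw [e1] at h1 h2
  rw [e2] at h3 h4
  intro _
  by_cases hc : i ∈ D.side e ↔ j ∈ D.side e
  · rw [if_pos hc, if_pos (by rw [node, node, h1, h2]; exact hc),
      if_pos (by rw [node, node, h3, h4]; exact hc), add_zero]
  · rw [if_neg hc, if_neg (by rw [node, node, h1, h2]; exact hc),
      if_neg (by rw [node, node, h3, h4]; exact hc), crossLog]

theorem pathLog_comm (a : D.Link → ℝ) (i j : Fin n) : D.pathLog a i j = D.pathLog a j i := by
  simp only [pathLog, iff_comm]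

theorem pairEnergy_node {d : ℕ} {y : Fin n → Bdry d} (hy : Function.Injective y) (w : Fin n → ℝ)
    (a : D.Link → ℝ) :
    pairEnergy D.Colour univ D.node y w a = D.boundaryPotential y a w := by
  have h0 : ∀ i j, exp (w i + w j + sepLog D.Colour univ a (D.node i) (D.node j)) *
      ‖y i - y j‖ ^ 2 = if i = j then 0 else
        exp (w i + w j + (log (‖y i - y j‖ ^ 2) + D.pathLog a i j)) := by
    intro i j
    rw [D.sepLog_node]
    split_ifs with h
    · subst h; simp
    · have hpos : 0 < ‖y i - y j‖ ^ 2 := by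
        have := norm_pos_iff.2 (sub_ne_zero.2 (hy.ne h))
        positivity
      rw [show w i + w j + (log (‖y i - y j‖ ^ 2) + D.pathLog a i j) =
        (w i + w j + D.pathLog a i j) + log (‖y i - y j‖ ^ 2) by ring,
        exp_add _ (log _), exp_log hpos]
  set f : Fin n → Fin n → ℝ := fun i j =>
    exp (w i + w j + (log (‖y i - y j‖ ^ 2) + D.pathLog a i j)) with hf
  have hfs : ∀ i j, f i j = f j i := fun i j => by
    simp only [hf, D.pathLog_comm a i j, norm_sub_rev (y i) (y j), add_comm (w i) (w j)]
  simp only [pairEnergy, h0, boundaryPotential, pairPotential]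
  have h3 : ∀ i, ∑ j, (if i = j then 0 else f i j) = ∑ j with i < j, f i j + ∑ j with j < i, f i j := by
    intro i
    rw [sum_filter, sum_filter, ← sum_add_distrib]
    refine sum_congr rfl fun j _ => ?_
    rcases lt_trichotomy i j with h | h | h
    · simp [h, h.ne, h.le.not_gt]
    · subst h; simp
    · simp [h, h.ne', h.le.not_gt]
  have h4 : ∑ i, ∑ j with j < i, f i j = ∑ i, ∑ j with i < j, f i j := by
    simp only [sum_filter]
    rw [sum_comm]
    simp only [hfs]
  rw [sum_congr rfl fun i _ => h3 i, sum_add_distrib, h4]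
  ring

theorem colour_link_iff (j k : D.Link) :
    (D.Colour j (Sum.inl k.1) ↔ D.Colour j (Sum.inr k.2.1)) ↔ j ≠ k :=
  D.grown_univ.colour_ends_iff j (mem_univ _) k (mem_univ _)

theorem card_separating (A : D.V) (B : D.V ⊕ D.E) :
    (univ.filter fun b : D.Incident A =>
      ¬ (D.Colour ⟨A, b⟩ (Sum.inl A) ↔ D.Colour ⟨A, b⟩ B)).card = if Sum.inl A = B then 0 else 1 := by
  rw [← D.grown_univ.card_separating _ (mem_univ (Sum.inl A)) B (mem_univ _)]
  refine Finset.card_bij (fun b _ => ⟨A, b⟩) ?_ ?_ ?_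
  · intro b hb
    exact mem_filter.2 ⟨mem_univ _, Or.inl rfl, (mem_filter.1 hb).2⟩
  · intro b _ b' _ h
    exact eq_of_heq (Sigma.mk.inj_iff.1 h).2
  · rintro ⟨v, b⟩ hb
    obtain ⟨-, h1 | h1, h2⟩ := mem_filter.1 hb
    · have : v = A := Sum.inl_injective h1
      subst this
      exact ⟨b, mem_filter.2 ⟨mem_univ _, h2⟩, rfl⟩
    · simp at h1

theorem sepLog_link (a : D.Link → ℝ) (k : D.Link) (B : D.V ⊕ D.E) :
    sepLog D.Colour univ a (Sum.inr k.2.1) B =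
      sepLog D.Colour univ a (Sum.inl k.1) B +
        if (D.Colour k (Sum.inl k.1) ↔ D.Colour k B) then logRho (a k) else -logRho (a k) := by
  rw [sepLog, sepLog, ← add_sum_erase _ _ (mem_univ k),
    ← add_sum_erase _ _ (mem_univ k)]
  have h1 : ∀ j ∈ univ.erase k, (if (D.Colour j (Sum.inr k.2.1) ↔ D.Colour j B) then 0 else logRho (a j)) =
      if (D.Colour j (Sum.inl k.1) ↔ D.Colour j B) then 0 else logRho (a j) := by
    intro j hj
    have := (D.colour_link_iff j k).2 (ne_of_mem_erase hj)
    simp only [this]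
  rw [sum_congr rfl h1]
  have h2 : ¬ (D.Colour k (Sum.inl k.1) ↔ D.Colour k (Sum.inr k.2.1)) := fun h =>
    (D.colour_link_iff k k).1 h rfl
  by_cases h3 : D.Colour k (Sum.inl k.1) ↔ D.Colour k B
  · have h4 : ¬ (D.Colour k (Sum.inr k.2.1) ↔ D.Colour k B) := by tauto
    rw [if_pos h3, if_neg h4, if_pos h3]; ring
  · have h4 : (D.Colour k (Sum.inr k.2.1) ↔ D.Colour k B) := by tauto
    rw [if_neg h3, if_pos h4, if_neg h3]; ring

/-- The total mass of the boundary points beyond a half-edge. -/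
theorem exp_mul_nodeMass_link (w : Fin n → ℝ) (a : D.Link → ℝ) (k : D.Link) :
    exp ((a k + softplus (a k)) / 2) * D.nodeMass w a (Sum.inr k.2.1) =
      exp (a k) * D.nodeMass w a (Sum.inl k.1) +
        ∑ i, if (D.Colour k (Sum.inl k.1) ↔ D.Colour k (D.node i)) then 0 else
          exp (w i + sepLog D.Colour univ a (Sum.inl k.1) (D.node i)) := by
  simp only [nodeMass, mass]
  rw [mul_sum, mul_sum, ← sum_add_distrib]
  refine sum_congr rfl fun i _ => ?_
  rw [sepLog_link]
  set x := w i + sepLog D.Colour univ a (Sum.inl k.1) (D.node i) with hx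
  split_ifs
  · rw [← exp_add, ← exp_add, add_zero, logRho]
    congr 1
    rw [hx]; ring
  · have h1 : exp (softplus (a k) + x) = (1 + exp (a k)) * exp x := by
      rw [exp_add, exp_softplus]
    rw [← exp_add, logRho, show (a k + softplus (a k)) / 2 +
      (w i + (sepLog D.Colour univ a (Sum.inl k.1) (D.node i) + -((a k - softplus (a k)) / 2))) =
      softplus (a k) + x by rw [hx]; ring, h1]
    ring

theorem sum_exp_legs (w : Fin n → ℝ) (a : D.Link → ℝ) (A : D.V) :
    ∑ i with D.attach i = A, exp (w i) + ∑ b : D.Incident A,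
      exp ((a ⟨A, b⟩ + softplus (a ⟨A, b⟩)) / 2) * D.nodeMass w a (Sum.inr b.1) =
      D.nodeMass w a (Sum.inl A) * (1 + ∑ b : D.Incident A, exp (a ⟨A, b⟩)) := by
  have h1 : ∀ b : D.Incident A, exp ((a ⟨A, b⟩ + softplus (a ⟨A, b⟩)) / 2) *
      D.nodeMass w a (Sum.inr b.1) = _ := fun b => D.exp_mul_nodeMass_link w a ⟨A, b⟩
  simp only [h1]
  rw [sum_add_distrib, ← sum_mul, sum_comm]
  have h2 : ∀ i, ∑ b : D.Incident A, (if (D.Colour ⟨A, b⟩ (Sum.inl A) ↔ D.Colour ⟨A, b⟩ (D.node i)) then 0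
      else exp (w i + sepLog D.Colour univ a (Sum.inl A) (D.node i))) =
      if D.attach i = A then 0 else
        exp (w i + sepLog D.Colour univ a (Sum.inl A) (D.node i)) := by
    intro i
    have h3 := D.card_separating A (D.node i)
    have h5 : ∀ b : D.Incident A, (if (D.Colour ⟨A, b⟩ (Sum.inl A) ↔ D.Colour ⟨A, b⟩ (D.node i)) then 0
        else exp (w i + sepLog D.Colour univ a (Sum.inl A) (D.node i))) =
        if ¬ (D.Colour ⟨A, b⟩ (Sum.inl A) ↔ D.Colour ⟨A, b⟩ (D.node i)) then
          exp (w i + sepLog D.Colour univ a (Sum.inl A) (D.node i)) else 0 := fun b =>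
      (ite_not _ _ _).symm
    rw [sum_congr rfl fun b _ => h5 b, ← sum_filter, Finset.sum_const, h3]
    by_cases h : D.attach i = A
    · simp [node, h]
    · rw [if_neg (by simpa [node] using Ne.symm h), if_neg h, one_smul]
  rw [sum_congr rfl fun i _ => h2 i, sum_filter]
  have h4 : D.nodeMass w a (Sum.inl A) = ∑ i, (if D.attach i = A then exp (w i) else 0) +
      ∑ i, if D.attach i = A then 0 else
        exp (w i + sepLog D.Colour univ a (Sum.inl A) (D.node i)) := by
    rw [← sum_add_distrib, nodeMass, mass]
    refine sum_congr rfl fun i _ => ?_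
    split_ifs with h
    · rw [node, h, add_zero]
      simp [sepLog]
    · rw [zero_add]
  rw [mul_add, mul_one]
  nth_rewrite 2 [h4]
  ring

/-- The logarithm of the density of the Schwinger parameters and of the radial coordinates. -/
def preWeight (d : ℕ) (Δ : Fin n → ℝ) (u : D.V → ℝ) (s : (Fin n → ℝ) × (D.Link → ℝ)) : ℝ :=
  ∑ i, Δ i * (s.1 i + u (D.attach i)) + h d * ∑ k : D.Link, (s.2 k + u k.1) - d * ∑ v, u v -
    (∑ i, exp (s.1 i + 2 * u (D.attach i)) + ∑ k : D.Link, exp (s.2 k + 2 * u k.1))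

/-- The densities agree after the change of variables. -/
theorem treeWeight_add_preWeight [Nonempty (Fin n)] {d : ℕ} (Δ : Fin n → ℝ) {y : Fin n → Bdry d}
    (hy : Function.Injective y) (w : Fin n → ℝ) (p : D.Params) :
    treeWeight D.Colour univ univ D.node y w p.2 +
      D.preWeight d Δ (fun v => p.1 v / 2 - log (D.nodeMass w p.2 (Sum.inl v)))
        (treeT D.Colour univ D.node w p.2, treeTau (fun k : D.Link => Sum.inl k.1)
          (fun k => Sum.inr k.2.1) D.Colour univ D.node w p.2) = D.totalWeight Δ y (p, w) := by
  obtain ⟨ζ, a⟩ := p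
  set lm : D.V ⊕ D.E → ℝ := fun B => log (D.nodeMass w a B) with hlm
  have hexp : ∀ B, exp (lm B) = D.nodeMass w a B := fun B => exp_log (D.nodeMass_pos w a B)
  have hT : ∀ i, treeT D.Colour univ D.node w a i = w i + lm (D.node i) := fun i => rfl
  have hτ : ∀ k : D.Link, treeTau (fun k : D.Link => Sum.inl k.1)
      (fun k => Sum.inr k.2.1) D.Colour univ D.node w a k =
      (a k + softplus (a k)) / 2 + lm (Sum.inl k.1) + lm (Sum.inr k.2.1) := fun k => by
    rw [treeTau, if_pos (mem_univ _)]; rfl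
  have hfib : ∀ f : D.V → Fin n → ℝ, ∑ i, f (D.attach i) i = ∑ v, ∑ i with D.attach i = v, f v i := by
    intro f
    rw [← Finset.sum_fiberwise univ D.attach]
    refine sum_congr rfl fun v _ => sum_congr rfl fun i hi => ?_
    rw [(mem_filter.1 hi).2]
  have hexpsum : ∑ i, exp (w i + lm (D.node i) + 2 * (ζ (D.attach i) / 2 - lm (Sum.inl (D.attach i)))) +
      ∑ k : D.Link, exp ((a k + softplus (a k)) / 2 + lm (Sum.inl k.1) + lm (Sum.inr k.2.1) +
        2 * (ζ k.1 / 2 - lm (Sum.inl k.1))) = ∑ v, exp (ζ v) + ∑ k : D.Link, exp (ζ k.1 + a k) := by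
    simp only [node]
    rw [hfib (fun v i => exp (w i + lm (Sum.inl v) + 2 * (ζ v / 2 - lm (Sum.inl v)))),
      Fintype.sum_sigma, Fintype.sum_sigma, ← sum_add_distrib, ← sum_add_distrib]
    refine sum_congr rfl fun v _ => ?_
    have h1 := D.sum_exp_legs w a v
    have hm := (D.nodeMass_pos w a (Sum.inl v)).ne'
    have h2 : ∀ i, exp (w i + lm (Sum.inl v) + 2 * (ζ v / 2 - lm (Sum.inl v))) =
        exp (ζ v) / D.nodeMass w a (Sum.inl v) * exp (w i) := by
      intro i
      rw [show w i + lm (Sum.inl v) + 2 * (ζ v / 2 - lm (Sum.inl v)) = ζ v - lm (Sum.inl v) + w i by ring,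
        exp_add, Real.exp_sub, hexp]
    have h3 : ∀ b : D.Incident v, exp ((a ⟨v, b⟩ + softplus (a ⟨v, b⟩)) / 2 + lm (Sum.inl v) +
        lm (Sum.inr b.1) + 2 * (ζ v / 2 - lm (Sum.inl v))) = exp (ζ v) / D.nodeMass w a (Sum.inl v) *
        (exp ((a ⟨v, b⟩ + softplus (a ⟨v, b⟩)) / 2) * D.nodeMass w a (Sum.inr b.1)) := by
      intro b
      rw [show (a ⟨v, b⟩ + softplus (a ⟨v, b⟩)) / 2 + lm (Sum.inl v) +
        lm (Sum.inr b.1) + 2 * (ζ v / 2 - lm (Sum.inl v)) = ζ v - lm (Sum.inl v) +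
        ((a ⟨v, b⟩ + softplus (a ⟨v, b⟩)) / 2 + lm (Sum.inr b.1)) by ring,
        exp_add, Real.exp_sub, exp_add, hexp, hexp]
    simp only [h2, h3, ← mul_sum]
    rw [← mul_add, h1]
    simp only [exp_add, ← mul_sum]
    field_simp
  have hmass : ∑ B, lm B = ∑ v, lm (Sum.inl v) + ∑ e, lm (Sum.inr e) := Fintype.sum_sum_type _
  have hlinkE : ∑ k : D.Link, lm (Sum.inr k.2.1) = 2 * ∑ e, lm (Sum.inr e) := by
    rw [D.sum_link, mul_sum]
    exact sum_congr rfl fun e _ => by simp only [srcLink, tgtLink]; ring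
  have hlinkζ : ∑ k : D.Link, ζ k.1 = ∑ v, D.valency v * ζ v := by
    rw [Fintype.sum_sigma]
    exact sum_congr rfl fun v _ => by simp [valency]
  have hΔ : ∑ i, Δ i * ζ (D.attach i) = ∑ v, D.vertexDim Δ v * ζ v := by
    rw [hfib (fun v i => Δ i * ζ v)]
    exact sum_congr rfl fun v _ => by rw [vertexDim, sum_mul]
  have hd : (d : ℝ) = 2 * h d := by unfold h; ring
  have hlmdef : ∀ B, log (D.nodeMass w a B) = lm B := fun B => rfl
  have hmdef : ∀ B, log (mass D.Colour univ D.node w a B) = lm B := fun B => rfl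
  simp only [preWeight, totalWeight, vertexWeight, treeWeight, D.pairEnergy_node hy, hT, hτ, hlmdef, hmdef,
    hexpsum, hmass, vertexPower]
  have e1 : ∑ i, Δ i * (w i + lm (D.node i) + (ζ (D.attach i) / 2 - lm (Sum.inl (D.attach i)))) =
      ∑ i, Δ i * w i + 1 / 2 * ∑ v, D.vertexDim Δ v * ζ v := by
    rw [← hΔ, mul_sum, ← sum_add_distrib]
    exact sum_congr rfl fun i _ => by simp only [node]; ring
  have e2 : ∑ k : D.Link, ((a k + softplus (a k)) / 2 + lm (Sum.inl k.1) + lm (Sum.inr k.2.1) +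
      (ζ k.1 / 2 - lm (Sum.inl k.1))) = ∑ k : D.Link, logRho (a k) + ∑ k, softplus (a k) +
      2 * ∑ e, lm (Sum.inr e) + 1 / 2 * ∑ v, D.valency v * ζ v := by
    rw [← hlinkE, ← hlinkζ, mul_sum, ← sum_add_distrib, ← sum_add_distrib,
      ← sum_add_distrib]
    exact sum_congr rfl fun k _ => by simp only [logRho]; ring
  have e3 : ∑ v, (ζ v / 2 - lm (Sum.inl v)) = 1 / 2 * ∑ v, ζ v - ∑ v, lm (Sum.inl v) := by
    rw [sum_sub_distrib, mul_sum]
    congr 1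
    exact sum_congr rfl fun v _ => by ring
  have e4 : ∑ v, ((D.vertexDim Δ v + ((D.valency v : ℝ) - 2) * h d) / 2 * ζ v - exp (ζ v)) =
      1 / 2 * ∑ v, D.vertexDim Δ v * ζ v + h d * (1 / 2 * ∑ v, D.valency v * ζ v) - h d * ∑ v, ζ v -
        ∑ v, exp (ζ v) := by
    rw [mul_sum, mul_sum, mul_sum, mul_sum, ← sum_add_distrib,
      ← sum_sub_distrib, ← sum_sub_distrib]
    exact sum_congr rfl fun v _ => by ring
  have e5 : ∑ k : D.Link, (h d * logRho (a k) - exp (ζ k.1 + a k)) =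
      h d * ∑ k, logRho (a k) - ∑ k : D.Link, exp (ζ k.1 + a k) := by
    rw [sum_sub_distrib, mul_sum]
  rw [e1, e2, e3, e4, e5, hd]
  ring

/-- The spectrum phases agree after the change of variables. -/
theorem logLambda_eq (w : Fin n → ℝ) (p : D.Params) (e : D.E) :
    (treeTau (fun k : D.Link => (Sum.inl k.1 : D.V ⊕ D.E)) (fun k => Sum.inr k.2.1) D.Colour univ
        D.node w p.2 (D.tgtLink e) + (p.1 (D.tgt e) / 2 - log (D.nodeMass w p.2 (Sum.inl (D.tgt e))))) -
      (treeTau (fun k : D.Link => (Sum.inl k.1 : D.V ⊕ D.E)) (fun k => Sum.inr k.2.1) D.Colour univ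
        D.node w p.2 (D.srcLink e) + (p.1 (D.src e) / 2 - log (D.nodeMass w p.2 (Sum.inl (D.src e))))) =
      D.logLambda p e := by
  simp only [treeTau, mem_univ, if_true, logLambda, nodeMass, srcLink, tgtLink]
  ring

end TreeDiagram

/-! ### The volume of anti-de Sitter space -/

section PiWithDensity
variable {ι X : Type*} [Fintype ι] [MeasurableSpace X]

theorem lintegral_pi_prod (μ : Measure X) [SigmaFinite μ] {f : ι → X → ENNReal}
    (hf : ∀ i, Measurable (f i)) :
    ∫⁻ x : ι → X, ∏ i, f i (x i) ∂Measure.pi (fun _ => μ) = ∏ i, ∫⁻ x, f i x ∂μ := by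
  have hm : Measurable fun x : ι → X => ∏ i, f i (x i) :=
    Finset.measurable_fun_prod _ fun i _ => (hf i).comp (measurable_pi_apply i)
  have key : ∀ (s : Finset ι) (x : ι → X), (∫⋯∫⁻_s, (fun x => ∏ i, f i (x i)) ∂fun _ => μ) x =
      (∏ i ∈ s, ∫⁻ x, f i x ∂μ) * ∏ i ∈ sᶜ, f i (x i) := by
    intro s
    induction s using Finset.induction_on with
    | empty => intro x; simp
    | insert j s hj ih =>
      intro x
      have hc : sᶜ = insert j (insert j s)ᶜ := by
        ext i
        by_cases h : i = j
        · subst h; simp [hj]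
        · simp [h]
      have hj' : j ∉ (insert j s)ᶜ := by simp
      rw [lmarginal_insert _ hm hj, Finset.prod_insert hj]
      simp only [ih]
      rw [hc]
      simp only [Finset.prod_insert hj', Function.update_self]
      have h1 : ∀ z, ∏ i ∈ (insert j s)ᶜ, f i (update x j z i) = ∏ i ∈ (insert j s)ᶜ, f i (x i) := by
        intro z
        refine prod_congr rfl fun i hi => ?_
        rw [Function.update_of_ne (by rintro rfl; exact hj' hi)]
      simp only [h1]
      rw [show (fun z => (∏ i ∈ s, ∫⁻ x, f i x ∂μ) * (f j z * ∏ i ∈ (insert j s)ᶜ, f i (x i))) =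
        fun z => ((∏ i ∈ s, ∫⁻ x, f i x ∂μ) * ∏ i ∈ (insert j s)ᶜ, f i (x i)) * f j z by
        funext z; ring, lintegral_const_mul _ (hf j)]
      ring
  by_cases hne : Nonempty (ι → X)
  · obtain ⟨x⟩ := hne
    rw [lintegral_eq_lmarginal_univ x, key]
    simp
  · rw [not_nonempty_iff] at hne
    obtain ⟨i, hi⟩ := isEmpty_pi.1 hne
    rw [lintegral_of_isEmpty]
    exact (Finset.prod_eq_zero (mem_univ i) (lintegral_of_isEmpty _ _)).symm

theorem pi_withDensity (μ : Measure X) [SigmaFinite μ] {f : X → ENNReal}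
    (hf : Measurable f) [SigmaFinite (μ.withDensity f)] :
    Measure.pi (fun _ : ι => μ.withDensity f) =
      (Measure.pi fun _ : ι => μ).withDensity fun x => ∏ i, f (x i) := by
  refine Measure.pi_eq fun s hs => ?_
  rw [withDensity_apply _ (MeasurableSet.univ_pi hs), ← lintegral_indicator (MeasurableSet.univ_pi hs)]
  have h1 : ∀ x : ι → X, (Set.univ.pi s).indicator (fun x => ∏ i, f (x i)) x =
      ∏ i, (s i).indicator f (x i) := by
    intro x
    by_cases hx : x ∈ Set.univ.pi s
    · rw [Set.indicator_of_mem hx]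
      exact prod_congr rfl fun i _ => (Set.indicator_of_mem (hx i (Set.mem_univ i)) _).symm
    · rw [Set.indicator_of_notMem hx]
      simp only [Set.mem_pi, Set.mem_univ, true_imp_iff, not_forall] at hx
      obtain ⟨i, hi⟩ := hx
      exact (Finset.prod_eq_zero (mem_univ i) (Set.indicator_of_notMem hi _)).symm
  simp only [h1]
  rw [lintegral_pi_prod μ fun i => hf.indicator (hs i)]
  refine prod_congr rfl fun i _ => ?_
  rw [lintegral_indicator (hs i), withDensity_apply _ (hs i)]

end PiWithDensity

/-- The bulk point with logarithmic radial coordinate. -/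
def bulkPoint {d : ℕ} (q : ℝ × Bdry d) : Bulk d := (exp q.1, q.2)

theorem measurable_bulkPoint {d : ℕ} : Measurable (bulkPoint (d := d)) := by
  unfold bulkPoint; fun_prop

theorem adsVolume_eq_map (d : ℕ) : adsVolume d =
    ((volume : Measure (ℝ × Bdry d)).withDensity fun q => ofReal (exp (-(d * q.1)))).map
      bulkPoint := by
  refine Measure.ext_of_lintegral _ fun f hf => ?_
  have hw : Measurable fun q : ℝ × Bdry d => ofReal (exp (-(d * q.1))) := by fun_prop
  have hv : Measurable fun q : Bulk d => ofReal ((q.1 ^ (d + 1))⁻¹) := by fun_prop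
  have hfb : Measurable fun q => f (bulkPoint (d := d) q) := hf.comp measurable_bulkPoint
  rw [lintegral_map hf measurable_bulkPoint, lintegral_withDensity_eq_lintegral_mul _ hw hfb, adsVolume,
    lintegral_withDensity_eq_lintegral_mul _ hv hf]
  have hset : {X : Bulk d | 0 < X.1} = Set.Ioi (0 : ℝ) ×ˢ Set.univ := by ext; simp
  rw [hset, Measure.volume_eq_prod, ← Measure.prod_restrict, Measure.restrict_univ,
    lintegral_prod _ (hv.mul hf).aemeasurable,
    lintegral_prod _ (hw.mul hfb).aemeasurable,
    ← Real.range_exp, ← Set.image_univ, lintegral_image_eq_lintegral_abs_deriv_mul MeasurableSet.univ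
      (fun x _ => (Real.hasDerivAt_exp x).hasDerivWithinAt) Real.exp_injective.injOn,
    Measure.restrict_univ]
  refine lintegral_congr fun u => ?_
  have hmu : Measurable fun x : Bdry d => ((fun q : Bulk d => ofReal ((q.1 ^ (d + 1))⁻¹)) * f)
      (exp u, x) := (hv.mul hf).comp measurable_prodMk_left
  rw [← lintegral_const_mul _ hmu]
  refine lintegral_congr fun x => ?_
  simp only [Pi.mul_apply, bulkPoint]
  rw [← mul_assoc, ← ENNReal.ofReal_mul (abs_nonneg _), abs_of_pos (exp_pos u), ← Real.exp_nat_mul,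
    ← Real.exp_neg, ← exp_add]
  congr 4
  push_cast
  ring

theorem lintegral_pi_adsVolume {V : Type*} [Fintype V] {d : ℕ} {F : (V → Bulk d) → ENNReal}
    (hF : Measurable F) : ∫⁻ X, F X ∂(Measure.pi fun _ => adsVolume d) =
      ∫⁻ u : V → ℝ, ∫⁻ x : V → Bdry d, ofReal (exp (-(d * ∑ v, u v))) *
        F fun v => bulkPoint (u v, x v) := by
  have hw : Measurable fun q : ℝ × Bdry d => ofReal (exp (-(d * q.1))) := by fun_prop
  have hsig : SigmaFinite ((volume : Measure (ℝ × Bdry d)).withDensity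
      fun q => ofReal (exp (-(d * q.1)))) := SigmaFinite.withDensity_ofReal _
  have hsig' : SigmaFinite (((volume : Measure (ℝ × Bdry d)).withDensity
      fun q => ofReal (exp (-(d * q.1)))).map bulkPoint) := by
    rw [← adsVolume_eq_map]; infer_instance
  have hb : Measurable fun (x : V → ℝ × Bdry d) v => bulkPoint (x v) :=
    measurable_pi_lambda _ fun v => measurable_bulkPoint.comp (measurable_pi_apply v)
  have hden : Measurable fun x : V → ℝ × Bdry d => ∏ v, ofReal (exp (-(d * (x v).1))) :=
    Finset.measurable_fun_prod _ fun i _ => by fun_prop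
  simp only [adsVolume_eq_map]
  rw [← Measure.pi_map_pi fun _ => measurable_bulkPoint.aemeasurable, lintegral_map hF hb,
    pi_withDensity _ hw, lintegral_withDensity_eq_lintegral_mul _ hden
      (show Measurable fun x : V → ℝ × Bdry d => F fun v => bulkPoint (x v) from hF.comp hb)]
  have hmp := volume_measurePreserving_arrowProdEquivProdArrow ℝ (Bdry d) V
  have h1 : ∀ x : V → ℝ × Bdry d, ((fun x : V → ℝ × Bdry d =>
      ∏ v, ofReal (exp (-(d * (x v).1)))) * fun x : V → ℝ × Bdry d => F fun v => bulkPoint (x v)) x =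
      (fun q : (V → ℝ) × (V → Bdry d) => ofReal (exp (-(d * ∑ v, q.1 v))) *
        F fun v => bulkPoint (q.1 v, q.2 v)) (MeasurableEquiv.arrowProdEquivProdArrow ℝ (Bdry d) V x) := by
    intro x
    simp only [Pi.mul_apply]
    rw [← ENNReal.ofReal_prod_of_nonneg fun _ _ => (exp_pos _).le, ← Real.exp_sum,
      mul_sum, sum_neg_distrib]
    rfl
  have hg : Measurable fun q : (V → ℝ) × (V → Bdry d) => ofReal (exp (-(d * ∑ v, q.1 v))) *
        F fun v => bulkPoint (q.1 v, q.2 v) := by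
    refine Measurable.mul (by fun_prop) (hF.comp ?_)
    refine measurable_pi_lambda _ fun v => measurable_bulkPoint.comp ?_
    fun_prop
  have h2 := hmp.lintegral_comp hg
  simp only [← h1] at h2
  exact h2.trans (lintegral_prod _ hg.aemeasurable)

theorem lintegral_comp_half_sub {V : Type*} [Fintype V] {F : (V → ℝ) → ENNReal} (hF : Measurable F)
    (b : V → ℝ) : ∫⁻ u, F u = ofReal (1 / 2 ^ Fintype.card V) * ∫⁻ ζ : V → ℝ, F fun v => ζ v / 2 - b v := by
  have h1 : Measure.map (fun ζ : V → ℝ => (1 / 2 : ℝ) • ζ) volume = _ :=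
    Measure.map_addHaar_smul (volume : Measure (V → ℝ)) (by norm_num)
  have h2 : ∫⁻ ζ : V → ℝ, F (fun v => ζ v / 2 - b v) = ofReal (2 ^ Fintype.card V) * ∫⁻ u, F u := by
    have h3 : ∀ ζ : V → ℝ, F (fun v => ζ v / 2 - b v) = (fun u => F (u - b)) ((1 / 2 : ℝ) • ζ) := by
      intro ζ
      simp only
      congr 1
      funext v
      simp
      ring
    simp only [h3]
    rw [← lintegral_map (f := fun u => F (u - b)) (by fun_prop) (by fun_prop), h1, lintegral_smul_measure,
      lintegral_sub_right_eq_self F b, smul_eq_mul]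
    congr 2
    rw [Module.finrank_fintype_fun_eq_card, ← inv_pow, abs_of_pos (by positivity)]
    norm_num
  rw [h2, ← mul_assoc, ← ENNReal.ofReal_mul (by positivity)]
  simp

/-! ### The measure of the position space representation -/

namespace TreeDiagram
variable {n : ℕ} (D : TreeDiagram n)

/-- The Schwinger parameters of the boundary points and of the half-edges. -/
abbrev Schwinger : Type := (Fin n → ℝ) × (D.Link → ℝ)

/-- The logarithm of the density of the Schwinger parameters at fixed bulk points `X` and fixed boundary
points `Q` of the split representation. -/
def schwingerWeight {d : ℕ} (Δ : Fin n → ℝ) (y : Fin n → Bdry d) (X : D.V → Bulk d) (Q : D.E → Bdry d)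
    (s : D.Schwinger) : ℝ :=
  ∑ i, Δ i * s.1 i + h d * ∑ k, s.2 k -
    (∑ i, exp (s.1 i) * (-2 * dot (bdryEmb (y i)) (bulkEmb (X (D.attach i)))) +
      ∑ k : D.Link, exp (s.2 k) * (-2 * dot (bdryEmb (Q k.2.1)) (bulkEmb (X k.1))))

/-- The variables conjugate to the spectrum variables. -/
def schwingerPhase (s : D.Schwinger) (e : D.E) : ℝ := s.2 (D.tgtLink e) - s.2 (D.srcLink e)

/-- The logarithmic radial coordinates at the ends of the boundary legs and of the half-edges. -/
def radialShift (u : D.V → ℝ) : D.Schwinger := (fun i => u (D.attach i), fun k => u k.1)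

theorem measurable_dot {α : Type*} [MeasurableSpace α] {d : ℕ} {f : α → Bdry d} {g : α → Bulk d}
    (hf : Measurable f) (hg : Measurable g) :
    Measurable fun q => -2 * dot (bdryEmb (f q)) (bulkEmb (g q)) := by
  unfold dot bdryEmb bulkEmb
  fun_prop

theorem measurable_schwingerWeight {d : ℕ} (Δ : Fin n → ℝ) (y : Fin n → Bdry d) :
    Measurable fun q : (D.V → Bulk d) × ((D.E → Bdry d) × D.Schwinger) =>
      D.schwingerWeight Δ y q.1 q.2.1 q.2.2 := by
  have hX : ∀ v, Measurable fun q : (D.V → Bulk d) × ((D.E → Bdry d) × D.Schwinger) => q.1 v := fun v => by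
    fun_prop
  have hQ : ∀ e, Measurable fun q : (D.V → Bulk d) × ((D.E → Bdry d) × D.Schwinger) => q.2.1 e := fun e => by
    fun_prop
  have ht : ∀ i, Measurable fun q : (D.V → Bulk d) × ((D.E → Bdry d) × D.Schwinger) => q.2.2.1 i := fun e => by
    fun_prop
  have hs : ∀ i, Measurable fun q : (D.V → Bulk d) × ((D.E → Bdry d) × D.Schwinger) => q.2.2.2 i := fun e => by
    fun_prop
  have h1 : ∀ i, Measurable _ := fun i =>
    measurable_dot (measurable_const (a := y i)) (hX (D.attach i))
  have h2 : ∀ k : D.Link, Measurable _ := fun k => measurable_dot (hQ k.2.1) (hX k.1)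
  have h3 := Finset.measurable_fun_sum univ fun i _ => (ht i).const_mul (Δ i)
  have h4 := (Finset.measurable_fun_sum univ fun i _ => hs i).const_mul (h d)
  have h5 := Finset.measurable_fun_sum univ fun i _ => (ht i).exp.mul (h1 i)
  have h6 := Finset.measurable_fun_sum univ fun i _ => (hs i).exp.mul (h2 i)
  exact (h3.add h4).sub (h5.add h6)

theorem schwingerWeight_add {d : ℕ} (Δ : Fin n → ℝ) (y : Fin n → Bdry d) (u : D.V → ℝ)
    (x : D.V → Bdry d) (Q : D.E → Bdry d) (s : D.Schwinger) :
    -(d * ∑ v, u v) + D.schwingerWeight Δ y (fun v => bulkPoint (u v, x v)) Q (s + D.radialShift u) =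
      D.preWeight d Δ u s - springEnergy (fun k : D.Link => (Sum.inl k.1 : D.V ⊕ D.E))
        (fun k => Sum.inr k.2.1) univ D.node y s.1 s.2 (Sum.elim x Q) := by
  have hdot : ∀ (t : ℝ) (p : Bdry d) v, exp (t + u v) * (-2 * dot (bdryEmb p) (bulkEmb (bulkPoint (u v, x v)))) =
      exp (t + 2 * u v) + exp t * ‖x v - p‖ ^ 2 := by
    intro t p v
    rw [neg_two_dot_bdry_bulk _ _ (exp_pos _), bulkPoint, exp_add, exp_add, two_mul,
      exp_add]
    field_simp
  simp only [schwingerWeight, preWeight, springEnergy, radialShift, Prod.fst_add, Prod.snd_add, Pi.add_apply,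
    hdot, sum_add_distrib, node, Sum.elim_inl, Sum.elim_inr]
  ring

theorem lintegral_springEnergy {d : ℕ} (y : Fin n → Bdry d) (s : D.Schwinger) (x₀ : D.V ⊕ D.E → Bdry d) :
    ∫⁻ z : (D.V → Bdry d) × (D.E → Bdry d), ofReal (exp (-springEnergy
      (fun k : D.Link => (Sum.inl k.1 : D.V ⊕ D.E)) (fun k => Sum.inr k.2.1) univ D.node y s.1 s.2
        (Sum.elim z.1 z.2))) =
      springIntegral (fun k : D.Link => (Sum.inl k.1 : D.V ⊕ D.E)) (fun k => Sum.inr k.2.1) univ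
        univ D.node y x₀ s := by
  have hmp := volume_measurePreserving_sumPiEquivProdPi_symm fun _ : D.V ⊕ D.E => Bdry d
  rw [springIntegral, lmarginal_univ]
  have h1 := hmp.lintegral_comp_emb (MeasurableEquiv.measurableEmbedding _)
    fun x => ofReal (exp (-springEnergy
      (fun k : D.Link => (Sum.inl k.1 : D.V ⊕ D.E)) (fun k => Sum.inr k.2.1) univ D.node y s.1 s.2 x))
  refine Eq.trans (lintegral_congr fun z => ?_) h1
  have h2 : (Sum.elim z.1 z.2 : D.V ⊕ D.E → Bdry d) =
      (MeasurableEquiv.sumPiEquivProdPi fun _ : D.V ⊕ D.E => Bdry d).symm z := by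
    funext a
    rcases a with a | a <;> rfl
  rw [h2]

set_option maxHeartbeats 800000 in
/-- Pushed forward to the variables conjugate to the spectrum variables, the measure of the
position space representation is a multiple of that of the combined representation. -/
theorem lintegral_schwinger [Nonempty (Fin n)] {d : ℕ} (Δ : Fin n → ℝ) {y : Fin n → Bdry d}
    (hy : Function.Injective y) (hside : ∀ e, ∃ i j, ¬ (i ∈ D.side e ↔ j ∈ D.side e))
    {Φ : (D.E → ℝ) → ENNReal} (hΦ : Measurable Φ) :
    ∫⁻ X, (∫⁻ r : (D.E → Bdry d) × D.Schwinger,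
        ofReal (exp (D.schwingerWeight Δ y X r.1 r.2)) * Φ (D.schwingerPhase r.2))
          ∂(Measure.pi fun _ => adsVolume d) =
      2 * gaussConst d ^ (Fintype.card D.V + Fintype.card D.E) *
        ofReal (1 / 2 ^ Fintype.card D.V) *
        ∫⁻ q : D.Params × (Fin n → ℝ), ofReal (exp (D.totalWeight Δ y q)) *
          Φ (D.logLambda q.1) := by
  have hphase : Measurable D.schwingerPhase := by
    refine measurable_pi_lambda _ fun e => ?_
    unfold schwingerPhase
    fun_prop
  have hshift : Measurable D.radialShift := by
    unfold radialShift
    fun_prop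
  obtain ⟨G, hGd⟩ : ∃ G : (D.V → Bulk d) × ((D.E → Bdry d) × D.Schwinger) → ENNReal, G = fun q =>
      ofReal (exp (D.schwingerWeight Δ y q.1 q.2.1 q.2.2)) * Φ (D.schwingerPhase q.2.2) := ⟨_, rfl⟩
  have hG : Measurable G := by
    rw [hGd]
    have h1 := (D.measurable_schwingerWeight Δ y).exp.ennreal_ofReal
    have h0 : Measurable fun q : (D.V → Bulk d) × ((D.E → Bdry d) × D.Schwinger) => q.2.2 := by fun_prop
    have h2 := hΦ.comp (hphase.comp h0)
    exact h1.mul h2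
  have hpre : Measurable fun q : (D.V → ℝ) × D.Schwinger => D.preWeight d Δ q.1 q.2 := by
    unfold preWeight
    fun_prop
  obtain ⟨H, hH⟩ : ∃ H : (D.V → ℝ) × D.Schwinger → ENNReal, H = fun q =>
    ofReal (exp (D.preWeight d Δ q.1 q.2)) * Φ (D.schwingerPhase (q.2 + D.radialShift q.1)) :=
    ⟨_, rfl⟩
  have hHm : Measurable H := by
    rw [hH]
    have h0 : Measurable fun q : (D.V → ℝ) × D.Schwinger => q.1 := by fun_prop
    have h1 : Measurable fun q : (D.V → ℝ) × D.Schwinger => q.2 := by fun_prop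
    have h2 := hΦ.comp (hphase.comp (h1.add (hshift.comp h0)))
    exact hpre.exp.ennreal_ofReal.mul h2
  obtain ⟨sp, hsp⟩ : ∃ sp : D.Schwinger × (D.V ⊕ D.E → Bdry d) → ENNReal, sp = fun q =>
      ofReal (exp (-springEnergy (fun k : D.Link => (Sum.inl k.1 : D.V ⊕ D.E))
        (fun k => Sum.inr k.2.1) univ D.node y q.1.1 q.1.2 q.2)) := ⟨_, rfl⟩
  have hspm : Measurable sp := by
    rw [hsp]
    exact (measurable_springEnergy (fun k : D.Link => (Sum.inl k.1 : D.V ⊕ D.E)) (fun k => Sum.inr k.2.1)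
      univ D.node y).neg.exp.ennreal_ofReal
  have helim : Measurable fun z : (D.V → Bdry d) × (D.E → Bdry d) => (Sum.elim z.1 z.2 : D.V ⊕ D.E → Bdry d) := by
    refine measurable_pi_lambda _ fun a => ?_
    rcases a with a | a
    · exact (measurable_pi_apply a).comp measurable_fst
    · exact (measurable_pi_apply a).comp measurable_snd
  have x₀ : D.V ⊕ D.E → Bdry d := fun _ => 0
  have τ₀ : D.Link → ℝ := fun _ => 0
  -- the radial coordinates are absorbed into the Schwinger parameters
  have step1 : ∀ (u : D.V → ℝ) (x : D.V → Bdry d), ofReal (exp (-(d * ∑ v, u v))) *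
      ∫⁻ r : (D.E → Bdry d) × D.Schwinger, G (fun v => bulkPoint (u v, x v), r) =
      ∫⁻ Q : D.E → Bdry d, ∫⁻ s : D.Schwinger, H (u, s) * sp (s, Sum.elim x Q) := by
    intro u x
    have hGu : Measurable fun r : (D.E → Bdry d) × D.Schwinger => G (fun v => bulkPoint (u v, x v), r) :=
      hG.comp measurable_prodMk_left
    rw [← lintegral_const_mul _ hGu, Measure.volume_eq_prod, lintegral_prod _ (hGu.const_mul _).aemeasurable]
    refine lintegral_congr fun Q => ?_
    haveI : (volume : Measure D.Schwinger).IsAddRightInvariant := by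
      rw [Measure.volume_eq_prod]
      infer_instance
    rw [← lintegral_add_right_eq_self _ (D.radialShift u)]
    refine lintegral_congr fun s => ?_
    simp only [hGd, hH, hsp]
    rw [← mul_assoc, ← ENNReal.ofReal_mul (exp_pos _).le, ← exp_add, D.schwingerWeight_add,
      sub_eq_add_neg, exp_add, ENNReal.ofReal_mul (exp_pos _).le]
    ring
  -- the positions are integrated out
  have step2 : ∀ u : D.V → ℝ, ∫⁻ x : D.V → Bdry d, ∫⁻ Q : D.E → Bdry d, ∫⁻ s : D.Schwinger,
      H (u, s) * sp (s, Sum.elim x Q) =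
      2 * gaussConst d ^ (Fintype.card D.V + Fintype.card D.E) * ∫⁻ q : D.Schwinger,
        ofReal (exp (treeWeight D.Colour univ univ D.node y q.1 q.2)) *
          H (u, (treeT D.Colour univ D.node q.1 q.2, treeTau (fun k : D.Link => Sum.inl k.1)
            (fun k => Sum.inr k.2.1) D.Colour univ D.node q.1 q.2)) := by
    intro u
    have hHu : Measurable fun s => H (u, s) := hHm.comp measurable_prodMk_left
    have hm1 : Measurable fun z : ((D.V → Bdry d) × (D.E → Bdry d)) × D.Schwinger =>
        H (u, z.2) * sp (z.2, Sum.elim z.1.1 z.1.2) := by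
      have h0 : Measurable fun z : ((D.V → Bdry d) × (D.E → Bdry d)) × D.Schwinger => z.2 := by fun_prop
      have h0' : Measurable fun z : ((D.V → Bdry d) × (D.E → Bdry d)) × D.Schwinger => z.1 := by fun_prop
      have h1 := hHu.comp h0
      have h2 := hspm.comp (h0.prodMk (helim.comp h0'))
      exact h1.mul h2
    have hm2 : Measurable fun z : (D.V → Bdry d) × (D.E → Bdry d) =>
        ∫⁻ s : D.Schwinger, H (u, s) * sp (s, Sum.elim z.1 z.2) := hm1.lintegral_prod_right'
    have e1 := lintegral_prod (μ := (volume : Measure (D.V → Bdry d)))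
      (ν := (volume : Measure (D.E → Bdry d))) _ hm2.aemeasurable
    rw [← e1]
    have e2 := lintegral_lintegral_swap (μ := (volume : Measure (D.V → Bdry d)).prod
      (volume : Measure (D.E → Bdry d))) (ν := (volume : Measure D.Schwinger))
      (f := fun z s => H (u, s) * sp (s, Sum.elim z.1 z.2)) hm1.aemeasurable
    rw [e2]
    have e3 : ∀ s : D.Schwinger, ∫⁻ z, H (u, s) * sp (s, Sum.elim z.1 z.2) ∂((volume : Measure (D.V → Bdry d)).prod
        (volume : Measure (D.E → Bdry d))) = H (u, s) * springIntegral (fun k : D.Link => (Sum.inl k.1 : D.V ⊕ D.E))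
        (fun k => Sum.inr k.2.1) univ univ D.node y x₀ s := by
      intro s
      have h2 : Measurable fun z : (D.V → Bdry d) × (D.E → Bdry d) => sp (s, Sum.elim z.1 z.2) :=
        hspm.comp (measurable_const.prodMk helim)
      rw [lintegral_const_mul _ h2, ← D.lintegral_springEnergy, hsp]
      rfl
    simp only [e3]
    have hspi := measurable_springIntegral (e₁ := fun k : D.Link => (Sum.inl k.1 : D.V ⊕ D.E))
        (e₂ := fun k => Sum.inr k.2.1) (S := univ) (L := univ) (att := D.node) y x₀
    refine Eq.trans (lintegral_prod (μ := (volume : Measure (Fin n → ℝ)))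
      (ν := (volume : Measure (D.Link → ℝ))) (fun s : D.Schwinger => H (u, s) * springIntegral
        (fun k : D.Link => (Sum.inl k.1 : D.V ⊕ D.E)) (fun k => Sum.inr k.2.1) univ univ D.node y x₀ s)
      (hHu.mul hspi).aemeasurable) ?_
    have hgr := D.grown_univ.lintegral_eq y x₀ τ₀ D.node (fun _ => mem_univ _) (fun k _ => by
      obtain ⟨i, j, hij⟩ := hside k.2.1
      refine ⟨i, j, ?_⟩
      have h1 := D.colour_attach_iff k i
      have h2 := D.colour_attach_iff k j
      rw [node, node, h1, h2]
      exact hij) (fun s => H (u, s)) hHu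
    simp only [lmarginal_univ] at hgr
    have hcard : (univ : Finset (D.V ⊕ D.E)).card = Fintype.card D.V + Fintype.card D.E := by
      rw [card_univ, Fintype.card_sum]
    rw [hcard] at hgr
    refine Eq.trans hgr ?_
    congr 1
    refine (lintegral_prod (fun q : D.Schwinger => ofReal (exp (treeWeight D.Colour univ
      univ D.node y q.1 q.2)) * H (u, (treeT D.Colour univ D.node q.1 q.2,
        treeTau (fun k : D.Link => Sum.inl k.1) (fun k => Sum.inr k.2.1) D.Colour univ D.node q.1 q.2))) ?_).symm
    have h1 := (measurable_treeWeight D.Colour univ univ D.node y).exp.ennreal_ofReal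
    have h2 := hHu.comp ((measurable_treeT D.Colour univ D.node).prodMk
      (measurable_treeTau (fun k : D.Link => (Sum.inl k.1 : D.V ⊕ D.E)) (fun k => Sum.inr k.2.1) D.Colour
        univ D.node))
    exact (h1.mul h2).aemeasurable
  have eG : ∀ X r, ofReal (exp (D.schwingerWeight Δ y X r.1 r.2)) * Φ (D.schwingerPhase r.2) =
      G (X, r) := fun X r => by rw [hGd]
  simp only [eG]
  rw [lintegral_pi_adsVolume hG.lintegral_prod_right']
  simp only [step1, step2]
  obtain ⟨J, hJ⟩ : ∃ J : (D.V → ℝ) × D.Schwinger → ENNReal, J = fun q =>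
    ofReal (exp (treeWeight D.Colour univ univ D.node y q.2.1 q.2.2)) *
      H (q.1, (treeT D.Colour univ D.node q.2.1 q.2.2, treeTau (fun k : D.Link => Sum.inl k.1)
        (fun k => Sum.inr k.2.1) D.Colour univ D.node q.2.1 q.2.2)) := ⟨_, rfl⟩
  have hJm : Measurable J := by
    rw [hJ]
    have h0 : Measurable fun q : (D.V → ℝ) × D.Schwinger => q.1 := by fun_prop
    have h0' : Measurable fun q : (D.V → ℝ) × D.Schwinger => q.2 := by fun_prop
    have h1 := ((measurable_treeWeight D.Colour univ univ D.node y).comp h0').exp.ennreal_ofReal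
    have h2 := ((measurable_treeT D.Colour univ D.node).comp h0').prodMk
      ((measurable_treeTau (fun k : D.Link => (Sum.inl k.1 : D.V ⊕ D.E)) (fun k => Sum.inr k.2.1) D.Colour
        univ D.node).comp h0')
    have h3 := hHm.comp (h0.prodMk h2)
    exact h1.mul h3
  have e0 : ∀ u, ∫⁻ q : D.Schwinger,
        ofReal (exp (treeWeight D.Colour univ univ D.node y q.1 q.2)) *
          H (u, (treeT D.Colour univ D.node q.1 q.2, treeTau (fun k : D.Link => Sum.inl k.1)
            (fun k => Sum.inr k.2.1) D.Colour univ D.node q.1 q.2)) = ∫⁻ q, J (u, q) := fun u => by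
    rw [hJ]
  simp only [e0]
  rw [lintegral_const_mul _ hJm.lintegral_prod_right']
  have e1 := lintegral_lintegral_swap (μ := (volume : Measure (D.V → ℝ)))
    (ν := (volume : Measure D.Schwinger)) (f := fun u q => J (u, q)) hJm.aemeasurable
  rw [e1]
  -- the radial coordinates are rescaled by the masses of the vertices
  have e2 : ∀ q : D.Schwinger, ∫⁻ u, J (u, q) = ofReal (1 / 2 ^ Fintype.card D.V) *
      ∫⁻ ζ : D.V → ℝ, ofReal (exp (D.totalWeight Δ y ((ζ, q.2), q.1))) *
        Φ (D.logLambda (ζ, q.2)) := by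
    intro q
    have h1 : Measurable fun u => J (u, q) := hJm.comp (measurable_id.prodMk measurable_const)
    rw [lintegral_comp_half_sub h1 fun v => log (D.nodeMass q.1 q.2 (Sum.inl v))]
    congr 1
    refine lintegral_congr fun ζ => ?_
    simp only [hJ, hH]
    rw [← mul_assoc, ← ENNReal.ofReal_mul (exp_pos _).le, ← exp_add]
    have h2 := D.treeWeight_add_preWeight Δ hy q.1 (ζ, q.2)
    have h3 : D.schwingerPhase ((treeT D.Colour univ D.node q.1 q.2, treeTau (fun k : D.Link => Sum.inl k.1)
        (fun k => Sum.inr k.2.1) D.Colour univ D.node q.1 q.2) +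
          D.radialShift fun v => ζ v / 2 - log (D.nodeMass q.1 q.2 (Sum.inl v))) = D.logLambda (ζ, q.2) := by
      funext e
      exact D.logLambda_eq q.1 (ζ, q.2) e
    rw [h3, ← h2]
  simp only [e2]
  obtain ⟨T, hT⟩ : ∃ T : D.Params × (Fin n → ℝ) → ENNReal, T = fun q =>
    ofReal (exp (D.totalWeight Δ y q)) * Φ (D.logLambda q.1) := ⟨_, rfl⟩
  have hTm : Measurable T := by
    rw [hT]
    have h1 := (D.continuous_totalWeight Δ y).measurable.exp.ennreal_ofReal
    have h0 : Measurable fun q : D.Params × (Fin n → ℝ) => q.1 := by fun_prop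
    have hl : Measurable D.logLambda := measurable_pi_lambda _ fun e => (D.continuous_logLambda e).measurable
    have h2 := hΦ.comp (hl.comp h0)
    exact h1.mul h2
  have e3 : ∀ (q : D.Schwinger) (ζ : D.V → ℝ), ofReal (exp (D.totalWeight Δ y ((ζ, q.2), q.1))) *
      Φ (D.logLambda (ζ, q.2)) = T ((ζ, q.2), q.1) := fun q ζ => by rw [hT]
  have e4 : ∀ q : D.Params × (Fin n → ℝ), ofReal (exp (D.totalWeight Δ y q)) *
      Φ (D.logLambda q.1) = T q := fun q => by rw [hT]
  simp only [e3, e4]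
  have hm : Measurable fun z : D.Schwinger × (D.V → ℝ) => T ((z.2, z.1.2), z.1.1) :=
    hTm.comp (by fun_prop)
  rw [lintegral_const_mul _ hm.lintegral_prod_right', ← mul_assoc]
  congr 1
  have hm2 : Measurable fun z : Fin n → ℝ => ∫⁻ p : D.Params, T (p, z) :=
    (hTm.comp measurable_swap).lintegral_prod_right'
  rw [Measure.volume_eq_prod (D.Params), lintegral_prod_symm _ hTm.aemeasurable,
    Measure.volume_eq_prod, lintegral_prod _ hm.lintegral_prod_right'.aemeasurable]
  refine lintegral_congr fun w => ?_
  have hTw : Measurable fun p : D.Params => T (p, w) := hTm.comp (measurable_id.prodMk measurable_const)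
  rw [Measure.volume_eq_prod, lintegral_prod_symm _ hTw.aemeasurable]

end TreeDiagram

/-! ### Schwinger parametrisation of the diagram -/

section Kernels

theorem neg_two_dot_pos {d : ℕ} (y : Bdry d) {X : Bulk d} (hX : 0 < X.1) :
    0 < -2 * dot (bdryEmb y) (bulkEmb X) := by
  rw [neg_two_dot_bdry_bulk y X hX]
  positivity

theorem integrable_dot_rpow {d : ℕ} (hd : 0 < d) {X : Bulk d} (hX : 0 < X.1) :
    Integrable fun Q : Bdry d => (-2 * dot (bdryEmb Q) (bulkEmb X)) ^ (-(d : ℝ)) := by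
  have hd' : (0 : ℝ) < d := by exact_mod_cast hd
  have h1 : Integrable fun Q : Bdry d => (1 + ‖Q‖ ^ 2) ^ (-(2 * d : ℝ) / 2) :=
    integrable_rpow_neg_one_add_norm_sq (by simp; linarith)
  have h2 := ((h1.comp_smul (R := X.1⁻¹) (by positivity)).comp_sub_right X.2).const_mul (X.1 ^ (-(d : ℝ)))
  refine h2.congr (.of_forall fun Q => ?_)
  simp only
  have e : -(2 * d : ℝ) / 2 = -(d : ℝ) := by ring
  rw [neg_two_dot_bdry_bulk Q X hX, e, ← Real.mul_rpow hX.le (by positivity), norm_smul, norm_inv,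
    Real.norm_of_nonneg hX.le, norm_sub_rev Q]
  have : X.1 * (1 + (X.1⁻¹ * ‖X.2 - Q‖) ^ 2) = (X.1 ^ 2 + ‖X.2 - Q‖ ^ 2) / X.1 := by
    field_simp
  rw [this]

/-- The split representation without its normalisation. -/
def splitKernel (d : ℕ) (c : ℂ) (X Y : Bulk d) (Q : Bdry d) : ℂ :=
  cexp (-(h d - c) * log (-2 * dot (bdryEmb Q) (bulkEmb X))) *
    cexp (-(h d + c) * log (-2 * dot (bdryEmb Q) (bulkEmb Y)))

theorem inv_ofReal_cpow {a : ℝ} (ha : 0 < a) (s : ℂ) : ((a : ℂ) ^ s)⁻¹ = cexp (-s * log a) := by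
  rw [Complex.cpow_def_of_ne_zero (by exact_mod_cast ha.ne'), ← Complex.exp_neg, ← Complex.ofReal_log ha.le]
  congr 1
  ring

theorem splitIntegrand_eq {d : ℕ} (c : ℂ) {X Y : Bulk d} (hX : 0 < X.1) (hY : 0 < Y.1) (Q : Bdry d) :
    splitIntegrand d c X Y Q = splitNorm d c * splitKernel d c X Y Q := by
  rw [splitIntegrand, splitKernel, div_eq_mul_inv, mul_inv, inv_ofReal_cpow (neg_two_dot_pos Q hX),
    inv_ofReal_cpow (neg_two_dot_pos Q hY)]

theorem measurable_splitKernel {d : ℕ} (c : ℂ) (X Y : Bulk d) : Measurable (splitKernel d c X Y) := by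
  have h1 : Measurable fun Q : Bdry d => -2 * dot (bdryEmb Q) (bulkEmb X) :=
    TreeDiagram.measurable_dot measurable_id measurable_const
  have h2 : Measurable fun Q : Bdry d => -2 * dot (bdryEmb Q) (bulkEmb Y) :=
    TreeDiagram.measurable_dot measurable_id measurable_const
  unfold splitKernel
  exact (Complex.measurable_exp.comp ((Complex.measurable_ofReal.comp h1.log).const_mul _)).mul
    (Complex.measurable_exp.comp ((Complex.measurable_ofReal.comp h2.log).const_mul _))

theorem integrable_splitKernel {d : ℕ} (hd : 0 < d) {c : ℂ} (hc : c.re = 0) {X Y : Bulk d} (hX : 0 < X.1)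
    (hY : 0 < Y.1) : Integrable (splitKernel d c X Y) := by
  refine ((integrable_dot_rpow hd hX).add (integrable_dot_rpow hd hY)).mono'
    (measurable_splitKernel c X Y).aestronglyMeasurable (.of_forall fun Q => ?_)
  have hx := neg_two_dot_pos Q hX
  have hy := neg_two_dot_pos Q hY
  simp only [Pi.add_apply, splitKernel, norm_mul, Complex.norm_exp]
  have e1 : (-(h d - c) * log (-2 * dot (bdryEmb Q) (bulkEmb X))).re =
      log (-2 * dot (bdryEmb Q) (bulkEmb X)) * (-h d) := by
    rw [Complex.re_mul_ofReal]; simp [hc]; ring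
  have e2 : (-(h d + c) * log (-2 * dot (bdryEmb Q) (bulkEmb Y))).re =
      log (-2 * dot (bdryEmb Q) (bulkEmb Y)) * (-h d) := by
    rw [Complex.re_mul_ofReal]; simp [hc]; ring
  rw [e1, e2, ← Real.rpow_def_of_pos hx, ← Real.rpow_def_of_pos hy]
  have e3 : ∀ a : ℝ, 0 < a → a ^ (-(d : ℝ)) = (a ^ (-h d)) ^ 2 := fun a ha => by
    rw [← Real.rpow_natCast, ← Real.rpow_mul ha.le]
    congr 1
    simp [h]
  rw [e3 _ hx, e3 _ hy]
  have p1 := Real.rpow_pos_of_pos hx (-h d)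
  have p2 := Real.rpow_pos_of_pos hy (-h d)
  nlinarith [sq_nonneg ((-2 * dot (bdryEmb Q) (bulkEmb X)) ^ (-h d) - (-2 * dot (bdryEmb Q) (bulkEmb Y)) ^ (-h d))]

theorem integrable_splitIntegrand {d : ℕ} (hd : 0 < d) {c : ℂ} (hc : c.re = 0) {X Y : Bulk d} (hX : 0 < X.1)
    (hY : 0 < Y.1) : Integrable (splitIntegrand d c X Y) :=
  ((integrable_splitKernel hd hc hX hY).const_mul (splitNorm d c)).congr
    (.of_forall fun Q => (splitIntegrand_eq c hX hY Q).symm)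

/-- The constant of the split representation in Schwinger parameters. At `c = 0` both sides vanish, as
`Γ(0) = 0` by convention. -/
theorem splitNorm_eq {d : ℕ} (c : ℂ) : splitNorm d c =
    Gamma (h d - c) * Gamma (h d + c) *
      (1 / (2 * (pi : ℂ) ^ (2 * h d : ℂ)) * (1 / (Gamma c * Gamma (-c)))) := by
  rw [splitNorm]
  simp only [div_eq_mul_inv, mul_inv]
  ring

end Kernels

/-- Two weighted measures with the same image under their phase maps have the same oscillating
integrals. -/
theorem integral_exp_mul_eq_of_lintegral_eq {A B L : Type*} [MeasurableSpace A] [MeasurableSpace B]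
    [MeasurableSpace L] {μ : Measure A} {ν : Measure B} {a : A → ℝ} {b : B → ℝ} {φ : A → L} {ψ : B → L}
    (ha : Measurable a) (hb : Measurable b) (hφ : Measurable φ) (hψ : Measurable ψ) {K : ENNReal}
    (hK : ∀ Φ : L → ENNReal, Measurable Φ → ∫⁻ x, ofReal (exp (a x)) * Φ (φ x) ∂μ =
      K * ∫⁻ x, ofReal (exp (b x)) * Φ (ψ x) ∂ν) {g : L → ℂ} (hg : Measurable g) :
    ∫ x, cexp (a x) * g (φ x) ∂μ = K.toReal * ∫ x, cexp (b x) * g (ψ x) ∂ν := by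
  have hma : Measurable fun x => ofReal (exp (a x)) := ha.exp.ennreal_ofReal
  have hmb : Measurable fun x => ofReal (exp (b x)) := hb.exp.ennreal_ofReal
  have key : (μ.withDensity fun x => ofReal (exp (a x))).map φ =
      K • (ν.withDensity fun x => ofReal (exp (b x))).map ψ := by
    refine Measure.ext_of_lintegral _ fun Φ hΦ => ?_
    rw [lintegral_smul_measure, lintegral_map hΦ hφ, lintegral_map hΦ hψ]
    have e1 := lintegral_withDensity_eq_lintegral_mul μ hma (hΦ.comp hφ)
    have e2 := lintegral_withDensity_eq_lintegral_mul ν hmb (hΦ.comp hψ)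
    simp only [Function.comp_apply] at e1 e2
    rw [e1, e2]
    exact hK Φ hΦ
  have h1 : ∫ l, g l ∂_ = ∫ l, g l ∂_ := congrArg (fun m : Measure L => ∫ l, g l ∂m) key
  rw [integral_smul_measure, integral_map hφ.aemeasurable hg.aestronglyMeasurable,
    integral_map hψ.aemeasurable hg.aestronglyMeasurable,
    integral_withDensity_eq_integral_toReal_smul hma (by simp),
    integral_withDensity_eq_integral_toReal_smul hmb (by simp)] at h1
  simpa [ENNReal.toReal_ofReal (exp_pos _).le] using h1

namespace TreeDiagram
variable {n : ℕ} (D : TreeDiagram n)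

/-- The exponents of the half-edges in the split representation. -/
def linkExponent (d : ℕ) (c : D.E → ℂ) (k : D.Link) : ℂ :=
  Sum.elim (fun e => h d - c e) (fun e => h d + c e) (D.linkEquiv.symm k)

theorem linkExponent_src (d : ℕ) (c : D.E → ℂ) (e : D.E) : D.linkExponent d c (D.srcLink e) = h d - c e := by
  have : D.linkEquiv.symm (D.srcLink e) = Sum.inl e := by rw [Equiv.symm_apply_eq]; rfl
  rw [linkExponent, this, Sum.elim_inl]

theorem linkExponent_tgt (d : ℕ) (c : D.E → ℂ) (e : D.E) : D.linkExponent d c (D.tgtLink e) = h d + c e := by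
  have : D.linkEquiv.symm (D.tgtLink e) = Sum.inr e := by rw [Equiv.symm_apply_eq]; rfl
  rw [linkExponent, this, Sum.elim_inr]

theorem linkExponent_re (d : ℕ) {c : D.E → ℂ} (hc : ∀ e, (c e).re = 0) (k : D.Link) :
    (D.linkExponent d c k).re = h d := by
  rw [linkExponent]
  rcases D.linkEquiv.symm k with e | e <;> simp [hc]

theorem schwinger_exp_eq {d : ℕ} (Δ : Fin n → ℝ) (y : Fin n → Bdry d) (X : D.V → Bulk d) (Q : D.E → Bdry d)
    (c : D.E → ℂ) (s : D.Schwinger) :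
    cexp (D.schwingerWeight Δ y X Q s + ∑ e, c e * D.schwingerPhase s e) =
      (∏ i, cexp (Δ i * s.1 i - (-2 * dot (bdryEmb (y i)) (bulkEmb (X (D.attach i))) : ℝ) *
        cexp (s.1 i))) *
      ∏ k : D.Link, cexp (D.linkExponent d c k * s.2 k -
        (-2 * dot (bdryEmb (Q k.2.1)) (bulkEmb (X k.1)) : ℝ) * cexp (s.2 k)) := by
  rw [← Complex.exp_sum, ← Complex.exp_sum, ← Complex.exp_add]
  congr 1
  have h1 : ∑ k : D.Link, D.linkExponent d c k * s.2 k =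
      h d * ∑ k : D.Link, (s.2 k : ℂ) + ∑ e, c e * D.schwingerPhase s e := by
    rw [D.sum_link, D.sum_link, mul_sum, ← sum_add_distrib]
    refine sum_congr rfl fun e _ => ?_
    rw [D.linkExponent_src, D.linkExponent_tgt, schwingerPhase]
    push_cast
    ring
  rw [sum_sub_distrib, sum_sub_distrib, h1, schwingerWeight]
  push_cast
  have h2 : ∀ a b : ℂ, a * b = b * a := mul_comm
  simp only [h2 (cexp _)]
  ring

/-- The Schwinger parametrisation at fixed bulk points and fixed boundary points of the split
representation. -/
theorem integral_schwinger_fiber {d : ℕ} (hd : 0 < d) {Δ : Fin n → ℝ} (hΔ : ∀ i, 0 < Δ i)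
    (y : Fin n → Bdry d) {X : D.V → Bulk d} (hX : ∀ v, 0 < (X v).1) (Q : D.E → Bdry d) {c : D.E → ℂ}
    (hc : ∀ e, (c e).re = 0) :
    Integrable (fun s => cexp (D.schwingerWeight Δ y X Q s + ∑ e, c e * D.schwingerPhase s e)) ∧
    ∫ s, cexp (D.schwingerWeight Δ y X Q s + ∑ e, c e * D.schwingerPhase s e) =
      (∏ i, Gamma (Δ i) * cexp (-Δ i * log
        (-2 * dot (bdryEmb (y i)) (bulkEmb (X (D.attach i)))))) *
      ∏ e, Gamma (h d - c e) * Gamma (h d + c e) *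
        splitKernel d (c e) (X (D.src e)) (X (D.tgt e)) (Q e) := by
  have hh : 0 < h d := by unfold h; positivity
  simp only [D.schwinger_exp_eq]
  have i1 : Integrable fun t : Fin n → ℝ => ∏ i, cexp (Δ i * t i -
      (-2 * dot (bdryEmb (y i)) (bulkEmb (X (D.attach i))) : ℝ) * cexp (t i)) :=
    Integrable.fintype_prod fun i => integrable_cexp_gamma (by simpa using hΔ i)
      (by rw [Complex.ofReal_re]; exact neg_two_dot_pos _ (hX _))
  have i2 : Integrable fun t : D.Link → ℝ => ∏ k : D.Link, cexp (D.linkExponent d c k * t k -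
        (-2 * dot (bdryEmb (Q k.2.1)) (bulkEmb (X k.1)) : ℝ) * cexp (t k)) :=
    Integrable.fintype_prod fun k => integrable_cexp_gamma (by rw [D.linkExponent_re d hc]; exact hh)
      (by rw [Complex.ofReal_re]; exact neg_two_dot_pos _ (hX _))
  refine ⟨i1.mul_prod i2, ?_⟩
  rw [Measure.volume_eq_prod]
  refine (integral_prod_mul (fun t : Fin n → ℝ => ∏ i, cexp (Δ i * t i -
      (-2 * dot (bdryEmb (y i)) (bulkEmb (X (D.attach i))) : ℝ) * cexp (t i)))
    (fun t : D.Link → ℝ => ∏ k : D.Link, cexp (D.linkExponent d c k * t k -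
        (-2 * dot (bdryEmb (Q k.2.1)) (bulkEmb (X k.1)) : ℝ) * cexp (t k)))).trans ?_
  rw [integral_fintype_prod_volume_eq_prod
      (f := fun i (t : ℝ) => cexp (Δ i * t -
      (-2 * dot (bdryEmb (y i)) (bulkEmb (X (D.attach i))) : ℝ) * cexp t)),
    integral_fintype_prod_volume_eq_prod (f := fun (k : D.Link) (t : ℝ) =>
      cexp (D.linkExponent d c k * t -
        (-2 * dot (bdryEmb (Q k.2.1)) (bulkEmb (X k.1)) : ℝ) * cexp t)), D.prod_link]
  congr 1
  · refine prod_congr rfl fun i _ => ?_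
    rw [integral_cexp_gamma_real (by simpa using hΔ i) (neg_two_dot_pos _ (hX _))]
  · refine prod_congr rfl fun e _ => ?_
    rw [integral_cexp_gamma_real (by rw [D.linkExponent_re d hc]; exact hh) (neg_two_dot_pos _ (hX _)),
      integral_cexp_gamma_real (by rw [D.linkExponent_re d hc]; exact hh) (neg_two_dot_pos _ (hX _)),
      D.linkExponent_src, D.linkExponent_tgt, splitKernel]
    simp only [srcLink, tgtLink]
    ring

theorem norm_schwinger_exp {d : ℕ} (Δ : Fin n → ℝ) (y : Fin n → Bdry d) (X : D.V → Bulk d) (Q : D.E → Bdry d)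
    {c : D.E → ℂ} (hc : ∀ e, (c e).re = 0) (s : D.Schwinger) :
    ‖cexp (D.schwingerWeight Δ y X Q s + ∑ e, c e * D.schwingerPhase s e)‖ =
      exp (D.schwingerWeight Δ y X Q s) := by
  rw [Complex.norm_exp]
  congr 1
  simp [Complex.re_sum, hc]

theorem measurable_schwinger_exp {d : ℕ} (Δ : Fin n → ℝ) (y : Fin n → Bdry d) (c : D.E → ℂ) :
    Measurable fun q : (D.V → Bulk d) × ((D.E → Bdry d) × D.Schwinger) =>
      cexp (D.schwingerWeight Δ y q.1 q.2.1 q.2.2 + ∑ e, c e * D.schwingerPhase q.2.2 e) := by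
  have h1 := D.measurable_schwingerWeight Δ y
  have h2 : Measurable fun q : (D.V → Bulk d) × ((D.E → Bdry d) × D.Schwinger) =>
      ∑ e, c e * (D.schwingerPhase q.2.2 e : ℂ) := by
    unfold schwingerPhase
    fun_prop
  exact Complex.measurable_exp.comp ((Complex.measurable_ofReal.comp h1).add h2)

/-- The constant between the integrand of the diagram and its Schwinger parametrisation. -/
def schwingerConst (d : ℕ) (Δ : Fin n → ℝ) (c : D.E → ℂ) : ℂ :=
  (∏ i, bdryNorm d (Δ i) / Gamma (Δ i)) *
    ∏ e, 1 / (2 * (pi : ℂ) ^ (2 * h d : ℂ)) * (1 / (Gamma (c e) * Gamma (-c e)))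

theorem correlatorIntegrand_eq {d : ℕ} (hd : 0 < d) {Δ : Fin n → ℝ} (hΔ : ∀ i, 0 < Δ i)
    (y : Fin n → Bdry d) {X : D.V → Bulk d} (hX : ∀ v, 0 < (X v).1) {c : D.E → ℂ}
    (hc : ∀ e, (c e).re = 0) :
    D.correlatorIntegrand d Δ c y X = D.schwingerConst d Δ c *
      ∫ r : (D.E → Bdry d) × D.Schwinger,
        cexp (D.schwingerWeight Δ y X r.1 r.2 + ∑ e, c e * D.schwingerPhase r.2 e) := by
  have hm : Measurable fun r : (D.E → Bdry d) × D.Schwinger =>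
      cexp (D.schwingerWeight Δ y X r.1 r.2 + ∑ e, c e * D.schwingerPhase r.2 e) := by
    obtain ⟨F, hF⟩ : ∃ F : (D.V → Bulk d) × ((D.E → Bdry d) × D.Schwinger) → ℂ, F = fun q =>
      cexp (D.schwingerWeight Δ y q.1 q.2.1 q.2.2 + ∑ e, c e * D.schwingerPhase q.2.2 e) := ⟨_, rfl⟩
    have h1 := D.measurable_schwinger_exp Δ y c
    rw [← hF] at h1
    have h2 : Measurable fun r => F (X, r) := h1.comp measurable_prodMk_left
    simpa only [hF] using h2
  have hQ : ∀ {c : D.E → ℂ}, (∀ e, (c e).re = 0) → Integrable fun Q : D.E → Bdry d =>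
      ∏ e, Gamma (h d - c e) * Gamma (h d + c e) *
        splitKernel d (c e) (X (D.src e)) (X (D.tgt e)) (Q e) := fun hc =>
    Integrable.fintype_prod fun e => (integrable_splitKernel hd (hc e) (hX _) (hX _)).const_mul _
  have hint : Integrable (fun r : (D.E → Bdry d) × D.Schwinger =>
        cexp (D.schwingerWeight Δ y X r.1 r.2 + ∑ e, c e * D.schwingerPhase r.2 e))
      ((volume : Measure (D.E → Bdry d)).prod (volume : Measure D.Schwinger)) := by
    rw [integrable_prod_iff hm.aestronglyMeasurable]
    refine ⟨.of_forall fun Q => (D.integral_schwinger_fiber hd hΔ y hX Q hc).1, ?_⟩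
    simp only [D.norm_schwinger_exp Δ y X _ hc]
    have h0 : ∀ e : D.E, ((0 : D.E → ℂ) e).re = 0 := fun e => rfl
    have h1 := (hQ h0).const_mul (∏ i, Gamma (Δ i) * cexp (-Δ i * log
        (-2 * dot (bdryEmb (y i)) (bulkEmb (X (D.attach i))))))
    refine h1.re.congr (.of_forall fun Q => ?_)
    simp only
    rw [← (D.integral_schwinger_fiber hd hΔ y hX Q h0).2]
    have h2 : ∀ s, cexp (D.schwingerWeight Δ y X Q s + ∑ e, (0 : D.E → ℂ) e * D.schwingerPhase s e) =
        ((exp (D.schwingerWeight Δ y X Q s) : ℝ) : ℂ) := fun s => by simp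
    simp only [h2]
    rw [integral_complex_ofReal]
    simp
  rw [Measure.volume_eq_prod, integral_prod _ hint]
  simp only [(D.integral_schwinger_fiber hd hΔ y hX _ hc).2]
  rw [integral_const_mul, integral_fintype_prod_volume_eq_prod
    (f := fun e Q => Gamma (h d - c e) * Gamma (h d + c e) *
        splitKernel d (c e) (X (D.src e)) (X (D.tgt e)) Q)]
  simp only [integral_const_mul]
  rw [correlatorIntegrand, schwingerConst]
  have e1 : ∀ i, bulkToBdry d (Δ i) (X (D.attach i)) (y i) = bdryNorm d (Δ i) / Gamma (Δ i) *
      (Gamma (Δ i) * cexp (-Δ i * log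
        (-2 * dot (bdryEmb (y i)) (bulkEmb (X (D.attach i)))))) := fun i => by
    have := Complex.Gamma_ne_zero_of_re_pos (s := (Δ i : ℂ)) (by simpa using hΔ i)
    rw [bulkToBdry, div_eq_mul_inv, inv_ofReal_cpow (neg_two_dot_pos _ (hX _))]
    field_simp
  have e2 : ∀ e, splitPropagator d (c e) (X (D.src e)) (X (D.tgt e)) =
      1 / (2 * (pi : ℂ) ^ (2 * h d : ℂ)) * (1 / (Gamma (c e) * Gamma (-c e))) *
      (Gamma (h d - c e) * Gamma (h d + c e) *
        ∫ Q, splitKernel d (c e) (X (D.src e)) (X (D.tgt e)) Q) := fun e => by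
    rw [splitPropagator]
    simp only [splitIntegrand_eq (c e) (hX _) (hX _)]
    rw [integral_const_mul, splitNorm_eq]
    ring
  simp only [e1, e2, prod_mul_distrib]
  ring

end TreeDiagram

/-! ### The position space side -/

theorem ae_adsVolume_pos (d : ℕ) : ∀ᵐ X ∂adsVolume d, 0 < X.1 := by
  have h1 : ∀ᵐ X ∂(volume : Measure (Bulk d)).restrict {X | 0 < X.1}, 0 < X.1 :=
    ae_restrict_mem (measurableSet_lt measurable_const measurable_fst)
  exact (withDensity_absolutelyContinuous _ _).ae_le h1

theorem ofReal_pi_cpow (x : ℝ) : (pi : ℂ) ^ (x : ℂ) = (exp (x * log pi) : ℝ) := by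
  rw [← Complex.ofReal_cpow Real.pi_pos.le, Real.rpow_def_of_pos Real.pi_pos, mul_comm]

namespace TreeDiagram
variable {n : ℕ} (D : TreeDiagram n)

/-- The constants of the position space representation combine into the normalisation. -/
theorem schwingerConst_mul (d : ℕ) (Δ : Fin n → ℝ) (c : D.E → ℂ) :
    D.schwingerConst d Δ c * (2 * gaussConst d ^ (Fintype.card D.V + Fintype.card D.E) *
        ofReal (1 / 2 ^ Fintype.card D.V)).toReal = 2 * D.normalization d Δ c := by
  have hG : (gaussConst d).toReal = exp (h d * log pi) := by
    rw [gaussConst, ENNReal.toReal_ofReal (exp_pos _).le]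
  obtain ⟨G, hGd⟩ : ∃ G, G = exp (h d * log pi) := ⟨_, rfl⟩
  have hG0 : (G : ℂ) ≠ 0 := by rw [hGd]; exact_mod_cast (exp_pos _).ne'
  have e1 : (pi : ℂ) ^ (h d : ℂ) = G := by rw [ofReal_pi_cpow, hGd]
  have e2 : (pi : ℂ) ^ (2 * h d : ℂ) = G ^ 2 := by
    have := ofReal_pi_cpow (2 * h d)
    rw [Complex.ofReal_mul, Complex.ofReal_ofNat] at this
    rw [this, hGd, ← Complex.ofReal_pow, ← Real.exp_nat_mul]
    congr 2
    push_cast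
    ring
  rw [ENNReal.toReal_mul, ENNReal.toReal_mul, ENNReal.toReal_pow, hG, ENNReal.toReal_ofReal (by positivity),
    ← hGd, schwingerConst, normalization, e1, e2, prod_mul_distrib, Finset.prod_const, card_univ,
    D.noLoops]
  have e3 : 2 * (Fintype.card D.E + 1) - 1 = 2 * Fintype.card D.E + 1 := by omega
  rw [e3]
  obtain ⟨N, hN⟩ : ∃ N, N = Fintype.card D.E := ⟨_, rfl⟩
  rw [← hN]
  push_cast
  have e4 : (2 : ENNReal).toReal = 2 := by simp
  rw [e4]
  push_cast
  have e5 : (1 / (2 * (G : ℂ) ^ 2)) ^ N * (2 * (G : ℂ) ^ (N + 1 + N) * (1 / 2 ^ (N + 1))) =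
      2 * (G / 2 ^ (2 * N + 1)) := by
    rw [div_pow, mul_pow, ← pow_mul]
    field_simp
    ring
  linear_combination (∏ i, bdryNorm d (Δ i) / Gamma (Δ i)) *
    (∏ e, 1 / (Gamma (c e) * Gamma (-c e))) * e5

/-- The position space side of the Mellin representation. -/
theorem correlator_eq {d : ℕ} (hd : 0 < d) {Δ : Fin n → ℝ} (hΔ : D.Convergent d Δ)
    (hside : ∀ e, ∃ i j, ¬ (i ∈ D.side e ↔ j ∈ D.side e)) [Nonempty (Fin n)]
    {c : D.E → ℂ} (hc : ∀ e, (c e).re = 0) {y : Fin n → Bdry d} (hy : Function.Injective y)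
    (hint : Integrable fun q => exp (D.totalWeight Δ y q)) :
    Integrable (D.correlatorIntegrand d Δ c y) (Measure.pi fun _ => adsVolume d) ∧
    D.correlator d Δ c y = D.normalization d Δ c *
      (2 * ∫ q, cexp (D.totalWeight Δ y q + ∑ e, c e * D.logLambda q.1 e)) := by
  obtain ⟨μ, hμ⟩ : ∃ μ : Measure (D.V → Bulk d), μ = Measure.pi fun _ => adsVolume d := ⟨_, rfl⟩
  haveI : SigmaFinite μ := by rw [hμ]; infer_instance
  obtain ⟨W, hW⟩ : ∃ W : (D.V → Bulk d) × ((D.E → Bdry d) × D.Schwinger) → ℝ, W = fun q =>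
    D.schwingerWeight Δ y q.1 q.2.1 q.2.2 := ⟨_, rfl⟩
  have hWm : Measurable W := by rw [hW]; exact D.measurable_schwingerWeight Δ y
  obtain ⟨F, hF⟩ : ∃ F : (D.V → Bulk d) × ((D.E → Bdry d) × D.Schwinger) → ℂ, F = fun q =>
      cexp (D.schwingerWeight Δ y q.1 q.2.1 q.2.2 + ∑ e, c e * D.schwingerPhase q.2.2 e) := ⟨_, rfl⟩
  have hFm : Measurable F := by rw [hF]; exact D.measurable_schwinger_exp Δ y c
  have hFn : ∀ q, ‖F q‖ = exp (W q) := fun q => by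
    rw [hF, hW]; exact D.norm_schwinger_exp Δ y _ _ hc _
  have hphase : Measurable D.schwingerPhase := by
    refine measurable_pi_lambda _ fun e => ?_
    unfold schwingerPhase
    fun_prop
  have hφ : Measurable fun q : (D.V → Bulk d) × ((D.E → Bdry d) × D.Schwinger) => D.schwingerPhase q.2.2 := by
    have h0 : Measurable fun q : (D.V → Bulk d) × ((D.E → Bdry d) × D.Schwinger) => q.2.2 := by fun_prop
    exact hphase.comp h0
  have hψ : Measurable fun q : D.Params × (Fin n → ℝ) => D.logLambda q.1 := by
    have hl : Measurable D.logLambda := measurable_pi_lambda _ fun e => (D.continuous_logLambda e).measurable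
    exact hl.comp measurable_fst
  have key : ∀ Φ : (D.E → ℝ) → ENNReal, Measurable Φ →
      ∫⁻ q, ofReal (exp (W q)) * Φ (D.schwingerPhase q.2.2) ∂(μ.prod volume) =
      2 * gaussConst d ^ (Fintype.card D.V + Fintype.card D.E) *
        ofReal (1 / 2 ^ Fintype.card D.V) *
        ∫⁻ q : D.Params × (Fin n → ℝ), ofReal (exp (D.totalWeight Δ y q)) *
          Φ (D.logLambda q.1) := by
    intro Φ hΦ
    have h1 := hWm.exp.ennreal_ofReal
    have h2 := hΦ.comp hφ
    have hm : Measurable fun q => ofReal (exp (W q)) * Φ (D.schwingerPhase q.2.2) := h1.mul h2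
    rw [← D.lintegral_schwinger Δ hy hside hΦ, lintegral_prod _ hm.aemeasurable, hμ]
    simp only [hW]
  obtain ⟨K, hK⟩ : ∃ K : ENNReal, K = 2 * gaussConst d ^ (Fintype.card D.V + Fintype.card D.E) *
        ofReal (1 / 2 ^ Fintype.card D.V) := ⟨_, rfl⟩
  have hKt : K ≠ ⊤ := by
    rw [hK, gaussConst]
    exact ENNReal.mul_ne_top (ENNReal.mul_ne_top (by simp) (ENNReal.pow_ne_top ENNReal.ofReal_ne_top))
      ENNReal.ofReal_ne_top
  rw [← hK] at key
  have hFi : Integrable F (μ.prod volume) := by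
    refine ⟨hFm.aestronglyMeasurable, ?_⟩
    rw [hasFiniteIntegral_iff_norm]
    simp only [hFn]
    have h1 := key (fun _ => 1) measurable_const
    simp only [mul_one] at h1
    rw [h1]
    refine ENNReal.mul_lt_top hKt.lt_top ?_
    have h2 := hint.2
    rw [hasFiniteIntegral_iff_norm] at h2
    simpa only [Real.norm_of_nonneg (exp_pos _).le] using h2
  have hae : ∀ᵐ X ∂μ, D.schwingerConst d Δ c * ∫ r, F (X, r) = D.correlatorIntegrand d Δ c y X := by
    have h1 : ∀ᵐ X ∂μ, ∀ v, 0 < (X v).1 := by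
      rw [ae_all_iff, hμ]
      exact fun v => (Measure.tendsto_eval_ae_ae (μ := fun _ : D.V => adsVolume d) (i := v)).eventually
        (ae_adsVolume_pos d)
    filter_upwards [h1] with X hX
    rw [D.correlatorIntegrand_eq hd hΔ.pos y hX hc, hF]
  refine ⟨hμ ▸ (hFi.integral_prod_left.const_mul _).congr hae, ?_⟩
  rw [correlator, ← hμ, ← integral_congr_ae hae, integral_const_mul, ← integral_prod _ hFi]
  have h1 := integral_exp_mul_eq_of_lintegral_eq hWm (D.continuous_totalWeight Δ y).measurable hφ hψ key
    (g := fun l => cexp (∑ e, c e * l e)) (by fun_prop)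
  have h2 : ∀ q, F q = cexp (W q) * cexp (∑ e, c e * D.schwingerPhase q.2.2 e) := fun q => by
    rw [hF, hW, ← Complex.exp_add]
  simp only [h2]
  rw [h1, ← mul_assoc, hK, D.schwingerConst_mul]
  simp only [← Complex.exp_add]
  ring

/-- A propagator all of whose boundary points lie on one side has vanishing `s_e`. -/
theorem exists_separated {Δ : Fin n → ℝ} {δ₀ : Fin n → Fin n → ℝ} (hp : IsMellinPoint δ₀)
    (hdiag : ∀ i, δ₀ i i = -Δ i) {e : D.E} (hpos : D.mandelstam Δ (fun i j => (δ₀ i j : ℂ)) e ≠ 0) :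
    ∃ i j, ¬ (i ∈ D.side e ↔ j ∈ D.side e) := by
  by_contra! hcon
  apply hpos
  rw [D.mandelstam_eq (fun i j => by rw [hp.symm]) (fun i => by rw [hdiag]; simp)
    (fun i => by rw [← Complex.ofReal_sum, hp.sum, Complex.ofReal_zero])]
  exact Finset.sum_eq_zero fun i _ => Finset.sum_eq_zero fun j _ => if_pos (hcon i j)

end TreeDiagram

/-! ### The product of the factors is a pre-amplitude -/

theorem continuousAt_Gamma_of_re_pos {s : ℂ} (hs : 0 < s.re) : ContinuousAt Gamma s :=
  (Complex.differentiableAt_Gamma s fun m hm => by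
    have := congrArg Complex.re hm
    simp at this
    linarith [Nat.cast_nonneg (α := ℝ) m]).continuousAt

namespace TreeDiagram
variable {n : ℕ} {D : TreeDiagram n}

theorem continuous_mandelstam (Δ : Fin n → ℝ) (e : D.E) :
    Continuous fun δ : Fin n → Fin n → ℂ => D.mandelstam Δ δ e := by
  unfold mandelstam
  fun_prop

theorem continuousOn_treeProduct (d : ℕ) (Δ : Fin n → ℝ) {c : D.E → ℂ} (hc : ∀ e, (c e).re = 0) :
    ContinuousOn (treeProduct d (correction d) D Δ c) (D.tube d Δ) := by
  intro δ hδ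
  refine ContinuousAt.continuousWithinAt ?_
  have hs := fun e => (D.continuous_mandelstam Δ e).continuousAt (x := δ)
  have hΓ : ∀ (e : D.E) (σ : ℂ), σ.re = 0 →
      ContinuousAt (fun δ => Gamma ((h d + σ - D.mandelstam Δ δ e) / 2)) δ := by
    intro e σ hσ
    have h1 : ContinuousAt (fun δ => (h d + σ - D.mandelstam Δ δ e) / 2) δ := by fun_prop
    refine ContinuousAt.comp (g := Gamma) (continuousAt_Gamma_of_re_pos ?_) h1
    have h5 := hδ.2.2.2.2 e
    rw [Complex.div_ofNat_re]
    simp [hσ]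
    linarith
  unfold treeProduct propagatorFactor
  refine ContinuousAt.mul ?_ ?_
  · refine tendsto_finsetProd _ fun e _ => ?_
    refine (hΓ e (c e) (hc e)).mul ?_
    have := hΓ e (-c e) (by simp [hc])
    simpa only [← sub_eq_add_neg] using this
  · refine tendsto_finsetProd _ fun v _ => ContinuousAt.mul continuousAt_const ?_
    obtain ⟨C, hC⟩ : ∃ C : ℂ × (D.Incident v → ℂ) × (D.Incident v → ℂ) → ℂ,
      C = fun p => correction d (D.Incident v) p.1 p.2.1 p.2.2 := ⟨_, rfl⟩
    have h1 : Continuous C := by rw [hC]; exact (differentiable_correction d (D.Incident v)).continuous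
    have h2 : ContinuousAt (fun δ => ((D.vertexDim Δ v : ℂ), ((fun a : D.Incident v => c a.1),
        (fun a : D.Incident v => D.mandelstam Δ δ a.1)))) δ :=
      continuousAt_const.prodMk (continuousAt_const.prodMk (continuousAt_pi.2 fun a => hs a.1))
    have h3 := ContinuousAt.comp h1.continuousAt h2
    rw [hC] at h3
    exact h3

/-- The integral representation bounds the product of the factors by its value at vanishing imaginary
parts. -/
theorem exists_norm_treeProduct_le {d : ℕ} {Δ : Fin n → ℝ} (hΔ : D.Convergent d Δ) (hn : 3 ≤ n)
    {c : D.E → ℂ} (hc : ∀ e, (c e).re = 0) {δ₀ : Fin n → Fin n → ℝ}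
    (hδ : (fun i j => (δ₀ i j : ℂ)) ∈ D.tube d Δ) :
    ∃ K : ℝ, ∀ t, ‖treeProduct d (correction d) D Δ c (contourPoint δ₀ t)‖ ≤ K := by
  obtain ⟨-, -, hcont⟩ := mem_tube_contourPoint hn hδ
  refine ⟨∫ p, exp (D.amplitudeExponent d Δ 0 (D.mandelstam Δ fun i j => (δ₀ i j : ℂ)) p).re, fun t => ?_⟩
  rw [(D.treeProduct_eq_integral d hΔ hc (hcont t).1.2.2.2.2).2]
  refine (norm_integral_le_integral_norm _).trans_eq (integral_congr_ae (.of_forall fun p => ?_))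
  simp only [Complex.norm_exp, amplitudeExponent]
  congr 1
  simp [Complex.re_sum, hc, (hcont t).2]

/-- In a convergent diagram every propagator has boundary points on both sides. -/
theorem Convergent.separated {d : ℕ} (hd : 0 < d) {Δ : Fin n → ℝ} (hΔ : D.Convergent d Δ) (e : D.E) :
    ∃ i j, ¬ (i ∈ D.side e ↔ j ∈ D.side e) := by
  obtain ⟨-, δ₀, η, hp, hdiag, hη, -, hs⟩ := hΔ.exists_mellinPoint hd
  exact D.exists_separated hp hdiag (by rw [hs]; exact_mod_cast hη.ne')

theorem Convergent.exists_mem_tube {d : ℕ} (hd : 0 < d) {Δ : Fin n → ℝ} (hΔ : D.Convergent d Δ) :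
    ∃ δ₀ : Fin n → Fin n → ℝ, (fun i j => (δ₀ i j : ℂ)) ∈ D.tube d Δ := by
  obtain ⟨-, δ₀, η, hp, hdiag, hη, hηh, hs⟩ := hΔ.exists_mellinPoint hd
  refine ⟨δ₀, fun i j => by simp only [hp.symm i j], fun i => by simp only [hdiag]; simp, fun i => ?_, fun i j hij => ?_,
    fun e => ?_⟩
  · rw [← Complex.ofReal_sum, hp.sum, Complex.ofReal_zero]
  · simpa using hp.pos i j hij
  · rw [hs]; simpa using hηh

theorem Convergent.correlator {d : ℕ} (hd : 0 < d) {Δ : Fin n → ℝ} (hΔ : D.Convergent d Δ) {c : D.E → ℂ}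
    (hc : ∀ e, (c e).re = 0) {δ₀ : Fin n → Fin n → ℝ} (hδ : (fun i j => (δ₀ i j : ℂ)) ∈ D.tube d Δ)
    {y : Fin n → Bdry d} (hy : Function.Injective y) :
    Integrable (D.correlatorIntegrand d Δ c y) (Measure.pi fun _ => adsVolume d) ∧
    D.correlator d Δ c y = D.normalization d Δ c *
      mellinIntegral δ₀ y (treeProduct d (correction d) D Δ c) := by
  obtain ⟨hn, -⟩ := hΔ.exists_mellinPoint hd
  have : Nonempty (Fin n) := ⟨⟨0, by omega⟩⟩
  obtain ⟨-, h2, h3⟩ := mellinIntegral_treeProduct hΔ hn hc hδ hy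
  rw [h3]
  exact D.correlator_eq hd hΔ (hΔ.separated hd) hc hy h2

theorem isPreAmplitude_treeProduct {d : ℕ} (hd : 0 < d) {Δ : Fin n → ℝ} (hΔ : D.Convergent d Δ) {c : D.E → ℂ}
    (hc : ∀ e, (c e).re = 0) : IsPreAmplitude D d Δ c (treeProduct d (correction d) D Δ c) := by
  obtain ⟨hn, -⟩ := hΔ.exists_mellinPoint hd
  refine ⟨continuousOn_treeProduct d Δ hc, fun δ₀ hδ => ?_, fun δ₀ hδ y hy => ?_, fun δ₀ hδ y hy => ?_⟩
  · obtain ⟨K, hK⟩ := exists_norm_treeProduct_le hΔ hn hc hδ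
    exact ⟨K, 0, fun t => by simpa using hK t⟩
  · exact (mellinIntegral_treeProduct hΔ hn hc hδ hy).1
  · exact (hΔ.correlator hd hc hδ hy).2

end TreeDiagram

/-! ### Uniqueness for Fourier transforms -/

section FourierUniqueness
variable {ι : Type*} [Fintype ι]

theorem integrable_exp_neg_mul_sum_abs {b : ℝ} (hb : 0 < b) :
    Integrable fun t : ι → ℝ => exp (-b * ∑ q, |t q|) := by
  have h1 : Integrable fun t : ι → ℝ => ∏ q, exp (-b * |t q|) :=
    Integrable.fintype_prod fun _ => integrable_exp_neg_mul_abs hb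
  refine h1.congr (.of_forall fun t => ?_)
  simp only
  rw [← Real.exp_sum, mul_sum]

/-- The Fourier transform of an exponentially decaying function, along a line through the origin, is
holomorphic on a strip. -/
theorem exists_differentiableOn_fourier {g : (ι → ℝ) → ℂ} (hg : Continuous g) {K b : ℝ} (hb : 0 < b)
    (hK : ∀ t, ‖g t‖ ≤ K * exp (-b * ∑ q, |t q|)) (ξ : ι → ℝ) :
    ∃ r : ℝ, 0 < r ∧ DifferentiableOn ℂ (fun s : ℂ => ∫ t, g t *
      cexp (s * (-I * (∑ q, t q * ξ q : ℝ)))) {s | |s.im| < r} := by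
  set B := 1 + ‖ξ‖ with hB
  have hB0 : 0 < B := by positivity
  have hK0 : 0 ≤ K := by
    have := (norm_nonneg _).trans (hK 0)
    simpa using this
  set r := b / (4 * B) with hr
  have hr0 : 0 < r := by positivity
  have hu : ∀ t : ι → ℝ, |∑ q, t q * ξ q| ≤ B * ∑ q, |t q| := by
    intro t
    refine (Finset.abs_sum_le_sum_abs _ _).trans ?_
    rw [mul_sum]
    refine sum_le_sum fun q _ => ?_
    rw [abs_mul, mul_comm]
    gcongr
    have := norm_le_pi_norm ξ q
    rw [Real.norm_eq_abs] at this
    linarith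
  have hnorm : ∀ (s : ℂ) (t : ι → ℝ), |s.im| < r →
      ‖cexp (s * (-I * (∑ q, t q * ξ q : ℝ)))‖ ≤ exp (r * |∑ q, t q * ξ q|) := by
    intro s t hs
    rw [Complex.norm_exp]
    refine exp_le_exp.2 ?_
    have h1 : (s * (-I * (∑ q, t q * ξ q : ℝ))).re = s.im * ∑ q, t q * ξ q := by
      rw [← mul_assoc, Complex.re_mul_ofReal]; simp
    rw [h1]
    refine (le_abs_self _).trans ?_
    rw [abs_mul]
    gcongr
  have hopen : IsOpen {s : ℂ | |s.im| < r} := isOpen_lt (by fun_prop) continuous_const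
  refine ⟨r, hr0, fun s₀ hs₀ => ?_⟩
  have hcont : ∀ s : ℂ, Continuous fun t : ι → ℝ => g t * cexp (s * (-I * (∑ q, t q * ξ q : ℝ))) :=
    fun s => by fun_prop
  have hbound : ∀ t : ι → ℝ, exp (-b * ∑ q, |t q|) * exp (2 * r * |∑ q, t q * ξ q|) ≤
      exp (-(b / 2) * ∑ q, |t q|) := by
    intro t
    rw [← exp_add]
    refine exp_le_exp.2 ?_
    have h1 : 2 * r * |∑ q, t q * ξ q| ≤ 2 * r * (B * ∑ q, |t q|) := by gcongr; exact hu t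
    have h2 : 2 * r * (B * ∑ q, |t q|) = b / 2 * ∑ q, |t q| := by rw [hr]; field_simp; norm_num
    linarith
  have hint := ((integrable_exp_neg_mul_sum_abs (ι := ι) (half_pos hb)).const_mul K)
  have hmain := hasDerivAt_integral_of_dominated_loc_of_deriv_le (μ := (volume : Measure (ι → ℝ)))
    (F := fun s t => g t * cexp (s * (-I * (∑ q, t q * ξ q : ℝ))))
    (F' := fun s t => g t * (cexp (s * (-I * (∑ q, t q * ξ q : ℝ))) *
      (-I * (∑ q, t q * ξ q : ℝ)))) (x₀ := s₀)
    (bound := fun t => r⁻¹ * (K * exp (-(b / 2) * ∑ q, |t q|)))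
    (hopen.mem_nhds hs₀)
    (.of_forall fun s => (hcont s).aestronglyMeasurable)
    (by
      refine hint.mono' (hcont s₀).aestronglyMeasurable (.of_forall fun t => ?_)
      rw [norm_mul]
      refine (mul_le_mul (hK t) (hnorm s₀ t hs₀) (norm_nonneg _) (by positivity)).trans ?_
      rw [mul_assoc]
      refine mul_le_mul_of_nonneg_left (le_trans ?_ (hbound t)) hK0
      gcongr
      nlinarith [abs_nonneg (∑ q, t q * ξ q)])
    (by
      have := (hcont s₀)
      exact Continuous.aestronglyMeasurable (by fun_prop))
    (.of_forall fun t s hs => by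
      have h1 : ‖(-I * (∑ q, t q * ξ q : ℝ))‖ = |∑ q, t q * ξ q| := by
        rw [norm_mul, norm_neg, Complex.norm_I, one_mul, Complex.norm_real, Real.norm_eq_abs]
      rw [norm_mul, norm_mul, h1]
      obtain ⟨u, hu'⟩ : ∃ u, u = |∑ q, t q * ξ q| := ⟨_, rfl⟩
      have hu0 : 0 ≤ u := by rw [hu']; exact abs_nonneg _
      have h2 := hnorm s t hs
      have h3 := hbound t
      rw [← hu'] at h2 h3 ⊢
      have h4 : u ≤ r⁻¹ * exp (r * u) := by
        rw [inv_mul_eq_div, le_div_iff₀ hr0]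
        have := Real.add_one_le_exp (r * u)
        linarith
      calc _ ≤ (K * exp (-b * ∑ q, |t q|)) * (exp (r * u) * (r⁻¹ * exp (r * u))) := by
            gcongr
            exact hK t
        _ = r⁻¹ * (K * (exp (-b * ∑ q, |t q|) * exp (2 * r * u))) := by
            have : exp (2 * r * u) = exp (r * u) * exp (r * u) := by
              rw [← exp_add]; congr 1; ring
            rw [this]; ring
        _ ≤ _ := by gcongr)
    (hint.const_mul _)
    (.of_forall fun t s _ => by
      have h1 : HasDerivAt (fun s : ℂ => s * (-I * (∑ q, t q * ξ q : ℝ)))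
          (-I * (∑ q, t q * ξ q : ℝ)) s := by
        simpa using (hasDerivAt_id s).mul_const (-I * ((∑ q, t q * ξ q : ℝ) : ℂ))
      exact h1.cexp.const_mul (g t))
  exact hmain.2.differentiableAt.differentiableWithinAt

/-- An exponentially decaying function whose Fourier transform vanishes near the origin vanishes. -/
theorem eq_zero_of_fourier_eq_zero {g : (ι → ℝ) → ℂ} (hg : Continuous g) {K b : ℝ} (hb : 0 < b)
    (hK : ∀ t, ‖g t‖ ≤ K * exp (-b * ∑ q, |t q|)) {ε : ℝ} (hε : 0 < ε)
    (hz : ∀ ξ : ι → ℝ, ‖ξ‖ < ε → ∫ t, g t * cexp (-I * (∑ q, t q * ξ q : ℝ)) = 0) :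
    g = 0 := by
  have hall : ∀ ξ : ι → ℝ, ∫ t, g t * cexp (-I * (∑ q, t q * ξ q : ℝ)) = 0 := by
    intro ξ
    obtain ⟨r, hr, hD⟩ := exists_differentiableOn_fourier hg hb hK ξ
    have hopen : IsOpen {s : ℂ | |s.im| < r} := isOpen_lt (by fun_prop) continuous_const
    have hconv : Convex ℝ {s : ℂ | |s.im| < r} := by
      have : {s : ℂ | |s.im| < r} = Complex.imLm ⁻¹' (Metric.ball 0 r) := by ext s; simp
      rw [this]
      exact (convex_ball 0 r).linear_preimage _
    have hA := hD.analyticOnNhd hopen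
    have h0 : (0 : ℂ) ∈ {s : ℂ | |s.im| < r} := by simpa using hr
    have hfreq : ∃ᶠ s in nhdsWithin (0 : ℂ) {0}ᶜ, ∫ t, g t *
      cexp (s * (-I * (∑ q, t q * ξ q : ℝ))) = 0 := by
      have hzr : ∀ x : ℝ, |x| * ‖ξ‖ < ε → ∫ t, g t *
          cexp ((x : ℂ) * (-I * (∑ q, t q * ξ q : ℝ))) = 0 := by
        intro x hx
        rw [← hz (x • ξ) (by rwa [norm_smul, Real.norm_eq_abs])]
        congr 1
        funext t
        congr 2
        simp only [Pi.smul_apply, smul_eq_mul]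
        push_cast
        simp only [mul_sum]
        exact sum_congr rfl fun q _ => by ring
      have ht : Filter.Tendsto (fun x : ℝ => (x : ℂ)) (nhdsWithin 0 {0}ᶜ) (nhdsWithin 0 {0}ᶜ) := by
        refine tendsto_nhdsWithin_iff.2 ⟨?_, ?_⟩
        · have := Complex.continuous_ofReal.tendsto 0
          rw [Complex.ofReal_zero] at this
          exact this.mono_left nhdsWithin_le_nhds
        · filter_upwards [self_mem_nhdsWithin] with x hx
          simpa using hx
      refine ht.frequently (Filter.Eventually.frequently ?_)
      have h1 : Filter.Tendsto (fun x : ℝ => |x| * ‖ξ‖) (nhds 0) (nhds 0) := by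
        have : Continuous fun x : ℝ => |x| * ‖ξ‖ := by fun_prop
        simpa using this.tendsto 0
      filter_upwards [nhdsWithin_le_nhds (h1.eventually (gt_mem_nhds hε))] with x hx
      exact hzr x hx
    have h1 := hA.eqOn_zero_of_preconnected_of_frequently_eq_zero hconv.isPreconnected h0 hfreq
    have h2 := h1 (show (1 : ℂ) ∈ {s : ℂ | |s.im| < r} by simpa using hr)
    simpa using h2
  have hgi : Integrable g := ((integrable_exp_neg_mul_sum_abs hb).const_mul K).mono' hg.aestronglyMeasurable
    (.of_forall hK)
  have hmp := EuclideanSpace.volume_preserving_symm_measurableEquiv_toLp ι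
  set G : EuclideanSpace ℝ ι → ℂ := fun x => g x.ofLp with hG
  have hGc : Continuous G := by rw [hG]; fun_prop
  have hGi : Integrable G := (hmp.integrable_comp_emb (MeasurableEquiv.measurableEmbedding _)).2 hgi
  have hF : FourierTransform.fourier G = 0 := by
    funext w
    rw [Real.fourier_eq']
    have h1 := hmp.integral_comp (MeasurableEquiv.measurableEmbedding _)
      (fun t : ι → ℝ => g t * cexp (-I * (∑ q, t q * (2 * pi * w q) : ℝ)))
    refine Eq.trans (integral_congr_ae (.of_forall fun x => ?_))
      (h1.trans (hall fun q => 2 * pi * w q))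
    simp only [smul_eq_mul, hG]
    rw [mul_comm]
    congr 2
    have h3 : -2 * pi * inner ℝ x w =
        -∑ q, (MeasurableEquiv.toLp 2 (ι → ℝ)).symm x q * (2 * pi * w q) := by
      rw [PiLp.inner_apply, mul_sum, ← sum_neg_distrib]
      refine sum_congr rfl fun q _ => ?_
      simp
      ring
    rw [h3]
    push_cast
    ring
  have h2 := hGc.fourierInv_fourier_eq hGi (by rw [hF]; exact integrable_zero _ _ _)
  rw [hF] at h2
  funext t
  have h3 := congrFun h2 (WithLp.toLp 2 t)
  rw [Real.fourierInv_eq] at h3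
  simpa [hG] using h3.symm

end FourierUniqueness

/-! ### Independence of the cross ratios -/

section Simplices

/-- A small perturbation of the Gram matrix of the regular simplex is positive semidefinite. -/
theorem posSemidef_of_near_simplex {κ : Type*} [Fintype κ] [DecidableEq κ] {G : Matrix κ κ ℝ}
    (hsymm : ∀ i j, G i j = G j i)
    (hG : ∀ i j, |G i j - (if i = j then 1 else 1 / 2)| * (2 * Fintype.card κ) ≤ 1) : G.PosSemidef := by
  refine Matrix.PosSemidef.of_dotProduct_mulVec_nonneg ?_ fun x => ?_
  · ext i j
    simp [Matrix.conjTranspose_apply, hsymm i j]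
  simp only [star_trivial, dotProduct, Matrix.mulVec, mul_sum]
  have h1 : ∀ i j, x i * (G i j * x j) = (G i j - (if i = j then 1 else 1 / 2)) * (x i * x j) +
      1 / 2 * (x i * x j) + (if i = j then 1 / 2 * (x i * x j) else 0) := by
    intro i j
    split_ifs <;> ring
  have h2 : ∀ i j, -((x i ^ 2 + x j ^ 2)) ≤
      4 * Fintype.card κ * ((G i j - (if i = j then 1 else 1 / 2)) * (x i * x j)) := by
    intro i j
    have h3 := hG i j
    set g := G i j - (if i = j then 1 else 1 / 2)
    have h4 : |g * (2 * Fintype.card κ)| ≤ 1 := by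
      rw [abs_mul, abs_of_nonneg (by positivity : (0 : ℝ) ≤ 2 * Fintype.card κ)]
      exact h3
    obtain ⟨h5, h6⟩ := abs_le.1 h4
    have : 4 * Fintype.card κ * (g * (x i * x j)) = (g * (2 * Fintype.card κ)) * (2 * (x i * x j)) := by ring
    rw [this]
    nlinarith [sq_nonneg (x i + x j), sq_nonneg (x i - x j)]
  have hm : ∑ i, ∑ j, x i * (G i j * x j) = ∑ i, ∑ j, (G i j - (if i = j then 1 else 1 / 2)) * (x i * x j) +
      1 / 2 * (∑ i, x i) ^ 2 + 1 / 2 * ∑ i, x i ^ 2 := by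
    simp only [h1, sum_add_distrib, Finset.sum_ite_eq, mem_univ, if_true]
    rw [sq, Finset.sum_mul_sum, mul_sum, mul_sum]
    simp only [mul_sum]
    congr 1
    exact sum_congr rfl fun i _ => by ring
  rw [hm]
  rcases isEmpty_or_nonempty κ with he | he
  · simp
  have hc : (0 : ℝ) < Fintype.card κ := by exact_mod_cast Fintype.card_pos
  have h3 := sum_le_sum fun i (_ : i ∈ univ) => sum_le_sum fun j (_ : j ∈ univ) => h2 i j
  simp only [← mul_sum, sum_neg_distrib, sum_add_distrib, Finset.sum_const,
    card_univ, nsmul_eq_mul] at h3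
  have h4 : -(1 / 2 * ∑ i, x i ^ 2) ≤ ∑ i, ∑ j, (G i j - (if i = j then 1 else 1 / 2)) * (x i * x j) := by
    refine le_of_mul_le_mul_left ?_ (by positivity : (0 : ℝ) < 4 * Fintype.card κ)
    refine le_trans (le_of_eq ?_) h3
    ring
  nlinarith [sq_nonneg (∑ i, x i)]

open scoped MatrixOrder in
/-- A positive semidefinite matrix of size at most `d` is the Gram matrix of vectors in `ℝ^d`. -/
theorem exists_gram {κ : Type*} [Fintype κ] {d : ℕ} (hd : Fintype.card κ ≤ d) {G : Matrix κ κ ℝ}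
    (hG : G.PosSemidef) : ∃ x : κ → Bdry d, ∀ i j, inner ℝ (x i) (x j) = G i j := by
  obtain ⟨B, hB⟩ := CStarAlgebra.nonneg_iff_eq_star_mul_self.1 hG.nonneg
  obtain ⟨f⟩ : Nonempty (κ ↪ Fin d) := Function.Embedding.nonempty_of_card_le (by simpa using hd)
  refine ⟨fun i => ∑ k, B k i • EuclideanSpace.single (f k) (1 : ℝ), fun i j => ?_⟩
  rw [hB, Matrix.mul_apply, sum_inner]
  refine sum_congr rfl fun k _ => ?_
  rw [inner_sum, sum_eq_single k]
  · simp [inner_smul_left, inner_smul_right, mul_comm]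
  · intro l _ hl
    have : f k ≠ f l := fun h => hl (f.injective h).symm
    simp [inner_smul_left, inner_smul_right, EuclideanSpace.inner_single_left, this]
  · simp

/-- Distances near those of a regular simplex are realised by points of `ℝ^d`. -/
theorem exists_points_of_dist {κ : Type*} [Fintype κ] {d : ℕ} (hd : Fintype.card κ ≤ d + 1) {L : κ → κ → ℝ}
    (hsymm : ∀ i j, L i j = L j i) (hL : ∀ i j, |exp (L i j) - 1| * (3 * Fintype.card κ) ≤ 1) :
    ∃ x : κ → Bdry d, ∀ i j, i ≠ j → ‖x i - x j‖ ^ 2 = exp (L i j) := by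
  rcases isEmpty_or_nonempty κ with he | ⟨⟨o⟩⟩
  · exact ⟨fun i => he.elim i, fun i => he.elim i⟩
  set E : κ → κ → ℝ := fun i j => if i = j then 0 else exp (L i j) with hE
  have hEs : ∀ i j, E i j = E j i := fun i j => by
    simp only [hE, eq_comm (a := i), hsymm i j]
  set G : Matrix {i // i ≠ o} {i // i ≠ o} ℝ := fun i j => (E i o + E j o - E i j) / 2 with hG
  have hcard : Fintype.card {i // i ≠ o} + 1 = Fintype.card κ := by
    rw [Fintype.card_subtype_compl, Fintype.card_subtype_eq]
    have := Fintype.card_pos_iff.2 ⟨o⟩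
    omega
  have hpsd : G.PosSemidef := by
    refine posSemidef_of_near_simplex (fun i j => ?_) fun i j => ?_
    · simp only [hG, hEs i j]; ring
    · have h1 := hL i o
      have h2 := hL j o
      have h3 := hL i j
      have hc0 : (0 : ℝ) ≤ Fintype.card {i // i ≠ o} := by positivity
      have hc1 : (Fintype.card κ : ℝ) = Fintype.card {i // i ≠ o} + 1 := by exact_mod_cast hcard.symm
      have hb : |G i j - (if i = j then 1 else 1 / 2)| ≤
          (|exp (L i o) - 1| + |exp (L j o) - 1| + |exp (L i j) - 1|) / 2 := by
        have p1 := abs_nonneg (exp (L i j) - 1)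
        simp only [hG, hE, i.2, j.2, if_false]
        rw [abs_le]
        have q1 := abs_le.1 (le_refl |exp (L i o) - 1|)
        have q2 := abs_le.1 (le_refl |exp (L j o) - 1|)
        have q3 := abs_le.1 (le_refl |exp (L i j) - 1|)
        by_cases hij : i = j
        · subst hij
          simp only [if_true]
          constructor <;> linarith [q1.1, q1.2, q2.1, q2.2]
        · have hij' : (i : κ) ≠ j := fun h => hij (Subtype.ext h)
          simp only [hij, hij', if_false]
          constructor <;> linarith [q1.1, q1.2, q2.1, q2.2, q3.1, q3.2]
      have p1 := abs_nonneg (exp (L i j) - 1)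
      have p2 := abs_nonneg (exp (L i o) - 1)
      have p3 := abs_nonneg (exp (L j o) - 1)
      rw [hc1] at h1 h2 h3
      calc _ ≤ (|exp (L i o) - 1| + |exp (L j o) - 1| + |exp (L i j) - 1|) / 2 *
            (2 * Fintype.card {i // i ≠ o}) := mul_le_mul_of_nonneg_right hb (by positivity)
        _ ≤ 1 := by nlinarith
  obtain ⟨x, hx⟩ := exists_gram (d := d) (by omega) hpsd
  refine ⟨fun i => if h : i = o then 0 else x ⟨i, h⟩, fun i j hij => ?_⟩
  simp only
  have hE' : ∀ {i j : κ}, i ≠ j → E i j = exp (L i j) := fun h => by simp only [hE, h, if_false]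
  have hnorm : ∀ i, ‖x i‖ ^ 2 = E i o := fun i => by
    rw [← real_inner_self_eq_norm_sq, hx]; simp [hG, hE]
  by_cases hi : i = o
  · have hj : j ≠ o := fun h => hij (hi.trans h.symm)
    rw [dif_pos hi, dif_neg hj, zero_sub, norm_neg, hnorm, ← hE' hij, hi, hEs]
  · by_cases hj : j = o
    · rw [dif_neg hi, dif_pos hj, sub_zero, hnorm, ← hE' hij, hj]
    · rw [dif_neg hi, dif_neg hj, norm_sub_sq_real, hnorm, hnorm, hx, ← hE' hij]
      simp only [hG]
      ring

/-- By inversion in the first point, the cross ratios of `n ≤ d + 2` boundary points are independent. -/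
theorem exists_points_of_crossRatios {d n : ℕ} (hd : 0 < d) (hn : n ≤ d + 2) {L : Fin n → Fin n → ℝ}
    (hsymm : ∀ i j, L i j = L j i) (h0 : ∀ i j : Fin n, i.val = 0 → L i j = 0)
    (hL : ∀ i j, |exp (L i j) - 1| * (3 * n) ≤ 1) :
    ∃ (y : Fin n → Bdry d) (a : Fin n → ℝ), Function.Injective y ∧
      ∀ i j, i ≠ j → ‖y i - y j‖ ^ 2 = exp (L i j + a i + a j) := by
  rcases Nat.eq_zero_or_pos n with rfl | hn0
  · exact ⟨fun i => i.elim0, fun i => i.elim0, fun i => i.elim0, fun i => i.elim0⟩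
  set o : Fin n := ⟨0, hn0⟩
  have ho : ∀ i : Fin n, i ≠ o → i.val ≠ 0 := fun i hi h => hi (Fin.ext h)
  have hcard : Fintype.card {i : Fin n // i ≠ o} + 1 = n := by
    rw [Fintype.card_subtype_compl, Fintype.card_subtype_eq, Fintype.card_fin]
    omega
  obtain ⟨x, hx⟩ := exists_points_of_dist (κ := {i : Fin n // i ≠ o}) (d := d) (by omega)
    (L := fun i j => L i j) (fun i j => hsymm i j) (fun i j => by
      refine le_trans ?_ (hL i j)
      have : (Fintype.card {i : Fin n // i ≠ o} : ℝ) ≤ n := by exact_mod_cast (by omega)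
      gcongr)
  -- translate the points away from the centre of inversion
  obtain ⟨v, hv⟩ : ∃ v : Bdry d, ∀ i, x i + v ≠ 0 := by
    have : Nonempty (Fin d) := ⟨⟨0, hd⟩⟩
    obtain ⟨v, hv⟩ := (Set.finite_range fun i => -x i).exists_notMem (α := Bdry d)
    exact ⟨v, fun i hi => hv ⟨i, by simpa using (eq_neg_of_add_eq_zero_right hi).symm⟩⟩
  set z : {i : Fin n // i ≠ o} → Bdry d := fun i => x i + v with hz
  have hz0 : ∀ i, 0 < ‖z i‖ := fun i => norm_pos_iff.2 (hv i)
  have hzd : ∀ i j, i ≠ j → ‖z i - z j‖ ^ 2 = exp (L i j) := fun i j hij => by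
    rw [← hx i j hij]; simp [hz]
  refine ⟨fun i => if h : i = o then 0 else (‖z ⟨i, h⟩‖ ^ 2)⁻¹ • z ⟨i, h⟩,
    fun i => if h : i = o then 0 else -(2 * log ‖z ⟨i, h⟩‖), ?_⟩
  have key : ∀ i j : Fin n, i ≠ j → ‖(if h : i = o then (0 : Bdry d) else (‖z ⟨i, h⟩‖ ^ 2)⁻¹ • z ⟨i, h⟩) -
      (if h : j = o then (0 : Bdry d) else (‖z ⟨j, h⟩‖ ^ 2)⁻¹ • z ⟨j, h⟩)‖ ^ 2 =
      exp (L i j + (if h : i = o then 0 else -(2 * log ‖z ⟨i, h⟩‖)) +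
        (if h : j = o then 0 else -(2 * log ‖z ⟨j, h⟩‖))) := by
    have hexp : ∀ i, exp (-(2 * log ‖z i‖)) = (‖z i‖ ^ 2)⁻¹ := fun i => by
      rw [Real.exp_neg, two_mul, exp_add, exp_log (hz0 i), sq]
    have hn : ∀ i, ‖(‖z i‖ ^ 2)⁻¹ • z i‖ ^ 2 = (‖z i‖ ^ 2)⁻¹ := fun i => by
      have := (hz0 i).ne'
      rw [norm_smul, mul_pow, Real.norm_of_nonneg (by positivity)]
      field_simp
    intro i j hij
    by_cases hi : i = o
    · have hj : j ≠ o := fun h => hij (hi.trans h.symm)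
      rw [dif_pos hi, dif_neg hj, dif_pos hi, dif_neg hj, zero_sub, norm_neg, hn,
        h0 i j (by rw [hi]), zero_add, zero_add, hexp]
    · by_cases hj : j = o
      · rw [dif_neg hi, dif_pos hj, dif_neg hi, dif_pos hj, sub_zero, hn, hsymm,
          h0 j i (by rw [hj]), zero_add, add_zero, hexp]
      · rw [dif_neg hi, dif_neg hj, dif_neg hi, dif_neg hj, exp_add, exp_add, hexp, hexp,
          ← hzd ⟨i, hi⟩ ⟨j, hj⟩ (fun h => hij (congrArg Subtype.val h)), norm_sub_sq_real, norm_sub_sq_real,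
          hn, hn, inner_smul_left, inner_smul_right]
        have p1 := (hz0 ⟨i, hi⟩).ne'
        have p2 := (hz0 ⟨j, hj⟩).ne'
        simp only [conj_trivial]
        field_simp
        ring
  refine ⟨fun i j hij => ?_, key⟩
  by_contra hne
  have h1 := key i j hne
  simp only at hij
  rw [hij, sub_self, norm_zero, zero_pow two_ne_zero] at h1
  exact (exp_pos _).ne h1

end Simplices

/-! ### Uniqueness of the pre-amplitude -/

theorem one_add_pow_le_exp {b : ℝ} (hb : 0 < b) (N : ℕ) :
    ∃ K : ℝ, 0 ≤ K ∧ ∀ x : ℝ, 0 ≤ x → (1 + x) ^ N ≤ K * exp (b * x) := by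
  set b' := b / (N + 1) with hb'
  have hb0 : 0 < b' := by positivity
  refine ⟨(1 + b'⁻¹) ^ N, by positivity, fun x hx => ?_⟩
  have h1 : 1 + x ≤ (1 + b'⁻¹) * exp (b' * x) := by
    have h2 := Real.one_le_exp (x := b' * x) (by positivity)
    have h3 : x ≤ b'⁻¹ * exp (b' * x) := by
      rw [inv_mul_eq_div, le_div_iff₀ hb0]
      have := Real.add_one_le_exp (b' * x)
      linarith
    linarith
  calc (1 + x) ^ N ≤ ((1 + b'⁻¹) * exp (b' * x)) ^ N := by gcongr
    _ = (1 + b'⁻¹) ^ N * exp (N * (b' * x)) := by rw [mul_pow, ← Real.exp_nat_mul]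
    _ ≤ _ := by
      refine mul_le_mul_of_nonneg_left (exp_le_exp.2 ?_) (by positivity)
      have h2 : (N + 1) * b' = b := by rw [hb']; field_simp
      rw [← h2]
      nlinarith [mul_nonneg hb0.le hx]

section Contours
variable {n : ℕ}

theorem norm_le_sum_abs {ι : Type*} [Fintype ι] (t : ι → ℝ) : ‖t‖ ≤ ∑ q, |t q| := by
  refine (pi_norm_le_iff_of_nonneg (Finset.sum_nonneg fun _ _ => abs_nonneg _)).2 fun q => ?_
  rw [Real.norm_eq_abs]
  exact Finset.single_le_sum (f := fun q => |t q|) (fun _ _ => abs_nonneg _) (mem_univ q)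

/-- The product of the `Γ` functions decays exponentially along the contours. -/
theorem exists_norm_prod_Gamma_le (hn : 3 ≤ n) {δ₀ : Fin n → Fin n → ℝ} (hp : IsMellinPoint δ₀) :
    ∃ K : ℝ, 0 ≤ K ∧ ∀ t : MellinIndex n → ℝ, ‖∏ i, ∏ j with i < j, Gamma (contourPoint δ₀ t i j)‖ ≤
      K * exp (-(pi / 4) * ∑ q, |t q|) := by
  have hK : ∀ i j : Fin n, ∃ K : ℝ, 0 < K ∧ (i < j → ∀ s : ℂ, s.re = δ₀ i j →
      ‖Gamma s‖ ≤ K * exp (-(pi / 4) * |s.im|)) := by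
    intro i j
    by_cases hij : i < j
    · obtain ⟨K, hK, hle⟩ := norm_Gamma_le (hp.pos i j hij.ne)
      exact ⟨K, hK, fun _ => hle⟩
    · exact ⟨1, one_pos, fun h => absurd h hij⟩
  choose K hK0 hK using hK
  refine ⟨∏ i, ∏ j with i < j, K i j, Finset.prod_nonneg fun i _ => Finset.prod_nonneg fun j _ => (hK0 i j).le,
    fun t => ?_⟩
  have h1 : ‖∏ i, ∏ j with i < j, Gamma (contourPoint δ₀ t i j)‖ ≤
      ∏ i, ∏ j with i < j, (K i j * exp (-(pi / 4) * |mellinMatrix t i j|)) := by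
    rw [norm_prod]
    refine Finset.prod_le_prod (fun _ _ => norm_nonneg _) fun i _ => ?_
    rw [norm_prod]
    refine Finset.prod_le_prod (fun _ _ => norm_nonneg _) fun j hj => ?_
    have := hK i j (mem_filter.1 hj).2 (contourPoint δ₀ t i j) (by simp [contourPoint])
    simpa [contourPoint] using this
  refine h1.trans ?_
  simp only [prod_mul_distrib, ← Real.exp_sum, ← mul_sum]
  refine mul_le_mul_of_nonneg_left (exp_le_exp.2 ?_)
    (Finset.prod_nonneg fun i _ => Finset.prod_nonneg fun j _ => (hK0 i j).le)
  rw [sum_pairs hn]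
  simp only [mellinMatrix_index]
  have : 0 ≤ ∑ r, |mellinMatrix t (dependentPair hn r).1 (dependentPair hn r).2| :=
    Finset.sum_nonneg fun _ _ => abs_nonneg _
  nlinarith [Real.pi_pos]

/-- A symmetric matrix with vanishing diagonal and row sums is determined by its independent entries. -/
theorem eq_zero_of_index_eq_zero (hn : 3 ≤ n) {B : Fin n → Fin n → ℂ} (hsymm : ∀ i j, B i j = B j i)
    (hdiag : ∀ i, B i i = 0) (hsum : ∀ i, ∑ j, B i j = 0) (hB : ∀ q : MellinIndex n, B q.1.1 q.1.2 = 0) :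
    B = 0 := by
  have key : ∀ v : Fin n → ℂ, ∑ r, B (dependentPair hn r).1 (dependentPair hn r).2 *
      (v (dependentPair hn r).1 + v (dependentPair hn r).2) = 0 := by
    intro v
    have h1 := sum_pairs_add hsymm hsum v
    rw [sum_pairs hn] at h1
    simpa [hB, hdiag] using h1
  set o : Fin n := ⟨0, by omega⟩ with ho
  have hdo : dependentPair hn o = (⟨1, by omega⟩, ⟨2, by omega⟩) := if_pos rfl
  have hdr : ∀ r : Fin n, r ≠ o → dependentPair hn r = (o, r) := fun r hr =>
    if_neg fun h => hr (Fin.ext h)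
  have h12 : B ⟨1, by omega⟩ ⟨2, by omega⟩ = 0 := by
    have h1 := key fun i => if i = o then -1 else 1
    rw [sum_eq_single o] at h1
    · rw [hdo] at h1
      simp only [ho, Fin.mk.injEq, one_ne_zero, two_ne_zero, if_false] at h1
      exact (mul_eq_zero.1 h1).resolve_right (by norm_num)
    · intro r _ hr
      rw [hdr r hr]
      simp [hr]
    · simp
  have h0 : ∀ r, r ≠ o → B o r = 0 := by
    intro r hr
    have h1 := key fun i => if i = r then 1 else 0
    rw [sum_eq_single r] at h1
    · rw [hdr r hr] at h1
      simpa [hr.symm] using h1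
    · intro r' _ hr'
      by_cases hr0 : r' = o
      · rw [hr0, hdo]
        simp only [h12, zero_mul]
      · rw [hdr r' hr0]
        simp [hr', hr.symm]
    · simp
  have hlt : ∀ i j, i < j → B i j = 0 := by
    intro i j hij
    by_cases hi : i = o
    · rw [hi]
      exact h0 j fun h => by rw [hi, h] at hij; exact lt_irrefl _ hij
    · have hi' : 1 ≤ i.val := Nat.one_le_iff_ne_zero.2 fun h => hi (Fin.ext h)
      by_cases h2 : i.val = 1 ∧ j.val = 2
      · have e1 : i = ⟨1, by omega⟩ := Fin.ext h2.1
        have e2 : j = ⟨2, by omega⟩ := Fin.ext h2.2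
        rw [e1, e2, h12]
      · exact hB ⟨(i, j), hi', hij, h2⟩
  funext i j
  rcases lt_trichotomy i j with h | h | h
  · exact hlt i j h
  · rw [h]; exact hdiag j
  · rw [hsymm]; exact hlt j i h

/-- The symmetric matrix with the given independent entries and zeros elsewhere. -/
def logCrossRatio (ξ : MellinIndex n → ℝ) (i j : Fin n) : ℝ :=
  if hp : 1 ≤ (min i j).val ∧ min i j < max i j ∧
      ¬ ((min i j).val = 1 ∧ (max i j).val = 2) then ξ ⟨(min i j, max i j), hp⟩ else 0

theorem logCrossRatio_comm (ξ : MellinIndex n → ℝ) (i j : Fin n) :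
    logCrossRatio ξ i j = logCrossRatio ξ j i := by
  simp only [logCrossRatio, min_comm i j, max_comm i j]

theorem logCrossRatio_zero (ξ : MellinIndex n → ℝ) (i j : Fin n) (hi : i.val = 0) :
    logCrossRatio ξ i j = 0 := by
  have h1 : min i j = i := min_eq_left (by rw [Fin.le_def]; omega)
  rw [logCrossRatio, dif_neg]
  rw [h1]
  omega

theorem logCrossRatio_dependentPair (hn : 3 ≤ n) (ξ : MellinIndex n → ℝ) (r : Fin n) :
    logCrossRatio ξ (dependentPair hn r).1 (dependentPair hn r).2 = 0 := by
  by_cases hr : r.val = 0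
  · rw [dependentPair, if_pos hr, logCrossRatio, dif_neg]
    rw [min_eq_left (by simp), max_eq_right (by simp)]
    simp
  · rw [dependentPair, if_neg hr]
    exact logCrossRatio_zero _ _ _ rfl

theorem logCrossRatio_index (ξ : MellinIndex n → ℝ) (q : MellinIndex n) :
    logCrossRatio ξ q.1.1 q.1.2 = ξ q := by
  obtain ⟨⟨a, b⟩, hp⟩ := q
  have hab : a < b := hp.2.1
  simp only [logCrossRatio, min_eq_left hab.le, max_eq_right hab.le]
  exact dif_pos hp

theorem abs_logCrossRatio_le (ξ : MellinIndex n → ℝ) (i j : Fin n) : |logCrossRatio ξ i j| ≤ ‖ξ‖ := by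
  unfold logCrossRatio
  split_ifs
  · exact norm_le_pi_norm ξ _
  · simp

/-- At points with prescribed cross ratios, the dressing is a Fourier character times the `Γ` functions. -/
theorem dressing_crossRatios {d : ℕ} (hn : 3 ≤ n) {δ₀ : Fin n → Fin n → ℝ} (hp : IsMellinPoint δ₀)
    {y : Fin n → Bdry d} (hy : Function.Injective y) {ξ : MellinIndex n → ℝ} {a : Fin n → ℝ}
    (ha : ∀ i j, i ≠ j → ‖y i - y j‖ ^ 2 = exp (logCrossRatio ξ i j + a i + a j)) (t : MellinIndex n → ℝ) :
    dressing y (contourPoint δ₀ t) =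
      cexp (∑ i, δ₀ i i * a i - ∑ q : MellinIndex n, δ₀ q.1.1 q.1.2 * ξ q) *
      ((∏ i, ∏ j with i < j, Gamma (contourPoint δ₀ t i j)) *
        cexp (-I * (∑ q, t q * ξ q : ℝ))) := by
  rw [dressing_eq hy]
  simp only [prod_mul_distrib, ← Complex.exp_sum]
  rw [mul_left_comm, ← Complex.exp_add]
  congr 2
  have h1 := sum_pairs_add (δ := contourPoint δ₀ t)
    (fun i j => by simp only [contourPoint, hp.symm i j, mellinMatrix_comm t i j])
    (fun i => by
      simp only [contourPoint]
      rw [sum_add_distrib, ← mul_sum, ← Complex.ofReal_sum, ← Complex.ofReal_sum,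
        hp.sum, sum_mellinMatrix hn]
      simp) (fun i => (a i : ℂ))
  have h2 : ∀ i, contourPoint δ₀ t i i = δ₀ i i := fun i => by
    simp [contourPoint, mellinMatrix_self]
  simp only [h2] at h1
  have h3 := sum_pairs hn fun i j => contourPoint δ₀ t i j * (logCrossRatio ξ i j : ℂ)
  simp only [logCrossRatio_dependentPair, logCrossRatio_index, Complex.ofReal_zero, mul_zero,
    sum_const_zero, zero_add] at h3
  have h4 : ∑ i, ∑ j with i < j, -contourPoint δ₀ t i j * (log (‖y i - y j‖ ^ 2) : ℝ) =
      -(∑ i, ∑ j with i < j, contourPoint δ₀ t i j * (logCrossRatio ξ i j : ℂ)) -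
        ∑ i, ∑ j with i < j, contourPoint δ₀ t i j * ((a i : ℂ) + a j) := by
    simp only [← sum_neg_distrib, ← sum_sub_distrib]
    refine sum_congr rfl fun i _ => sum_congr rfl fun j hj => ?_
    rw [ha i j (mem_filter.1 hj).2.ne, log_exp]
    push_cast
    ring
  rw [h4, h1, h3]
  have h5 : ∀ q : MellinIndex n, contourPoint δ₀ t q.1.1 q.1.2 = δ₀ q.1.1 q.1.2 + I * t q := fun q => by
    rw [contourPoint, mellinMatrix_index]
  simp only [h5, add_mul, sum_add_distrib]
  push_cast
  simp only [mul_assoc, ← mul_sum]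
  ring

end Contours

namespace TreeDiagram
variable {n : ℕ} {D : TreeDiagram n}

/-- A pre-amplitude is determined on the domain of the Mellin variables. -/
theorem IsPreAmplitude.eqOn_tube {d : ℕ} (hd : 0 < d) (hn : 3 ≤ n) (hnd : n ≤ d + 2) {Δ : Fin n → ℝ} {c : D.E → ℂ}
    (hN : D.normalization d Δ c ≠ 0) {M M' : (Fin n → Fin n → ℂ) → ℂ} (hM : IsPreAmplitude D d Δ c M)
    (hM' : IsPreAmplitude D d Δ c M') : Set.EqOn M M' (D.tube d Δ) := by
  intro δ hδ
  set δ₀ : Fin n → Fin n → ℝ := fun i j => (δ i j).re with hδ₀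
  have hδ₀m : (fun i j => (δ₀ i j : ℂ)) ∈ D.tube d Δ := by
    obtain ⟨h1, h2, h3, h4, h5⟩ := hδ
    refine ⟨fun i j => by simp only [hδ₀, h1 i j], fun i => by simp only [hδ₀, h2]; simp, fun i => ?_,
      fun i j hij => by simpa [hδ₀] using h4 i j hij, fun e => ?_⟩
    · simp only [hδ₀]
      rw [← Complex.ofReal_sum, ← Complex.re_sum, h3]
      simp
    · have := h5 e
      simp only [mandelstam, Complex.sub_re, Complex.re_sum, Complex.mul_re] at this ⊢
      simpa [hδ₀] using this
  obtain ⟨hp, hdiag, hcont⟩ := mem_tube_contourPoint hn hδ₀m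
  set t₀ : MellinIndex n → ℝ := fun q => (δ q.1.1 q.1.2).im with ht₀
  have hpt : contourPoint δ₀ t₀ = δ := by
    have hcB := (hcont t₀).1
    have h1 : (fun i j => contourPoint δ₀ t₀ i j - δ i j) = 0 := by
      refine eq_zero_of_index_eq_zero hn (fun i j => ?_) (fun i => ?_) (fun i => ?_) fun q => ?_
      · rw [hcB.1 i j, hδ.1 i j]
      · rw [hcB.2.1 i, hδ.2.1 i, sub_self]
      · rw [sum_sub_distrib, hcB.2.2.1 i, hδ.2.2.1 i, sub_self]
      · rw [contourPoint, mellinMatrix_index, mul_comm, Complex.re_add_im, sub_self]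
    funext i j
    exact sub_eq_zero.1 (congrFun (congrFun h1 i) j)
  have hcp : Continuous fun t : MellinIndex n → ℝ => contourPoint δ₀ t :=
    continuous_pi fun i => continuous_pi fun j => continuous_contourPoint δ₀ i j
  have hcM : ∀ {M : (Fin n → Fin n → ℂ) → ℂ}, IsPreAmplitude D d Δ c M →
      Continuous fun t => M (contourPoint δ₀ t) := fun hM =>
    hM.continuousOn.comp_continuous hcp fun t => (hcont t).1
  have hgr : ∀ {M : (Fin n → Fin n → ℂ) → ℂ}, IsPreAmplitude D d Δ c M →
      ∃ K : ℝ, 0 ≤ K ∧ ∀ t, ‖M (contourPoint δ₀ t)‖ ≤ K * exp (pi / 8 * ∑ q, |t q|) := by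
    intro M hM
    obtain ⟨K, N, hK⟩ := hM.growth δ₀ hδ₀m
    -- half of the rate `π / 4` at which the `Γ` functions decay
    obtain ⟨K', hK', hle⟩ := one_add_pow_le_exp (b := pi / 8) (by positivity) N
    refine ⟨|K| * K', by positivity, fun t => (hK t).trans ?_⟩
    have h1 : (1 + ‖t‖) ^ N ≤ K' * exp (pi / 8 * ∑ q, |t q|) := by
      refine (hle _ (norm_nonneg t)).trans ?_
      gcongr
      exact norm_le_sum_abs t
    calc K * (1 + ‖t‖) ^ N ≤ |K| * (1 + ‖t‖) ^ N := by gcongr; exact le_abs_self K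
      _ ≤ |K| * (K' * exp (pi / 8 * ∑ q, |t q|)) := by gcongr
      _ = _ := by ring
  obtain ⟨Γ, hΓ⟩ : ∃ Γ : (MellinIndex n → ℝ) → ℂ, Γ = fun t =>
    ∏ i, ∏ j with i < j, Gamma (contourPoint δ₀ t i j) := ⟨_, rfl⟩
  have hΓc : Continuous Γ := by
    rw [hΓ]
    refine continuous_finsetProd _ fun i _ => continuous_finsetProd _ fun j hj => ?_
    rw [continuous_iff_continuousAt]
    intro t
    refine ContinuousAt.comp (g := Gamma) (continuousAt_Gamma_of_re_pos ?_)
      (continuous_contourPoint δ₀ i j).continuousAt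
    exact (hcont t).1.2.2.2.1 i j (mem_filter.1 hj).2.ne
  have hΓ0 : ∀ t, Γ t ≠ 0 := fun t => by
    rw [hΓ]
    refine prod_ne_zero_iff.2 fun i _ => prod_ne_zero_iff.2 fun j hj => ?_
    exact Complex.Gamma_ne_zero_of_re_pos ((hcont t).1.2.2.2.1 i j (mem_filter.1 hj).2.ne)
  obtain ⟨KΓ, hKΓ, hΓle⟩ := exists_norm_prod_Gamma_le hn hp
  obtain ⟨K, hK, hMle⟩ := hgr hM
  obtain ⟨K', hK', hMle'⟩ := hgr hM'
  set g : (MellinIndex n → ℝ) → ℂ := fun t => (M (contourPoint δ₀ t) - M' (contourPoint δ₀ t)) * Γ t with hg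
  have hgz : g = 0 := by
    refine eq_zero_of_fourier_eq_zero (K := (K + K') * KΓ) (b := pi / 8) (((hcM hM).sub (hcM hM')).mul hΓc)
      (by positivity) (fun t => ?_) (ε := log (1 + 1 / (3 * n))) ?_ fun ξ hξ => ?_
    · have h1 := hΓle t
      rw [hg, norm_mul]
      have h2 : Γ t = ∏ i, ∏ j with i < j, Gamma (contourPoint δ₀ t i j) := by rw [hΓ]
      rw [← h2] at h1
      have h3 : ‖M (contourPoint δ₀ t) - M' (contourPoint δ₀ t)‖ ≤
          (K + K') * exp (pi / 8 * ∑ q, |t q|) := by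
        refine (norm_sub_le _ _).trans ?_
        have := hMle t; have := hMle' t
        linarith
      calc _ ≤ ((K + K') * exp (pi / 8 * ∑ q, |t q|)) *
            (KΓ * exp (-(pi / 4) * ∑ q, |t q|)) := by gcongr
        _ = (K + K') * KΓ * (exp (pi / 8 * ∑ q, |t q|) * exp (-(pi / 4) * ∑ q, |t q|)) := by
          ring
        _ = _ := by rw [← exp_add]; congr 2; ring
    · exact Real.log_pos (by
        have : (0 : ℝ) < n := by exact_mod_cast (by omega : 0 < n)
        have : 0 < 1 / (3 * n : ℝ) := by positivity
        linarith)
    · have hn0 : (0 : ℝ) < n := by exact_mod_cast (by omega : 0 < n)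
      -- boundary points whose cross ratios have the logarithms `ξ`
      obtain ⟨y, a, hy, hya⟩ := exists_points_of_crossRatios hd hnd (logCrossRatio_comm ξ)
        (logCrossRatio_zero ξ) (fun i j => by
          have h1 := (abs_logCrossRatio_le ξ i j).trans_lt hξ
          set L := logCrossRatio ξ i j
          have h2 : exp |L| ≤ 1 + 1 / (3 * n) := by
            rw [← exp_log (show (0 : ℝ) < 1 + 1 / (3 * n) by positivity)]
            exact exp_le_exp.2 h1.le
          have h3 : |exp L - 1| ≤ exp |L| - 1 := by
            have h4 := exp_le_exp.2 (le_abs_self L)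
            have h5 := exp_le_exp.2 (neg_abs_le L)
            have h6 : exp (-|L|) * exp |L| = 1 := by rw [← exp_add]; simp
            have h7 := Real.one_le_exp (abs_nonneg L)
            rw [abs_le]
            constructor
            · nlinarith [sq_nonneg (exp |L| - 1), exp_pos (-|L|)]
            · linarith
          have h8 : |exp L - 1| ≤ 1 / (3 * n) := by linarith
          calc _ ≤ 1 / (3 * n) * (3 * n : ℝ) := by gcongr
            _ = 1 := by field_simp)
      have h1 := hM.representation δ₀ hδ₀m y hy
      rw [hM'.representation δ₀ hδ₀m y hy] at h1
      have h2 := mul_left_cancel₀ hN h1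
      simp only [mellinIntegral] at h2
      rw [integral_const_mul, integral_const_mul] at h2
      have h3 := mul_left_cancel₀ (pow_ne_zero _ (by
        simp [Real.pi_ne_zero] : (1 / (2 * (pi : ℂ))) ≠ 0)) h2
      have h4 : ∫ t, (M (contourPoint δ₀ t) * dressing y (contourPoint δ₀ t) -
          M' (contourPoint δ₀ t) * dressing y (contourPoint δ₀ t)) = 0 := by
        rw [integral_sub (hM.integrable δ₀ hδ₀m y hy) (hM'.integrable δ₀ hδ₀m y hy), h3, sub_self]
      have h5 : ∀ t, M (contourPoint δ₀ t) * dressing y (contourPoint δ₀ t) -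
          M' (contourPoint δ₀ t) * dressing y (contourPoint δ₀ t) =
          cexp (∑ i, δ₀ i i * a i - ∑ q : MellinIndex n, δ₀ q.1.1 q.1.2 * ξ q) *
            (g t * cexp (-I * (∑ q, t q * ξ q : ℝ))) := by
        intro t
        rw [dressing_crossRatios hn hp hy hya, hg, hΓ]
        ring
      simp only [h5] at h4
      rw [integral_const_mul] at h4
      exact (mul_eq_zero.1 h4).resolve_left (Complex.exp_ne_zero _)
  have h1 := congrFun hgz t₀
  simp only [hg, Pi.zero_apply, hpt] at h1
  exact sub_eq_zero.1 ((mul_eq_zero.1 h1).resolve_right (hΓ0 _))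

theorem normalization_ne_zero {d : ℕ} {Δ : Fin n → ℝ} (hΔ : ∀ i, 0 < Δ i) (hΔ' : ∀ i, h d - 1 < Δ i)
    {c : D.E → ℂ} (hc : ∀ e, (c e).re = 0) (hc0 : ∀ e, c e ≠ 0) : D.normalization d Δ c ≠ 0 := by
  have hπ : ∀ x : ℂ, (pi : ℂ) ^ x ≠ 0 := fun x => by
    rw [Complex.cpow_def_of_ne_zero (by exact_mod_cast Real.pi_ne_zero)]
    exact Complex.exp_ne_zero _
  have hΓ : ∀ z : ℂ, z.re = 0 → z ≠ 0 → Gamma z ≠ 0 := fun z hz hz0 =>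
    Complex.Gamma_ne_zero fun m hm => by
      rw [hm] at hz
      simp at hz
      exact hz0 (by rw [hm, hz]; simp)
  refine mul_ne_zero (mul_ne_zero (div_ne_zero (hπ _) (pow_ne_zero _ two_ne_zero)) ?_) ?_
  · refine prod_ne_zero_iff.2 fun i _ => div_ne_zero ?_ ?_
    · refine mul_ne_zero (one_div_ne_zero (mul_ne_zero two_ne_zero (hπ _))) (div_ne_zero ?_ ?_)
      · exact Complex.Gamma_ne_zero_of_re_pos (by simpa using hΔ i)
      · refine Complex.Gamma_ne_zero_of_re_pos ?_
        have := hΔ' i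
        simp
        linarith
    · exact Complex.Gamma_ne_zero_of_re_pos (by simpa using hΔ i)
  · refine prod_ne_zero_iff.2 fun e _ => one_div_ne_zero (mul_ne_zero ?_ ?_)
    · exact hΓ _ (hc e) (hc0 e)
    · exact hΓ _ (by simp [hc]) (neg_ne_zero.2 (hc0 e))

end TreeDiagram

end Witten

end

open MeasureTheory Witten in
theorem mainTheorem4 (d : ℕ) (hd : 0 < d) :
    ∃ C : (ι : Type) → [Fintype ι] → ℂ → (ι → ℂ) → (ι → ℂ) → ℂ,
      -- the correction functions have no poles
      (∀ (ι : Type) [Fintype ι],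
        Differentiable ℂ fun p : ℂ × (ι → ℂ) × (ι → ℂ) => C ι p.1 p.2.1 p.2.2) ∧
      -- they are given by the Mellin–Barnes integral
      (∀ (ι : Type) [Fintype ι] (ΔA : ℂ) (c s : ι → ℂ) (u : ι → ℝ),
        IsVertexContour d ΔA c s u →
          Integrable (fun v => correctionIntegrand d ΔA c s (vertexContourPoint u v)) ∧
          C ι ΔA c s = correctionIntegral d ΔA c s u) ∧
      -- the pre-amplitude of a tree diagram is the product of the factors
      ∀ (n : ℕ) (D : TreeDiagram n) (Δ : Fin n → ℝ), D.Convergent d Δ →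
        (∃ δ₀ : Fin n → Fin n → ℝ, (fun i j => (δ₀ i j : ℂ)) ∈ D.tube d Δ) ∧
        ∀ c : D.E → ℂ, (∀ e, (c e).re = 0) →
          (∀ (e : D.E) (X Y : Bulk d), 0 < X.1 → 0 < Y.1 →
            Integrable (splitIntegrand d (c e) X Y)) ∧
          (∀ y : Fin n → Bdry d, Function.Injective y →
            Integrable (D.correlatorIntegrand d Δ c y) (Measure.pi fun _ => adsVolume d)) ∧
          IsPreAmplitude D d Δ c (treeProduct d C D Δ c) ∧
          (n ≤ d + 2 → (∀ i, h d - 1 < Δ i) → (∀ e, c e ≠ 0) →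
            ∀ M, IsPreAmplitude D d Δ c M →
              Set.EqOn M (treeProduct d C D Δ c) (D.tube d Δ)) := by
  refine ⟨fun ι _ => correction d ι, fun ι _ => differentiable_correction d ι,
    fun ι _ ΔA c s u hu => correction_eq_correctionIntegral d ΔA c s u hu, fun n D Δ hΔ =>
    ⟨hΔ.exists_mem_tube hd, fun c hc => ⟨fun e X Y hX hY => integrable_splitIntegrand hd (hc e) hX hY,
      fun y hy => ?_, TreeDiagram.isPreAmplitude_treeProduct hd hΔ hc, fun hnd hΔ' hc0 M hM => ?_⟩⟩⟩
  · obtain ⟨δ₀, hδ₀⟩ := hΔ.exists_mem_tube hd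
    exact (hΔ.correlator hd hc hδ₀ hy).1
  · obtain ⟨hn, -⟩ := hΔ.exists_mellinPoint hd
    exact TreeDiagram.IsPreAmplitude.eqOn_tube hd hn hnd
      (TreeDiagram.normalization_ne_zero hΔ.pos hΔ' hc hc0) hM
      (TreeDiagram.isPreAmplitude_treeProduct hd hΔ hc)
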